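/- Let $m\ge 1$ and let $S$ be a compact connected toric Sasaki manifold of dimension $2m-1$: $S$ carries a Riemannian metric $g$, the cone $C(S)=S\times\mathbb{R}^+$ with metric $\overline g=r^2g+dr^2$ carries a complex structure $J$ for which $(C(S),\overline g,J)$ is Kähler, and the torus $T^m$ acts smoothly and effectively on $S$ so that the induced action $\tau\cdot(s,r)=(\tau\cdot s,r)$ on $C(S)$ is holomorphic and preserves $\overline g$. Let $\mathfrak g\cong\mathbb{R}^m$ be the Lie algebra of $T^m$; for $v\in\mathfrak g$ write $v(p)=\frac{d}{dt}\big|_{t=0}\exp(tv)\cdot p$. Put $\xi=J\,r\frac{\partial}{\partial r}$ and $\eta(Y)=r^{-2}\,\overline g(\xi,Y)$, let $\omega=\overline g(J\cdot,\cdot)$ be the Kähler form, and let $\mu:C(S)\to\mathfrak g^*$, $\langle\mu(p),v\rangle=\frac12 r(p)^2\,\eta(v(p))$, be the moment map. Assume that the Reeb field $\xi$ is generated by an element of $\mathfrak g$. Let $\Delta=\mu(C(S))$, and let $\Lambda$ be the set of primitive inward normal vectors (in the integral lattice $\ker(\exp:\mathfrak g\to T^m)$) of the facets of the cone $\Delta$.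 For $y\in\Delta$ put $\mathfrak z_y=\mathrm{Span}_{\mathbb R}\{\lambda\in\Lambda\mid\langle y,\lambda\rangle=0\}$. Let $\sigma:C(S)\to C(S)$ be an anti-holomorphic involution of the toric variety $C(S)$, that is, a smooth map with $\sigma^2=\mathrm{id}$, $\sigma_*J=-J\sigma_*$ and $\sigma(w\cdot p)=\overline w\cdot\sigma(p)$ for $w$ in the torus (so $\overline w=w^{-1}$ for $w\in T^m$), and let $C(S)^\sigma=\{p\mid\sigma(p)=p\}$ be the real form. Let $\zeta\in\mathfrak g$ and $c\in\mathbb R$, put $H_{\zeta,c}=\{y\in\mathfrak g^*\mid\langle y,\zeta\rangle=c\}$, and assume that $\mathrm{Int}\,\Delta\cap H_{\zeta,c}\ne\emptyset$ and that $\zeta\notin\mathfrak z_y$ for every $y\in\Delta\cap H_{\zeta,c}$. Put $$C(S)^\sigma_{\zeta,c}=\{p\in C(S)^\sigma\mid\langle\mu(p),\zeta\rangle=c\}.$$ Let $I\subset\mathbb R$ be an open interval, $f:I\to\mathbb R$ and $\rho:I\to\mathbb R^+$ smooth functions with $\dot f$ nowhere zero on $I$, let $\tau_0\in T^m$, and write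 $\tau(t)=\exp(f(t)\zeta)\,\tau_0$. For $\rho\in\mathbb R^+$ and $(s,r)\in C(S)$ let $\rho\cdot(s,r)=(s,\rho r)$. Then $C(S)^\sigma_{\zeta,c}$ is a smooth embedded submanifold of $C(S)$ of real dimension $m-1$, and the map $$F:C(S)^\sigma_{\zeta,c}\times I\to C(S),\qquad F(p,t)=\rho(t)\cdot\tau(t)\cdot p,$$ is a Lagrangian immersion: it is a smooth immersion of an $m$-dimensional manifold into the $2m$-dimensional manifold $C(S)$ with $F^*\omega=0$. -/

import Mathlib

open scoped Manifold ContDiff Topology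
open Set Module Bundle TopologicalSpace

noncomputable section

namespace ToricSasaki

/-! ### The cone `C(S) = S × ℝ⁺` -/

/-- The half line `ℝ⁺ = (0, ∞)` as an open submanifold of `ℝ`. -/
abbrev PosReal : Opens ℝ := ⟨Ioi 0, isOpen_Ioi⟩

/-- The manifold `C(S) = S × ℝ⁺` (without apex). -/
abbrev Cone (S : Type*) : Type _ := S × PosReal

/-- The model with corners of the cone over a manifold modelled on `E`. -/
abbrev coneModel (E : Type*) [NormedAddCommGroup E] [NormedSpace ℝ E] :
    ModelWithCorners ℝ (E × ℝ) (ModelProd E ℝ) :=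
  𝓘(ℝ, E).prod 𝓘(ℝ, ℝ)

/-- The action of `ρ ∈ ℝ⁺` on the cone: `ρ · (s, r) = (s, ρ r)`. -/
def scale {S : Type*} (ρ : PosReal) (p : Cone S) : Cone S :=
  (p.1, ⟨(ρ : ℝ) * (p.2 : ℝ), mul_pos (show (0 : ℝ) < ρ from ρ.2) (show (0 : ℝ) < p.2 from p.2.2)⟩)

/-! ### Vector fields, smooth maps -/

section General

variable {V : Type*} [NormedAddCommGroup V] [NormedSpace ℝ V]
  {H : Type*} [TopologicalSpace H] (I : ModelWithCorners ℝ V H)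
  {M : Type*} [TopologicalSpace M] [ChartedSpace H M]

/-- `X` is a smooth vector field on `M`. -/
def IsSmoothField [IsManifold I 1 M] (X : ∀ p : M, TangentSpace I p) : Prop :=
  ContMDiff I I.tangent ∞ (fun p ↦ (⟨p, X p⟩ : TangentBundle I M))

/-- The Nijenhuis tensor of `J` vanishes:
`[JX, JY] - J[JX, Y] - J[X, JY] - [X, Y] = 0` for all smooth vector fields `X`, `Y`. -/
def IsIntegrable [IsManifold I 1 M]
    (J : ∀ p : M, TangentSpace I p →L[ℝ] TangentSpace I p) : Prop :=
  ∀ X Y : ∀ p : M, TangentSpace I p, IsSmoothField I X → IsSmoothField I Y → ∀ p : M,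
    VectorField.mlieBracket I (fun q ↦ J q (X q)) (fun q ↦ J q (Y q)) p
      - J p (VectorField.mlieBracket I (fun q ↦ J q (X q)) Y p)
      - J p (VectorField.mlieBracket I X (fun q ↦ J q (Y q)) p)
      - VectorField.mlieBracket I X Y p = 0

/-- The derivative `X u` of a function `u` along a vector field `X`. -/
def fieldDeriv (X : ∀ p : M, TangentSpace I p) (u : M → ℝ) (p : M) : ℝ :=
  mfderiv I 𝓘(ℝ, ℝ) u p (X p)

/-- The 2-form `α` is closed: `dα(X, Y, Z) = 0` for all smooth vector fields, where
`dα(X,Y,Z) = X α(Y,Z) - Y α(X,Z) + Z α(X,Y) - α([X,Y],Z) + α([X,Z],Y) - α([Y,Z],X)`. -/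
def IsClosedForm [IsManifold I 1 M]
    (α : ∀ p : M, TangentSpace I p → TangentSpace I p → ℝ) : Prop :=
  ∀ X Y Z : ∀ p : M, TangentSpace I p,
    IsSmoothField I X → IsSmoothField I Y → IsSmoothField I Z → ∀ p : M,
    fieldDeriv I X (fun q ↦ α q (Y q) (Z q)) p
      - fieldDeriv I Y (fun q ↦ α q (X q) (Z q)) p
      + fieldDeriv I Z (fun q ↦ α q (X q) (Y q)) p
      - α p (VectorField.mlieBracket I X Y p) (Z p)
      + α p (VectorField.mlieBracket I X Z p) (Y p)
      - α p (VectorField.mlieBracket I Y Z p) (X p) = 0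

variable {V' : Type*} [NormedAddCommGroup V'] [NormedSpace ℝ V']
  {H' : Type*} [TopologicalSpace H'] (I' : ModelWithCorners ℝ V' H')
  {M' : Type*} [TopologicalSpace M'] [ChartedSpace H' M']

/-- `F : M → M'` is a smooth immersion: it is smooth and its differential is injective at
every point. -/
def IsSmoothImmersion (F : M → M') : Prop :=
  ContMDiff I I' ∞ F ∧ ∀ x : M, Function.Injective (mfderiv I I' F x)

/-- `F : M → M'` is a Lagrangian immersion with respect to the 2-form `α` on `M'`: it is a smooth
immersion, `2 dim M = dim M'`, and `F^* α = 0`. -/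
def IsLagrangianImmersion
    (α : ∀ p : M', TangentSpace I' p → TangentSpace I' p → ℝ) (F : M → M') : Prop :=
  IsSmoothImmersion I I' F ∧ 2 * finrank ℝ V = finrank ℝ V' ∧
    ∀ (x : M) (X Y : TangentSpace I x),
      α (F x) (mfderiv I I' F x X) (mfderiv I I' F x Y) = 0

end General

/-! ### The torus `T^m` -/

/-- The torus `T^m`. -/
abbrev Torus (m : ℕ) : Type := Fin m → Circle

/-- The Lie algebra `𝔤 = ℝ^m` of `T^m`. -/
abbrev LieAlg (m : ℕ) : Type := Fin m → ℝ

/-- The dual `𝔤^*` of the Lie algebra. -/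
abbrev DualLieAlg (m : ℕ) : Type := StrongDual ℝ (LieAlg m)

/-- The exponential map `𝔤 → T^m`, `v ↦ (e^{i v_1}, …, e^{i v_m})`. -/
def torusExp {m : ℕ} (v : LieAlg m) : Torus m := fun k ↦ Circle.exp (v k)

/-- The integral lattice of `𝔤`: the kernel of the exponential map. -/
def lattice (m : ℕ) : Set (LieAlg m) := {v | torusExp v = 1}

/-- `v` is a primitive vector of the integral lattice. -/
def IsPrimitive {m : ℕ} (v : LieAlg m) : Prop :=
  v ∈ lattice m ∧ v ≠ 0 ∧ ∀ (n : ℕ) (w : LieAlg m), w ∈ lattice m → n • w = v → n = 1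

/-- The set `Λ` of the primitive inward normal vectors of the facets of a cone `Δ ⊆ 𝔤^*`: those
primitive vectors `λ` that are nonnegative on `Δ` and for which the face `{y ∈ Δ | ⟨y, λ⟩ = 0}`
has codimension one, that is, spans a subspace of dimension `m - 1`. If `Δ ∪ {0}` is a rational
polyhedral cone with nonempty interior, this is the minimal set of primitive vectors with
`Δ ∪ {0} = {y | ⟨y, λ⟩ ≥ 0 for all λ ∈ Λ}`. -/
def facetNormals {m : ℕ} (Δ : Set (DualLieAlg m)) : Set (LieAlg m) :=
  {l | IsPrimitive l ∧ (∀ y ∈ Δ, 0 ≤ y l) ∧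
    finrank ℝ (Submodule.span ℝ {y | y ∈ Δ ∧ y l = 0}) + 1 = m}

/-- `𝔷_y = Span {λ ∈ Λ | ⟨y, λ⟩ = 0}`. -/
def zSpan {m : ℕ} (Δ : Set (DualLieAlg m)) (y : DualLieAlg m) : Submodule ℝ (LieAlg m) :=
  Submodule.span ℝ {l | l ∈ facetNormals Δ ∧ y l = 0}

/-- The hyperplane `H_{ζ,c} = {y ∈ 𝔤^* | ⟨y, ζ⟩ = c}`. -/
def hyperplane {m : ℕ} (ζ : LieAlg m) (c : ℝ) : Set (DualLieAlg m) := {y | y ζ = c}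

/-! ### Sasaki manifolds -/

section Sasaki

variable {E : Type*} [NormedAddCommGroup E] [NormedSpace ℝ E]
  {S : Type*} [TopologicalSpace S] [ChartedSpace E S] [IsManifold 𝓘(ℝ, E) ∞ S]

/-- The cone metric `r² g + dr²` on `C(S)`; here `T_{(s,r)} C(S) = T_s S × ℝ`. -/
def coneMetric
    (g : ContMDiffRiemannianMetric 𝓘(ℝ, E) ∞ E (fun x : S ↦ TangentSpace 𝓘(ℝ, E) x))
    (p : Cone S) (X Y : TangentSpace (coneModel E) p) : ℝ :=
  (p.2 : ℝ) ^ 2 * g.inner p.1 X.1 Y.1 + (show ℝ from X.2) * (show ℝ from Y.2)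

theorem coneMetric_add_right
    (g : ContMDiffRiemannianMetric 𝓘(ℝ, E) ∞ E (fun x : S ↦ TangentSpace 𝓘(ℝ, E) x))
    (p : Cone S) (X Y Z : TangentSpace (coneModel E) p) :
    coneMetric g p X (Y + Z) = coneMetric g p X Y + coneMetric g p X Z := by
  have h : g.inner p.1 X.1 (Y + Z).1 = g.inner p.1 X.1 Y.1 + g.inner p.1 X.1 Z.1 :=
    (g.inner p.1 X.1).map_add Y.1 Z.1
  have h' : (show ℝ from (Y + Z).2) = (show ℝ from Y.2) + (show ℝ from Z.2) := rfl
  simp only [coneMetric, h, h']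
  ring

theorem coneMetric_smul_right
    (g : ContMDiffRiemannianMetric 𝓘(ℝ, E) ∞ E (fun x : S ↦ TangentSpace 𝓘(ℝ, E) x))
    (p : Cone S) (a : ℝ) (X Y : TangentSpace (coneModel E) p) :
    coneMetric g p X (a • Y) = a * coneMetric g p X Y := by
  have h : g.inner p.1 X.1 (a • Y).1 = a * g.inner p.1 X.1 Y.1 :=
    (g.inner p.1 X.1).map_smul a Y.1
  have h' : (show ℝ from (a • Y).2) = a * (show ℝ from Y.2) := rfl
  simp only [coneMetric, h, h']
  ring

/-- The position vector `r ∂/∂r` at a point `p = (s, r)` of the cone. -/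
def positionVector (p : Cone S) : TangentSpace (coneModel E) p :=
  ((0 : E), (p.2 : ℝ))

variable (E S) in
/-- A Sasaki manifold: a Riemannian metric `g` on `S` and a complex structure `J` on the cone
`C(S)` such that `(C(S), r² g + dr², J)` is a Kähler manifold. -/
structure SasakiStructure where
  /-- the Riemannian metric on `S` -/
  g : ContMDiffRiemannianMetric 𝓘(ℝ, E) ∞ E (fun x : S ↦ TangentSpace 𝓘(ℝ, E) x)
  /-- the complex structure on the cone -/
  J : ∀ p : Cone S, TangentSpace (coneModel E) p →L[ℝ] TangentSpace (coneModel E) p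
  smooth_J : ∀ X : ∀ p : Cone S, TangentSpace (coneModel E) p,
    IsSmoothField (coneModel E) X → IsSmoothField (coneModel E) (fun p ↦ J p (X p))
  J_sq : ∀ (p : Cone S) (X : TangentSpace (coneModel E) p), J p (J p X) = -X
  integrable_J : IsIntegrable (coneModel E) J
  metric_J : ∀ (p : Cone S) (X Y : TangentSpace (coneModel E) p),
    coneMetric g p (J p X) (J p Y) = coneMetric g p X Y
  closed : IsClosedForm (coneModel E) (fun (p : Cone S) X Y ↦ coneMetric g p (J p X) Y)

namespace SasakiStructure

variable (A : SasakiStructure E S)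

/-- The Kähler form `ω(X, Y) = ḡ(JX, Y)` of the cone. -/
def kaehlerForm (p : Cone S) (X Y : TangentSpace (coneModel E) p) : ℝ :=
  coneMetric A.g p (A.J p X) Y

/-- The Reeb field `ξ = J (r ∂/∂r)` on the cone. -/
def reeb (p : Cone S) : TangentSpace (coneModel E) p := A.J p (positionVector p)

/-- The 1-form `η(Y) = r⁻² ḡ(ξ, Y)` on the cone. -/
def eta (p : Cone S) (Y : TangentSpace (coneModel E) p) : ℝ :=
  ((p.2 : ℝ) ^ 2)⁻¹ * coneMetric A.g p (A.reeb p) Y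

end SasakiStructure

/-! ### Torus actions -/

variable {m : ℕ} [MulAction (Torus m) S]

/-- The action of the torus on the cone: `τ · (s, r) = (τ · s, r)`. -/
def torusAct (τ : Torus m) (p : Cone S) : Cone S := (τ • p.1, p.2)

variable (E) in
/-- The linear map `𝔤 → T_p C(S)`, `v ↦ v(p) = d/dt|_{t=0} exp(tv) · p`, written as the differential
at `0` of the map `v ↦ exp(v) · p` (see `generator_eq_deriv`). -/
def generator (p : Cone S) : LieAlg m →L[ℝ] TangentSpace (coneModel E) p :=
  mfderiv 𝓘(ℝ, LieAlg m) (coneModel E) (fun v : LieAlg m ↦ torusAct (torusExp v) p) 0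

variable (E S m) in
/-- The action of the torus on `S` is smooth. Since the exponential map of the torus is a
surjective local diffeomorphism, smoothness of `T^m × S → S` is smoothness of
`𝔤 × S → S`, `(v, s) ↦ exp(v) · s`. -/
def IsSmoothTorusAction : Prop :=
  ContMDiff (𝓘(ℝ, LieAlg m).prod 𝓘(ℝ, E)) 𝓘(ℝ, E) ∞
    (fun q : LieAlg m × S ↦ torusExp q.1 • q.2)

theorem generator_eq_deriv (h : IsSmoothTorusAction E S m) (p : Cone S) (v : LieAlg m) :
    generator E p v =
      mfderiv 𝓘(ℝ, ℝ) (coneModel E) (fun t : ℝ ↦ torusAct (torusExp (t • v)) p) 0 (1 : ℝ) := by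
  have hA : ContMDiff 𝓘(ℝ, LieAlg m) (coneModel E) ∞
      (fun w : LieAlg m ↦ torusAct (torusExp w) p) :=
    ContMDiff.prodMk (h.comp (contMDiff_id.prodMk contMDiff_const)) contMDiff_const
  have hl : MDifferentiableAt 𝓘(ℝ, ℝ) 𝓘(ℝ, LieAlg m) (fun t : ℝ ↦ t • v) 0 :=
    (differentiableAt_id.smul_const v).mdifferentiableAt
  have h0 : MDifferentiableAt 𝓘(ℝ, LieAlg m) (coneModel E)
      (fun w : LieAlg m ↦ torusAct (torusExp w) p) ((0 : ℝ) • v) :=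
    hA.mdifferentiableAt (by simp)
  have hc := mfderiv_comp (0 : ℝ) h0 hl
  have hd : mfderiv 𝓘(ℝ, ℝ) 𝓘(ℝ, LieAlg m) (fun t : ℝ ↦ t • v) 0 (1 : ℝ) = v := by
    have h1 : HasFDerivAt (fun t : ℝ ↦ t • v)
        ((ContinuousLinearMap.id ℝ ℝ).smulRight v) 0 :=
      (hasFDerivAt_id (𝕜 := ℝ) (0 : ℝ)).smul_const v
    rw [mfderiv_eq_fderiv]
    exact (congrArg (fun L : ℝ →L[ℝ] LieAlg m ↦ L 1) h1.fderiv).trans (one_smul ℝ v)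
  have he := congrArg (fun L ↦ L (1 : ℝ)) hc
  refine Eq.trans ?_ he.symm
  have hg : generator E p = mfderiv 𝓘(ℝ, LieAlg m) (coneModel E)
      (fun w : LieAlg m ↦ torusAct (torusExp w) p) ((0 : ℝ) • v) := by
    unfold generator
    rw [zero_smul]
  rw [hg]
  exact (congrArg (mfderiv 𝓘(ℝ, LieAlg m) (coneModel E)
      (fun w : LieAlg m ↦ torusAct (torusExp w) p) ((0 : ℝ) • v)) hd).symm

namespace SasakiStructure

variable (A : SasakiStructure E S)

variable (m) in
/-- `S`, with the given action of the torus `T^m`, is a toric Sasaki manifold: the action is smooth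
and effective, and the induced action on the cone is holomorphic and preserves the cone metric. -/
structure IsToric : Prop where
  smooth : IsSmoothTorusAction E S m
  effective : FaithfulSMul (Torus m) S
  holomorphic : ∀ (τ : Torus m) (p : Cone S) (X : TangentSpace (coneModel E) p),
    mfderiv (coneModel E) (coneModel E) (torusAct τ) p (A.J p X) =
      A.J (torusAct τ p) (mfderiv (coneModel E) (coneModel E) (torusAct τ) p X)
  isometric : ∀ (τ : Torus m) (p : Cone S) (X Y : TangentSpace (coneModel E) p),
    coneMetric A.g (torusAct τ p) (mfderiv (coneModel E) (coneModel E) (torusAct τ) p X)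
      (mfderiv (coneModel E) (coneModel E) (torusAct τ) p Y) = coneMetric A.g p X Y

variable (m) in
/-- The Reeb field is generated by an element of `𝔤`. -/
def ReebGenerated : Prop :=
  ∃ b : LieAlg m, ∀ p : Cone S, generator E p b = A.reeb p

/-- The 1-form `η` at `p` as a linear form. -/
def etaLin (p : Cone S) : TangentSpace (coneModel E) p →ₗ[ℝ] ℝ where
  toFun := A.eta p
  map_add' X Y := by simp only [eta, coneMetric_add_right, mul_add]
  map_smul' a X := by
    simp only [eta, coneMetric_smul_right, RingHom.id_apply, smul_eq_mul]
    ring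

/-- The moment map `μ : C(S) → 𝔤^*`, `⟨μ(p), v⟩ = ½ r² η(v(p))`. -/
def moment (p : Cone S) : DualLieAlg m :=
  LinearMap.toContinuousLinearMap
    (((1 / 2 : ℝ) * (p.2 : ℝ) ^ 2) • (A.etaLin p ∘ₗ (generator E p : LieAlg m →L[ℝ] _).toLinearMap))

theorem moment_apply (p : Cone S) (v : LieAlg m) :
    A.moment p v = 1 / 2 * (p.2 : ℝ) ^ 2 * A.eta p (generator E p v) := rfl

variable (m) in
/-- The moment image `Δ = μ(C(S))`. -/
def momentImage : Set (DualLieAlg m) := range (A.moment (m := m))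

variable (m) in
/-- `σ` is an anti-holomorphic involution of the cone as it comes from its structure of a toric
variety: `σ² = id`, `σ_* J = - J σ_*`, and `σ(w · p) = w̄ · σ(p)`. The last condition is imposed for
`w` in the compact torus `T^m`, where `w̄ = w⁻¹`. It then holds for all `w` in the complex torus:
it gives `σ_* v = -v` for `v ∈ 𝔤`, so `σ_* (J v) = J v`, and `σ` commutes with the flows of the
fields `J v`, which make up the noncompact part of the action of the complex torus. -/
structure IsToricConjugation (σ : Cone S → Cone S) : Prop where
  smooth : ContMDiff (coneModel E) (coneModel E) ∞ σ
  involutive : ∀ p, σ (σ p) = p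
  antiholomorphic : ∀ (p : Cone S) (X : TangentSpace (coneModel E) p),
    mfderiv (coneModel E) (coneModel E) σ p (A.J p X) =
      -A.J (σ p) (mfderiv (coneModel E) (coneModel E) σ p X)
  equivariant : ∀ (w : Torus m) (p : Cone S), σ (torusAct w p) = torusAct w⁻¹ (σ p)

/-- The level set `C(S)^σ_{ζ,c} = {p ∈ C(S)^σ | ⟨μ(p), ζ⟩ = c}` in the real form
`C(S)^σ = {p | σ(p) = p}`. -/
def realLevel (σ : Cone S → Cone S) (ζ : LieAlg m) (c : ℝ) : Set (Cone S) :=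
  {p | σ p = p ∧ A.moment p ζ = c}

/-- The map `F : C(S)^σ_{ζ,c} × I → C(S)`, `F(p, t) = ρ(t) · τ(t) · p`, with
`τ(t) = exp(f(t) ζ) τ₀`. -/
def lagMap (σ : Cone S → Cone S) (ζ : LieAlg m) (c : ℝ) {I : Opens ℝ} (f : I → ℝ)
    (ρ : I → PosReal) (τ₀ : Torus m) (x : A.realLevel σ ζ c × I) : Cone S :=
  scale (ρ x.2) (torusAct (torusExp (f x.2 • ζ) * τ₀) (x.1 : Cone S))

end SasakiStructure
end Sasaki
end ToricSasaki
end

open ToricSasaki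

noncomputable section

set_option maxSynthPendingDepth 3

namespace ToricSasaki

/-! ### Parametric integrals and Fourier coefficients -/

section ParametricIntegral

open MeasureTheory

variable {V G : Type*} [NormedAddCommGroup V] [NormedSpace ℝ V] [FiniteDimensional ℝ V]
  [NormedAddCommGroup G] [NormedSpace ℝ G] {d : ℕ}
  {K : Set (Fin d → ℝ)} {U : Set V}

/-! Write `D` for the differential of `σ` at a real point `p` (one with `σ p = p`), `R` for the
position vector field, and `v` also for the vector field of `v ∈ 𝔤`. The basic tool is the
Hamiltonian identity `d⟨μ, v⟩ = -ω(v, ·)` (`mD_moment`), which follows from Cartan calculus because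
`R` is holomorphic and scales the metric by a homothety.

Submanifold. `D` is an involution with `D J = -J D`, so its fixed space has dimension `m`. If `ζ(p)
≠ 0`, then `-Jζ(p)` is fixed by `D`, and `d⟨μ, ζ⟩` takes the positive value `|ζ(p)|²` on it. Hence
the level set in the real form is cut out regularly and has dimension `m - 1` (`exists_sliceChart`,
`exists_submanifold`).

Lagrangian immersion. Up to a torus element, which preserves `ω`, the tangent vectors of `F` are `Z
+ c (kζ + lR)` at a dilated real point, with `Z` tangent to a dilated level set and `k` the
derivative of `f`. Here `D` fixes `Z` and `R`, because `σ` commutes with dilations (`scale_comm`),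
and negates `ζ(p)`; since `k ≠ 0` this gives injectivity. The pairing `ω(ζ, Z)` vanishes because
`⟨μ, ζ⟩` is constant along `Z`. The other pairings vanish because the real form is isotropic.

Isotropy of the real form needs an argument, since `σ` is not assumed to be an isometry. At `p` the
tangent space splits into `𝔤(p)`, `J𝔤(p)` and complex lines on which the isotropy algebra acts by
weights forming a basis of its dual (`exists_isotropy_basis`). `D` respects this splitting. Fixed
vectors have no component in `𝔤(p)`, the space `J𝔤(p)` is isotropic (`gen_isotropic`), and on each
weight line `D` is antilinear, so that its fixed vectors lie on one real line.

It remains to deduce `ζ(p) ≠ 0` from `ζ ∉ 𝔷_y`: the isotropy algebra of `p` must lie in the span of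
the normals of the facets through `μ(p)` (`mem_zSpan_of_gen_eq_zero`). Let `β_i` be the basis dual
to the weights. Near `p` the function `⟨μ, β_i⟩` is Morse-Bott with semidefinite Hessian, so it has
a local minimum with value `0`. Local minima are global, as in the connectedness theorems for moment
maps: Hessians are complex linear, so a nonzero negative part has real dimension at least two, and
sublevel sets are locally connected near critical points
(`le_of_eventually_le_of_sublevelConnectedAt`, applied on `S` by homogeneity). So `β_i` is
nonnegative on `Δ`. At a suitable point near `p` the isotropy algebra is the line of `β_i`. It is
cut out by integral weights, hence rational, and the face where `β_i` vanishes has codimension one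
(`exists_smul_mem_facetNormals`).

The local normal form is `exists_localModel`. Torus Fourier components of the coordinates of an
embedding of `S` give a map to a linear torus representation which is an immersion near `p`, and an
equivariant orthogonal projection turns it into a chart. -/

theorem continuousOn_setIntegral_param (hK : IsCompact K) (hU : IsOpen U)
    {F : (Fin d → ℝ) × V → G} (hF : ContinuousOn F (univ ×ˢ U)) :
    ContinuousOn (fun x ↦ ∫ θ in K, F (θ, x)) U := by
  have : LocallyCompactSpace U := hU.locallyCompactSpace
  rw [continuousOn_iff_continuous_domRestrict]
  refine continuous_parametric_integral_of_continuous (f := fun (x : U) θ ↦ F (θ, x)) ?_ hK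
  refine hF.comp_continuous (f := fun q : U × (Fin d → ℝ) ↦ (q.2, (q.1 : V))) (by fun_prop) ?_
  exact fun q ↦ ⟨mem_univ _, q.1.2⟩

theorem hasFDerivAt_setIntegral_param (hK : IsCompact K) (hU : IsOpen U)
    {F : (Fin d → ℝ) × V → G} (hF : ContDiffOn ℝ 1 F (univ ×ˢ U)) {x : V} (hx : x ∈ U) :
    HasFDerivAt (fun x ↦ ∫ θ in K, F (θ, x))
      (∫ θ in K, (fderiv ℝ F (θ, x)).comp (ContinuousLinearMap.inr ℝ (Fin d → ℝ) V)) x := by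
  have hO : IsOpen ((univ : Set (Fin d → ℝ)) ×ˢ U) := isOpen_univ.prod hU
  have hDc : ContinuousOn (fun q ↦ (fderiv ℝ F q).comp (ContinuousLinearMap.inr ℝ (Fin d → ℝ) V))
      (univ ×ˢ U) :=
    (hF.continuousOn_fderiv_of_isOpen hO le_rfl).clm_comp continuousOn_const
  obtain ⟨r, hr, hrU⟩ := Metric.isOpen_iff.1 hU x hx
  have hball : Metric.closedBall x (r / 2) ⊆ U :=
    (Metric.closedBall_subset_ball (by linarith)).trans hrU
  -- Compactness of `K` times a closed ball gives a constant that dominates the derivative.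
  obtain ⟨C, hC⟩ := (hK.prod (isCompact_closedBall x (r / 2))).exists_bound_of_continuousOn
    (hDc.mono (prod_mono (subset_univ _) hball))
  have hslice : ∀ y ∈ U, Continuous fun θ ↦ F (θ, y) := fun y hy ↦
    hF.continuousOn.comp_continuous (by fun_prop) fun θ ↦ ⟨mem_univ _, hy⟩
  have hslice' : Continuous fun θ ↦ (fderiv ℝ F (θ, x)).comp
      (ContinuousLinearMap.inr ℝ (Fin d → ℝ) V) :=
    hDc.comp_continuous (f := fun θ ↦ (θ, x)) (by fun_prop) fun θ ↦ ⟨mem_univ _, hx⟩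
  refine hasFDerivAt_integral_of_dominated_of_fderiv_le (μ := volume.restrict K)
    (F := fun y θ ↦ F (θ, y)) (F' := fun y θ ↦ (fderiv ℝ F (θ, y)).comp
      (ContinuousLinearMap.inr ℝ (Fin d → ℝ) V)) (bound := fun _ ↦ C)
    (Metric.closedBall_mem_nhds x (half_pos hr)) ?_ ?_ ?_ ?_ ?_ ?_
  · filter_upwards [hU.mem_nhds hx] with y hy using (hslice y hy).aestronglyMeasurable
  · exact (hslice x hx).continuousOn.integrableOn_compact hK
  · exact hslice'.aestronglyMeasurable
  · rw [ae_restrict_iff' hK.measurableSet]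
    exact .of_forall fun θ hθ y hy ↦ hC (θ, y) ⟨hθ, hy⟩
  · exact integrableOn_const hK.measure_ne_top
  · refine .of_forall fun θ y hy ↦ ?_
    have h1 : HasFDerivAt F (fderiv ℝ F (θ, y)) (θ, y) :=
      ((hF.differentiableOn one_ne_zero).differentiableAt
        (hO.mem_nhds ⟨mem_univ _, hball hy⟩)).hasFDerivAt
    exact h1.comp y (hasFDerivAt_prodMk_right θ y)

/-- Induction on `n`: a directional derivative of the integral is again an integral over `K`, with
integrand `fderiv ℝ F · (0, y)`. -/
theorem contDiffOn_setIntegral_param [CompleteSpace G] (hK : IsCompact K) (hU : IsOpen U) (n : ℕ)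
    {F : (Fin d → ℝ) × V → G} (hF : ContDiffOn ℝ n F (univ ×ˢ U)) :
    ContDiffOn ℝ n (fun x ↦ ∫ θ in K, F (θ, x)) U := by
  induction n generalizing F with
  | zero =>
    rw [Nat.cast_zero, contDiffOn_zero] at hF ⊢
    exact continuousOn_setIntegral_param hK hU hF
  | succ n ih =>
    have hO : IsOpen ((univ : Set (Fin d → ℝ)) ×ˢ U) := isOpen_univ.prod hU
    have hF1 : ContDiffOn ℝ 1 F (univ ×ˢ U) := hF.of_le (by exact_mod_cast Nat.le_add_left 1 n)
    rw [Nat.cast_succ] at hF ⊢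
    rw [contDiffOn_succ_iff_fderiv_apply hU.uniqueDiffOn]
    refine ⟨fun x hx ↦ (hasFDerivAt_setIntegral_param hK hU hF1 hx).differentiableAt
      |>.differentiableWithinAt, by simp, fun y ↦ ?_⟩
    have h2 : ContDiffOn ℝ n (fun q ↦ fderiv ℝ F q (0, y)) (univ ×ˢ U) :=
      ((contDiffOn_succ_iff_fderiv_of_isOpen hO).1 hF).2.2.clm_apply contDiffOn_const
    refine (ih h2).congr fun x hx ↦ ?_
    rw [fderivWithin_of_isOpen hU hx, (hasFDerivAt_setIntegral_param hK hU hF1 hx).fderiv,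
      ContinuousLinearMap.integral_apply]
    · simp
    · have hDc : ContinuousOn
          (fun q ↦ (fderiv ℝ F q).comp (ContinuousLinearMap.inr ℝ (Fin d → ℝ) V)) (univ ×ˢ U) :=
        (hF1.continuousOn_fderiv_of_isOpen hO le_rfl).clm_comp continuousOn_const
      exact (hDc.comp_continuous (f := fun θ ↦ (θ, x)) (by fun_prop)
        fun θ ↦ ⟨mem_univ _, hx⟩).continuousOn.integrableOn_compact hK

end ParametricIntegral

section Fourier

open MeasureTheory UnitAddTorus

variable {d : ℕ}

/-- The character of the torus with weight `n`, in exponential coordinates. -/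
def weight (n : Fin d → ℤ) : LieAlg d →ₗ[ℝ] ℝ := ∑ i, (n i : ℝ) • LinearMap.proj i

theorem weight_apply (n : Fin d → ℤ) (v : LieAlg d) : weight n v = ∑ i, (n i : ℝ) * v i := by
  simp [weight]

theorem mFourier_coe (n : Fin d → ℤ) (x : LieAlg d) :
    mFourier n (fun i ↦ (x i : UnitAddCircle)) =
      Complex.exp ((2 * Real.pi * weight n x : ℝ) * Complex.I) := by
  simp only [mFourier, ContinuousMap.coe_mk, fourier_coe_apply, ← Complex.exp_sum]
  congr 1
  rw [weight_apply]
  push_cast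
  rw [Finset.mul_sum, Finset.sum_mul]
  exact Finset.sum_congr rfl fun i _ ↦ by ring

/-- The map from the standard torus `(ℝ/ℤ)^m` to `T^m`. -/
def toTorus (x : UnitAddTorus (Fin d)) : Torus d := fun i ↦ (x i).toCircle

theorem toTorus_add (x y : UnitAddTorus (Fin d)) : toTorus (x + y) = toTorus x * toTorus y := by
  ext i
  simp [toTorus, AddCircle.toCircle_add]

theorem toTorus_coe (x : LieAlg d) :
    toTorus (fun i ↦ (x i : UnitAddCircle)) = torusExp ((2 * Real.pi) • x) := by
  ext i
  simp [toTorus, torusExp, AddCircle.toCircle_apply_mk]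

theorem exists_toTorus (v : LieAlg d) : ∃ x : LieAlg d, v = (2 * Real.pi) • x :=
  ⟨(2 * Real.pi)⁻¹ • v, by rw [smul_smul, mul_inv_cancel₀ (by positivity), one_smul]⟩

local instance : MeasureSpace UnitAddCircle := ⟨AddCircle.haarAddCircle⟩

local instance : Measure.IsAddHaarMeasure (volume : Measure UnitAddCircle) :=
  inferInstanceAs (Measure.IsAddHaarMeasure AddCircle.haarAddCircle)

/-- Invariance of Haar measure under translation. It makes the torus act on `torusCoeff` by a
character. -/
theorem mFourierCoeff_comp_add (f : UnitAddTorus (Fin d) → ℂ) (n : Fin d → ℤ)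
    (a : UnitAddTorus (Fin d)) :
    mFourierCoeff (fun x ↦ f (x + a)) n = mFourier n a * mFourierCoeff f n := by
  have h1 : mFourierCoeff (fun x ↦ f (x + a)) n =
      ∫ x, (fun y ↦ mFourier n a * (mFourier (-n) y • f y)) (x + a) := by
    refine integral_congr_ae (.of_forall fun x ↦ ?_)
    have h2 : mFourier (-n) (x + a) = mFourier (-n) x * mFourier (-n) a := by
      simp [mFourier, fourier_apply, smul_add, AddCircle.toCircle_add, Finset.prod_mul_distrib]
    have h3 : mFourier n a * mFourier (-n) a = 1 := by
      rw [← mFourier_add, add_neg_cancel, mFourier_zero]; rfl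
    simp only [h2, smul_eq_mul]
    linear_combination (-(mFourier (-n) x * f (x + a))) * h3
  rw [h1, integral_add_right_eq_self (μ := (volume : Measure (UnitAddTorus (Fin d))))
    (fun y ↦ mFourier n a * (mFourier (-n) y • f y)) a, integral_const_mul]
  rfl

/-- Vanishing coefficients are summable, so the Fourier series converges to `f` at every point. -/
theorem eq_zero_of_mFourierCoeff_eq_zero (f : C(UnitAddTorus (Fin d), ℂ))
    (h : ∀ n, mFourierCoeff f n = 0) (x : UnitAddTorus (Fin d)) : f x = 0 := by
  have h1 : Summable (mFourierCoeff f) := by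
    rw [show mFourierCoeff f = fun _ ↦ 0 from funext h]
    exact summable_zero
  have h2 := hasSum_mFourier_series_apply_of_summable h1 x
  have h3 : (fun n ↦ mFourierCoeff f n • mFourier n x) = fun _ ↦ (0 : ℂ) :=
    funext fun n ↦ by rw [h n, zero_smul]
  rw [h3] at h2
  exact h2.unique hasSum_zero

/-- The half-open and the closed cube differ by a null set. The closed one is compact, so the
results on parametric integrals apply. -/
theorem mFourierCoeff_eq_integral_cube (f : UnitAddTorus (Fin d) → ℂ) (n : Fin d → ℤ) :
    mFourierCoeff f n = ∫ x in Icc (0 : Fin d → ℝ) 1,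
      mFourier (-n) (fun i ↦ (x i : UnitAddCircle)) * f (fun i ↦ (x i : UnitAddCircle)) := by
  rw [mFourierCoeff_eq_integral f n 0]
  have h1 : {x : Fin d → ℝ | ∀ i, x i ∈ Ioc ((0 : Fin d → ℝ) i) ((0 : Fin d → ℝ) i + 1)} =
      univ.pi fun i ↦ Ioc ((0 : Fin d → ℝ) i) ((1 : Fin d → ℝ) i) := by
    ext x
    simp [Set.mem_pi]
  rw [h1]
  exact setIntegral_congr_set Measure.univ_pi_Ioc_ae_eq_Icc

end Fourier

/-! ### Vector fields in a chart -/

section Charts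

variable {V : Type*} [NormedAddCommGroup V] [NormedSpace ℝ V]
  {H : Type*} [TopologicalSpace H] (I : ModelWithCorners ℝ V H)
  {M : Type*} [TopologicalSpace M] [ChartedSpace H M]

/-- The differential of a map of manifolds, as a linear map of the model vector spaces. -/
def mD {V' : Type*} [NormedAddCommGroup V'] [NormedSpace ℝ V'] {H' : Type*} [TopologicalSpace H']
    (I' : ModelWithCorners ℝ V' H') {M' : Type*} [TopologicalSpace M'] [ChartedSpace H' M']
    (f : M → M') (p : M) : V →L[ℝ] V' := mfderiv I I' f p

/-- The differential of the inverse of the preferred chart at `p`. -/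
def chartD (p : M) (x : V) : V →L[ℝ] V :=
  (mfderivWithin 𝓘(ℝ, V) I (extChartAt I p).symm (range I) x : V →L[ℝ] V)

/-- A vector field in the preferred chart at `p`. -/
def fieldInChart (p : M) (Y : M → V) (x : V) : V :=
  (chartD I p x).inverse (Y ((extChartAt I p).symm x))

section mD

variable {V₂ : Type*} [NormedAddCommGroup V₂] [NormedSpace ℝ V₂] {H₂ : Type*} [TopologicalSpace H₂]
  (I₂ : ModelWithCorners ℝ V₂ H₂) {M₂ : Type*} [TopologicalSpace M₂] [ChartedSpace H₂ M₂]
  {V₃ : Type*} [NormedAddCommGroup V₃] [NormedSpace ℝ V₃] {H₃ : Type*} [TopologicalSpace H₃]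
  (I₃ : ModelWithCorners ℝ V₃ H₃) {M₃ : Type*} [TopologicalSpace M₃] [ChartedSpace H₃ M₃]

theorem mD_comp {g : M₂ → M₃} {f : M → M₂} {p : M} (hg : MDifferentiableAt I₂ I₃ g (f p))
    (hf : MDifferentiableAt I I₂ f p) :
    mD I I₃ (g ∘ f) p = (mD I₂ I₃ g (f p)).comp (mD I I₂ f p) := mfderiv_comp p hg hf

theorem mD_comp_apply {g : M₂ → M₃} {f : M → M₂} {p : M} (hg : MDifferentiableAt I₂ I₃ g (f p))
    (hf : MDifferentiableAt I I₂ f p) (X : V) :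
    mD I I₃ (fun q ↦ g (f q)) p X = mD I₂ I₃ g (f p) (mD I I₂ f p X) :=
  congrArg (fun L : V →L[ℝ] V₃ ↦ L X) (mD_comp I I₂ I₃ hg hf)

theorem mD_id (p : M) : mD I I (fun q : M ↦ q) p = ContinuousLinearMap.id ℝ V := mfderiv_id

theorem mD_const (p : M) (c : M₂) : mD I I₂ (fun _ : M ↦ c) p = 0 := mfderiv_const

theorem mD_congr {f g : M → M₂} {p : M} (h : f =ᶠ[𝓝 p] g) : mD I I₂ f p = mD I I₂ g p :=
  h.mfderiv_eq

theorem mD_eq_fderiv {f : V → V₂} {x : V} : mD 𝓘(ℝ, V) 𝓘(ℝ, V₂) f x = fderiv ℝ f x :=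
  mfderiv_eq_fderiv

end mD

variable [I.Boundaryless]

theorem target_mem_nhds (p : M) {x : V} (hx : x ∈ (extChartAt I p).target) :
    (extChartAt I p).target ∈ 𝓝 x := (isOpen_extChartAt_target p).mem_nhds hx

theorem eventually_mem_target (p : M) :
    ∀ᶠ x in 𝓝 (extChartAt I p p), x ∈ (extChartAt I p).target :=
  target_mem_nhds I p (mem_extChartAt_target p)

omit [I.Boundaryless] in
theorem tendsto_extChartAt_symm (p : M) :
    Filter.Tendsto (extChartAt I p).symm (𝓝 (extChartAt I p p)) (𝓝 p) := by
  have := continuousAt_extChartAt_symm (I := I) p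
  rwa [ContinuousAt, extChartAt_to_inv] at this

variable [IsManifold I 1 M]

omit [I.Boundaryless] in
theorem chartD_isInvertible (p : M) {x : V} (hx : x ∈ (extChartAt I p).target) :
    (chartD I p x).IsInvertible :=
  isInvertible_mfderivWithin_extChartAt_symm hx

omit [I.Boundaryless] in
theorem chartD_self (p : M) : chartD I p (extChartAt I p p) = ContinuousLinearMap.id ℝ V :=
  mfderivWithin_range_extChartAt_symm

theorem mdifferentiableAt_extChartAt_symm (p : M) {x : V} (hx : x ∈ (extChartAt I p).target) :
    MDifferentiableAt 𝓘(ℝ, V) I (extChartAt I p).symm x := by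
  have h := mdifferentiableWithinAt_extChartAt_symm (I := I) hx
  have hr : range I = univ := I.range_eq_univ
  rwa [hr, mdifferentiableWithinAt_univ] at h

omit [IsManifold I 1 M] in
theorem chartD_eq_mD (p : M) (x : V) : chartD I p x = mD 𝓘(ℝ, V) I (extChartAt I p).symm x := by
  unfold chartD mD
  rw [I.range_eq_univ, mfderivWithin_univ]

theorem fderiv_comp_symm {G : Type*} [NormedAddCommGroup G] [NormedSpace ℝ G] (p : M) {x : V}
    (hx : x ∈ (extChartAt I p).target) {f : M → G}
    (hf : MDifferentiableAt I 𝓘(ℝ, G) f ((extChartAt I p).symm x)) :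
    fderiv ℝ (f ∘ (extChartAt I p).symm) x =
      (mD I 𝓘(ℝ, G) f ((extChartAt I p).symm x)).comp (chartD I p x) := by
  rw [chartD_eq_mD, ← mD_comp _ _ _ hf (mdifferentiableAt_extChartAt_symm I p hx), mD_eq_fderiv]

theorem differentiableAt_comp_symm {G : Type*} [NormedAddCommGroup G] [NormedSpace ℝ G] (p : M)
    {x : V} (hx : x ∈ (extChartAt I p).target) {f : M → G}
    (hf : MDifferentiableAt I 𝓘(ℝ, G) f ((extChartAt I p).symm x)) :
    DifferentiableAt ℝ (f ∘ (extChartAt I p).symm) x :=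
  (hf.comp x (mdifferentiableAt_extChartAt_symm I p hx)).differentiableAt

theorem fderiv_comp_symm_self {G : Type*} [NormedAddCommGroup G] [NormedSpace ℝ G] (p : M)
    {f : M → G} (hf : MDifferentiableAt I 𝓘(ℝ, G) f p) :
    fderiv ℝ (f ∘ (extChartAt I p).symm) (extChartAt I p p) = mD I 𝓘(ℝ, G) f p := by
  rw [fderiv_comp_symm I p (mem_extChartAt_target p) (by rwa [extChartAt_to_inv]), chartD_self,
    extChartAt_to_inv, ContinuousLinearMap.comp_id]

omit [I.Boundaryless] in
theorem mD_extChartAt_comp_chartD (p : M) {x : V} (hx : x ∈ (extChartAt I p).target) :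
    (mD I 𝓘(ℝ, V) (extChartAt I p) ((extChartAt I p).symm x)).comp (chartD I p x) =
      ContinuousLinearMap.id ℝ V :=
  mfderiv_extChartAt_comp_mfderivWithin_extChartAt_symm hx

omit [I.Boundaryless] in
theorem mD_extChartAt_eq_inverse (p : M) {x : V} (hx : x ∈ (extChartAt I p).target) :
    mD I 𝓘(ℝ, V) (extChartAt I p) ((extChartAt I p).symm x) = (chartD I p x).inverse := by
  have hinv := chartD_isInvertible I p hx
  ext X
  have h1 := congrArg (fun L : V →L[ℝ] V ↦ L ((chartD I p x).inverse X))
    (mD_extChartAt_comp_chartD I p hx)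
  simpa [hinv.self_apply_inverse] using h1

omit [I.Boundaryless] in
theorem mD_extChartAt_self (p : M) :
    mD I 𝓘(ℝ, V) (extChartAt I p) p = ContinuousLinearMap.id ℝ V := mfderiv_extChartAt_self

omit [I.Boundaryless] in
theorem chartD_fieldInChart (p : M) (Y : M → V) {x : V}
    (hx : x ∈ (extChartAt I p).target) :
    chartD I p x (fieldInChart I p Y x) = Y ((extChartAt I p).symm x) := by
  have hinv := chartD_isInvertible I p hx
  unfold fieldInChart
  exact hinv.self_apply_inverse _

omit [I.Boundaryless] in
theorem fieldInChart_self (p : M) (Y : M → V) :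
    fieldInChart I p Y (extChartAt I p p) = Y p := by
  unfold fieldInChart
  rw [chartD_self, ContinuousLinearMap.inverse_id]
  rw [extChartAt_to_inv, ContinuousLinearMap.id_apply]

/-- The preferred chart at `p` has identity differential at `p`, so no change of frame appears in
the formula for the bracket there. -/
theorem mlieBracket_eq_fieldInChart (p : M) (Y Z : M → V) :
    VectorField.mlieBracket I Y Z p =
      fderiv ℝ (fieldInChart I p Z) (extChartAt I p p) (Y p) -
        fderiv ℝ (fieldInChart I p Y) (extChartAt I p p) (Z p) := by
  have hr : range I = univ := I.range_eq_univ
  have h2 : VectorField.mlieBracket I Y Z p =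
      (mD I 𝓘(ℝ, V) (extChartAt I p) p).inverse
        (VectorField.lieBracketWithin ℝ (fieldInChart I p Y) (fieldInChart I p Z)
          ((extChartAt I p).symm ⁻¹' univ ∩ range I) (extChartAt I p p)) := rfl
  rw [h2, mD_extChartAt_self, ContinuousLinearMap.inverse_id, hr, preimage_univ, univ_inter,
    VectorField.lieBracketWithin_univ, VectorField.lieBracket, fieldInChart_self, fieldInChart_self]
  rfl

theorem IsSmoothField.differentiableAt_fieldInChart [IsManifold I 2 M] [CompleteSpace V]
    {Y : M → V} (hY : IsSmoothField I Y) (p : M) :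
    DifferentiableAt ℝ (fieldInChart I p Y) (extChartAt I p p) := by
  have h1 : MDifferentiableWithinAt I I.tangent
      (fun q ↦ (⟨q, Y q⟩ : TangentBundle I M)) univ p :=
    ((hY p).mdifferentiableAt (by simp)).mdifferentiableWithinAt
  have h2 := h1.differentiableWithinAt_mpullbackWithin_vectorField
  have h3 : DifferentiableWithinAt ℝ (fieldInChart I p Y)
      ((extChartAt I p).symm ⁻¹' univ ∩ range I) (extChartAt I p p) := h2
  rwa [preimage_univ, univ_inter, I.range_eq_univ, differentiableWithinAt_univ] at h3

/-- Every tangent vector extends to a smooth vector field that is constant in the chart near its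
base point. -/
theorem exists_smoothField [IsManifold I ∞ M] [FiniteDimensional ℝ V] [T2Space M] (p : M) (X : V) :
    ∃ Y : M → V, IsSmoothField I Y ∧
      ∀ᶠ x in 𝓝 (extChartAt I p p), Y ((extChartAt I p).symm x) = chartD I p x X := by
  set e := trivializationAt V (TangentSpace I) p
  obtain ⟨ψ, hψ⟩ : ∃ ψ : SmoothBumpFunction I p, True := ⟨Classical.arbitrary _, trivial⟩
  let s : ∀ q : M, TangentSpace I q := fun q ↦ e.symm q X
  have hs : ContMDiffOn I I.tangent ∞ (fun q ↦ (⟨q, s q⟩ : TangentBundle I M)) e.baseSet := by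
    intro q hq
    rw [Trivialization.contMDiffWithinAt_section (e := e) _ hq]
    refine (contMDiffWithinAt_const (c := X)).congr_of_mem (fun y hy ↦ ?_) hq
    simp [s, hy]
  refine ⟨(ψ : M → ℝ) • s, ?_, ?_⟩
  · refine ContMDiffOn.smul_section_of_tsupport (ψ.contMDiff.contMDiffOn) e.open_baseSet ?_ hs
    rw [TangentBundle.trivializationAt_baseSet]
    exact ψ.tsupport_subset_chartAt_source
  · have h1 : ∀ᶠ x in 𝓝 (extChartAt I p p), ψ ((extChartAt I p).symm x) = 1 :=
      (tendsto_extChartAt_symm I p).eventually ψ.eventuallyEq_one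
    filter_upwards [h1, eventually_mem_target I p] with x hx hxt
    have hq : (extChartAt I p).symm x ∈ (chartAt H p).source := by
      have := (extChartAt I p).map_target hxt
      rwa [extChartAt_source] at this
    have h2 : s ((extChartAt I p).symm x) = chartD I p x X := by
      have h3 := congrArg (fun L : V →L[ℝ] V ↦ L X) (TangentBundle.symmL_trivializationAt (I := I) hq)
      have h4 : extChartAt I p ((extChartAt I p).symm x) = x := (extChartAt I p).right_inv hxt
      rw [h4] at h3
      refine Eq.trans ?_ h3
      exact (Trivialization.symmL_apply _
        (by rw [TangentBundle.trivializationAt_baseSet]; exact hq) _).symm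
    change ψ ((extChartAt I p).symm x) • s _ = _
    rw [hx, one_smul, h2]

omit [I.Boundaryless] [IsManifold I 1 M] in
-- For finite dimensional `V` the space `V →L[ℝ] G'` is a finite product of copies of `G'`, by
-- evaluation on a basis.
theorem differentiableAt_of_apply [FiniteDimensional ℝ V] {G G' : Type*} [NormedAddCommGroup G]
    [NormedSpace ℝ G] [NormedAddCommGroup G'] [NormedSpace ℝ G'] {f : G → V →L[ℝ] G'} {x : G}
    (h : ∀ X, DifferentiableAt ℝ (fun y ↦ f y X) x) : DifferentiableAt ℝ f x := by
  let d := finrank ℝ V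
  have hd : d = finrank ℝ (Fin d → ℝ) := (finrank_fin_fun ℝ).symm
  let e₁ := ContinuousLinearEquiv.ofFinrankEq hd
  let e₂ := (e₁.arrowCongr (1 : G' ≃L[ℝ] G')).trans (ContinuousLinearEquiv.piRing (Fin d))
  rw [← Function.id_comp f, ← e₂.symm_comp_self]
  exact e₂.symm.differentiable.differentiableAt.comp x (differentiableAt_pi.2 fun i ↦ h _)

/-- An endomorphism of the tangent bundle in the preferred chart at `p`. -/
def endInChart (J : M → V →L[ℝ] V) (p : M) (x : V) :
    V →L[ℝ] V :=
  (chartD I p x).inverse.comp ((J ((extChartAt I p).symm x)).comp (chartD I p x))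

/-- A two-tensor in the preferred chart at `p`. -/
def tensorInChart (α : M → V → V → ℝ) (p : M) (X Y : V) (x : V) :
    ℝ :=
  α ((extChartAt I p).symm x) (chartD I p x X) (chartD I p x Y)

omit [I.Boundaryless] in
theorem endInChart_self (J : M → V →L[ℝ] V) (p : M) :
    endInChart I J p (extChartAt I p p) = J p := by
  unfold endInChart
  rw [chartD_self, ContinuousLinearMap.inverse_id]
  rw [extChartAt_to_inv]
  rfl

omit [I.Boundaryless] in
theorem tensorInChart_self (α : M → V → V → ℝ) (p : M)
    (X Y : V) : tensorInChart I α p X Y (extChartAt I p p) = α p X Y := by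
  unfold tensorInChart
  rw [chartD_self]
  rw [extChartAt_to_inv]
  rfl

omit [I.Boundaryless] in
theorem chartD_endInChart (J : M → V →L[ℝ] V) (p : M) {x : V}
    (hx : x ∈ (extChartAt I p).target) (X : V) :
    chartD I p x (endInChart I J p x X) = J ((extChartAt I p).symm x) (chartD I p x X) := by
  have hinv := chartD_isInvertible I p hx
  unfold endInChart
  exact hinv.self_apply_inverse _

theorem eventually_fieldInChart_eq {p : M} {Y : M → V} {X : V}
    (h : ∀ᶠ x in 𝓝 (extChartAt I p p), Y ((extChartAt I p).symm x) = chartD I p x X) :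
    fieldInChart I p Y =ᶠ[𝓝 (extChartAt I p p)] fun _ ↦ X := by
  filter_upwards [h, eventually_mem_target I p] with x hx hxt
  unfold fieldInChart
  rw [hx]
  exact (chartD_isInvertible I p hxt).inverse_apply_self X

omit [I.Boundaryless] [IsManifold I 1 M] in
theorem eventually_fieldInChart_end_eq {p : M} {Y : M → V} {X : V}
    (J : M → V →L[ℝ] V)
    (h : ∀ᶠ x in 𝓝 (extChartAt I p p), Y ((extChartAt I p).symm x) = chartD I p x X) :
    fieldInChart I p (fun q ↦ J q (Y q)) =ᶠ[𝓝 (extChartAt I p p)]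
      fun x ↦ endInChart I J p x X := by
  filter_upwards [h] with x hx
  simp only [fieldInChart, endInChart, hx]
  rfl

section Tensors

variable [IsManifold I ∞ M] [IsManifold I 2 M] [FiniteDimensional ℝ V] [T2Space M]

theorem differentiableAt_endInChart {J : M → V →L[ℝ] V}
    (hJ : ∀ X : M → V, IsSmoothField I X → IsSmoothField I (fun q ↦ J q (X q)))
    (p : M) : DifferentiableAt ℝ (endInChart I J p) (extChartAt I p p) := by
  have : CompleteSpace V := FiniteDimensional.complete ℝ V
  refine differentiableAt_of_apply fun X ↦ ?_
  obtain ⟨Y, hY, hYX⟩ := exists_smoothField I p X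
  exact ((hJ Y hY).differentiableAt_fieldInChart I p).congr_of_eventuallyEq
    (eventually_fieldInChart_end_eq I J hYX).symm

/-- The Nijenhuis tensor is tested on fields constant in the chart near `p`. Their mutual bracket is
zero, and the other brackets reduce to derivatives of the matrix of `J`. -/
theorem IsIntegrable.in_chart {J : M → V →L[ℝ] V}
    (hJ : ∀ X : M → V, IsSmoothField I X → IsSmoothField I (fun q ↦ J q (X q)))
    (hint : IsIntegrable I J) (p : M) (X Y : V) :
    fderiv ℝ (endInChart I J p) (extChartAt I p p) (J p X) Y
      - fderiv ℝ (endInChart I J p) (extChartAt I p p) (J p Y) X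
      + J p (fderiv ℝ (endInChart I J p) (extChartAt I p p) Y X)
      - J p (fderiv ℝ (endInChart I J p) (extChartAt I p p) X Y) = 0 := by
  obtain ⟨X', hX', hX⟩ := exists_smoothField I p X
  obtain ⟨Y', hY', hY⟩ := exists_smoothField I p Y
  have hd := differentiableAt_endInChart I hJ p
  have h := hint X' Y' hX' hY' p
  have hXp : X' p = X := by
    have := (eventually_fieldInChart_eq I hX).self_of_nhds
    rwa [fieldInChart_self] at this
  have hYp : Y' p = Y := by
    have := (eventually_fieldInChart_eq I hY).self_of_nhds
    rwa [fieldInChart_self] at this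
  have e1 : ∀ Z W : V, fderiv ℝ (fun x ↦ endInChart I J p x Z) (extChartAt I p p) W =
      fderiv ℝ (endInChart I J p) (extChartAt I p p) W Z := by
    intro Z W
    rw [fderiv_clm_apply hd (differentiableAt_const _)]
    simp
  have c0 : ∀ Z W : V, fderiv ℝ (fun _ : V ↦ Z) (extChartAt I p p) W = 0 := by
    intro Z W
    simp
  have h' : (show V from VectorField.mlieBracket I (fun q ↦ J q (X' q)) (fun q ↦ J q (Y' q)) p)
      - J p (VectorField.mlieBracket I (fun q ↦ J q (X' q)) Y' p)
      - J p (VectorField.mlieBracket I X' (fun q ↦ J q (Y' q)) p)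
      - (show V from VectorField.mlieBracket I X' Y' p) = 0 := h
  rw [mlieBracket_eq_fieldInChart, mlieBracket_eq_fieldInChart, mlieBracket_eq_fieldInChart,
    mlieBracket_eq_fieldInChart, (eventually_fieldInChart_eq I hX).fderiv_eq,
    (eventually_fieldInChart_eq I hY).fderiv_eq, (eventually_fieldInChart_end_eq I J hX).fderiv_eq,
    (eventually_fieldInChart_end_eq I J hY).fderiv_eq, hXp, hYp] at h'
  simp only [e1, c0] at h'
  simpa [sub_eq_add_neg] using h'

variable {α : M → V → V → ℝ}

omit [IsManifold I 2 M] in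
theorem exists_tensorInChart_eq (p : M) (X Y : V) :
    ∃ X' Y' : M → V, IsSmoothField I X' ∧ IsSmoothField I Y' ∧
      tensorInChart I α p X Y =ᶠ[𝓝 (extChartAt I p p)]
        (fun q ↦ α q (X' q) (Y' q)) ∘ (extChartAt I p).symm := by
  obtain ⟨X', hX', hX⟩ := exists_smoothField I p X
  obtain ⟨Y', hY', hY⟩ := exists_smoothField I p Y
  refine ⟨X', Y', hX', hY', ?_⟩
  filter_upwards [hX, hY] with x hx hy
  simp only [Function.comp, hx, hy, tensorInChart]

omit [IsManifold I 2 M] in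
theorem differentiableAt_tensorInChart
    (hsm : ∀ Y Z : M → V, IsSmoothField I Y → IsSmoothField I Z →
      MDifferentiable I 𝓘(ℝ, ℝ) fun q ↦ α q (Y q) (Z q)) (p : M) (X Y : V) :
    DifferentiableAt ℝ (tensorInChart I α p X Y) (extChartAt I p p) := by
  obtain ⟨X', Y', hX', hY', h⟩ := exists_tensorInChart_eq I (α := α) p X Y
  exact (differentiableAt_comp_symm I p (mem_extChartAt_target p)
    (hsm X' Y' hX' hY' _)).congr_of_eventuallyEq h

omit [IsManifold I 2 M] in
-- Closedness is tested on fields constant in the chart near `p`: the bracket terms drop out and the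
-- alternating sum of derivatives remains.
theorem IsClosedForm.in_chart (h0 : ∀ q Y, α q 0 Y = 0)
    (hsm : ∀ Y Z : M → V, IsSmoothField I Y → IsSmoothField I Z →
      MDifferentiable I 𝓘(ℝ, ℝ) fun q ↦ α q (Y q) (Z q))
    (hcl : IsClosedForm I α) (p : M) (X Y Z : V) :
    fderiv ℝ (tensorInChart I α p Y Z) (extChartAt I p p) X
      - fderiv ℝ (tensorInChart I α p X Z) (extChartAt I p p) Y
      + fderiv ℝ (tensorInChart I α p X Y) (extChartAt I p p) Z = 0 := by
  obtain ⟨X', hX', hX⟩ := exists_smoothField I p X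
  obtain ⟨Y', hY', hY⟩ := exists_smoothField I p Y
  obtain ⟨Z', hZ', hZ⟩ := exists_smoothField I p Z
  have h := hcl X' Y' Z' hX' hY' hZ' p
  have hp : ∀ {W : V} {W' : M → V},
      (∀ᶠ x in 𝓝 (extChartAt I p p), W' ((extChartAt I p).symm x) = chartD I p x W) → W' p = W := by
    intro W W' hW
    have := (eventually_fieldInChart_eq I hW).self_of_nhds
    rwa [fieldInChart_self] at this
  have c0 : ∀ Z W : V, fderiv ℝ (fun _ : V ↦ Z) (extChartAt I p p) W = 0 := by
    intro Z W
    simp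
  have hb : ∀ {W₁ W₂ : V} {W₁' W₂' : M → V},
      (∀ᶠ x in 𝓝 (extChartAt I p p), W₁' ((extChartAt I p).symm x) = chartD I p x W₁) →
      (∀ᶠ x in 𝓝 (extChartAt I p p), W₂' ((extChartAt I p).symm x) = chartD I p x W₂) →
      ∀ W, α p (VectorField.mlieBracket I W₁' W₂' p) W = 0 := by
    intro W₁ W₂ W₁' W₂' h1 h2 W
    have h3 : (show V from VectorField.mlieBracket I W₁' W₂' p) = 0 := ?_
    · exact (congrArg (fun Z ↦ α p Z W) h3).trans (h0 p W)
    rw [mlieBracket_eq_fieldInChart, (eventually_fieldInChart_eq I h1).fderiv_eq,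
      (eventually_fieldInChart_eq I h2).fderiv_eq, c0, c0, sub_zero]
  have hf : ∀ {W₁ W₂ : V} {W₁' W₂' : M → V}, IsSmoothField I W₁' →
      IsSmoothField I W₂' →
      (∀ᶠ x in 𝓝 (extChartAt I p p), W₁' ((extChartAt I p).symm x) = chartD I p x W₁) →
      (∀ᶠ x in 𝓝 (extChartAt I p p), W₂' ((extChartAt I p).symm x) = chartD I p x W₂) →
      ∀ W : V, mD I 𝓘(ℝ, ℝ) (fun q ↦ α q (W₁' q) (W₂' q)) p W =
        fderiv ℝ (tensorInChart I α p W₁ W₂) (extChartAt I p p) W := by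
    intro W₁ W₂ W₁' W₂' hW₁ hW₂ h1 h2 W
    rw [← fderiv_comp_symm_self I p (hsm _ _ hW₁ hW₂ p)]
    congr 1
    refine Filter.EventuallyEq.fderiv_eq ?_
    filter_upwards [h1, h2] with x hx hy
    simp only [Function.comp, hx, hy, tensorInChart]
  rw [hb hX hY, hb hX hZ, hb hY hZ, sub_zero, add_zero, sub_zero] at h
  have h' : mD I 𝓘(ℝ, ℝ) (fun q ↦ α q (Y' q) (Z' q)) p (X' p)
      - mD I 𝓘(ℝ, ℝ) (fun q ↦ α q (X' q) (Z' q)) p (Y' p)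
      + mD I 𝓘(ℝ, ℝ) (fun q ↦ α q (X' q) (Y' q)) p (Z' p) = 0 := h
  rwa [hp hX, hp hY, hp hZ, hf hY' hZ' hY hZ, hf hX' hZ' hX hZ, hf hX' hY' hX hY] at h'

end Tensors

end Charts

/-! ### Differentiating invariance under a local action -/

section LocalAction

variable {W 𝔥 : Type*} [NormedAddCommGroup W] [NormedSpace ℝ W] [NormedAddCommGroup 𝔥]
  [NormedSpace ℝ 𝔥] {Φ : 𝔥 × W → W} {x₀ : W}

/-- The infinitesimal generators of a local action. -/
def localField (Φ : 𝔥 × W → W) (a : 𝔥) (x : W) : W := fderiv ℝ Φ (0, x) (a, 0)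

/-- The differentials of the maps of a local action at a point. -/
def localD (Φ : 𝔥 × W → W) (x₀ : W) (a : 𝔥) : W →L[ℝ] W :=
  (fderiv ℝ Φ (a, x₀)).comp (ContinuousLinearMap.inr ℝ 𝔥 W)

theorem hasFDerivAt_localField (hΦ : ContDiffAt ℝ 2 Φ (0, x₀)) (a : 𝔥) :
    DifferentiableAt ℝ (localField Φ a) x₀ ∧ ∀ X, fderiv ℝ (localField Φ a) x₀ X =
      fderiv ℝ (fderiv ℝ Φ) (0, x₀) (0, X) (a, 0) := by
  have h1 : DifferentiableAt ℝ (fderiv ℝ Φ) (0, x₀) :=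
    (hΦ.fderiv_right (m := 1) (by norm_num)).differentiableAt one_ne_zero
  have h2 : HasFDerivAt (fun x ↦ fderiv ℝ Φ (0, x))
      ((fderiv ℝ (fderiv ℝ Φ) (0, x₀)).comp (ContinuousLinearMap.inr ℝ 𝔥 W)) x₀ :=
    h1.hasFDerivAt.comp x₀ (hasFDerivAt_prodMk_right 0 x₀)
  have h3 := h2.clm_apply (hasFDerivAt_const (a, (0 : W)) x₀)
  refine ⟨h3.differentiableAt, fun X ↦ ?_⟩
  have h4 : fderiv ℝ (localField Φ a) x₀ = _ := h3.fderiv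
  rw [h4]
  simp

/-- Symmetry of the second derivative of `Φ` exchanges differentiation in the group direction with
differentiation in space. -/
theorem hasDerivAt_localD (hΦ : ContDiffAt ℝ 2 Φ (0, x₀)) (a : 𝔥) :
    HasDerivAt (fun t : ℝ ↦ localD Φ x₀ (t • a)) (fderiv ℝ (localField Φ a) x₀) 0 := by
  have h1 : DifferentiableAt ℝ (fderiv ℝ Φ) (0, x₀) :=
    (hΦ.fderiv_right (m := 1) (by norm_num)).differentiableAt one_ne_zero
  have h2 : HasDerivAt (fun t : ℝ ↦ ((t • a, x₀) : 𝔥 × W)) (a, 0) 0 := by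
    have := ((hasDerivAt_id (0 : ℝ)).smul_const a).prodMk (hasDerivAt_const (0 : ℝ) x₀)
    simpa using this
  have h3 : HasDerivAt (fun t : ℝ ↦ fderiv ℝ Φ (t • a, x₀))
      (fderiv ℝ (fderiv ℝ Φ) (0, x₀) (a, 0)) 0 := by
    have h4 : HasFDerivAt (fderiv ℝ Φ) (fderiv ℝ (fderiv ℝ Φ) (0, x₀)) ((0 : ℝ) • a, x₀) := by
      rw [zero_smul]; exact h1.hasFDerivAt
    exact h4.comp_hasDerivAt (0 : ℝ) h2
  have h5 := h3.clm_comp (hasDerivAt_const (0 : ℝ) (ContinuousLinearMap.inr ℝ 𝔥 W))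
  have h6 : fderiv ℝ (localField Φ a) x₀ =
      (fderiv ℝ (fderiv ℝ Φ) (0, x₀) (a, 0)).comp (ContinuousLinearMap.inr ℝ 𝔥 W) := by
    ext X
    rw [(hasFDerivAt_localField hΦ a).2]
    exact (hΦ.isSymmSndFDerivAt (by simp)).eq _ _
  rw [h6]
  simpa [localD] using h5

theorem localD_zero (h0 : ∀ᶠ x in 𝓝 x₀, Φ (0, x) = x) (hΦ : DifferentiableAt ℝ Φ (0, x₀)) :
    localD Φ x₀ 0 = ContinuousLinearMap.id ℝ W := by
  have h1 : HasFDerivAt (fun x ↦ Φ (0, x)) (localD Φ x₀ 0) x₀ :=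
    hΦ.hasFDerivAt.comp x₀ (hasFDerivAt_prodMk_right 0 x₀)
  have h2 : (fun x ↦ Φ (0, x)) =ᶠ[𝓝 x₀] fun x ↦ x := h0
  exact (h1.congr_of_eventuallyEq h2.symm).unique (hasFDerivAt_id x₀)

theorem hasDerivAt_orbit (hΦ : DifferentiableAt ℝ Φ (0, x₀)) (a : 𝔥) :
    HasDerivAt (fun t : ℝ ↦ Φ (t • a, x₀)) (localField Φ a x₀) 0 := by
  have h2 : HasDerivAt (fun t : ℝ ↦ ((t • a, x₀) : 𝔥 × W)) (a, 0) 0 := by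
    have := ((hasDerivAt_id (0 : ℝ)).smul_const a).prodMk (hasDerivAt_const (0 : ℝ) x₀)
    simpa using this
  have h4 : HasFDerivAt Φ (fderiv ℝ Φ (0, x₀)) ((0 : ℝ) • a, x₀) := by
    rw [zero_smul]; exact hΦ.hasFDerivAt
  exact h4.comp_hasDerivAt (0 : ℝ) h2

theorem hasDerivAt_comp_orbit {F : Type*} [NormedAddCommGroup F] [NormedSpace ℝ F] {g : W → F}
    (hΦ : DifferentiableAt ℝ Φ (0, x₀)) (h0 : ∀ᶠ x in 𝓝 x₀, Φ (0, x) = x)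
    (hg : DifferentiableAt ℝ g x₀) (a : 𝔥) :
    HasDerivAt (fun t : ℝ ↦ g (Φ (t • a, x₀))) (fderiv ℝ g x₀ (localField Φ a x₀)) 0 := by
  have hx : Φ ((0 : ℝ) • a, x₀) = x₀ := by rw [zero_smul]; exact h0.self_of_nhds
  have h4 : HasFDerivAt g (fderiv ℝ g x₀) (Φ ((0 : ℝ) • a, x₀)) := by
    rw [hx]; exact hg.hasFDerivAt
  exact h4.comp_hasDerivAt (0 : ℝ) (hasDerivAt_orbit hΦ a)

/-- The Lie derivative of `J` along the generator vanishes: the `t`-derivative at `0` of the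
intertwining relation between `J` and the maps of the action. -/
theorem fderiv_localField_end (hΦ : ContDiffAt ℝ 2 Φ (0, x₀)) (h0 : ∀ᶠ x in 𝓝 x₀, Φ (0, x) = x)
    {J : W → W →L[ℝ] W} (hJ : DifferentiableAt ℝ J x₀) (a : 𝔥)
    (hinv : ∀ᶠ t : ℝ in 𝓝 0, (localD Φ x₀ (t • a)).comp (J x₀) =
      (J (Φ (t • a, x₀))).comp (localD Φ x₀ (t • a))) (X : W) :
    fderiv ℝ (localField Φ a) x₀ (J x₀ X) =
      fderiv ℝ J x₀ (localField Φ a x₀) X + J x₀ (fderiv ℝ (localField Φ a) x₀ X) := by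
  have hd : DifferentiableAt ℝ Φ (0, x₀) := hΦ.differentiableAt (by norm_num)
  have hM := hasDerivAt_localD hΦ a
  have hx : Φ ((0 : ℝ) • a, x₀) = x₀ := by rw [zero_smul]; exact h0.self_of_nhds
  have hJ' : HasDerivAt (fun t : ℝ ↦ J (Φ (t • a, x₀))) (fderiv ℝ J x₀ (localField Φ a x₀)) 0 :=
    hasDerivAt_comp_orbit hd h0 hJ a
  have h1 := hM.clm_comp (hasDerivAt_const (0 : ℝ) (J x₀))
  have h2 := hJ'.clm_comp hM
  have h3 := h1.unique (h2.congr_of_eventuallyEq hinv)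
  have h4 := congrArg (fun L : W →L[ℝ] W ↦ L X) h3
  simpa [localD_zero h0 hd, hx, h0.self_of_nhds] using h4

set_option synthInstance.maxHeartbeats 400000 in
-- The Lie derivative of `g` along the generator is `c g`. The cases used are `c = 0` for isometries
-- and `c = 2` for dilations.
theorem fderiv_localField_metric (hΦ : ContDiffAt ℝ 2 Φ (0, x₀))
    (h0 : ∀ᶠ x in 𝓝 x₀, Φ (0, x) = x)
    {g : W → W →L[ℝ] W →L[ℝ] ℝ} (hg : DifferentiableAt ℝ g x₀) (a : 𝔥) (c : ℝ) (X Y : W)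
    (hinv : ∀ᶠ t : ℝ in 𝓝 0, g (Φ (t • a, x₀)) (localD Φ x₀ (t • a) X) (localD Φ x₀ (t • a) Y) =
      Real.exp (c * t) * g x₀ X Y) :
    fderiv ℝ g x₀ (localField Φ a x₀) X Y + g x₀ (fderiv ℝ (localField Φ a) x₀ X) Y
      + g x₀ X (fderiv ℝ (localField Φ a) x₀ Y) = c * g x₀ X Y := by
  have hd : DifferentiableAt ℝ Φ (0, x₀) := hΦ.differentiableAt (by norm_num)
  have hM := hasDerivAt_localD hΦ a
  have hx : Φ ((0 : ℝ) • a, x₀) = x₀ := by rw [zero_smul]; exact h0.self_of_nhds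
  have hg' : HasDerivAt (fun t : ℝ ↦ g (Φ (t • a, x₀))) (fderiv ℝ g x₀ (localField Φ a x₀)) 0 :=
    hasDerivAt_comp_orbit (F := W →L[ℝ] W →L[ℝ] ℝ) (g := g) hd h0 hg a
  have hMX := hM.clm_apply (hasDerivAt_const (0 : ℝ) X)
  have hMY := hM.clm_apply (hasDerivAt_const (0 : ℝ) Y)
  have h1 := (hg'.clm_apply hMX).clm_apply hMY
  have h2 : HasDerivAt (fun t : ℝ ↦ Real.exp (c * t) * g x₀ X Y) (c * g x₀ X Y) 0 := by
    have := (((hasDerivAt_id (0 : ℝ)).const_mul c).exp).mul_const (g x₀ X Y)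
    simpa using this
  have h3 := h1.unique (h2.congr_of_eventuallyEq hinv)
  simpa [localD_zero h0 hd, hx, h0.self_of_nhds] using h3

/-- The bracket of two generators vanishes, from the invariance of one under the flow of the other.
-/
theorem fderiv_localField_comm (hΦ : ContDiffAt ℝ 2 Φ (0, x₀)) (h0 : ∀ᶠ x in 𝓝 x₀, Φ (0, x) = x)
    (a a' : 𝔥)
    (hinv : ∀ᶠ t : ℝ in 𝓝 0, localField Φ a' (Φ (t • a, x₀)) =
      localD Φ x₀ (t • a) (localField Φ a' x₀)) :
    fderiv ℝ (localField Φ a') x₀ (localField Φ a x₀) =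
      fderiv ℝ (localField Φ a) x₀ (localField Φ a' x₀) := by
  have hd : DifferentiableAt ℝ Φ (0, x₀) := hΦ.differentiableAt (by norm_num)
  have hM := hasDerivAt_localD hΦ a
  have hO := hasDerivAt_orbit hd a
  have hx : Φ ((0 : ℝ) • a, x₀) = x₀ := by rw [zero_smul]; exact h0.self_of_nhds
  have hF : HasDerivAt (fun t : ℝ ↦ localField Φ a' (Φ (t • a, x₀)))
      (fderiv ℝ (localField Φ a') x₀ (localField Φ a x₀)) 0 := by
    have h4 : HasFDerivAt (localField Φ a') (fderiv ℝ (localField Φ a') x₀)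
        (Φ ((0 : ℝ) • a, x₀)) := by
      rw [hx]; exact (hasFDerivAt_localField hΦ a').1.hasFDerivAt
    exact h4.comp_hasDerivAt (0 : ℝ) hO
  have h1 := hM.clm_apply (hasDerivAt_const (0 : ℝ) (localField Φ a' x₀))
  have h3 := hF.unique (h1.congr_of_eventuallyEq hinv)
  simpa using h3

/-- The calculation behind `d⟨μ, v⟩ = -ω(v, ·)`: the data are the 1-jets at a point of the complex
structure, the metric, the fields `b = J R`, `v` and `R` in a chart. -/
theorem moment_calculation {J₀ : W →L[ℝ] W} {J' : W →L[ℝ] W →L[ℝ] W} {g₀ : W →L[ℝ] W →L[ℝ] ℝ}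
    {g' : W →L[ℝ] W →L[ℝ] W →L[ℝ] ℝ} {b₀ v₀ R₀ : W} {b' v' R' : W →L[ℝ] W}
    (hJ : ∀ X, J₀ (J₀ X) = -X) (hJ' : ∀ X Y, J' X (J₀ Y) + J₀ (J' X Y) = 0)
    (hR₀ : R₀ = -J₀ b₀) (hR' : ∀ X, R' X = -(J' X b₀) - J₀ (b' X))
    (hb : ∀ X, b' (J₀ X) = J' b₀ X + J₀ (b' X)) (hv : ∀ X, v' (J₀ X) = J' v₀ X + J₀ (v' X))
    (hN : ∀ X Y, J' (J₀ X) Y - J' (J₀ Y) X + J₀ (J' Y X) - J₀ (J' X Y) = 0)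
    (hgv : ∀ X Y, g' v₀ X Y + g₀ (v' X) Y + g₀ X (v' Y) = 0)
    (hgR : ∀ X Y, g' R₀ X Y + g₀ (R' X) Y + g₀ X (R' Y) = 2 * g₀ X Y)
    (hω : ∀ X Y, g₀ (J₀ X) Y = -g₀ (J₀ Y) X) (hcomm : R' v₀ = v' R₀)
    (hcl : ∀ X Y Z, (g' X (J₀ Y) Z + g₀ (J' X Y) Z) - (g' Y (J₀ X) Z + g₀ (J' Y X) Z)
      + (g' Z (J₀ X) Y + g₀ (J' Z X) Y) = 0) (X : W) :
    g' X b₀ v₀ + g₀ (b' X) v₀ + g₀ b₀ (v' X) = -2 * g₀ (J₀ v₀) X := by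
  -- Integrability makes `R = -J b` holomorphic together with `b`: the Lie derivative of `J` along
  -- `R` vanishes.
  have hLR : ∀ Y, J' R₀ Y = R' (J₀ Y) - J₀ (R' Y) := by
    intro Y
    have h1 := hN b₀ Y
    have h2 : J' R₀ Y = -(J' (J₀ b₀) Y) := by rw [hR₀, map_neg]; rfl
    rw [h2, hR', hR', map_sub, map_neg, hJ, hb, map_add, hJ]
    rw [← sub_eq_zero, ← neg_eq_zero, ← h1]
    abel
  have hJR : J₀ R₀ = b₀ := by rw [hR₀, map_neg, hJ, neg_neg]
  -- With `ω(R, v) = g(b, v)`, the claim is the Cartan formula for `X ω(R, v)`, where `dω = 0`, `L_R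
  -- ω = 2ω`, `L_v ω = 0` and `[R, v] = 0`.
  have h1 := hcl R₀ v₀ X
  have h2 := hgR (J₀ v₀) X
  have h3 := hgv (J₀ R₀) X
  have h4 : g₀ (J' R₀ v₀) X = g₀ (R' (J₀ v₀)) X - g₀ (J₀ (R' v₀)) X := by
    rw [hLR, map_sub]; rfl
  have h5 : g₀ (v' (J₀ R₀)) X = g₀ (J' v₀ R₀) X + g₀ (J₀ (v' R₀)) X := by
    rw [hv, map_add]; rfl
  have h6 : b' X = J' X R₀ + J₀ (R' X) := by
    rw [hR', hR₀, map_sub, map_neg, map_neg, hJ, sub_neg_eq_add, ← add_assoc, ← neg_add,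
      hJ', neg_zero, zero_add]
  have h7 : g₀ (b' X) v₀ = g₀ (J' X R₀) v₀ + g₀ (J₀ (R' X)) v₀ := by
    rw [h6, map_add]; rfl
  have h8 : J₀ (R' v₀) = J₀ (v' R₀) := by rw [hcomm]
  have h9 := hω (R' X) v₀
  rw [h8] at h4
  rw [hJR] at h1 h3 h5
  linear_combination h1 - h2 + h3 + h7 - h4 - h5 + h9

end LocalAction

/-! ### Actions of a vector group on a manifold -/

section VectorAction

variable {V : Type*} [NormedAddCommGroup V] [NormedSpace ℝ V]
  {H : Type*} [TopologicalSpace H] (I : ModelWithCorners ℝ V H)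
  {M : Type*} [TopologicalSpace M] [ChartedSpace H M]
  {𝔥 : Type*} [NormedAddCommGroup 𝔥] [NormedSpace ℝ 𝔥]

/-- A smooth action of the additive group of a vector space. -/
structure IsSmoothVectorAction (act : 𝔥 → M → M) : Prop where
  smooth : ContMDiff (𝓘(ℝ, 𝔥).prod I) I ∞ (fun q : 𝔥 × M ↦ act q.1 q.2)
  zero : ∀ q, act 0 q = q
  add : ∀ a a' q, act (a + a') q = act a (act a' q)

/-- The infinitesimal generators of an action of a vector group. -/
def genField (act : 𝔥 → M → M) (q : M) : 𝔥 →L[ℝ] V := mD 𝓘(ℝ, 𝔥) I (fun v ↦ act v q) 0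

/-- An action of a vector group in the preferred chart at `p`. -/
def chartAct (act : 𝔥 → M → M) (p : M) (y : 𝔥 × V) : V :=
  extChartAt I p (act y.1 ((extChartAt I p).symm y.2))

namespace IsSmoothVectorAction

variable {I} {act : 𝔥 → M → M} (hact : IsSmoothVectorAction I act)
include hact

theorem smooth_map (a : 𝔥) : ContMDiff I I ∞ (act a) :=
  hact.smooth.comp (contMDiff_const.prodMk contMDiff_id)

theorem smooth_orbit (q : M) : ContMDiff 𝓘(ℝ, 𝔥) I ∞ (fun a ↦ act a q) :=
  hact.smooth.comp (contMDiff_id.prodMk contMDiff_const)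

theorem mdifferentiableAt_map (a : 𝔥) (q : M) : MDifferentiableAt I I (act a) q :=
  (hact.smooth_map a).mdifferentiableAt (by simp)

theorem mdifferentiableAt_orbit (q : M) (a : 𝔥) :
    MDifferentiableAt 𝓘(ℝ, 𝔥) I (fun a ↦ act a q) a :=
  (hact.smooth_orbit q).mdifferentiableAt (by simp)

theorem mD_orbit (q : M) (a : 𝔥) :
    mD 𝓘(ℝ, 𝔥) I (fun v ↦ act v q) a = genField I act (act a q) := by
  have h1 : (fun v ↦ act v q) = (fun v ↦ act v (act a q)) ∘ fun v ↦ v - a := by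
    ext v; simp [← hact.add]
  have h2 : mD 𝓘(ℝ, 𝔥) 𝓘(ℝ, 𝔥) (fun v ↦ v - a) a = ContinuousLinearMap.id ℝ 𝔥 := by
    rw [mD_eq_fderiv, fderiv_sub_const, fderiv_fun_id]
  rw [h1, mD_comp _ 𝓘(ℝ, 𝔥) _ (hact.mdifferentiableAt_orbit _ _)
    (by fun_prop : DifferentiableAt ℝ (fun v ↦ v - a) a).mdifferentiableAt, h2, sub_self]
  rfl

theorem genField_act (q : M) (a a' : 𝔥) :
    genField I act (act a q) a' = mD I I (act a) q (genField I act q a') := by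
  have h1 : (fun v ↦ act v (act a q)) = act a ∘ fun v ↦ act v q := by
    ext v; simp [← hact.add, add_comm]
  have h2 := mD_comp 𝓘(ℝ, 𝔥) I I (f := fun v ↦ act v q) (hact.mdifferentiableAt_map a (act 0 q))
    (hact.mdifferentiableAt_orbit q 0)
  unfold genField
  rw [h1, h2, hact.zero]
  rfl

variable [I.Boundaryless] [IsManifold I 1 M]

omit [IsManifold I 1 M] in
theorem contDiffAt_chartAct [IsManifold I ∞ M] (p : M) :
    ContDiffAt ℝ ∞ (chartAct I act p) (0, extChartAt I p p) := by
  rw [← contMDiffAt_iff_contDiffAt]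
  have hs : ContMDiffAt 𝓘(ℝ, 𝔥 × V) 𝓘(ℝ, V) ∞ (Prod.snd : 𝔥 × V → V) (0, extChartAt I p p) :=
    contDiff_snd.contMDiff.contMDiffAt
  have hf : ContMDiffAt 𝓘(ℝ, 𝔥 × V) 𝓘(ℝ, 𝔥) ∞ (Prod.fst : 𝔥 × V → 𝔥) (0, extChartAt I p p) :=
    contDiff_fst.contMDiff.contMDiffAt
  have h1 : ContMDiffAt 𝓘(ℝ, V) I ∞ (extChartAt I p).symm (extChartAt I p p) :=
    (contMDiffOn_extChartAt_symm p).contMDiffAt (target_mem_nhds I p (mem_extChartAt_target p))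
  have h2 : ContMDiffAt 𝓘(ℝ, 𝔥 × V) I ∞
      (fun y : 𝔥 × V ↦ act y.1 ((extChartAt I p).symm y.2)) (0, extChartAt I p p) := by
    have h3 := hf.prodMk (ContMDiffAt.comp (0, extChartAt I p p) h1 hs)
    exact hact.smooth.contMDiffAt.comp _ h3
  refine ContMDiffAt.comp (0, extChartAt I p p) (g := extChartAt I p) ?_ h2
  refine contMDiffAt_extChartAt' ?_
  simp [hact.zero]

omit [IsManifold I 1 M] in
theorem eventually_chartAct_zero (p : M) :
    ∀ᶠ x in 𝓝 (extChartAt I p p), chartAct I act p (0, x) = x := by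
  filter_upwards [eventually_mem_target I p] with x hx
  simp only [chartAct, hact.zero, (extChartAt I p).right_inv hx]

/-- The equality is needed on a neighbourhood of the base point and not only there, because
derivatives of the generators enter the moment calculation. -/
theorem eventually_localField_chartAct [IsManifold I ∞ M] (p : M) (a : 𝔥) :
    localField (chartAct I act p) a =ᶠ[𝓝 (extChartAt I p p)]
      fieldInChart I p (fun q ↦ genField I act q a) := by
  have h1 : ∀ᶠ x in 𝓝 (extChartAt I p p),
      DifferentiableAt ℝ (chartAct I act p) (0, x) := by
    have h2 : ∀ᶠ y in 𝓝 ((0 : 𝔥), extChartAt I p p), DifferentiableAt ℝ (chartAct I act p) y :=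
      (((hact.contDiffAt_chartAct p).of_le (m := 1) (by simp)).eventually (by simp)).mono
        fun y hy ↦ hy.differentiableAt one_ne_zero
    have h3 : Filter.Tendsto (fun x ↦ ((0 : 𝔥), x)) (𝓝 (extChartAt I p p))
      (𝓝 (0, extChartAt I p p)) := (Continuous.prodMk_right (0 : 𝔥)).continuousAt
    exact h3.eventually h2
  filter_upwards [h1, eventually_mem_target I p] with x hx hxt
  have h4 : HasFDerivAt (fun v ↦ chartAct I act p (v, x))
      ((fderiv ℝ (chartAct I act p) (0, x)).comp (ContinuousLinearMap.inl ℝ 𝔥 V)) 0 :=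
    HasFDerivAt.comp (0 : 𝔥) (f := fun v : 𝔥 ↦ (v, x)) hx.hasFDerivAt
      (hasFDerivAt_prodMk_left (0 : 𝔥) x)
  have h5 : localField (chartAct I act p) a x =
      mD 𝓘(ℝ, 𝔥) 𝓘(ℝ, V) (fun v ↦ chartAct I act p (v, x)) 0 a := by
    rw [mD_eq_fderiv, h4.fderiv]; rfl
  have h6 : MDifferentiableAt I 𝓘(ℝ, V) (extChartAt I p) (act 0 ((extChartAt I p).symm x)) := by
    rw [hact.zero]
    exact mdifferentiableAt_extChartAt (by simpa using (extChartAt I p).map_target hxt)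
  rw [h5]
  unfold fieldInChart
  rw [← mD_extChartAt_eq_inverse I p hxt]
  have := mD_comp_apply 𝓘(ℝ, 𝔥) I 𝓘(ℝ, V) (f := fun v ↦ act v ((extChartAt I p).symm x)) h6
    (hact.mdifferentiableAt_orbit ((extChartAt I p).symm x) 0) a
  rw [hact.zero] at this
  exact this

omit [IsManifold I 1 M] [I.Boundaryless] in
theorem eventually_act_mem_source (p : M) :
    ∀ᶠ a in 𝓝 (0 : 𝔥), act a p ∈ (extChartAt I p).source := by
  have h := (hact.smooth_orbit p).continuous.continuousAt (x := (0 : 𝔥))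
  refine h.eventually (?_ : (extChartAt I p).source ∈ 𝓝 (act 0 p))
  rw [hact.zero]
  exact extChartAt_source_mem_nhds p

theorem eventually_localD_chartAct [IsManifold I ∞ M] (p : M) :
    ∀ᶠ a in 𝓝 (0 : 𝔥), localD (chartAct I act p) (extChartAt I p p) a =
      (chartD I p (extChartAt I p (act a p))).inverse.comp (mD I I (act a) p) := by
  have h1 : ∀ᶠ a in 𝓝 (0 : 𝔥),
      DifferentiableAt ℝ (chartAct I act p) (a, extChartAt I p p) := by
    have h2 : ∀ᶠ y in 𝓝 ((0 : 𝔥), extChartAt I p p), DifferentiableAt ℝ (chartAct I act p) y :=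
      (((hact.contDiffAt_chartAct p).of_le (m := 1) (by simp)).eventually (by simp)).mono
        fun y hy ↦ hy.differentiableAt one_ne_zero
    have h3 : Filter.Tendsto (fun a ↦ (a, extChartAt I p p)) (𝓝 (0 : 𝔥))
      (𝓝 (0, extChartAt I p p)) := (Continuous.prodMk_left (extChartAt I p p)).continuousAt
    exact h3.eventually h2
  filter_upwards [h1, hact.eventually_act_mem_source p] with a ha hs
  have h4 : HasFDerivAt (fun x ↦ chartAct I act p (a, x))
      (localD (chartAct I act p) (extChartAt I p p) a) (extChartAt I p p) :=
    ha.hasFDerivAt.comp (extChartAt I p p) (hasFDerivAt_prodMk_right a (extChartAt I p p))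
  have h6 : MDifferentiableAt I 𝓘(ℝ, V) (extChartAt I p) (act a p) :=
    mdifferentiableAt_extChartAt (by simpa using hs)
  have h7 : MDifferentiableAt I 𝓘(ℝ, V) (fun q ↦ extChartAt I p (act a q)) p :=
    h6.comp p (hact.mdifferentiableAt_map a p)
  have h8 := fderiv_comp_symm_self I p h7
  have h9 : fderiv ℝ ((fun q ↦ extChartAt I p (act a q)) ∘ (extChartAt I p).symm)
    (extChartAt I p p) = _ := h4.fderiv
  rw [← h9, h8, ← mD_extChartAt_eq_inverse I p ((extChartAt I p).map_source hs),
    (extChartAt I p).left_inv hs]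
  exact mD_comp _ _ _ h6 (hact.mdifferentiableAt_map a p)

end IsSmoothVectorAction

/-! ### Kähler manifolds -/

/-- A Kähler structure with complex structure `J` and metric `G`. -/
structure IsKaehler [IsManifold I 1 M] (J : M → V →L[ℝ] V) (G : M → V →L[ℝ] V →L[ℝ] ℝ) : Prop where
  smooth_J : ∀ X : M → V, IsSmoothField I X → IsSmoothField I (fun q ↦ J q (X q))
  J_sq : ∀ q X, J q (J q X) = -X
  integrable : IsIntegrable I J
  symm : ∀ q X Y, G q X Y = G q Y X
  pos : ∀ q X, X ≠ 0 → 0 < G q X X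
  compat : ∀ q X Y, G q (J q X) (J q Y) = G q X Y
  smooth_G : ∀ X Y : M → V, IsSmoothField I X → IsSmoothField I Y →
    ContMDiff I 𝓘(ℝ, ℝ) ∞ fun q ↦ G q (X q) (Y q)
  closed : IsClosedForm I (fun q (X Y : V) ↦ G q (J q X) Y)

/-- A metric in the preferred chart at `p`. -/
def metricInChart (G : M → V →L[ℝ] V →L[ℝ] ℝ) (p : M) (x : V) : V →L[ℝ] V →L[ℝ] ℝ :=
  (G ((extChartAt I p).symm x)).bilinearComp (chartD I p x) (chartD I p x)

theorem metricInChart_apply (G : M → V →L[ℝ] V →L[ℝ] ℝ) (p : M) (x X Y : V) :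
    metricInChart I G p x X Y = tensorInChart I (fun q X Y ↦ G q X Y) p X Y x := rfl

theorem metricInChart_self [IsManifold I 1 M] (G : M → V →L[ℝ] V →L[ℝ] ℝ) (p : M) :
    metricInChart I G p (extChartAt I p p) = G p := by
  ext X Y
  rw [metricInChart_apply, tensorInChart_self]

theorem metricInChart_inverse [IsManifold I 1 M] (G : M → V →L[ℝ] V →L[ℝ] ℝ) (p : M) {x : V}
    (hx : x ∈ (extChartAt I p).target) (X Y : V) :
    metricInChart I G p x ((chartD I p x).inverse X) ((chartD I p x).inverse Y) =
      G ((extChartAt I p).symm x) X Y := by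
  have hinv := chartD_isInvertible I p hx
  simp only [metricInChart, ContinuousLinearMap.bilinearComp_apply]
  rw [hinv.self_apply_inverse, hinv.self_apply_inverse]

namespace IsKaehler

variable [I.Boundaryless] [IsManifold I ∞ M] [IsManifold I 1 M] [IsManifold I 2 M]
  [FiniteDimensional ℝ V] [T2Space M]
variable {I} {J : M → V →L[ℝ] V} {G : M → V →L[ℝ] V →L[ℝ] ℝ} (hK : IsKaehler I J G)
include hK

omit [I.Boundaryless] [IsManifold I ∞ M] [IsManifold I 2 M] [FiniteDimensional ℝ V] [T2Space M] in
theorem J_left (q : M) (X Y : V) : G q (J q X) Y = -G q X (J q Y) := by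
  rw [← hK.compat q (J q X) Y, hK.J_sq, map_neg]
  rfl

omit [I.Boundaryless] [IsManifold I ∞ M] [IsManifold I 2 M] [FiniteDimensional ℝ V] [T2Space M] in
theorem J_antisymm (q : M) (X Y : V) : G q (J q X) Y = -G q (J q Y) X := by
  rw [hK.J_left, hK.symm]

theorem differentiableAt_metricInChart (p : M) :
    DifferentiableAt ℝ (metricInChart I G p) (extChartAt I p p) :=
  differentiableAt_of_apply fun X ↦ differentiableAt_of_apply fun Y ↦
    differentiableAt_tensorInChart I (α := fun q X Y ↦ G q X Y)
      (fun Y Z hY hZ ↦ (hK.smooth_G Y Z hY hZ).mdifferentiable (by simp)) p X Y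

/-- The Hamiltonian identity `d⟨μ, v⟩ = -ω(v, ·)`, where `⟨μ, v⟩ = G(b, v) / 2`. -/
theorem hasMFDerivAt_moment {act : 𝔥 → M → M} (hact : IsSmoothVectorAction I act) {b v ρ : 𝔥}
    (hρ : ∀ q, genField I act q ρ = -J q (genField I act q b))
    (hJb : ∀ (t : ℝ) q X, mD I I (act (t • b)) q (J q X) =
      J (act (t • b) q) (mD I I (act (t • b)) q X))
    (hJv : ∀ (t : ℝ) q X, mD I I (act (t • v)) q (J q X) =
      J (act (t • v) q) (mD I I (act (t • v)) q X))
    (hGv : ∀ (t : ℝ) q X Y, G (act (t • v) q) (mD I I (act (t • v)) q X)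
      (mD I I (act (t • v)) q Y) = G q X Y)
    (hGρ : ∀ (t : ℝ) q X Y, G (act (t • ρ) q) (mD I I (act (t • ρ)) q X)
      (mD I I (act (t • ρ)) q Y) = Real.exp (2 * t) * G q X Y)
    (hsm : MDifferentiable I 𝓘(ℝ, ℝ) fun q ↦ G q (genField I act q b) (genField I act q v))
    (p : M) (X : V) :
    mD I 𝓘(ℝ, ℝ) (fun q ↦ G q (genField I act q b) (genField I act q v)) p X =
      -2 * G p (J p (genField I act p v)) X := by
  set x₀ := extChartAt I p p
  set Φ := chartAct I act p
  have hΦ : ContDiffAt ℝ 2 Φ (0, x₀) := (hact.contDiffAt_chartAct p).of_le (WithTop.coe_le_coe.2 le_top)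
  have h0 := hact.eventually_chartAct_zero p
  have hJd : DifferentiableAt ℝ (endInChart I J p) x₀ := differentiableAt_endInChart I hK.smooth_J p
  have hGd : DifferentiableAt ℝ (metricInChart I G p) x₀ := hK.differentiableAt_metricInChart p
  have hF := hact.eventually_localField_chartAct p
  have hD := hact.eventually_localD_chartAct p
  have hS := hact.eventually_act_mem_source p
  have hF0 : ∀ a, localField Φ a x₀ = genField I act p a := fun a ↦ by
    rw [(hF a).self_of_nhds, fieldInChart_self]
  have hE0 : endInChart I J p x₀ = J p := endInChart_self I J p
  have hM0 : metricInChart I G p x₀ = G p := metricInChart_self I G p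
  have hFd := fun a ↦ (hasFDerivAt_localField hΦ a).1
  have htend : ∀ a : 𝔥, Filter.Tendsto (fun t : ℝ ↦ t • a) (𝓝 0) (𝓝 0) := fun a ↦ by
    have : Continuous fun t : ℝ ↦ t • a := by fun_prop
    simpa using this.tendsto 0
  have hchart : ∀ a, act a p ∈ (extChartAt I p).source →
      extChartAt I p (act a p) ∈ (extChartAt I p).target ∧
        (extChartAt I p).symm (extChartAt I p (act a p)) = act a p := fun a ha ↦
    ⟨(extChartAt I p).map_source ha, (extChartAt I p).left_inv ha⟩
  have hΦp : ∀ a, Φ (a, x₀) = extChartAt I p (act a p) := fun a ↦ by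
    simp only [Φ, chartAct, x₀, extChartAt_to_inv]
  -- invariance in the chart
  have hinvJ : ∀ a : 𝔥, (∀ (t : ℝ) q X, mD I I (act (t • a)) q (J q X) =
      J (act (t • a) q) (mD I I (act (t • a)) q X)) →
      ∀ᶠ t : ℝ in 𝓝 0, (localD Φ x₀ (t • a)).comp (endInChart I J p x₀) =
      (endInChart I J p (Φ (t • a, x₀))).comp (localD Φ x₀ (t • a)) := by
    intro a ha
    filter_upwards [(htend a).eventually hD, (htend a).eventually hS] with t h1 h2
    obtain ⟨h3, h4⟩ := hchart _ h2
    ext X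
    rw [h1, hΦp, endInChart_self]
    simp only [endInChart, ContinuousLinearMap.comp_apply, h4, ha]
    rw [(chartD_isInvertible I p h3).self_apply_inverse]
  have hinvG : ∀ (a : 𝔥) (c : ℝ), (∀ (t : ℝ) q X Y, G (act (t • a) q) (mD I I (act (t • a)) q X)
      (mD I I (act (t • a)) q Y) = Real.exp (c * t) * G q X Y) → ∀ X Y,
      ∀ᶠ t : ℝ in 𝓝 0, metricInChart I G p (Φ (t • a, x₀)) (localD Φ x₀ (t • a) X)
        (localD Φ x₀ (t • a) Y) = Real.exp (c * t) * metricInChart I G p x₀ X Y := by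
    intro a c ha X Y
    filter_upwards [(htend a).eventually hD, (htend a).eventually hS] with t h1 h2
    obtain ⟨h3, h4⟩ := hchart _ h2
    rw [h1, hΦp, metricInChart_self]
    simp only [ContinuousLinearMap.comp_apply]
    rw [metricInChart_inverse I G p h3, h4, ha]
  have hinvF : ∀ a a' : 𝔥, ∀ᶠ t : ℝ in 𝓝 0, localField Φ a' (Φ (t • a, x₀)) =
      localD Φ x₀ (t • a) (localField Φ a' x₀) := by
    intro a a'
    have hc : Filter.Tendsto (fun t : ℝ ↦ Φ (t • a, x₀)) (𝓝 0) (𝓝 x₀) := by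
      have h5 := (hasDerivAt_orbit (hΦ.differentiableAt (by norm_num)) a).continuousAt.tendsto
      rwa [zero_smul, show Φ (0, x₀) = x₀ from h0.self_of_nhds] at h5
    filter_upwards [(htend a).eventually hD, (htend a).eventually hS, hc.eventually (hF a')]
      with t h1 h2 h5
    obtain ⟨h3, h4⟩ := hchart _ h2
    rw [h5, h1, hF0, hΦp]
    simp only [fieldInChart, ContinuousLinearMap.comp_apply, h4, hact.genField_act]
  have hR : localField Φ ρ =ᶠ[𝓝 x₀] fun x ↦ -endInChart I J p x (localField Φ b x) := by
    filter_upwards [hF ρ, hF b, eventually_mem_target I p] with x h1 h2 h3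
    rw [h1, h2]
    simp only [fieldInChart, endInChart, ContinuousLinearMap.comp_apply, hρ, map_neg]
    rw [(chartD_isInvertible I p h3).self_apply_inverse]
  have hJJ : ∀ Y, (fun x ↦ endInChart I J p x (endInChart I J p x Y)) =ᶠ[𝓝 x₀] fun _ ↦ -Y := by
    intro Y
    filter_upwards [eventually_mem_target I p] with x h3
    simp only [endInChart, ContinuousLinearMap.comp_apply]
    rw [(chartD_isInvertible I p h3).self_apply_inverse, hK.J_sq, map_neg,
      (chartD_isInvertible I p h3).inverse_apply_self]
  have hR' : ∀ X, fderiv ℝ (localField Φ ρ) x₀ X =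
      -(fderiv ℝ (endInChart I J p) x₀ X (genField I act p b)) -
        J p (fderiv ℝ (localField Φ b) x₀ X) := by
    intro X
    rw [hR.fderiv_eq, fderiv_fun_neg, fderiv_clm_apply hJd (hFd b)]
    simp [hF0, hE0]
    rw [← sub_eq_add_neg, sub_eq_neg_add, add_comm, ← sub_eq_add_neg, neg_sub_left]
  have hJ' : ∀ X Y, fderiv ℝ (endInChart I J p) x₀ X (J p Y) +
      J p (fderiv ℝ (endInChart I J p) x₀ X Y) = 0 := by
    intro X Y
    have h1 : DifferentiableAt ℝ (fun x ↦ endInChart I J p x Y) x₀ :=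
      hJd.clm_apply (differentiableAt_const Y)
    have h2 := (hJJ Y).fderiv_eq (𝕜 := ℝ)
    rw [fderiv_clm_apply hJd h1, fderiv_clm_apply hJd (differentiableAt_const Y)] at h2
    have h3 := congrArg (fun L : V →L[ℝ] V ↦ L X) h2
    simp [hE0] at h3
    rw [← h3, add_comm]
  have hcl : ∀ X Y Z, (fderiv ℝ (metricInChart I G p) x₀ X (J p Y) Z +
      G p (fderiv ℝ (endInChart I J p) x₀ X Y) Z) -
      (fderiv ℝ (metricInChart I G p) x₀ Y (J p X) Z +
      G p (fderiv ℝ (endInChart I J p) x₀ Y X) Z) +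
      (fderiv ℝ (metricInChart I G p) x₀ Z (J p X) Y +
      G p (fderiv ℝ (endInChart I J p) x₀ Z X) Y) = 0 := by
    intro X Y Z
    have h1 := IsClosedForm.in_chart I (α := fun q (X Y : V) ↦ G q (J q X) Y) (by simp)
      (fun Y Z hY hZ ↦ (hK.smooth_G _ Z (hK.smooth_J Y hY) hZ).mdifferentiable (by simp))
      hK.closed p X Y Z
    have h2 : ∀ Y Z, tensorInChart I (fun q (X Y : V) ↦ G q (J q X) Y) p Y Z =ᶠ[𝓝 x₀]
        fun x ↦ metricInChart I G p x (endInChart I J p x Y) Z := by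
      intro Y Z
      filter_upwards [eventually_mem_target I p] with x h3
      rw [metricInChart_apply, tensorInChart, tensorInChart, chartD_endInChart I J p h3]
    have h4 : ∀ Y Z X, fderiv ℝ (tensorInChart I (fun q (X Y : V) ↦ G q (J q X) Y) p Y Z) x₀ X =
        fderiv ℝ (metricInChart I G p) x₀ X (J p Y) Z +
          G p (fderiv ℝ (endInChart I J p) x₀ X Y) Z := by
      intro Y Z X
      have h5 : DifferentiableAt ℝ (fun x ↦ endInChart I J p x Y) x₀ :=
        hJd.clm_apply (differentiableAt_const Y)
      rw [(h2 Y Z).fderiv_eq, fderiv_clm_apply (hGd.clm_apply h5) (differentiableAt_const Z),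
        fderiv_clm_apply hGd h5, fderiv_clm_apply hJd (differentiableAt_const Y)]
      simp [hE0, hM0]
      rw [add_comm]
    rw [h4, h4, h4] at h1
    exact h1
  have hmain : mD I 𝓘(ℝ, ℝ) (fun q ↦ G q (genField I act q b) (genField I act q v)) p X =
      fderiv ℝ (metricInChart I G p) x₀ X (genField I act p b) (genField I act p v) +
      G p (fderiv ℝ (localField Φ b) x₀ X) (genField I act p v) +
      G p (genField I act p b) (fderiv ℝ (localField Φ v) x₀ X) := by
    rw [← fderiv_comp_symm_self I p (hsm p)]
    have h1 : (fun q ↦ G q (genField I act q b) (genField I act q v)) ∘ (extChartAt I p).symm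
        =ᶠ[𝓝 x₀] fun x ↦ metricInChart I G p x (localField Φ b x) (localField Φ v x) := by
      filter_upwards [hF v, hF b, eventually_mem_target I p] with x h1 h2 h3
      rw [h1, h2]
      simp only [fieldInChart]
      rw [metricInChart_inverse I G p h3]
      rfl
    rw [h1.fderiv_eq, fderiv_clm_apply (hGd.clm_apply (hFd b)) (hFd v),
      fderiv_clm_apply hGd (hFd b)]
    simp [hM0, hF0]
    ring
  rw [hmain]
  refine moment_calculation (J' := fderiv ℝ (endInChart I J p) x₀) (R₀ := genField I act p ρ)
    (R' := fderiv ℝ (localField Φ ρ) x₀) (hK.J_sq p) hJ' (hρ p) hR' ?_ ?_ ?_ ?_ ?_ (hK.J_antisymm p)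
    ?_ hcl X
  · intro X
    have := fderiv_localField_end hΦ h0 hJd b (hinvJ b hJb) X
    rwa [hF0, endInChart_self] at this
  · intro X
    have := fderiv_localField_end hΦ h0 hJd v (hinvJ v hJv) X
    rwa [hF0, endInChart_self] at this
  · intro X Y
    exact hK.integrable.in_chart I hK.smooth_J p X Y
  · intro X Y
    have := fderiv_localField_metric hΦ h0 hGd v 0 X Y (hinvG v 0 (by simpa using hGv) X Y)
    rwa [hF0, metricInChart_self, zero_mul] at this
  · intro X Y
    have := fderiv_localField_metric hΦ h0 hGd ρ 2 X Y (hinvG ρ 2 hGρ X Y)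
    rwa [hF0, metricInChart_self] at this
  · have := fderiv_localField_comm hΦ h0 v ρ (hinvF v ρ)
    rwa [hF0, hF0] at this

end IsKaehler

end VectorAction

/-! ### The cone -/

/-- The generator at `q` is the tangent map of the whole action, applied to the vector `(v, 0)` at
`(0, q)`; both ingredients depend smoothly on `q`. -/
theorem IsSmoothVectorAction.isSmoothField_genField {V : Type*} [NormedAddCommGroup V]
    [NormedSpace ℝ V] {H : Type*} [TopologicalSpace H] {I : ModelWithCorners ℝ V H}
    {M : Type*} [TopologicalSpace M] [ChartedSpace H M] [IsManifold I ∞ M] [IsManifold I 1 M]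
    {𝔥 : Type*} [NormedAddCommGroup 𝔥] [NormedSpace ℝ 𝔥] {act : 𝔥 → M → M}
    (hact : IsSmoothVectorAction I act) (v : 𝔥) :
    IsSmoothField I (fun q ↦ genField I act q v) := by
  have h0 : ContMDiff I 𝓘(ℝ, 𝔥).tangent ∞ (fun _ : M ↦ (⟨0, v⟩ : TangentBundle 𝓘(ℝ, 𝔥) 𝔥)) :=
    contMDiff_const
  have hz : ContMDiff I I.tangent ∞ (fun q : M ↦ (TotalSpace.mk' V q 0 : TangentBundle I M)) :=
    contMDiff_zeroSection _ _
  have h1 := h0.prodMk hz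
  have h2 := (contMDiff_equivTangentBundleProd_symm (I := 𝓘(ℝ, 𝔥)) (M := 𝔥) (I' := I) (M' := M)
    (n := ∞)).comp h1
  have h3 := (hact.smooth.contMDiff_tangentMap (m := ∞) (by simp)).comp h2
  have h4 : ∀ q : M, MDifferentiableAt (𝓘(ℝ, 𝔥).prod I) I (fun y : 𝔥 × M ↦ act y.1 y.2) (0, q) :=
    fun q ↦ hact.smooth.mdifferentiableAt (by simp)
  have h5 : ∀ q : M, (fun y : 𝔥 × M ↦ act y.1 y.2) (0, q) = q := hact.zero
  have h6 : ∀ q : M, mD (𝓘(ℝ, 𝔥).prod I) I (fun y : 𝔥 × M ↦ act y.1 y.2) (0, q) (v, 0) =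
      genField I act q v := by
    intro q
    have h7 := mD_comp_apply 𝓘(ℝ, 𝔥) (𝓘(ℝ, 𝔥).prod I) I (f := fun a : 𝔥 ↦ (a, q)) (p := 0) (h4 q)
      (mdifferentiableAt_id.prodMk mdifferentiableAt_const) v
    have h8 : mD 𝓘(ℝ, 𝔥) (𝓘(ℝ, 𝔥).prod I) (fun a : 𝔥 ↦ (a, q)) 0 v = (v, 0) :=
      congrArg (fun L : 𝔥 →L[ℝ] 𝔥 × V ↦ L v) mfderiv_prod_left
    rw [h8] at h7
    exact h7.symm
  have h9 : ∀ q : M, (⟨q, genField I act q v⟩ : TangentBundle I M) =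
      ⟨act 0 q, genField I act q v⟩ := fun q ↦ by rw [hact.zero]
  refine ContMDiff.congr h3 fun q ↦ ?_
  rw [h9, ← h6]
  rfl

section PosReal

variable {V : Type*} [NormedAddCommGroup V] [NormedSpace ℝ V]
  {H : Type*} [TopologicalSpace H] {I : ModelWithCorners ℝ V H}
  {M : Type*} [TopologicalSpace M] [ChartedSpace H M]

theorem contMDiff_posReal_iff {f : M → PosReal} {n : WithTop ℕ∞} :
    ContMDiff I 𝓘(ℝ, ℝ) n f ↔ ContMDiff I 𝓘(ℝ, ℝ) n (fun q ↦ (f q : ℝ)) := by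
  refine ⟨fun h ↦ contMDiff_subtype_val.comp h, fun h q ↦ ?_⟩
  rw [contMDiffAt_iff_target]
  exact ⟨(h.continuous.subtype_mk fun q ↦ (f q).2).continuousAt, h q⟩

/-- The inclusion is the preferred chart of `PosReal`, and a preferred chart has identity
differential at its base point. -/
theorem mD_posReal_val (r : PosReal) :
    mD 𝓘(ℝ, ℝ) 𝓘(ℝ, ℝ) (fun r : PosReal ↦ (r : ℝ)) r = ContinuousLinearMap.id ℝ ℝ :=
  mD_extChartAt_self 𝓘(ℝ, ℝ) r

theorem mD_coe_posReal {f : M → PosReal} {p : M} (hf : MDifferentiableAt I 𝓘(ℝ, ℝ) f p) :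
    mD I 𝓘(ℝ, ℝ) (fun q ↦ (f q : ℝ)) p = mD I 𝓘(ℝ, ℝ) f p := by
  have h : MDifferentiableAt 𝓘(ℝ, ℝ) 𝓘(ℝ, ℝ) (fun r : PosReal ↦ (r : ℝ)) (f p) :=
    contMDiff_subtype_val.mdifferentiableAt (n := 1) (by simp)
  have h2 := mD_comp I 𝓘(ℝ, ℝ) 𝓘(ℝ, ℝ) h hf
  rw [mD_posReal_val] at h2
  exact h2

end PosReal

section Cone

variable {E : Type*} [NormedAddCommGroup E] [NormedSpace ℝ E]
  {S : Type*} [TopologicalSpace S] [ChartedSpace E S]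

theorem mD_cone_fst (p : Cone S) :
    mD (coneModel E) 𝓘(ℝ, E) (fun q : Cone S ↦ q.1) p = ContinuousLinearMap.fst ℝ E ℝ := mfderiv_fst

theorem contMDiff_radius {n : WithTop ℕ∞} :
    ContMDiff (coneModel E) 𝓘(ℝ, ℝ) n (fun q : Cone S ↦ (q.2 : ℝ)) :=
  contMDiff_posReal_iff.1 contMDiff_snd

theorem mD_radius (p : Cone S) :
    mD (coneModel E) 𝓘(ℝ, ℝ) (fun q : Cone S ↦ (q.2 : ℝ)) p = ContinuousLinearMap.snd ℝ E ℝ := by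
  rw [mD_coe_posReal mdifferentiableAt_snd]
  exact mfderiv_snd

theorem mD_prodMk {V : Type*} [NormedAddCommGroup V] [NormedSpace ℝ V]
    {H : Type*} [TopologicalSpace H] {I : ModelWithCorners ℝ V H}
    {M : Type*} [TopologicalSpace M] [ChartedSpace H M] {f : M → S} {r : M → PosReal} {p : M}
    (hf : MDifferentiableAt I 𝓘(ℝ, E) f p) (hr : MDifferentiableAt I 𝓘(ℝ, ℝ) r p) :
    mD I (coneModel E) (fun q ↦ ((f q, r q) : Cone S)) p =
      (mD I 𝓘(ℝ, E) f p).prod (mD I 𝓘(ℝ, ℝ) (fun q ↦ (r q : ℝ)) p) := by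
  rw [mD_coe_posReal hr]
  exact mfderiv_prodMk hf hr

variable [IsManifold 𝓘(ℝ, E) ∞ S]

theorem IsSmoothField.contMDiff_fst {X : Cone S → E × ℝ} (hX : IsSmoothField (coneModel E) X) :
    ContMDiff (coneModel E) 𝓘(ℝ, E).tangent ∞
      (fun q : Cone S ↦ (⟨q.1, (X q).1⟩ : TangentBundle 𝓘(ℝ, E) S)) := by
  have h1 : ContMDiff (coneModel E) 𝓘(ℝ, E) ∞ (fun q : Cone S ↦ q.1) := _root_.contMDiff_fst
  have h2 := (h1.contMDiff_tangentMap (m := ∞) (by simp)).comp hX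
  convert h2 using 2 with q
  have := congrArg (fun L : E × ℝ →L[ℝ] E ↦ L (X q)) (mD_cone_fst (E := E) q)
  exact congrArg (fun Y : E ↦ (⟨q.1, Y⟩ : TangentBundle 𝓘(ℝ, E) S)) this.symm

theorem IsSmoothField.contMDiff_snd {X : Cone S → E × ℝ} (hX : IsSmoothField (coneModel E) X) :
    ContMDiff (coneModel E) 𝓘(ℝ, ℝ) ∞ (fun q : Cone S ↦ (X q).2) := by
  have h1 : ContMDiff (coneModel E) 𝓘(ℝ, ℝ) ∞ (fun q : Cone S ↦ (q.2 : ℝ)) := contMDiff_radius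
  have h2 := (h1.contMDiff_tangentMap (m := ∞) (by simp)).comp hX
  have h3 := contMDiff_snd_tangentBundle_modelSpace ℝ 𝓘(ℝ, ℝ) (n := ∞)
  convert h3.comp h2 using 2 with q
  exact (congrArg (fun L : E × ℝ →L[ℝ] ℝ ↦ L (X q)) (mD_radius (E := E) q)).symm

/-- The metric of the cone, as a field of bilinear forms. -/
def coneForm (g : ContMDiffRiemannianMetric 𝓘(ℝ, E) ∞ E (fun x : S ↦ TangentSpace 𝓘(ℝ, E) x))
    (p : Cone S) : (E × ℝ) →L[ℝ] (E × ℝ) →L[ℝ] ℝ :=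
  (p.2 : ℝ) ^ 2 • (show E →L[ℝ] E →L[ℝ] ℝ from g.inner p.1).bilinearComp
    (ContinuousLinearMap.fst ℝ E ℝ) (ContinuousLinearMap.fst ℝ E ℝ) +
  (ContinuousLinearMap.mul ℝ ℝ).bilinearComp
    (ContinuousLinearMap.snd ℝ E ℝ) (ContinuousLinearMap.snd ℝ E ℝ)

theorem contMDiff_coneForm
    (g : ContMDiffRiemannianMetric 𝓘(ℝ, E) ∞ E (fun x : S ↦ TangentSpace 𝓘(ℝ, E) x))
    {X Y : Cone S → E × ℝ} (hX : IsSmoothField (coneModel E) X)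
    (hY : IsSmoothField (coneModel E) Y) :
    ContMDiff (coneModel E) 𝓘(ℝ, ℝ) ∞ fun q ↦ coneForm g q (X q) (Y q) := by
  have h1 : ContMDiff (coneModel E) 𝓘(ℝ, ℝ) ∞
      fun q : Cone S ↦ (show ℝ from g.inner q.1 (X q).1 (Y q).1) := by
    have h2 : ContMDiff (coneModel E) (𝓘(ℝ, E).prod 𝓘(ℝ, ℝ)) ∞
        (fun q : Cone S ↦ TotalSpace.mk' ℝ (E := Bundle.Trivial S ℝ) q.1
          (g.inner q.1 (X q).1 (Y q).1)) := by
      intro q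
      refine ContMDiffAt.clm_bundle_apply₂ (F₁ := E) (F₂ := E) ?_ (hX.contMDiff_fst q)
        (hY.contMDiff_fst q)
      exact ContMDiffAt.comp q g.contMDiff.contMDiffAt contMDiff_fst.contMDiffAt
    intro q
    have h3 := h2 q
    simp only [contMDiffAt_totalSpace] at h3
    exact h3.2
  exact (contMDiff_radius.pow 2 |>.mul h1).add (hX.contMDiff_snd.mul hY.contMDiff_snd)

/-- The action of `𝔤 × ℝ` on the cone: `ℝ` acts by the scalings with `e ^ t`. -/
def coneAct {m : ℕ} [MulAction (Torus m) S] (a : LieAlg m × ℝ) (q : Cone S) : Cone S :=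
  scale ⟨Real.exp a.2, Real.exp_pos _⟩ (torusAct (torusExp a.1) q)

omit [TopologicalSpace S] [ChartedSpace E S] in
theorem torusExp_add {m : ℕ} (v w : LieAlg m) : torusExp (v + w) = torusExp v * torusExp w := by
  ext k; simp [torusExp, Circle.exp_add]

theorem torusExp_zero {m : ℕ} : torusExp (0 : LieAlg m) = 1 := by
  ext k; simp [torusExp]

omit [IsManifold 𝓘(ℝ, E) ∞ S] in
theorem coneAct_isSmooth {m : ℕ} [MulAction (Torus m) S] (h : IsSmoothTorusAction E S m) :
    IsSmoothVectorAction (coneModel E) (coneAct (S := S) (m := m)) where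
  smooth := by
    refine ContMDiff.prodMk ?_ (contMDiff_posReal_iff.2 ?_)
    · refine h.comp (ContMDiff.prodMk ?_ (contMDiff_fst.comp contMDiff_snd))
      exact (contDiff_fst.contMDiff).comp contMDiff_fst
    · have h1 : ContMDiff 𝓘(ℝ, LieAlg m × ℝ) 𝓘(ℝ, ℝ) ∞
          (fun a : LieAlg m × ℝ ↦ Real.exp a.2) :=
        (Real.contDiff_exp.comp contDiff_snd).contMDiff
      have h2 : ContMDiff (𝓘(ℝ, LieAlg m × ℝ).prod (coneModel E)) (coneModel E) ∞
          (fun q : (LieAlg m × ℝ) × Cone S ↦ q.2) := contMDiff_snd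
      have h3 := (contMDiff_radius (E := E) (S := S) (n := ∞)).comp h2
      have h4 : ContMDiff (𝓘(ℝ, LieAlg m × ℝ).prod (coneModel E)) 𝓘(ℝ, ℝ) ∞
          (fun q : (LieAlg m × ℝ) × Cone S ↦ Real.exp q.1.2) := h1.comp contMDiff_fst
      exact h4.mul h3
  zero q := by
    ext
    · simp [coneAct, scale, torusAct, torusExp_zero]
    · simp [coneAct, scale, torusAct]
  add a a' q := by
    ext
    · simp [coneAct, scale, torusAct, torusExp_add, mul_smul]
    · simp [coneAct, scale, torusAct, Real.exp_add, mul_assoc]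

end Cone

section ConeGenerators

variable {E : Type*} [NormedAddCommGroup E] [NormedSpace ℝ E]
  {S : Type*} [TopologicalSpace S] [ChartedSpace E S] {m : ℕ} [MulAction (Torus m) S]

variable (E) in
/-- The generators of the torus action, as vectors of the model space. -/
def gen (p : Cone S) : LieAlg m →L[ℝ] E × ℝ := generator E p

omit [TopologicalSpace S] [ChartedSpace E S] [NormedAddCommGroup E] [NormedSpace ℝ E] in
theorem torusAct_one (q : Cone S) : torusAct (1 : Torus m) q = q := by
  simp [torusAct]

omit [TopologicalSpace S] [ChartedSpace E S] [NormedAddCommGroup E] [NormedSpace ℝ E] in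
theorem torusAct_mul (τ τ' : Torus m) (q : Cone S) :
    torusAct (τ * τ') q = torusAct τ (torusAct τ' q) := by
  simp [torusAct, mul_smul]

omit [TopologicalSpace S] [ChartedSpace E S] [NormedAddCommGroup E] [NormedSpace ℝ E] in
theorem coneAct_inl (v : LieAlg m) : coneAct (S := S) (v, 0) = torusAct (torusExp v) := by
  ext q <;> simp [coneAct, scale, torusAct]

omit [TopologicalSpace S] [ChartedSpace E S] [NormedAddCommGroup E] [NormedSpace ℝ E] in
theorem coneAct_inr (t : ℝ) : coneAct (S := S) ((0 : LieAlg m), t) =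
    scale ⟨Real.exp t, Real.exp_pos t⟩ := by
  ext q <;> simp [coneAct, scale, torusAct, torusExp_zero]

theorem exists_torusExp (τ : Torus m) : ∃ v : LieAlg m, torusExp v = τ :=
  ⟨fun k ↦ (τ k : ℂ).arg, by ext k; simp [torusExp]⟩

theorem mdifferentiableAt_scale (ρ : PosReal) (q : Cone S) :
    MDifferentiableAt (coneModel E) (coneModel E) (scale ρ) q := by
  refine MDifferentiableAt.prodMk mdifferentiableAt_fst ?_
  have : ContMDiff (coneModel E) 𝓘(ℝ, ℝ) 1 fun q : Cone S ↦ (scale ρ q).2 :=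
    contMDiff_posReal_iff.2 (contMDiff_const.mul contMDiff_radius)
  exact this.mdifferentiableAt one_ne_zero

theorem mD_scale (ρ : PosReal) (q : Cone S) (X : E × ℝ) :
    mD (coneModel E) (coneModel E) (scale ρ) q X = (X.1, (ρ : ℝ) * X.2) := by
  have h1 : ContMDiff (coneModel E) 𝓘(ℝ, ℝ) 1 fun q : Cone S ↦ (scale ρ q).2 :=
    contMDiff_posReal_iff.2 (contMDiff_const.mul contMDiff_radius)
  have h2 := mD_prodMk (E := E) (p := q) mdifferentiableAt_fst (h1.mdifferentiableAt one_ne_zero)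
  have h3 : mD (coneModel E) 𝓘(ℝ, ℝ) (fun q : Cone S ↦ (ρ : ℝ) * (q.2 : ℝ)) q X =
      (ρ : ℝ) * X.2 := by
    have h4 := mD_comp_apply (coneModel E) 𝓘(ℝ, ℝ) 𝓘(ℝ, ℝ) (f := fun q : Cone S ↦ (q.2 : ℝ))
      (g := fun r ↦ (ρ : ℝ) * r) (p := q)
      (by fun_prop : DifferentiableAt ℝ (fun r ↦ (ρ : ℝ) * r) _).mdifferentiableAt
      ((contMDiff_radius (n := 1)).mdifferentiableAt one_ne_zero) X
    rw [h4, mD_radius, mD_eq_fderiv, fderiv_const_mul (by fun_prop)]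
    simp
  rw [show scale ρ = fun q : Cone S ↦ (q.1, (scale ρ q).2) from rfl, h2]
  refine Prod.ext ?_ h3
  exact congrArg (fun L : E × ℝ →L[ℝ] E ↦ L X) (mD_cone_fst (E := E) q)

variable (h : IsSmoothTorusAction E S m)
include h

theorem genField_inl (q : Cone S) (v : LieAlg m) :
    genField (coneModel E) (coneAct (m := m)) q (v, 0) = gen E q v := by
  have hs := coneAct_isSmooth h
  have h1 := mD_comp_apply 𝓘(ℝ, LieAlg m) 𝓘(ℝ, LieAlg m × ℝ) (coneModel E)
    (f := fun v : LieAlg m ↦ ((v, 0) : LieAlg m × ℝ)) (p := 0) (hs.mdifferentiableAt_orbit q _)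
    (by fun_prop : DifferentiableAt ℝ (fun v : LieAlg m ↦ ((v, 0) : LieAlg m × ℝ)) 0
      ).mdifferentiableAt v
  have h2 : mD 𝓘(ℝ, LieAlg m) 𝓘(ℝ, LieAlg m × ℝ)
      (fun v : LieAlg m ↦ ((v, 0) : LieAlg m × ℝ)) 0 v = (v, 0) := by
    rw [mD_eq_fderiv, (hasFDerivAt_prodMk_left (𝕜 := ℝ) (0 : LieAlg m) (0 : ℝ)).fderiv]
    rfl
  rw [h2] at h1
  simp only [coneAct_inl] at h1
  exact h1.symm

theorem genField_inr (q : Cone S) :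
    genField (coneModel E) (coneAct (m := m)) q (0, 1) = positionVector (E := E) q := by
  have hs := coneAct_isSmooth h
  have h1 := mD_comp_apply 𝓘(ℝ, ℝ) 𝓘(ℝ, LieAlg m × ℝ) (coneModel E)
    (f := fun t : ℝ ↦ ((0, t) : LieAlg m × ℝ)) (p := 0) (hs.mdifferentiableAt_orbit q _)
    (by fun_prop : DifferentiableAt ℝ (fun t : ℝ ↦ ((0, t) : LieAlg m × ℝ)) 0
      ).mdifferentiableAt 1
  have h2 : mD 𝓘(ℝ, ℝ) 𝓘(ℝ, LieAlg m × ℝ)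
      (fun t : ℝ ↦ ((0, t) : LieAlg m × ℝ)) 0 1 = (0, 1) := by
    rw [mD_eq_fderiv, (hasFDerivAt_prodMk_right (𝕜 := ℝ) (0 : LieAlg m) (0 : ℝ)).fderiv]
    rfl
  rw [h2] at h1
  refine h1.symm.trans ?_
  simp only [coneAct_inr]
  have h3 : ContMDiff 𝓘(ℝ, ℝ) 𝓘(ℝ, ℝ) 1
      fun t : ℝ ↦ (scale ⟨Real.exp t, Real.exp_pos t⟩ q).2 :=
    contMDiff_posReal_iff.2 (Real.contDiff_exp.contMDiff.mul contMDiff_const)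
  have h4 := mD_prodMk (E := E) (I := 𝓘(ℝ, ℝ)) (f := fun _ : ℝ ↦ q.1) (p := 0)
    mdifferentiableAt_const (h3.mdifferentiableAt one_ne_zero)
  have h5 : mD 𝓘(ℝ, ℝ) (coneModel E)
    (fun t : ℝ ↦ scale (⟨Real.exp t, Real.exp_pos t⟩ : PosReal) q) 0 = _ := h4
  rw [h5]
  refine Prod.ext ?_ ?_
  · exact congrArg (fun L : ℝ →L[ℝ] E ↦ L 1) (mD_const 𝓘(ℝ, ℝ) 𝓘(ℝ, E) (0 : ℝ) q.1)
  · change mD 𝓘(ℝ, ℝ) 𝓘(ℝ, ℝ) (fun t : ℝ ↦ Real.exp t * (q.2 : ℝ)) 0 1 = (q.2 : ℝ)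
    have h6 := ((Real.hasDerivAt_exp 0).mul_const (q.2 : ℝ)).hasFDerivAt.fderiv
    rw [mD_eq_fderiv, h6]
    simp

theorem isSmooth_torusVectorAction :
    IsSmoothVectorAction (coneModel E) (fun v : LieAlg m ↦ torusAct (S := S) (torusExp v)) where
  smooth := by
    have h1 : ContMDiff (𝓘(ℝ, LieAlg m).prod (coneModel E))
        (𝓘(ℝ, LieAlg m × ℝ).prod (coneModel E)) ∞
        (fun y : LieAlg m × Cone S ↦ (((y.1, 0) : LieAlg m × ℝ), y.2)) := by
      refine ContMDiff.prodMk ?_ contMDiff_snd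
      exact (ContDiff.contMDiff (by fun_prop : ContDiff ℝ ∞ fun v : LieAlg m ↦
        ((v, 0) : LieAlg m × ℝ))).comp contMDiff_fst
    have h2 := (coneAct_isSmooth h).smooth.comp h1
    refine h2.congr fun y ↦ ?_
    exact congrFun (coneAct_inl y.1).symm y.2
  zero q := by simp [torusExp_zero, torusAct_one]
  add v w q := by rw [torusExp_add, torusAct_mul]

omit h in
theorem genField_torus (q : Cone S) :
    genField (coneModel E) (fun v : LieAlg m ↦ torusAct (S := S) (torusExp v)) q = gen E q := rfl

variable [IsManifold 𝓘(ℝ, E) ∞ S]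

theorem isSmoothField_gen (v : LieAlg m) :
    IsSmoothField (coneModel E) (fun q : Cone S ↦ gen E q v) :=
  (isSmooth_torusVectorAction h).isSmoothField_genField v

omit [IsManifold 𝓘(ℝ, E) ∞ S] in
theorem contMDiff_torusAct (τ : Torus m) :
    ContMDiff (coneModel E) (coneModel E) ∞ (torusAct (S := S) τ) := by
  obtain ⟨v, rfl⟩ := exists_torusExp τ
  exact (isSmooth_torusVectorAction h).smooth_map v

end ConeGenerators

/-! ### The cone as a Kähler manifold and the Hamiltonian identity for its moment map -/

namespace SasakiStructure

variable {E : Type*} [NormedAddCommGroup E] [NormedSpace ℝ E]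
  {S : Type*} [TopologicalSpace S] [ChartedSpace E S] [IsManifold 𝓘(ℝ, E) ∞ S]
  (A : SasakiStructure E S)

theorem isKaehler : IsKaehler (coneModel E) A.J (coneForm A.g) where
  smooth_J := A.smooth_J
  J_sq := A.J_sq
  integrable := A.integrable_J
  symm q X Y := by
    have h1 : A.g.inner q.1 X.1 Y.1 = A.g.inner q.1 Y.1 X.1 := A.g.symm q.1 X.1 Y.1
    have h2 : ∀ X Y : E × ℝ, coneForm A.g q X Y =
      (q.2 : ℝ) ^ 2 * A.g.inner q.1 X.1 Y.1 + X.2 * Y.2 := fun _ _ ↦ rfl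
    rw [h2, h2, h1, mul_comm X.2]
  pos q X hX := by
    have h2 : coneForm A.g q X X =
      (q.2 : ℝ) ^ 2 * A.g.inner q.1 X.1 X.1 + X.2 * X.2 := rfl
    have h0 : 0 < (q.2 : ℝ) := q.2.2
    rw [h2]
    by_cases h : X.1 = 0
    · have h3 : X.2 ≠ 0 := fun h3 ↦ hX (Prod.ext h h3)
      have h4 : A.g.inner q.1 X.1 X.1 = 0 := by
        rw [h]; exact congrArg (fun L : E →L[ℝ] ℝ ↦ L 0) (map_zero (A.g.inner q.1))
      rw [h4]
      have := mul_self_pos.2 h3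
      linarith
    · have h5 : (0 : ℝ) < A.g.inner q.1 X.1 X.1 := A.g.pos q.1 X.1 h
      have := mul_self_nonneg X.2
      positivity
  compat := A.metric_J
  smooth_G X Y hX hY := contMDiff_coneForm A.g hX hY
  closed := A.closed

variable {m : ℕ} [MulAction (Torus m) S]

theorem coneForm_positionVector (q : Cone S) (X : E × ℝ) :
    coneForm A.g q (positionVector (E := E) q) X = (q.2 : ℝ) * X.2 := by
  have h2 : coneForm A.g q (positionVector (E := E) q) X =
      (q.2 : ℝ) ^ 2 * A.g.inner q.1 (0 : E) X.1 + (q.2 : ℝ) * X.2 := rfl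
  have h4 : A.g.inner q.1 (0 : E) X.1 = 0 :=
    congrArg (fun L : E →L[ℝ] ℝ ↦ L X.1) (map_zero (A.g.inner q.1))
  rw [h2, h4]; ring

section Reeb

variable {A} {b : LieAlg m} (hb : ∀ p : Cone S, generator E p b = A.reeb p)
include hb

theorem positionVector_eq (q : Cone S) : (positionVector q : E × ℝ) = -A.J q (gen E q b) := by
  have h1 : (gen E q b : E × ℝ) = A.J q (positionVector q) := hb q
  rw [h1]
  have h2 : (show E × ℝ from A.J q (A.J q (positionVector q))) = -(positionVector q : E × ℝ) :=
    A.J_sq q _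
  have h3 : (positionVector q : E × ℝ) = - -(positionVector q : E × ℝ) := (neg_neg _).symm
  exact h3.trans (congrArg Neg.neg h2.symm)

theorem moment_eq (q : Cone S) (v : LieAlg m) :
    A.moment q v = 1 / 2 * coneForm A.g q (gen E q b) (gen E q v) := by
  rw [moment_apply]
  have h0 : (0 : ℝ) < q.2 := q.2.2
  have h1 : A.eta q (generator E q v) =
      ((q.2 : ℝ) ^ 2)⁻¹ * coneForm A.g q (gen E q b) (gen E q v) := by
    have h2 : (gen E q b : E × ℝ) = A.reeb q := hb q
    rw [h2]; rfl
  rw [h1]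
  field_simp

variable [FiniteDimensional ℝ E] [T2Space S] (hA : A.IsToric m)
include hA

omit hb [FiniteDimensional ℝ E] [T2Space S] in
theorem contMDiff_coneForm_gen (v w : LieAlg m) :
    ContMDiff (coneModel E) 𝓘(ℝ, ℝ) ∞ fun q : Cone S ↦ coneForm A.g q (gen E q v) (gen E q w) :=
  contMDiff_coneForm A.g (isSmoothField_gen hA.smooth v) (isSmoothField_gen hA.smooth w)

omit [FiniteDimensional ℝ E] [T2Space S] in
theorem contMDiff_moment (v : LieAlg m) :
    ContMDiff (coneModel E) 𝓘(ℝ, ℝ) ∞ fun q : Cone S ↦ A.moment q v := by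
  simp only [moment_eq hb]
  exact contMDiff_const.mul (contMDiff_coneForm_gen hA b v)

/-- This is `hasMFDerivAt_moment` for the action of `LieAlg m × ℝ`, in which the position vector is
the generator of `(0, 1)`. The dilation by `exp t` multiplies the cone metric by `exp (2 * t)`, and
the moment map carries the factor `1 / 2`. -/
theorem mD_moment (v : LieAlg m) (p : Cone S) (X : E × ℝ) :
    mD (coneModel E) 𝓘(ℝ, ℝ) (fun q : Cone S ↦ A.moment q v) p X =
      -coneForm A.g p (A.J p (gen E p v)) X := by
  have hs := coneAct_isSmooth hA.smooth
  have hsm := (contMDiff_coneForm_gen hA b v).mdifferentiable (by simp)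
  have key := A.isKaehler.hasMFDerivAt_moment hs (b := (b, 0)) (v := (v, 0)) (ρ := (0, 1))
  simp only [genField_inl hA.smooth, genField_inr hA.smooth, Prod.smul_mk, smul_zero, mul_zero, coneAct_inl,
    coneAct_inr, smul_eq_mul, mul_one] at key
  have hJ : ∀ (w : LieAlg m) (t : ℝ) (q : Cone S) (X : E × ℝ),
      mD (coneModel E) (coneModel E) (torusAct (torusExp (t • w))) q (A.J q X) =
        A.J (coneAct (t • w, t * 0) q)
          (mD (coneModel E) (coneModel E) (torusAct (torusExp (t • w))) q X) := by
    intro w t q X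
    have h1 : ∀ (q q' : Cone S) (Y : E × ℝ), q = q' →
        (A.J q Y : E × ℝ) = (A.J q' Y : E × ℝ) := by
      rintro q _ Y rfl; rfl
    refine Eq.trans (hA.holomorphic _ q X) (h1 _ _ _ ?_)
    rw [mul_zero, coneAct_inl]
  have h1 := key (positionVector_eq hb) (hJ b) (hJ v) (fun t q X Y ↦ hA.isometric _ q X Y) ?_ hsm p X
  · have h2 := mD_comp_apply (coneModel E) 𝓘(ℝ, ℝ) 𝓘(ℝ, ℝ)
      (f := fun q : Cone S ↦ coneForm A.g q (gen E q b) (gen E q v))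
      (g := fun r ↦ (1 / 2 : ℝ) * r) (p := p)
      (by fun_prop : DifferentiableAt ℝ (fun r ↦ (1 / 2 : ℝ) * r) _).mdifferentiableAt
      (hsm p) X
    simp only [moment_eq hb]
    have h5 : ∀ x z : ℝ, fderiv ℝ (fun r ↦ (1 / 2 : ℝ) * r) x (-2 * z) = -z := by
      intro x z
      rw [fderiv_const_mul (by fun_prop)]
      simp
    rw [h2, h1, mD_eq_fderiv]
    exact h5 _ _
  · intro t q X Y
    rw [mD_scale, mD_scale]
    have h3 : ∀ (q : Cone S) (X Y : E × ℝ), coneForm A.g q X Y =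
      (q.2 : ℝ) ^ 2 * A.g.inner q.1 X.1 Y.1 + X.2 * Y.2 := fun _ _ _ ↦ rfl
    have h4 : Real.exp (2 * t) = Real.exp t * Real.exp t := by rw [← Real.exp_add]; ring_nf
    have h5 : ∀ r e a x y : ℝ, (e * r) ^ 2 * a + e * x * (e * y) = e * e * (r ^ 2 * a + x * y) := by
      intros; ring
    rw [h3, h3, h4]
    exact h5 _ _ _ _ _

end Reeb

end SasakiStructure

/-! ### Equivariant functions -/

/-- Take a finite set whose joint kernel has minimal dimension: adding an index cannot shrink it
further, so that kernel lies in the kernel of every `L i`. -/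
theorem exists_finset_joint_ker {V G ι : Type*} [NormedAddCommGroup V] [NormedSpace ℝ V]
    [FiniteDimensional ℝ V] [NormedAddCommGroup G] [NormedSpace ℝ G] (L : ι → V →L[ℝ] G)
    (h : ∀ X, (∀ i, L i X = 0) → X = 0) : ∃ s : Finset ι, ∀ X, (∀ i ∈ s, L i X = 0) → X = 0 := by
  classical
  let K : Finset ι → Submodule ℝ V := fun s ↦ ⨅ i ∈ s, LinearMap.ker (L i).toLinearMap
  have hK : ∀ s X, X ∈ K s ↔ ∀ i ∈ s, L i X = 0 := by simp [K]
  let f : Finset ι → ℕ := fun s ↦ finrank ℝ (K s)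
  refine ⟨Function.argmin f, fun X hX ↦ ?_⟩
  by_contra hne
  obtain ⟨i, hi⟩ : ∃ i, L i X ≠ 0 := by
    by_contra! hall
    exact hne (h X hall)
  refine Function.not_lt_argmin f (insert i (Function.argmin f))
    (Submodule.finrank_lt_finrank_of_lt (lt_of_le_of_ne ?_ ?_))
  · intro Y hY
    rw [hK] at hY ⊢
    exact fun j hj ↦ hY j (Finset.mem_insert_of_mem hj)
  · intro heq
    have hXm : X ∈ K (Function.argmin f) := (hK _ _).2 hX
    rw [← heq, hK] at hXm
    exact hi (hXm i (Finset.mem_insert_self _ _))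

theorem continuous_of_comp_coe {d : ℕ} {G : Type*} [TopologicalSpace G]
    {h : UnitAddTorus (Fin d) → G}
    (hc : Continuous fun x : LieAlg d ↦ h (fun i ↦ (x i : UnitAddCircle))) : Continuous h := by
  have h1 : IsOpenQuotientMap (fun (x : LieAlg d) (i : Fin d) ↦ (x i : UnitAddCircle)) := by
    refine ⟨?_, ?_, ?_⟩
    · intro y
      choose x hx using fun i ↦ QuotientAddGroup.mk_surjective (y i)
      exact ⟨x, funext hx⟩
    · exact continuous_pi fun i ↦ (AddCircle.continuous_mk' 1).comp (continuous_apply i)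
    · exact IsOpenMap.piMap (fun i ↦ QuotientAddGroup.isOpenMap_coe)
        (Filter.Eventually.of_forall fun i ↦ QuotientAddGroup.mk_surjective)
  exact h1.continuous_comp_iff.1 hc

section Fourier

variable {E : Type*} [NormedAddCommGroup E] [NormedSpace ℝ E]
  {S : Type*} [TopologicalSpace S] [ChartedSpace E S] {m : ℕ} [MulAction (Torus m) S]

/-- The component of a function on which the torus acts with a given weight. -/
def torusCoeff (f : S → ℝ) (n : Fin m → ℤ) (s : S) : ℂ :=
  UnitAddTorus.mFourierCoeff (fun x ↦ (f (toTorus x • s) : ℂ)) n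

omit [TopologicalSpace S] in
theorem torusCoeff_smul (f : S → ℝ) (n : Fin m → ℤ) (v : LieAlg m) (s : S) :
    torusCoeff f n (torusExp v • s) =
      Complex.exp ((weight n v : ℝ) * Complex.I) * torusCoeff f n s := by
  obtain ⟨x, rfl⟩ := exists_toTorus v
  have h := mFourierCoeff_comp_add (fun x ↦ (f (toTorus x • s) : ℂ)) n
    (fun i ↦ (x i : UnitAddCircle))
  rw [mFourier_coe] at h
  have e : ∀ τ τ' : Torus m, (τ * τ') • s = τ • τ' • s := fun _ _ ↦ mul_smul _ _ _
  simp only [toTorus_add, toTorus_coe, e] at h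
  rw [torusCoeff, h, map_smul, smul_eq_mul]
  rfl

/-- A function, translated by the torus, in a chart. -/
def translateInChart (f : S → ℝ) (s : S) (y : LieAlg m × E) : ℝ :=
  f (torusExp ((2 * Real.pi) • y.1) • (extChartAt 𝓘(ℝ, E) s).symm y.2)

variable (h : IsSmoothTorusAction E S m) [IsManifold 𝓘(ℝ, E) ∞ S] {f : S → ℝ}
  (hf : ContMDiff 𝓘(ℝ, E) 𝓘(ℝ, ℝ) ∞ f)
include h hf

theorem contDiffOn_translateInChart (s : S) :
    ContDiffOn ℝ ∞ (translateInChart (m := m) f s)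
      (univ ×ˢ (extChartAt 𝓘(ℝ, E) s).target) := by
  rw [← contMDiffOn_iff_contDiffOn]
  have h1 : ContMDiffOn 𝓘(ℝ, LieAlg m × E) 𝓘(ℝ, LieAlg m) ∞
      (fun y : LieAlg m × E ↦ (2 * Real.pi) • y.1) (univ ×ˢ (extChartAt 𝓘(ℝ, E) s).target) :=
    (ContDiff.contMDiff (by fun_prop)).contMDiffOn
  have h2 : ContMDiffOn 𝓘(ℝ, LieAlg m × E) 𝓘(ℝ, E) ∞
      (fun y : LieAlg m × E ↦ (extChartAt 𝓘(ℝ, E) s).symm y.2)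
      (univ ×ˢ (extChartAt 𝓘(ℝ, E) s).target) :=
    (contMDiffOn_extChartAt_symm s).comp contDiff_snd.contMDiff.contMDiffOn fun y hy ↦ hy.2
  exact (hf.comp h).comp_contMDiffOn (h1.prodMk h2)

omit h hf [IsManifold 𝓘(ℝ, E) ∞ S] in
theorem torusCoeff_symm (n : Fin m → ℤ) (s : S) :
    torusCoeff f n ∘ (extChartAt 𝓘(ℝ, E) s).symm = fun x ↦
      ∫ θ in Icc (0 : Fin m → ℝ) 1, UnitAddTorus.mFourier (-n) (fun i ↦ (θ i : UnitAddCircle)) *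
        (translateInChart f s (θ, x) : ℂ) := by
  funext x
  simp only [Function.comp_apply, torusCoeff, mFourierCoeff_eq_integral_cube, toTorus_coe]
  rfl

omit h hf [IsManifold 𝓘(ℝ, E) ∞ S] [NormedAddCommGroup E] [NormedSpace ℝ E] [TopologicalSpace S]
  [ChartedSpace E S] [MulAction (Torus m) S] in
theorem contDiff_mFourier_coe (n : Fin m → ℤ) :
    ContDiff ℝ ∞ fun θ : LieAlg m ↦ UnitAddTorus.mFourier n (fun i ↦ (θ i : UnitAddCircle)) := by
  simp only [mFourier_coe, weight_apply]
  have h1 : ContDiff ℝ ∞ fun θ : LieAlg m ↦ 2 * Real.pi * ∑ i, (n i : ℝ) * θ i := by fun_prop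
  have h2 := Complex.ofRealCLM.contDiff.comp h1
  exact Complex.contDiff_exp.comp (h2.mul contDiff_const)

theorem contDiffOn_torusCoeff_integrand (n : Fin m → ℤ) (s : S) :
    ContDiffOn ℝ ∞ (fun y : LieAlg m × E ↦
      UnitAddTorus.mFourier (-n) (fun i ↦ (y.1 i : UnitAddCircle)) *
        (translateInChart f s y : ℂ)) (univ ×ˢ (extChartAt 𝓘(ℝ, E) s).target) :=
  ((contDiff_mFourier_coe (-n)).comp contDiff_fst).contDiffOn.mul
    (Complex.ofRealCLM.contDiff.comp_contDiffOn (contDiffOn_translateInChart h hf s))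

variable [FiniteDimensional ℝ E]

/-- Class `C^2` is enough, since the charts built from these functions are used only up to their
second derivatives. -/
theorem contMDiff_torusCoeff (n : Fin m → ℤ) :
    ContMDiff 𝓘(ℝ, E) 𝓘(ℝ, ℂ) 2 (torusCoeff f n) := by
  intro s
  have hO := isOpen_extChartAt_target (I := 𝓘(ℝ, E)) s
  have h1 := contDiffOn_setIntegral_param (K := Icc (0 : Fin m → ℝ) 1) isCompact_Icc hO 2
    ((contDiffOn_torusCoeff_integrand h hf n s).of_le (WithTop.coe_le_coe.2 le_top))
  rw [← torusCoeff_symm n s] at h1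
  have h2 : ContMDiffAt 𝓘(ℝ, E) 𝓘(ℝ, ℂ) 2
      (torusCoeff f n ∘ (extChartAt 𝓘(ℝ, E) s).symm) (extChartAt 𝓘(ℝ, E) s s) :=
    (h1.contDiffAt (hO.mem_nhds (mem_extChartAt_target s))).contMDiffAt
  have h3 := h2.comp s (contMDiffAt_extChartAt (I := 𝓘(ℝ, E)))
  refine h3.congr_of_eventuallyEq ?_
  filter_upwards [extChartAt_source_mem_nhds (I := 𝓘(ℝ, E)) s] with s' hs'
  simp only [Function.comp_apply]
  rw [(extChartAt 𝓘(ℝ, E) s).left_inv hs']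

/-- The derivative along `X` of the translate of `f` by `x` is a continuous function `H` of `x` in
the torus. Its Fourier coefficients are the derivatives of the functions `torusCoeff f n` along `X`,
hence zero. So `H = 0`, and its value at the identity is the derivative of `f`. -/
theorem mD_eq_zero_of_torusCoeff (s : S) (X : E)
    (hX : ∀ n : Fin m → ℤ, mD 𝓘(ℝ, E) 𝓘(ℝ, ℂ) (torusCoeff f n) s X = 0) :
    mD 𝓘(ℝ, E) 𝓘(ℝ, ℝ) f s X = 0 := by
  set x₀ := extChartAt 𝓘(ℝ, E) s s
  set T := (extChartAt 𝓘(ℝ, E) s).target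
  have hO : IsOpen T := isOpen_extChartAt_target (I := 𝓘(ℝ, E)) s
  have hx₀ : x₀ ∈ T := mem_extChartAt_target s
  have hO2 : IsOpen ((univ : Set (LieAlg m)) ×ˢ T) := isOpen_univ.prod hO
  have ht := contDiffOn_translateInChart (m := m) h hf s
  have htd : ∀ θ : LieAlg m, DifferentiableAt ℝ (translateInChart f s) (θ, x₀) := fun θ ↦
    (ht.contDiffAt (hO2.mem_nhds ⟨mem_univ _, hx₀⟩)).differentiableAt (by simp)
  let H : UnitAddTorus (Fin m) → ℂ := fun x ↦
    (mD 𝓘(ℝ, E) 𝓘(ℝ, ℝ) (fun s' ↦ f (toTorus x • s')) s X : ℝ)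
  have hH : ∀ θ : LieAlg m, H (fun i ↦ (θ i : UnitAddCircle)) =
      (fderiv ℝ (translateInChart f s) (θ, x₀) (0, X) : ℝ) := by
    intro θ
    simp only [H, toTorus_coe]
    have h1 : ContMDiff 𝓘(ℝ, E) 𝓘(ℝ, ℝ) ∞ (fun s' ↦ f (torusExp ((2 * Real.pi) • θ) • s')) :=
      hf.comp (h.comp (contMDiff_const.prodMk contMDiff_id))
    rw [← fderiv_comp_symm_self 𝓘(ℝ, E) s (h1.mdifferentiableAt (by simp))]
    have h2 : HasFDerivAt (fun x ↦ translateInChart f s (θ, x)) _ x₀ :=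
      (htd θ).hasFDerivAt.comp x₀ (hasFDerivAt_prodMk_right θ x₀)
    have h3 : fderiv ℝ ((fun s' ↦ f (torusExp ((2 * Real.pi) • θ) • s')) ∘
      (extChartAt 𝓘(ℝ, E) s).symm) x₀ = _ := h2.fderiv
    rw [h3]
    rfl
  have hcont : Continuous fun θ : LieAlg m ↦ fderiv ℝ (translateInChart f s) (θ, x₀) (0, X) := by
    have h1 := (ht.continuousOn_fderiv_of_isOpen hO2 (by simp)).comp_continuous
      (f := fun θ : LieAlg m ↦ (θ, x₀)) (by fun_prop) fun θ ↦ ⟨mem_univ _, hx₀⟩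
    exact h1.clm_apply continuous_const
  have hHc : Continuous H := by
    refine continuous_of_comp_coe ?_
    simp only [hH]
    exact Complex.continuous_ofReal.comp hcont
  have hcoef : ∀ n, UnitAddTorus.mFourierCoeff H n = 0 := by
    intro n
    have h1 := hasFDerivAt_setIntegral_param (K := Icc (0 : Fin m → ℝ) 1) isCompact_Icc hO
      ((contDiffOn_torusCoeff_integrand h hf n s).of_le (by simp)) hx₀
    rw [← torusCoeff_symm n s] at h1
    have h2 := fderiv_comp_symm_self 𝓘(ℝ, E) s
      ((contMDiff_torusCoeff h hf n).mdifferentiableAt (x := s) (by norm_num))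
    rw [← hX n, ← h2, h1.fderiv, ContinuousLinearMap.integral_apply,
      mFourierCoeff_eq_integral_cube]
    · refine MeasureTheory.setIntegral_congr_fun measurableSet_Icc fun θ _ ↦ ?_
      have h4 : HasFDerivAt (fun x ↦ UnitAddTorus.mFourier (-n) (fun i ↦ (θ i : UnitAddCircle)) *
          (translateInChart f s (θ, x) : ℂ)) _ x₀ :=
        (Complex.ofRealCLM.hasFDerivAt.comp x₀ ((htd θ).hasFDerivAt.comp x₀
          (hasFDerivAt_prodMk_right θ x₀))).const_mul _
      have h5 := ((contDiffOn_torusCoeff_integrand h hf n s).contDiffAt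
        (hO2.mem_nhds (show (θ, x₀) ∈ univ ×ˢ T from ⟨mem_univ θ, hx₀⟩))).differentiableAt (by simp)
      have h6 := (h5.hasFDerivAt.comp x₀ (hasFDerivAt_prodMk_right θ x₀)).unique h4
      refine Eq.trans ?_ (congrArg (fun L : E →L[ℝ] ℂ ↦ L X) h6).symm
      rw [hH]
      rfl
    · have h7 := ((contDiffOn_torusCoeff_integrand h hf n s).continuousOn_fderiv_of_isOpen hO2
        (by simp)).comp_continuous (f := fun θ : LieAlg m ↦ (θ, x₀)) (by fun_prop)
        fun θ ↦ ⟨mem_univ _, hx₀⟩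
      exact (h7.clm_comp continuous_const).continuousOn.integrableOn_compact isCompact_Icc
  have h0 := eq_zero_of_mFourierCoeff_eq_zero ⟨H, hHc⟩ hcoef 0
  have h1 : H 0 = 0 := h0
  have h2 : toTorus (0 : UnitAddTorus (Fin m)) = 1 := by ext; simp [toTorus]
  simpa [H, h2] using h1

omit hf in
/-- Near each point of the cone there are enough functions on which the torus acts by characters. -/
theorem exists_equivariant_functions [T2Space S] [CompactSpace S] (p : Cone S) :
    ∃ (ι : Type) (_ : Fintype ι) (n : ι → Fin m → ℤ) (Z : ι → Cone S → ℂ),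
      (∀ j, ContMDiff (coneModel E) 𝓘(ℝ, ℂ) 2 (Z j)) ∧
      (∀ j v q, Z j (torusAct (torusExp v) q) =
        Complex.exp ((weight (n j) v : ℝ) * Complex.I) * Z j q) ∧
      ∀ X : E × ℝ, (∀ j, mD (coneModel E) 𝓘(ℝ, ℂ) (Z j) p X = 0) → X = 0 := by
  -- The coordinates of an embedding of `S` detect tangent vectors of `S`, hence so do their torus
  -- components. The index `none` stands for the radius, on which the torus acts with weight `0`.
  obtain ⟨d, e, he, -, hinj⟩ := exists_embedding_euclidean_of_compact (I := 𝓘(ℝ, E)) (M := S)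
  have hei : ∀ i, ContMDiff 𝓘(ℝ, E) 𝓘(ℝ, ℝ) ∞ fun s ↦ e s i := fun i ↦
    (EuclideanSpace.proj (𝕜 := ℝ) i).contDiff.contMDiff.comp he
  let n : Option (Fin d × (Fin m → ℤ)) → Fin m → ℤ := fun j ↦ j.elim 0 Prod.snd
  let Z : Option (Fin d × (Fin m → ℤ)) → Cone S → ℂ := fun j ↦
    j.elim (fun q ↦ ((q.2 : ℝ) : ℂ)) fun a q ↦ torusCoeff (fun s ↦ e s a.1) a.2 q.1
  have hZ : ∀ j, ContMDiff (coneModel E) 𝓘(ℝ, ℂ) 2 (Z j) := by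
    rintro (_ | ⟨i, k⟩)
    · exact Complex.ofRealCLM.contDiff.contMDiff.comp contMDiff_radius
    · exact (contMDiff_torusCoeff h (hei i) k).comp contMDiff_fst
  have hker : ∀ X : E × ℝ, (∀ j, mD (coneModel E) 𝓘(ℝ, ℂ) (Z j) p X = 0) → X = 0 := by
    intro X hX
    have h2 : X.2 = 0 := by
      have h3 := mD_comp_apply (coneModel E) 𝓘(ℝ, ℝ) 𝓘(ℝ, ℂ) (f := fun q : Cone S ↦ (q.2 : ℝ))
        (g := fun r ↦ Complex.ofRealCLM r) (p := p)
        Complex.ofRealCLM.differentiableAt.mdifferentiableAt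
        ((contMDiff_radius (n := 1)).mdifferentiableAt one_ne_zero) X
      have h4 := h3.symm.trans (hX none)
      rw [mD_radius, mD_eq_fderiv, Complex.ofRealCLM.fderiv] at h4
      simpa using h4
    have h1 : mD 𝓘(ℝ, E) 𝓘(ℝ, EuclideanSpace ℝ (Fin d)) e p.1 X.1 = 0 := by
      ext i
      have h3 : mD 𝓘(ℝ, E) 𝓘(ℝ, ℝ) (fun s ↦ e s i) p.1 X.1 = 0 := by
        refine mD_eq_zero_of_torusCoeff h (hei i) p.1 X.1 fun k ↦ ?_
        have h4 := mD_comp_apply (coneModel E) 𝓘(ℝ, E) 𝓘(ℝ, ℂ) (f := fun q : Cone S ↦ q.1)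
          (g := torusCoeff (fun s ↦ e s i) k) (p := p)
          ((contMDiff_torusCoeff h (hei i) k).mdifferentiableAt (by norm_num))
          mdifferentiableAt_fst X
        have h5 := h4.symm.trans (hX (some (i, k)))
        rwa [mD_cone_fst] at h5
      have h4 := mD_comp_apply 𝓘(ℝ, E) 𝓘(ℝ, EuclideanSpace ℝ (Fin d)) 𝓘(ℝ, ℝ) (f := e)
        (g := fun y ↦ EuclideanSpace.proj (𝕜 := ℝ) i y) (p := p.1)
        (EuclideanSpace.proj (𝕜 := ℝ) i).differentiableAt.mdifferentiableAt
        (he.mdifferentiableAt (by simp)) X.1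
      rw [mD_eq_fderiv, (EuclideanSpace.proj (𝕜 := ℝ) i).fderiv] at h4
      exact h4.symm.trans h3
    have h3 : X.1 = 0 := hinj p.1 (Eq.trans h1 (map_zero _).symm)
    exact Prod.ext h3 h2
  -- Among the infinitely many components, finitely many already detect all tangent vectors at `p`.
  obtain ⟨s, hs⟩ := exists_finset_joint_ker (fun j ↦ mD (coneModel E) 𝓘(ℝ, ℂ) (Z j) p) hker
  refine ⟨s, inferInstance, fun j ↦ n j, fun j ↦ Z j, fun j ↦ hZ j, ?_, fun X hX ↦
    hs X fun i hi ↦ hX ⟨i, hi⟩⟩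
  rintro ⟨_ | ⟨i, k⟩, -⟩ v q
  · simp [Z, n, torusAct, weight_apply]
  · exact torusCoeff_smul (fun s ↦ e s i) k v q.1

end Fourier

/-! ### Linearisation of the torus action at a point -/

/-- `ret` is the orthogonal projection to the image of `L`, followed by the inverse of `L`. A skew
map that preserves the image preserves its orthogonal complement as well, hence commutes with the
projection. -/
theorem exists_equivariant_retraction {W F : Type*} [NormedAddCommGroup W] [NormedSpace ℝ W]
    [NormedAddCommGroup F] [InnerProductSpace ℝ F] [FiniteDimensional ℝ F] (L : W →L[ℝ] F)
    (hL : Function.Injective L) :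
    ∃ ret : F →L[ℝ] W, (∀ X, ret (L X) = X) ∧ ∀ D : F →L[ℝ] F,
      (∀ z w, inner ℝ (D z) w = -inner ℝ z (D w)) → (∀ X, ∃ Y, D (L X) = L Y) →
      ∀ z, ret (D z) = ret (D (L (ret z))) := by
  let R := LinearMap.range L.toLinearMap
  let e : W ≃ₗ[ℝ] R := LinearEquiv.ofInjective L.toLinearMap hL
  let P : F →ₗ[ℝ] R := (Submodule.orthogonalProjectionOnto R).toLinearMap
  let ret : F →L[ℝ] W := LinearMap.toContinuousLinearMap (e.symm.toLinearMap ∘ₗ P)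
  have h1 : ∀ z, L (ret z) = P z := fun z ↦ congrArg Subtype.val (e.apply_symm_apply (P z))
  have h2 : ∀ X, ret (L X) = X := fun X ↦ hL <| by
    rw [h1]
    exact Submodule.starProjection_eq_self_iff.2 ⟨X, rfl⟩
  have h3 : ∀ z ∈ Rᗮ, ret z = 0 := fun z hz ↦ hL <| by
    rw [h1, map_zero]
    exact (Submodule.starProjection_apply_eq_zero_iff R).2 hz
  refine ⟨ret, h2, fun D hD hR z ↦ ?_⟩
  have h4 : z - L (ret z) ∈ Rᗮ := by
    rw [h1]; exact Submodule.sub_starProjection_mem_orthogonal z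
  have h5 : D (z - L (ret z)) ∈ Rᗮ := by
    rw [Submodule.mem_orthogonal'] at h4 ⊢
    rintro _ ⟨X, rfl⟩
    obtain ⟨Y, hY⟩ := hR X
    rw [hD]
    change -inner ℝ _ (D (L X)) = 0
    rw [hY, show inner ℝ (z - L (ret z)) (L Y) = 0 from h4 _ ⟨Y, rfl⟩, neg_zero]
  rw [← sub_eq_zero, ← map_sub, ← map_sub]
  exact h3 _ h5

section Curve

variable {V : Type*} [NormedAddCommGroup V] [NormedSpace ℝ V]
  {H : Type*} [TopologicalSpace H] {I : ModelWithCorners ℝ V H} [I.Boundaryless]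
  {M : Type*} [TopologicalSpace M] [ChartedSpace H M] [IsManifold I 1 M]

omit [I.Boundaryless] in
theorem eq_of_mD_eq_zero {γ : ℝ → M} (hγ : MDifferentiable 𝓘(ℝ, ℝ) I γ)
    (h : ∀ t, mD 𝓘(ℝ, ℝ) I γ t 1 = 0) (t t' : ℝ) : γ t = γ t' := by
  have hl : IsLocallyConstant γ := by
    rw [IsLocallyConstant.iff_eventually_eq]
    intro t
    have h1 : ∀ᶠ t' in 𝓝 t, γ t' ∈ (extChartAt I (γ t)).source :=
      (hγ t).continuousAt.eventually (extChartAt_source_mem_nhds (γ t))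
    obtain ⟨ε, hε, hb⟩ := Metric.eventually_nhds_iff_ball.1 h1
    have h2 : ∀ t' ∈ Metric.ball t ε, HasFDerivAt (fun u ↦ extChartAt I (γ t) (γ u)) (0 : ℝ →L[ℝ] V) t' := by
      intro t' ht'
      have h3 : MDifferentiableAt I 𝓘(ℝ, V) (extChartAt I (γ t)) (γ t') :=
        mdifferentiableAt_extChartAt (by simpa using hb t' ht')
      have h4 := mD_comp 𝓘(ℝ, ℝ) I 𝓘(ℝ, V) h3 (hγ t')
      have h5 : DifferentiableAt ℝ (fun u ↦ extChartAt I (γ t) (γ u)) t' :=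
        (h3.comp t' (hγ t')).differentiableAt
      have h6 : mD 𝓘(ℝ, ℝ) I γ t' = 0 := by
        ext
        simpa using h t'
      rw [h6, ContinuousLinearMap.comp_zero, mD_eq_fderiv] at h4
      have h7 := h5.hasFDerivAt
      have h8 : fderiv ℝ (fun u ↦ extChartAt I (γ t) (γ u)) t' = 0 := h4
      rwa [h8] at h7
    filter_upwards [Metric.ball_mem_nhds t hε] with t' ht'
    have h9 := Metric.isOpen_ball.is_const_of_fderiv_eq_zero (𝕜 := ℝ)
      (convex_ball t ε).isPreconnected
      (fun u hu ↦ (h2 u hu).differentiableAt.differentiableWithinAt)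
      (fun u hu ↦ (h2 u hu).fderiv) ht' (Metric.mem_ball_self hε)
    exact (extChartAt I (γ t)).injOn (hb t' ht') (mem_extChartAt_source (γ t)) h9
  exact hl.apply_eq_of_isPreconnected isPreconnected_univ (mem_univ _) (mem_univ _)

theorem eventually_mD_injective [FiniteDimensional ℝ V] {G : Type*} [NormedAddCommGroup G]
    [NormedSpace ℝ G] {f : M → G} {p : M} (hf : ContMDiff I 𝓘(ℝ, G) 1 f)
    (h : Function.Injective (mD I 𝓘(ℝ, G) f p)) :
    ∀ᶠ q in 𝓝 p, Function.Injective (mD I 𝓘(ℝ, G) f q) := by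
  have hd := fun q ↦ hf.mdifferentiableAt (x := q) one_ne_zero
  have h1 : ContDiffAt ℝ 1 (f ∘ (extChartAt I p).symm) (extChartAt I p p) := by
    rw [← contMDiffAt_iff_contDiffAt]
    refine ContMDiffAt.comp _ (hf _) ?_
    exact (contMDiffOn_extChartAt_symm p).contMDiffAt (target_mem_nhds I p (mem_extChartAt_target p))
  have h2 : ContinuousAt (fderiv ℝ (f ∘ (extChartAt I p).symm)) (extChartAt I p p) :=
    (h1.fderiv_right (m := 0) (by simp)).continuousAt
  have h3 : ∀ᶠ x in 𝓝 (extChartAt I p p),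
      Function.Injective (fderiv ℝ (f ∘ (extChartAt I p).symm) x) := by
    refine h2.eventually (ContinuousLinearMap.isOpen_injective.mem_nhds ?_)
    rw [fderiv_comp_symm_self I p (hd p)]
    exact h
  have h4 : Filter.Tendsto (extChartAt I p) (𝓝 p) (𝓝 (extChartAt I p p)) :=
    continuousAt_extChartAt p
  filter_upwards [h4.eventually h3, extChartAt_source_mem_nhds (I := I) p] with q hq hqs
  have hqt := (extChartAt I p).map_source hqs
  rw [fderiv_comp_symm I p hqt (hd _), (extChartAt I p).left_inv hqs] at hq
  have hinv := chartD_isInvertible I p hqt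
  intro X Y hXY
  have := @hq ((chartD I p (extChartAt I p q)).inverse X) ((chartD I p (extChartAt I p q)).inverse Y)
    (by simp only [ContinuousLinearMap.comp_apply, hinv.self_apply_inverse, hXY])
  have h5 := congrArg (chartD I p (extChartAt I p q)) this
  simpa only [hinv.self_apply_inverse] using h5

end Curve

section WeightSpace

variable {ι : Type*} [Fintype ι] {m : ℕ} (n : ι → Fin m → ℤ)

/-- The linear action of the Lie algebra with given weights. -/
def weightRep : LieAlg m →ₗ[ℝ] ((PiLp 2 fun _ : ι ↦ ℂ) →L[ℝ] PiLp 2 fun _ : ι ↦ ℂ) :=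
  LinearMap.toContinuousLinearMap.toLinearMap ∘ₗ LinearMap.mk₂ ℝ
    (fun v z ↦ WithLp.toLp 2 fun j ↦ ((weight (n j) v : ℝ) : ℂ) * Complex.I * z j)
    (fun v w z ↦ by ext j; simp; ring) (fun c v z ↦ by ext j; simp; ring)
    (fun v z w ↦ by ext j; simp; ring) (fun c v z ↦ by ext j; simp; ring)

theorem weightRep_apply (v : LieAlg m) (z : PiLp 2 fun _ : ι ↦ ℂ) (j : ι) :
    weightRep n v z j = ((weight (n j) v : ℝ) : ℂ) * Complex.I * z j := rfl

/-- The linear action of the torus with given weights. -/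
def weightExp (v : LieAlg m) (z : PiLp 2 fun _ : ι ↦ ℂ) : PiLp 2 fun _ : ι ↦ ℂ :=
  WithLp.toLp 2 fun j ↦ Complex.exp ((weight (n j) v : ℝ) * Complex.I) * z j

theorem weightRep_comm (v u : LieAlg m) (z : PiLp 2 fun _ : ι ↦ ℂ) :
    weightRep n v (weightRep n u z) = weightRep n u (weightRep n v z) := by
  ext j
  simp only [weightRep_apply]
  ring

theorem inner_weightRep (v : LieAlg m) (z w : PiLp 2 fun _ : ι ↦ ℂ) :
    inner ℝ (weightRep n v z) w = -inner ℝ z (weightRep n v w) := by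
  rw [PiLp.inner_apply, PiLp.inner_apply, ← Finset.sum_neg_distrib]
  refine Finset.sum_congr rfl fun j _ ↦ ?_
  simp only [weightRep_apply, Complex.inner, map_mul, Complex.conj_ofReal, Complex.conj_I]
  simp
  ring

theorem hasDerivAt_weightExp (v : LieAlg m) (z : PiLp 2 fun _ : ι ↦ ℂ) :
    HasDerivAt (fun t : ℝ ↦ weightExp n (t • v) z) (weightRep n v z) 0 := by
  have h1 : HasDerivAt (fun (t : ℝ) (j : ι) ↦ Complex.exp ((weight (n j) (t • v) : ℝ) * Complex.I) * z j)
      (fun j ↦ ((weight (n j) v : ℝ) : ℂ) * Complex.I * z j) 0 := by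
    rw [hasDerivAt_pi]
    intro j
    have h2 : HasDerivAt (fun t : ℝ ↦ ((weight (n j) (t • v) : ℝ) : ℂ) * Complex.I)
        (((weight (n j) v : ℝ) : ℂ) * Complex.I) 0 := by
      have h3 : HasDerivAt (fun t : ℝ ↦ weight (n j) (t • v)) (weight (n j) v) 0 := by
        simpa using (hasDerivAt_id (0 : ℝ)).mul_const (weight (n j) v)
      exact h3.ofReal_comp.mul_const Complex.I
    simpa using h2.cexp.mul_const (z j)
  exact (PiLp.continuousLinearEquiv 2 ℝ fun _ : ι ↦ ℂ).symm.hasFDerivAt.comp_hasDerivAt 0 h1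

theorem weightExp_isLinear (v : LieAlg m) : ∃ L : (PiLp 2 fun _ : ι ↦ ℂ) →L[ℝ] PiLp 2 fun _ : ι ↦ ℂ,
    ∀ z, L z = weightExp n v z := by
  refine ⟨LinearMap.toContinuousLinearMap
    { toFun := weightExp n v, map_add' := fun z w ↦ ?_, map_smul' := fun c z ↦ ?_ }, fun z ↦ rfl⟩
  · ext j; simp [weightExp]; ring
  · ext j; simp [weightExp]; ring

end WeightSpace

section LocalModel

variable {E : Type*} [NormedAddCommGroup E] [NormedSpace ℝ E]
  {S : Type*} [TopologicalSpace S] [ChartedSpace E S] {m : ℕ} [MulAction (Torus m) S]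

variable (E m) in
/-- A linearisation near `p` of the action of the identity component of the isotropy group: the
isotropy representation `B`, and a chart `Ψ` at `p` in which the isotropy algebra acts linearly. -/
structure LocalModel (p : Cone S) where
  /-- the infinitesimal isotropy representation -/
  B : LieAlg m →ₗ[ℝ] (E × ℝ →L[ℝ] E × ℝ)
  /-- the equivariant chart -/
  Ψ : Cone S → E × ℝ
  contMDiff : ContMDiff (coneModel E) 𝓘(ℝ, E × ℝ) 2 Ψ
  map_self : Ψ p = 0
  mD_self : mD (coneModel E) 𝓘(ℝ, E × ℝ) Ψ p = ContinuousLinearMap.id ℝ (E × ℝ)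
  mD_gen : ∀ v : LieAlg m, gen E p v = 0 → ∀ q,
    mD (coneModel E) 𝓘(ℝ, E × ℝ) Ψ q (gen E q v) = B v (Ψ q)
  hasDerivAt : ∀ v : LieAlg m, gen E p v = 0 → ∀ X,
    HasDerivAt (fun t : ℝ ↦ mD (coneModel E) (coneModel E) (torusAct (torusExp (t • v))) p X)
      (B v X) 0
  comm : ∀ v u : LieAlg m, gen E p v = 0 → gen E p u = 0 → ∀ X, B v (B u X) = B u (B v X)
  isotropy : ∀ᶠ q in 𝓝 p, ∃ T : Set (Fin m → ℤ), ∀ v : LieAlg m,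
    gen E q v = 0 ↔ ∀ n ∈ T, weight n v = 0
  ker_le : ∀ᶠ q in 𝓝 p, ∀ v : LieAlg m, gen E q v = 0 → gen E p v = 0

variable [IsManifold 𝓘(ℝ, E) ∞ S] (h : IsSmoothTorusAction E S m)
include h

/-- The velocity of the orbit of `p` at any time is the image of `gen E p v = 0` under a
differential, so the orbit is constant. -/
theorem torusAct_exp_eq_self {p : Cone S} {v : LieAlg m} (hv : gen E p v = 0) (t : ℝ) :
    torusAct (torusExp (t • v)) p = p := by
  have hs := isSmooth_torusVectorAction h
  have h1 : MDifferentiable 𝓘(ℝ, ℝ) (coneModel E) fun t : ℝ ↦ torusAct (torusExp (t • v)) p :=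
    fun t ↦ (hs.mdifferentiableAt_orbit p (t • v)).comp t
      (by fun_prop : DifferentiableAt ℝ (fun t : ℝ ↦ t • v) t).mdifferentiableAt
  have h2 : ∀ t, mD 𝓘(ℝ, ℝ) (coneModel E) (fun t : ℝ ↦ torusAct (torusExp (t • v)) p) t 1 = 0 := by
    intro t
    rw [mD_comp_apply 𝓘(ℝ, ℝ) 𝓘(ℝ, LieAlg m) (coneModel E) (f := fun t : ℝ ↦ t • v)
      (g := fun v ↦ torusAct (torusExp v) p) (hs.mdifferentiableAt_orbit p (t • v))
      (by fun_prop : DifferentiableAt ℝ (fun t : ℝ ↦ t • v) t).mdifferentiableAt, hs.mD_orbit]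
    have h3 : mD 𝓘(ℝ, ℝ) 𝓘(ℝ, LieAlg m) (fun t : ℝ ↦ t • v) t 1 = v := by
      have h4 : HasDerivAt (fun t : ℝ ↦ t • v) v t := by
        simpa using (hasDerivAt_id t).smul_const v
      rw [mD_eq_fderiv, h4.hasFDerivAt.fderiv]
      simp
    rw [h3, hs.genField_act, genField_torus, hv, map_zero]
  have h3 := eq_of_mD_eq_zero h1 h2 t 0
  simpa [torusExp_zero, torusAct_one] using h3

variable [FiniteDimensional ℝ E] [T2Space S] [CompactSpace S]

/-- The equivariant functions form a map `Zm` to a linear representation, with `dZm(v) = weightRep n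
v ∘ Zm`. Composed with the equivariant retraction to the image of `dZm` at `p`, it gives `Ψ`. Near
`p` the map `Zm` is an immersion, so `v` vanishes at `q` exactly when the weights of the nonzero
coordinates of `Zm q` kill `v`. This gives `isotropy`; since nonvanishing of a coordinate is an open
condition, it also gives `ker_le`. -/
theorem exists_localModel (p : Cone S) : Nonempty (LocalModel E m p) := by
  classical
  obtain ⟨ι, _, n, Z, hZ, hZv, hZinj⟩ := exists_equivariant_functions h p
  have hs := isSmooth_torusVectorAction h
  let Zm : Cone S → PiLp 2 fun _ : ι ↦ ℂ := fun q ↦ WithLp.toLp 2 fun j ↦ Z j q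
  have hZm : ContMDiff (coneModel E) 𝓘(ℝ, PiLp 2 fun _ : ι ↦ ℂ) 2 Zm := by
    have h1 : ContMDiff (coneModel E) 𝓘(ℝ, ι → ℂ) 2 fun q j ↦ Z j q := contMDiff_pi_space.2 hZ
    exact (PiLp.continuousLinearEquiv 2 ℝ fun _ : ι ↦ ℂ).symm.contDiff.contMDiff.comp h1
  have hZmd := fun q ↦ hZm.mdifferentiableAt (x := q) (by norm_num)
  have hZU : ∀ v q, Zm (torusAct (torusExp v) q) = weightExp n v (Zm q) := by
    intro v q
    ext j
    exact hZv j v q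
  have hZgen : ∀ v q, mD (coneModel E) 𝓘(ℝ, PiLp 2 fun _ : ι ↦ ℂ) Zm q (gen E q v) =
      weightRep n v (Zm q) := by
    intro v q
    have h1 := mD_comp_apply 𝓘(ℝ, LieAlg m) (coneModel E) 𝓘(ℝ, PiLp 2 fun _ : ι ↦ ℂ)
      (f := fun v ↦ torusAct (torusExp v) q) (g := Zm) (p := 0) (hZmd _)
      (hs.mdifferentiableAt_orbit q 0) v
    have h2 : DifferentiableAt ℝ (fun v ↦ weightExp n v (Zm q)) ((0 : ℝ) • v) := by
      rw [zero_smul, ← mdifferentiableAt_iff_differentiableAt]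
      simp only [← hZU]
      exact (hZmd _).comp 0 (hs.mdifferentiableAt_orbit q 0)
    have h3 : HasDerivAt (fun t : ℝ ↦ t • v) v 0 := by
      simpa using (hasDerivAt_id (0 : ℝ)).smul_const v
    have h5 := h2.hasFDerivAt.comp_hasDerivAt (0 : ℝ) h3
    have h6 : HasDerivAt ((fun v ↦ weightExp n v (Zm q)) ∘ fun t : ℝ ↦ t • v) _ 0 :=
      hasDerivAt_weightExp n v (Zm q)
    have h4 := h5.unique h6
    simp only [hZU] at h1
    rw [mD_eq_fderiv] at h1
    rw [zero_smul] at h4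
    rw [← h4, h1, torusExp_zero, torusAct_one]
    rfl
  let L : E × ℝ →L[ℝ] PiLp 2 fun _ : ι ↦ ℂ := mD (coneModel E) 𝓘(ℝ, PiLp 2 fun _ : ι ↦ ℂ) Zm p
  have hL : Function.Injective L := by
    rw [injective_iff_map_eq_zero]
    intro X hX
    refine hZinj X fun j ↦ ?_
    have h1 := mD_comp_apply (coneModel E) 𝓘(ℝ, PiLp 2 fun _ : ι ↦ ℂ) 𝓘(ℝ, ℂ) (f := Zm)
      (g := fun z ↦ PiLp.proj (𝕜 := ℝ) 2 (fun _ : ι ↦ ℂ) j z) (p := p)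
      (PiLp.proj (𝕜 := ℝ) 2 (fun _ : ι ↦ ℂ) j).differentiableAt.mdifferentiableAt (hZmd p) X
    exact h1.trans ((congrArg _ hX).trans (map_zero _))
  obtain ⟨ret, hret, hretD⟩ := exists_equivariant_retraction L hL
  -- Elements of the isotropy algebra exponentiate to maps fixing `p`, so `dZm` at `p` intertwines
  -- their differentials with the linear action.
  have hLK : ∀ v, gen E p v = 0 → ∀ (t : ℝ) X,
      L (mD (coneModel E) (coneModel E) (torusAct (torusExp (t • v))) p X) =
        weightExp n (t • v) (L X) := by
    intro v hv t X
    have hp := torusAct_exp_eq_self h hv t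
    obtain ⟨U, hU⟩ := weightExp_isLinear n (t • v)
    have h1 := mD_comp_apply (coneModel E) (coneModel E) 𝓘(ℝ, PiLp 2 fun _ : ι ↦ ℂ)
      (f := torusAct (torusExp (t • v))) (g := Zm) (p := p) (hZmd _)
      (hs.mdifferentiableAt_map (t • v) p) X
    have h2 := mD_comp_apply (coneModel E) 𝓘(ℝ, PiLp 2 fun _ : ι ↦ ℂ) 𝓘(ℝ, PiLp 2 fun _ : ι ↦ ℂ)
      (f := Zm) (g := fun z ↦ U z) (p := p) U.differentiableAt.mdifferentiableAt (hZmd _) X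
    rw [mD_eq_fderiv, U.fderiv] at h2
    simp only [hZU, hU, hp] at h1 h2
    exact h1.symm.trans h2
  have hder : ∀ v, gen E p v = 0 → ∀ X, HasDerivAt
      (fun t : ℝ ↦ mD (coneModel E) (coneModel E) (torusAct (torusExp (t • v))) p X)
      (ret (weightRep n v (L X))) 0 := by
    intro v hv X
    refine (ret.hasFDerivAt.comp_hasDerivAt 0 (hasDerivAt_weightExp n v (L X))).congr_of_eventuallyEq
      (.of_forall fun t ↦ ?_)
    simp only [Function.comp_apply, ← hLK v hv t X, hret]
  -- For isotropic `v` the image of `L` is stable under `weightRep n v`, as the retraction lemma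
  -- requires.
  have hLD : ∀ v, gen E p v = 0 → ∀ X, L (ret (weightRep n v (L X))) = weightRep n v (L X) := by
    intro v hv X
    have h1 := L.hasFDerivAt.comp_hasDerivAt 0 (hder v hv X)
    refine h1.unique ((hasDerivAt_weightExp n v (L X)).congr_of_eventuallyEq (.of_forall fun t ↦ ?_))
    exact hLK v hv t X
  let B : LieAlg m →ₗ[ℝ] (E × ℝ →L[ℝ] E × ℝ) :=
    { toFun := fun v ↦ ret.comp ((weightRep n v).comp L)
      map_add' := fun v w ↦ by ext X <;> simp
      map_smul' := fun c v ↦ by ext X <;> simp }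
  have hB : ∀ v X, B v X = ret (weightRep n v (L X)) := fun _ _ ↦ rfl
  have hΨm : ∀ q X, mD (coneModel E) 𝓘(ℝ, E × ℝ) (fun q ↦ ret (Zm q - Zm p)) q X =
      ret (mD (coneModel E) 𝓘(ℝ, PiLp 2 fun _ : ι ↦ ℂ) Zm q X) := by
    intro q X
    have hd : HasFDerivAt (fun z ↦ ret (z - Zm p)) ret (Zm q) := by
      have := ret.hasFDerivAt.comp (Zm q) ((hasFDerivAt_id (𝕜 := ℝ) (Zm q)).sub_const (Zm p))
      exact this
    have h1 := mD_comp_apply (coneModel E) 𝓘(ℝ, PiLp 2 fun _ : ι ↦ ℂ) 𝓘(ℝ, E × ℝ)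
      (f := Zm) (g := fun z ↦ ret (z - Zm p)) (p := q) hd.differentiableAt.mdifferentiableAt
      (hZmd q) X
    rw [h1, mD_eq_fderiv, hd.fderiv]
  have hker : ∀ v, gen E p v = 0 → weightRep n v (Zm p) = 0 := by
    intro v hv
    rw [← hZgen, hv, map_zero]
  have hinj := eventually_mD_injective (hZm.of_le (by norm_num)) hL
  have hiso : ∀ᶠ q in 𝓝 p, ∀ v, gen E q v = 0 ↔ ∀ j, Z j q ≠ 0 → weight (n j) v = 0 := by
    filter_upwards [hinj] with q hq v
    rw [← map_eq_zero_iff _ hq, hZgen, ← (WithLp.ofLp_injective 2).eq_iff, funext_iff]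
    refine forall_congr' fun j ↦ ?_
    change weightRep n v (Zm q) j = 0 ↔ _
    rw [weightRep_apply, mul_eq_zero, mul_eq_zero]
    simp only [Complex.I_ne_zero, or_false, Complex.ofReal_eq_zero, Zm]
    tauto
  refine ⟨⟨B, fun q ↦ ret (Zm q - Zm p), ?_, by simp, ?_, ?_, fun v hv X ↦ hder v hv X, ?_, ?_, ?_⟩⟩
  · exact ret.contDiff.contMDiff.comp (hZm.sub contMDiff_const)
  · refine ContinuousLinearMap.ext fun X ↦ ?_
    rw [hΨm]
    exact hret X
  · intro v hv q
    have hR : ∀ X, ∃ Y, weightRep n v (L X) = L Y := fun X ↦ ⟨_, (hLD v hv X).symm⟩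
    rw [hΨm, hZgen, hB, ← hretD _ (inner_weightRep n v) hR, map_sub (weightRep n v), hker v hv,
      sub_zero]
  · intro v u hv hu X
    refine hL ?_
    rw [hB, hB, hB, hB, hLD v hv, hLD u hu, hLD u hu, hLD v hv, weightRep_comm]
  · filter_upwards [hiso] with q hq
    refine ⟨n '' {j | Z j q ≠ 0}, fun v ↦ (hq v).trans ?_⟩
    simp
  · have hne : ∀ᶠ q in 𝓝 p, ∀ j, Z j p ≠ 0 → Z j q ≠ 0 := by
      rw [Filter.eventually_all]
      intro j
      by_cases hj : Z j p = 0
      · simp [hj]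
      · filter_upwards [(hZ j).continuous.continuousAt.eventually_ne hj] with q hq _ using hq
    filter_upwards [hiso, hne] with q hq hq' v hv
    rw [hiso.self_of_nhds v]
    exact fun j hj ↦ (hq v).1 hv j (hq' j hj)

end LocalModel

/-- With this instance `Cone S` is connected, as the clopen argument of
`eq_zero_of_eventually_gen_eq_zero` requires. -/
instance : ConnectedSpace PosReal :=
  isConnected_iff_connectedSpace.1 (isConnected_Ioi (a := (0 : ℝ)))

/-! ### The isotropy representation and effectiveness -/

section LocalModelProperties

variable {E : Type*} [NormedAddCommGroup E] [NormedSpace ℝ E]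
  {S : Type*} [TopologicalSpace S] [ChartedSpace E S] [IsManifold 𝓘(ℝ, E) ∞ S]
  {m : ℕ} [MulAction (Torus m) S] {p : Cone S}

namespace LocalModel

section

variable [FiniteDimensional ℝ E] (l : LocalModel E m p)
include l

theorem eventually_bijective :
    ∀ᶠ q in 𝓝 p, Function.Bijective (mD (coneModel E) 𝓘(ℝ, E × ℝ) l.Ψ q) := by
  have h1 := eventually_mD_injective (f := l.Ψ) (p := p) (l.contMDiff.of_le (by norm_num))
    (by rw [l.mD_self]; exact Function.injective_id)
  filter_upwards [h1] with q hq
  exact ⟨hq, (LinearMap.injective_iff_surjective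
    (f := (mD (coneModel E) 𝓘(ℝ, E × ℝ) l.Ψ q).toLinearMap)).1 hq⟩

theorem eventually_gen_eq_zero {v : LieAlg m} (hv : gen E p v = 0) (hB : l.B v = 0) :
    ∀ᶠ q in 𝓝 p, gen E q v = 0 := by
  filter_upwards [l.eventually_bijective] with q hq
  refine hq.1 ?_
  rw [l.mD_gen v hv, hB, map_zero]
  rfl

/-- Where the field of `v` vanishes on an open set, so does `l.B v ∘ l.Ψ`. Its differential there is
`l.B v` composed with a surjection. -/
theorem B_eq_zero_of_frequently {v : LieAlg m} (hv : gen E p v = 0)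
    (h : ∃ᶠ q in 𝓝 p, ∀ᶠ q' in 𝓝 q, gen E q' v = 0) : l.B v = 0 := by
  obtain ⟨q, h1, h2⟩ := (h.and_eventually l.eventually_bijective).exists
  have h3 : (fun q' ↦ l.B v (l.Ψ q')) =ᶠ[𝓝 q] fun _ ↦ 0 := by
    filter_upwards [h1] with q' hq'
    rw [← l.mD_gen v hv, hq', map_zero]
  refine ContinuousLinearMap.ext fun Y ↦ ?_
  obtain ⟨X, rfl⟩ := h2.2 Y
  have h4 := mD_comp_apply (coneModel E) 𝓘(ℝ, E × ℝ) 𝓘(ℝ, E × ℝ) (f := l.Ψ)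
    (g := fun x ↦ l.B v x) (p := q) (l.B v).differentiableAt.mdifferentiableAt
    (l.contMDiff.mdifferentiableAt (by norm_num)) X
  rw [mD_congr _ _ h3, mD_const, mD_eq_fderiv, (l.B v).fderiv] at h4
  exact h4.symm

end

variable {A : SasakiStructure E S} (hA : A.IsToric m) (l : LocalModel E m p) {v : LieAlg m}
  (hv : gen E p v = 0)
include hA hv

/-- The torus is abelian, so isotropy elements fix the vectors `gen E p u`. -/
theorem B_gen (u : LieAlg m) : l.B v (gen E p u) = 0 := by
  have hs := isSmooth_torusVectorAction hA.smooth
  refine (l.hasDerivAt v hv (gen E p u)).unique ?_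
  refine (hasDerivAt_const (0 : ℝ) (gen E p u)).congr_of_eventuallyEq (.of_forall fun t ↦ ?_)
  have h1 := hs.genField_act p (t • v) u
  simp only [genField_torus, torusAct_exp_eq_self hA.smooth hv t] at h1
  exact h1.symm

theorem B_J (X : E × ℝ) : l.B v (A.J p X) = A.J p (l.B v X) := by
  refine (l.hasDerivAt v hv (A.J p X)).unique ?_
  have h1 := (show E × ℝ →L[ℝ] E × ℝ from A.J p).hasFDerivAt.comp_hasDerivAt 0
    (l.hasDerivAt v hv X)
  refine h1.congr_of_eventuallyEq (.of_forall fun t ↦ ?_)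
  have h2 : ∀ (q q' : Cone S) (Y : E × ℝ), q = q' →
      (A.J q Y : E × ℝ) = (A.J q' Y : E × ℝ) := by
    rintro q _ Y rfl; rfl
  exact Eq.trans (hA.holomorphic _ p X) (h2 _ _ _ (torusAct_exp_eq_self hA.smooth hv t))

theorem B_skew (X Y : E × ℝ) : coneForm A.g p (l.B v X) Y = -coneForm A.g p X (l.B v Y) := by
  have h0 : (mD (coneModel E) (coneModel E) (torusAct (S := S) (torusExp ((0 : ℝ) • v))) p) =
      ContinuousLinearMap.id ℝ (E × ℝ) := by
    rw [zero_smul, torusExp_zero, show torusAct (S := S) (1 : Torus m) = fun q ↦ q from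
      funext torusAct_one, mD_id]
  have h1 := ((coneForm A.g p).hasFDerivAt.comp_hasDerivAt 0 (l.hasDerivAt v hv X)).clm_apply
    (l.hasDerivAt v hv Y)
  have h2 := h1.unique ((hasDerivAt_const (0 : ℝ) (coneForm A.g p X Y)).congr_of_eventuallyEq
    (.of_forall fun t ↦ ?_))
  · simp only [h0, Function.comp_apply, ContinuousLinearMap.id_apply] at h2
    exact eq_neg_of_add_eq_zero_left h2
  · have h3 := hA.isometric (torusExp (t • v)) p X Y
    rw [torusAct_exp_eq_self hA.smooth hv t] at h3
    exact h3

end LocalModel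

variable [FiniteDimensional ℝ E] [T2Space S] [CompactSpace S] [ConnectedSpace S]
  {A : SasakiStructure E S} (hA : A.IsToric m)
include hA

/-- The set of points near which the field of `v` vanishes is open. It is also closed: at a limit
point the linearised action has `B v = 0`, so the field vanishes on a whole neighbourhood. By
connectedness the one-parameter group of `v` acts trivially, and effectiveness makes it trivial in
the torus. -/
theorem eq_zero_of_eventually_gen_eq_zero {v : LieAlg m} (h : ∀ᶠ q in 𝓝 p, gen E q v = 0) :
    v = 0 := by
  have hc : IsClosed {q : Cone S | gen E q v = 0} := by
    have h1 : {q : Cone S | gen E q v = 0} = {q | coneForm A.g q (gen E q v) (gen E q v) = 0} := by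
      ext q
      refine ⟨fun h ↦ ?_, fun h ↦ ?_⟩
      · rw [mem_ofPred_eq] at h ⊢
        rw [h, map_zero]
      · by_contra hne
        exact (A.isKaehler.pos q _ hne).ne' h
    rw [h1]
    exact isClosed_eq (SasakiStructure.contMDiff_coneForm_gen hA v v).continuous continuous_const
  have hU : IsClopen {q : Cone S | ∀ᶠ q' in 𝓝 q, gen E q' v = 0} := by
    refine ⟨?_, isOpen_setOfPred_eventually_nhds⟩
    rw [← closure_subset_iff_isClosed]
    intro q hq
    have h1 : gen E q v = 0 := hc.closure_subset_iff.2 (fun q' hq' ↦ hq'.self_of_nhds) hq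
    obtain ⟨l⟩ := exists_localModel hA.smooth q
    refine l.eventually_gen_eq_zero h1 (l.B_eq_zero_of_frequently h1 ?_)
    exact mem_closure_iff_frequently.1 hq
  have hall := hU.eq_univ ⟨p, h⟩
  have hgen : ∀ q : Cone S, gen E q v = 0 := fun q ↦
    (eq_univ_iff_forall.1 hall q).self_of_nhds
  have := hA.effective
  have hexp : ∀ t : ℝ, torusExp (t • v) = 1 := fun t ↦ by
    refine eq_of_smul_eq_smul (α := S) fun s ↦ ?_
    have h1 := torusAct_exp_eq_self hA.smooth (hgen (s, p.2)) t
    rw [one_smul]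
    exact congrArg Prod.fst h1
  ext k
  by_contra hk
  -- At time `π / v k` the coordinate `k` of the one-parameter group is `-1`.
  have h1 := congrFun (hexp (Real.pi / v k)) k
  have h2 : Circle.exp Real.pi = 1 := by
    simpa [torusExp, div_mul_cancel₀ _ hk] using h1
  have h3 := congrArg (fun z : Circle ↦ (z : ℂ)) h2
  simp [Circle.coe_exp] at h3
  norm_num at h3

theorem LocalModel.eq_zero_of_B_eq_zero (l : LocalModel E m p) {v : LieAlg m} (hv : gen E p v = 0)
    (hB : l.B v = 0) : v = 0 :=
  eq_zero_of_eventually_gen_eq_zero hA (l.eventually_gen_eq_zero hv hB)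

end LocalModelProperties

/-! ### Weight decompositions of commuting skew complex linear maps -/

section LinearAlgebra

variable {𝔨 : Type*} [AddCommGroup 𝔨] [Module ℝ 𝔨] [FiniteDimensional ℝ 𝔨]

/-- The eigenvalues on a common eigenvector depend linearly on `v`. A `v` killed by all these
functionals acts as zero, so they span the dual of `𝔨`. A basis chosen among them, and the basis of
`𝔨` dual to it, have the required property. -/
theorem exists_basis_of_forall_eigenvector {V : Type*} [AddCommGroup V] [Module ℝ V]
    (A : 𝔨 →ₗ[ℝ] V →ₗ[ℝ] V)
    (hinj : ∀ v, A v = 0 → v = 0) (htop : ⨆ χ : 𝔨 → ℝ, ⨅ v, End.eigenspace (A v) (χ v) = ⊤) :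
    ∃ (b : Basis (Fin (finrank ℝ 𝔨)) ℝ 𝔨) (e : Fin (finrank ℝ 𝔨) → V), (∀ j, e j ≠ 0) ∧
      ∀ i j, A (b i) (e j) = if i = j then e j else 0 := by
  classical
  set t : Set (Dual ℝ 𝔨) := {α | ∃ e : V, e ≠ 0 ∧ ∀ v, A v e = α v • e}
  have hspan : Submodule.span ℝ t = ⊤ := by
    have h1 : (Submodule.span ℝ t).dualCoannihilator = ⊥ := by
      rw [Submodule.eq_bot_iff]
      intro v hv
      rw [Submodule.mem_dualCoannihilator] at hv
      refine hinj v (LinearMap.ext fun X ↦ ?_)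
      have hX : X ∈ ⨆ χ : 𝔨 → ℝ, ⨅ v, End.eigenspace (A v) (χ v) := htop ▸ Submodule.mem_top
      induction hX using Submodule.iSup_induction' with
      | zero => simp
      | add x y _ _ hx hy => rw [map_add, hx, hy]; simp
      | mem χ x hx =>
        simp only [Submodule.mem_iInf, End.mem_eigenspace_iff] at hx
        by_cases h0 : x = 0
        · simp [h0]
        let α : Dual ℝ 𝔨 :=
          { toFun := χ
            map_add' := fun v w ↦ smul_left_injective ℝ h0 (by
              change χ (v + w) • x = (χ v + χ w) • x
              rw [← hx, map_add, LinearMap.add_apply, hx, hx, add_smul])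
            map_smul' := fun a v ↦ smul_left_injective ℝ h0 (by
              change χ (a • v) • x = (a * χ v) • x
              rw [← hx, map_smul, LinearMap.smul_apply, hx, mul_smul]) }
        have h2 : χ v = 0 := hv α (Submodule.subset_span ⟨x, h0, hx⟩)
        rw [hx, h2, zero_smul, LinearMap.zero_apply]
    rw [← Subspace.dualCoannihilator_dualAnnihilator_eq (W := Submodule.span ℝ t), h1,
      Submodule.dualAnnihilator_bot]
  have hfin : finrank ℝ (Dual ℝ 𝔨) = finrank ℝ 𝔨 := Subspace.dual_finrank_eq
  let β₀ := Basis.ofSpan hspan.ge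
  have hmem : ∀ i, β₀ i ∈ t := fun i ↦ Basis.ofSpan_subset hspan.ge ⟨i, rfl⟩
  let κ := β₀.indexEquiv (Module.finBasisOfFinrankEq ℝ (Dual ℝ 𝔨) hfin)
  let β := β₀.reindex κ
  have hβ : ∀ j, ∃ e : V, e ≠ 0 ∧ ∀ v, A v e = β j v • e := fun j ↦ by
    rw [Basis.reindex_apply]
    exact hmem (κ.symm j)
  choose e he he' using hβ
  refine ⟨β.dualBasis.map (evalEquiv ℝ 𝔨).symm, e, he, fun i j ↦ ?_⟩
  rw [he']
  have h3 : β j ((β.dualBasis.map (evalEquiv ℝ 𝔨).symm) i) = if i = j then 1 else 0 := by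
    have h4 : ∀ (φ : Dual ℝ (Dual ℝ 𝔨)) (α : Dual ℝ 𝔨), α ((evalEquiv ℝ 𝔨).symm φ) = φ α :=
      fun φ α ↦ by
        obtain ⟨v, rfl⟩ := (evalEquiv ℝ 𝔨).surjective φ
        simp
    rw [Basis.map_apply, h4, Basis.dualBasis_apply_self]
    simp [eq_comm]
  rw [h3]
  split_ifs <;> simp

/-- The spectral theorem for commuting symmetric maps, with `g` installed as the inner product. -/
theorem iSup_iInf_eigenspace_eq_top {V ι : Type*} [AddCommGroup V] [Module ℝ V]
    [FiniteDimensional ℝ V] (g : V →ₗ[ℝ] V →ₗ[ℝ] ℝ) (hsymm : ∀ X Y, g X Y = g Y X)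
    (hpos : ∀ X, X ≠ 0 → 0 < g X X) (A : ι → V →ₗ[ℝ] V)
    (hA : ∀ v X Y, g (A v X) Y = g X (A v Y)) (hcomm : ∀ v w, Commute (A v) (A w)) :
    ⨆ χ : ι → ℝ, ⨅ v, End.eigenspace (A v) (χ v) = ⊤ := by
  classical
  let cd : InnerProductSpace.Core ℝ V :=
    { inner := fun X Y ↦ g X Y
      conj_inner_symm := fun X Y ↦ hsymm Y X
      re_inner_nonneg := fun X ↦ by
        rcases eq_or_ne X 0 with rfl | h
        · simp
        · exact (hpos X h).le
      add_left := fun X Y Z ↦ by simp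
      smul_left := fun X Y a ↦ by simp
      definite := fun X h ↦ by
        by_contra hne
        exact (hpos X hne).ne' h }
  let _ : NormedAddCommGroup V := cd.toNormedAddCommGroup
  let _ : InnerProductSpace ℝ V := InnerProductSpace.ofCore cd.toCore
  exact LinearMap.IsSymmetric.iSup_iInf_eq_top_of_commute (fun v X Y ↦ hA v X Y)
    fun v w _ ↦ hcomm v w

/-- A commuting family of skew complex linear maps on a hermitian space, killing an isotropic
subspace of complementary dimension, is simultaneously diagonalizable with weights forming a
basis. -/
theorem exists_weight_decomposition {V : Type*} [AddCommGroup V] [Module ℝ V]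
    [FiniteDimensional ℝ V] (g : V →ₗ[ℝ] V →ₗ[ℝ] ℝ) (hsymm : ∀ X Y, g X Y = g Y X)
    (hpos : ∀ X, X ≠ 0 → 0 < g X X) (J : V →ₗ[ℝ] V) (hJ : ∀ X, J (J X) = -X)
    (hgJ : ∀ X Y, g (J X) (J Y) = g X Y) (B : 𝔨 →ₗ[ℝ] V →ₗ[ℝ] V)
    (hBJ : ∀ v X, B v (J X) = J (B v X)) (hskew : ∀ v X Y, g (B v X) Y = -g X (B v Y))
    (hcomm : ∀ v w X, B v (B w X) = B w (B v X)) (hinj : ∀ v, B v = 0 → v = 0)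
    (O : Submodule ℝ V) (hO : ∀ x ∈ O, ∀ y ∈ O, g (J x) y = 0) (hBO : ∀ v, ∀ x ∈ O, B v x = 0)
    (hdim : finrank ℝ V = 2 * (finrank ℝ O + finrank ℝ 𝔨)) :
    ∃ (b : Basis (Fin (finrank ℝ 𝔨)) ℝ 𝔨) (e : Fin (finrank ℝ 𝔨) → V), (∀ j, e j ≠ 0) ∧
      (∀ i j, B (b i) (e j) = if i = j then J (e j) else 0) ∧
      ∀ X, ∃ x ∈ O, ∃ y ∈ O, ∃ c d : Fin (finrank ℝ 𝔨) → ℝ,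
        X = x + J y + ∑ i, (c i • e i + d i • J (e i)) := by
  classical
  have hJl : ∀ X Y, g (J X) Y = -g X (J Y) := fun X Y ↦ by
    rw [← hgJ X (J Y), hJ, map_neg, neg_neg]
  have hJe : ∀ X, g (J X) X = 0 := fun X ↦ by
    have := hJl X X
    rw [hsymm X (J X)] at this
    linarith
  -- The maps `-J B(v)` are symmetric for `g` and commute, so they are simultaneously diagonalizable
  -- over the reals.
  let A : 𝔨 →ₗ[ℝ] V →ₗ[ℝ] V := -(LinearMap.llcomp ℝ V V V J ∘ₗ B)
  have hA : ∀ v X, A v X = -J (B v X) := fun v X ↦ rfl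
  obtain ⟨b, e, he, hbe⟩ := exists_basis_of_forall_eigenvector A
    (fun v hv ↦ hinj v (LinearMap.ext fun X ↦ by
      have h1 : J (-J (B v X)) = 0 := by rw [← hA, hv]; simp
      rw [map_neg, hJ, neg_neg] at h1
      simpa using h1))
    (iSup_iInf_eigenspace_eq_top g hsymm hpos _
      (fun v X Y ↦ by
        rw [hA, hA, map_neg, LinearMap.neg_apply, hJl, neg_neg, hskew, hBJ, map_neg])
      (fun v w ↦ LinearMap.ext fun X ↦ by
        simp only [End.mul_apply, hA, map_neg, hBJ, hcomm v w]))
  have hBe : ∀ i j, B (b i) (e j) = if i = j then J (e j) else 0 := fun i j ↦ by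
    have h1 := congrArg J (hbe i j)
    rw [hA, map_neg, hJ, neg_neg] at h1
    rw [h1]
    split_ifs <;> simp
  refine ⟨b, e, he, hBe, ?_⟩
  let κ := Fin (finrank ℝ 𝔨)
  -- `T` adds up `O`, `J O` and the complex lines of the `e i`. Once it is injective, the hypothesis
  -- on dimensions makes it surjective.
  let T : (O × O) × ((κ → ℝ) × (κ → ℝ)) →ₗ[ℝ] V :=
    (O.subtype.coprod (J ∘ₗ O.subtype)).coprod
      ((Fintype.linearCombination ℝ e).coprod (Fintype.linearCombination ℝ fun i ↦ J (e i)))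
  have hT : ∀ z, T z = (z.1.1 : V) + J z.1.2 +
      ∑ i, (z.2.1 i • e i + z.2.2 i • J (e i)) := fun z ↦ by
    simp [T, Fintype.linearCombination_apply, Finset.sum_add_distrib]
    rfl
  have hTinj : Function.Injective T := by
    rw [injective_iff_map_eq_zero]
    rintro ⟨⟨x, y⟩, ⟨c, d⟩⟩ h0
    rw [hT] at h0
    have h1 : ∀ i, c i = 0 ∧ d i = 0 := fun i ↦ by
      -- `B (b i)` kills `O`, `J O` and all the lines but that of `e i`, which isolates the
      -- coefficients with index `i`.
      have h2 := congrArg (B (b i)) h0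
      simp only [map_add, map_sum, map_smul, hBJ, hBe, map_zero, hBO _ _ x.2, hBO _ _ y.2] at h2
      have h3 : c i • J (e i) - d i • e i = 0 := by
        rw [Finset.sum_eq_single i] at h2
        · simpa [hJ, sub_eq_add_neg] using h2
        · intro j _ hj
          simp [hj.symm]
        · simp
      have h4 := congrArg (fun X ↦ g X (e i)) h3
      have h5 := congrArg (fun X ↦ g X (J (e i))) h3
      have h6 := hpos _ (he i)
      simp [hJe, hgJ, hsymm (e i) (J (e i)), h6.ne'] at h4 h5
      exact ⟨h5, h4⟩
    have hc : c = 0 := funext fun i ↦ (h1 i).1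
    have hd : d = 0 := funext fun i ↦ (h1 i).2
    simp only [hc, hd, Pi.zero_apply, zero_smul, add_zero, Finset.sum_const_zero] at h0
    have h7 : (y : V) = 0 := by
      by_contra hne
      have h8 := congrArg (fun X ↦ g X (J y)) h0
      have h9 := hpos _ hne
      have h10 : g (x : V) (J y) = 0 := by rw [hsymm]; exact hO _ y.2 _ x.2
      simp [hgJ, h10] at h8
      exact h9.ne' h8
    have h11 : (x : V) = 0 := by simpa [h7] using h0
    ext <;> simp [hc, hd, h7, h11]
  have hTsurj : Function.Surjective T := by
    have h1 : finrank ℝ ((O × O) × ((κ → ℝ) × (κ → ℝ))) = finrank ℝ V := by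
      rw [hdim]
      simp [κ]
      ring
    exact (LinearMap.injective_iff_surjective_of_finrank_eq_finrank h1).1 hTinj
  intro X
  obtain ⟨z, rfl⟩ := hTsurj X
  exact ⟨z.1.1, z.1.1.2, z.1.2, z.1.2.2, z.2.1, z.2.2, hT z⟩

end LinearAlgebra

/-! ### Weight lines in the tangent space of the cone -/

section IsotropyBasis

/-- The complex structure of the cone, on the model space. -/
def SasakiStructure.cJ {E : Type*} [NormedAddCommGroup E] [NormedSpace ℝ E]
    {S : Type*} [TopologicalSpace S] [ChartedSpace E S] [IsManifold 𝓘(ℝ, E) ∞ S]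
    (A : SasakiStructure E S) (p : Cone S) : E × ℝ →L[ℝ] E × ℝ := A.J p

variable {E : Type*} [NormedAddCommGroup E] [NormedSpace ℝ E] [FiniteDimensional ℝ E]
  {S : Type*} [TopologicalSpace S] [ChartedSpace E S] [IsManifold 𝓘(ℝ, E) ∞ S] [T2Space S]
  {m : ℕ} [MulAction (Torus m) S] {A : SasakiStructure E S} (hA : A.IsToric m)
  {b : LieAlg m} (hb : ∀ p : Cone S, generator E p b = A.reeb p)
include hA hb

/-- The moment map is constant on torus orbits, and its derivative along `u` is `-ω(v, u)`. -/
theorem gen_isotropic (p : Cone S) (v u : LieAlg m) :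
    coneForm A.g p (A.J p (gen E p v)) (gen E p u) = 0 := by
  have hs := isSmooth_torusVectorAction hA.smooth
  have hinv : ∀ w : LieAlg m, A.moment (torusAct (torusExp w) p) v = A.moment p v := fun w ↦ by
    have h1 := hs.genField_act p w b
    have h2 := hs.genField_act p w v
    simp only [genField_torus] at h1 h2
    rw [A.moment_eq hb, A.moment_eq hb, h1, h2]
    exact congrArg (fun x ↦ 1 / 2 * x) (hA.isometric _ p _ _)
  have h3 := mD_comp_apply 𝓘(ℝ, LieAlg m) (coneModel E) 𝓘(ℝ, ℝ)
    (f := fun w : LieAlg m ↦ torusAct (torusExp w) p) (g := fun q : Cone S ↦ A.moment q v)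
    (p := (0 : LieAlg m)) ((A.contMDiff_moment hb hA v).mdifferentiable (by simp) _)
    (hs.mdifferentiableAt_orbit p 0) u
  simp only [hinv] at h3
  rw [mD_const] at h3
  have h4 : torusAct (torusExp (0 : LieAlg m)) p = p := by rw [torusExp_zero, torusAct_one]
  have h5 : ∀ q, q = p → mD (coneModel E) 𝓘(ℝ, ℝ) (fun q : Cone S ↦ A.moment q v) q (gen E p u) =
      -coneForm A.g p (A.J p (gen E p v)) (gen E p u) := by
    rintro q rfl
    exact A.mD_moment hb hA v q _
  have h6 := h3.trans (h5 _ h4)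
  exact neg_eq_zero.1 h6.symm

omit hb in
-- The weight decomposition for the isotropy algebra acting on the tangent space, with `𝔤(p)` as the
-- isotropic subspace that it kills. Since the cone has dimension `2 * m`, the required equality of
-- dimensions is rank-nullity for `gen E p`.
theorem exists_isotropy_basis [CompactSpace S] [ConnectedSpace S] (hdim : finrank ℝ E + 1 = 2 * m)
    (hb : ∀ p : Cone S, generator E p b = A.reeb p) {p : Cone S} (l : LocalModel E m p) :
    ∃ (k : ℕ) (β : Basis (Fin k) ℝ (gen E p).ker) (e : Fin k → E × ℝ), (∀ j, e j ≠ 0) ∧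
      (∀ i j, l.B (β i).1 (e j) = if i = j then A.cJ p (e j) else 0) ∧
      ∀ X : E × ℝ, ∃ u v : LieAlg m, ∃ c d : Fin k → ℝ,
        X = gen E p u + A.cJ p (gen E p v) + ∑ i, (c i • e i + d i • A.cJ p (e i)) := by
  have hJ := A.isKaehler
  have key := exists_weight_decomposition (𝔨 := (gen (m := m) E p).ker)
    (ContinuousLinearMap.coeLM ℝ ∘ₗ (coneForm A.g p).toLinearMap) (fun X Y ↦ hJ.symm p X Y)
    (fun X hX ↦ hJ.pos p X hX) (A.cJ p).toLinearMap
    (fun X ↦ hJ.J_sq p X) (fun X Y ↦ hJ.compat p X Y)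
    (ContinuousLinearMap.coeLM ℝ ∘ₗ l.B ∘ₗ (gen E p).ker.subtype)
    (fun v X ↦ l.B_J hA v.2 X) (fun v X Y ↦ l.B_skew hA v.2 X Y)
    (fun v w X ↦ l.comm v w v.2 w.2 X)
    (fun v hv ↦ Subtype.ext (LocalModel.eq_zero_of_B_eq_zero hA l v.2
      (ContinuousLinearMap.ext fun X ↦ congrArg (fun L ↦ L X) hv)))
    (gen (m := m) E p).range (by rintro _ ⟨v, rfl⟩ _ ⟨u, rfl⟩; exact gen_isotropic hA hb p v u)
    (by rintro v _ ⟨u, rfl⟩; exact l.B_gen hA v.2 u) (by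
      have h1 := LinearMap.finrank_range_add_finrank_ker (gen (m := m) E p).toLinearMap
      simp only [finrank_fin_fun, finrank_prod, finrank_self] at h1 ⊢
      rw [hdim]
      exact congrArg (2 * ·) h1.symm)
  obtain ⟨β, e, he, hB, hX⟩ := key
  refine ⟨_, β, e, he, hB, fun X ↦ ?_⟩
  obtain ⟨_, ⟨u, rfl⟩, _, ⟨v, rfl⟩, c, d, h⟩ := hX X
  exact ⟨u, v, c, d, h⟩

end IsotropyBasis

/-! ### Signature of symmetric complex linear maps -/

section Diagonalization

theorem exists_diagonal_basis {V : Type*} [AddCommGroup V] [Module ℝ V]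
    [FiniteDimensional ℝ V] (g : V →ₗ[ℝ] V →ₗ[ℝ] ℝ) (hsymm : ∀ X Y, g X Y = g Y X)
    (hpos : ∀ X, X ≠ 0 → 0 < g X X) (A : V →ₗ[ℝ] V) (hA : ∀ X Y, g (A X) Y = g X (A Y)) :
    ∃ (u : Basis (Fin (finrank ℝ V)) ℝ V) (a : Fin (finrank ℝ V) → ℝ),
      (∀ i j, g (u i) (u j) = if i = j then 1 else 0) ∧ ∀ i, A (u i) = a i • u i := by
  classical
  let cd : InnerProductSpace.Core ℝ V :=
    { inner := fun X Y ↦ g X Y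
      conj_inner_symm := fun X Y ↦ hsymm Y X
      re_inner_nonneg := fun X ↦ by
        rcases eq_or_ne X 0 with rfl | h
        · simp
        · exact (hpos X h).le
      add_left := fun X Y Z ↦ by simp
      smul_left := fun X Y a ↦ by simp
      definite := fun X h ↦ by
        by_contra hne
        exact (hpos X hne).ne' h }
  let _ : NormedAddCommGroup V := cd.toNormedAddCommGroup
  let _ : InnerProductSpace ℝ V := InnerProductSpace.ofCore cd.toCore
  have hT : A.IsSymmetric := fun X Y ↦ hA X Y
  refine ⟨(hT.eigenvectorBasis rfl).toBasis, hT.eigenvalues rfl, fun i j ↦ ?_, fun i ↦ ?_⟩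
  · have := orthonormal_iff_ite.1 (hT.eigenvectorBasis rfl).orthonormal i j
    rw [OrthonormalBasis.coe_toBasis]
    exact this
  · rw [OrthonormalBasis.coe_toBasis]
    exact hT.apply_eigenvectorBasis rfl i

/-- The splitting of a hermitian space into the kernel, the positive and the negative part of a
symmetric complex linear map. -/
theorem exists_signature_splitting {V : Type*} [NormedAddCommGroup V] [NormedSpace ℝ V]
    [FiniteDimensional ℝ V] (g : V →ₗ[ℝ] V →ₗ[ℝ] ℝ) (hsymm : ∀ X Y, g X Y = g Y X)
    (hpos : ∀ X, X ≠ 0 → 0 < g X X) (A : V →ₗ[ℝ] V) (hA : ∀ X Y, g (A X) Y = g X (A Y))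
    (J : V →ₗ[ℝ] V) (hJ : ∀ X, J (J X) = -X) (hAJ : ∀ X, A (J X) = J (A X)) :
    ∃ (k₀ k₁ k₂ : Type) (_ : Fintype k₀) (_ : Fintype k₁) (_ : Fintype k₂)
      (T : ((k₀ → ℝ) × (k₁ → ℝ) × (k₂ → ℝ)) ≃L[ℝ] V),
      (∀ z, A (T (z, 0, 0)) = 0) ∧ (∀ x ≠ 0, 0 < g (A (T (0, x, 0))) (T (0, x, 0))) ∧
      (∀ y ≠ 0, g (A (T (0, 0, y))) (T (0, 0, y)) < 0) ∧
      (IsEmpty k₂ ∨ 1 < Fintype.card k₂ ∧ ∃ X, g (A X) X < 0) := by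
  classical
  obtain ⟨u, a, hu, ha⟩ := exists_diagonal_basis g hsymm hpos A hA
  let n := finrank ℝ V
  let j : ({i : Fin n // a i = 0} ⊕ ({i : Fin n // 0 < a i} ⊕ {i : Fin n // a i < 0})) → Fin n :=
    Sum.elim Subtype.val (Sum.elim Subtype.val Subtype.val)
  have hj : Function.Bijective j := by
    constructor
    · rintro (⟨x, hx⟩ | ⟨x, hx⟩ | ⟨x, hx⟩) (⟨y, hy⟩ | ⟨y, hy⟩ | ⟨y, hy⟩) (h : x = y) <;>
        subst h <;> first | rfl | (exfalso; linarith)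
    · intro i
      rcases lt_trichotomy (a i) 0 with h | h | h
      · exact ⟨.inr (.inr ⟨i, h⟩), rfl⟩
      · exact ⟨.inl ⟨i, h⟩, rfl⟩
      · exact ⟨.inr (.inl ⟨i, h⟩), rfl⟩
  let w := u.reindex (Equiv.ofBijective j hj).symm
  let T' := (LinearEquiv.refl ℝ ({i : Fin n // a i = 0} → ℝ)).prodCongr (LinearEquiv.sumArrowLequivProdArrow
    {i : Fin n // 0 < a i} {i : Fin n // a i < 0} ℝ ℝ)
  let T := ((w.equivFun.trans (LinearEquiv.sumArrowLequivProdArrow _ _ ℝ ℝ)).trans T').symm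
  have hT : ∀ z x y, T (z, x, y) = ∑ i, z i • u i.1 + ∑ i, x i • u i.1 + ∑ i, y i • u i.1 := by
    intro z x y
    have h1 : T (z, x, y) = w.equivFun.symm (Sum.elim z (Sum.elim x y)) := by
      simp only [T, T', LinearEquiv.symm_apply_eq, LinearEquiv.trans_apply,
        LinearEquiv.apply_symm_apply]
      rfl
    rw [h1, Basis.equivFun_symm_apply, Fintype.sum_sum_type, Fintype.sum_sum_type, ← add_assoc]
    simp [w, j]
  have hdiag : ∀ {P : Fin n → Prop} (x : {i // P i} → ℝ) (f : {i // P i} → ℝ),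
      g (∑ i, x i • f i • u i.1) (∑ i, x i • u i.1) = ∑ i, f i * (x i * x i) := by
    intro P x f
    simp only [map_sum, map_smul, LinearMap.sum_apply, LinearMap.smul_apply, hu, smul_eq_mul,
      Finset.mul_sum]
    refine Finset.sum_congr rfl fun i _ ↦ ?_
    rw [Finset.sum_eq_single i]
    · simp; ring
    · intro i' _ hne
      rw [if_neg fun h ↦ hne (Subtype.ext h)]; ring
    · simp
  have hAs : ∀ {P : Fin n → Prop} (x : {i // P i} → ℝ),
      A (∑ i, x i • u i.1) = ∑ i, x i • a i.1 • u i.1 := by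
    intro P x
    simp only [map_sum, map_smul, ha]
  refine ⟨_, _, _, inferInstance, inferInstance, inferInstance, T.toContinuousLinearEquiv,
    fun z ↦ ?_, fun x hx ↦ ?_, fun y hy ↦ ?_, ?_⟩
  · change A (T (z, 0, 0)) = 0
    rw [hT]
    simp only [Pi.zero_apply, zero_smul, Finset.sum_const_zero, add_zero]
    rw [hAs]
    exact Finset.sum_eq_zero fun i _ ↦ by rw [i.2, zero_smul, smul_zero]
  · change 0 < g (A (T (0, x, 0))) (T (0, x, 0))
    rw [hT]
    simp only [Pi.zero_apply, zero_smul, Finset.sum_const_zero, add_zero, zero_add]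
    rw [hAs, hdiag]
    obtain ⟨i, hi⟩ := Function.ne_iff.1 hx
    exact Finset.sum_pos' (fun i _ ↦ mul_nonneg i.2.le (mul_self_nonneg _))
      ⟨i, Finset.mem_univ _, mul_pos i.2 (mul_self_pos.2 hi)⟩
  · change g (A (T (0, 0, y))) (T (0, 0, y)) < 0
    rw [hT]
    simp only [Pi.zero_apply, zero_smul, Finset.sum_const_zero, add_zero, zero_add]
    rw [hAs, hdiag]
    obtain ⟨i, hi⟩ := Function.ne_iff.1 hy
    exact Finset.sum_neg' (fun i _ ↦ mul_nonpos_of_nonpos_of_nonneg i.2.le (mul_self_nonneg _))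
      ⟨i, Finset.mem_univ _, mul_neg_of_neg_of_pos i.2 (mul_self_pos.2 hi)⟩
  · rcases isEmpty_or_nonempty {i : Fin n // a i < 0} with h | ⟨⟨i, hi⟩⟩
    · exact .inl h
    refine .inr ⟨?_, u i, by rw [ha, map_smul, LinearMap.smul_apply, hu]; simpa using hi⟩
    -- Were there only one negative eigenvalue, `J` would preserve the real line of `u i`, because
    -- it commutes with `A`; but a real scalar cannot square to `-1`.
    by_contra hcard
    have hsub : Subsingleton {i : Fin n // a i < 0} :=
      Fintype.card_le_one_iff_subsingleton.1 (not_lt.1 hcard)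
    have hcoef : ∀ i', i' ≠ i → u.repr (J (u i)) i' = 0 := by
      intro i' hi'
      have h1 : u.repr (A (J (u i))) i' = a i' * u.repr (J (u i)) i' := by
        conv_lhs => rw [← u.sum_repr (J (u i))]
        simp only [map_sum, map_smul, ha, Finsupp.coe_finsetSum, Finset.sum_apply,
          Finsupp.smul_apply, Basis.repr_self, smul_eq_mul]
        rw [Finset.sum_eq_single i']
        · simp; ring
        · intro k _ hk
          simp [hk]
        · simp
      rw [hAJ, ha, map_smul, map_smul, Finsupp.smul_apply, smul_eq_mul] at h1
      have h2 : a i' ≠ a i := fun h ↦ hi' (congrArg Subtype.val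
        (Subsingleton.elim (⟨i', h ▸ hi⟩ : {i : Fin n // a i < 0}) ⟨i, hi⟩))
      have h3 : (a i' - a i) * u.repr (J (u i)) i' = 0 := by linarith
      exact (mul_eq_zero.1 h3).resolve_left (sub_ne_zero.2 h2)
    have h4 : J (u i) = u.repr (J (u i)) i • u i := by
      conv_lhs => rw [← u.sum_repr (J (u i))]
      exact Finset.sum_eq_single i (fun k _ hk ↦ by rw [hcoef k hk, zero_smul]) (by simp)
    set c := u.repr (J (u i)) i
    have h5 : J (J (u i)) = (c * c) • u i := by
      rw [h4, map_smul, h4, smul_smul]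
    have h6 := congrArg (fun X ↦ g X (u i)) (h5.symm.trans (hJ (u i)))
    simp [hu] at h6
    nlinarith [mul_self_nonneg c]

end Diagonalization

/-! ### Local minima and connectedness of sublevel sets -/

/-- Near `x`, either `h` is at least `h x`, or the sublevel set `{h < h x}` is connected and has
all points of `{h ≤ h x}` in its closure. -/
def SublevelConnectedAt {X : Type*} [TopologicalSpace X] (h : X → ℝ) (x : X) : Prop :=
  (∀ᶠ y in 𝓝 x, h x ≤ h y) ∨ ∃ N ∈ 𝓝 x, IsPreconnected (N ∩ {y | h y < h x}) ∧
    N ∩ {y | h y ≤ h x} ⊆ closure {y | h y < h x}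

/-- A function without local obstructions to the connectedness of sublevel sets has no local minima
besides the global ones. -/
theorem le_of_eventually_le_of_sublevelConnectedAt {X : Type*} [TopologicalSpace X]
    [CompactSpace X] [T2Space X] [ConnectedSpace X] [LocallyPathConnectedSpace X] {h : X → ℝ}
    (hc : Continuous h) (hconn : ∀ x, SublevelConnectedAt h x) {p : X}
    (hp : ∀ᶠ y in 𝓝 p, h p ≤ h y) (q : X) : h p ≤ h q := by
  have : PathConnectedSpace X := PathConnectedSpace.of_locallyPathConnectedSpace
  by_contra hlt
  push Not at hlt
  have hopen : ∀ a, IsOpen {y | h y < a} := fun a ↦ isOpen_lt hc continuous_const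
  -- The levels below which `p` and `q` can be joined; the infimum `a` is the mountain pass level.
  set 𝒜 : Set ℝ := {a | JoinedIn {y | h y < a} p q} with h𝒜
  have hbdd : BddBelow 𝒜 := ⟨h p, fun a ha ↦ (show h p < a from ha.source_mem).le⟩
  have hne : 𝒜.Nonempty := by
    obtain ⟨a, ha⟩ := (isCompact_univ (X := X)).bddAbove_image hc.continuousOn
    refine ⟨a + 1, ?_⟩
    have h1 : {y | h y < a + 1} = univ :=
      eq_univ_of_forall fun y ↦ (ha ⟨y, mem_univ y, rfl⟩).trans_lt (lt_add_one a)
    rw [h𝒜, mem_ofPred_eq, h1, joinedIn_univ]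
    exact PathConnectedSpace.joined p q
  set a := sInf 𝒜
  have hpa : h p ≤ a := le_csInf hne fun a ha ↦ (show h p < a from ha.source_mem).le
  -- The infimum is not attained: a path below `a` has its maximum below `a`, so a smaller level
  -- would do.
  have hnot : ¬ JoinedIn {y | h y < a} p q := by
    rintro ⟨γ, hγ⟩
    obtain ⟨t, -, ht⟩ := (isCompact_univ (X := unitInterval)).exists_isMaxOn univ_nonempty
      (hc.comp γ.continuous).continuousOn
    have h1 : h (γ t) < a := hγ t
    obtain ⟨b, hb1, hb2⟩ := exists_between h1
    have h2 : b ∈ 𝒜 := ⟨γ, fun s ↦ lt_of_le_of_lt (ht (mem_univ s)) hb1⟩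
    exact (csInf_le hbdd h2).not_gt hb2
  set U : Set X := {y | h y < a} with hU
  have hqU : q ∈ U := hlt.trans_le hpa
  set V := pathComponentIn U p
  set V' := U \ V with hV'
  have hVo : IsOpen V := (hopen a).pathComponentIn p
  have hVo' : IsOpen V' := by
    rw [isOpen_iff_mem_nhds]
    rintro y ⟨hy, hyV⟩
    refine Filter.mem_of_superset (((hopen a).pathComponentIn y).mem_nhds
      (mem_pathComponentIn_self hy)) fun z hz ↦ ⟨hz.target_mem, fun hzV ↦ hyV ?_⟩
    exact JoinedIn.trans hzV (JoinedIn.symm hz)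
  -- `V` is the path component of `p` below level `a` and `V'` the rest; `D` is the part of the
  -- closed sublevel set adherent to `V'`.
  set D := {y | h y ≤ a} ∩ closure V' with hD
  have hDc : IsClosed D := (isClosed_le hc continuous_const).inter isClosed_closure
  -- `D` is open in `{h ≤ a}`. At a point of level `a` the local sublevel set is connected and meets
  -- `V'`, hence lies in `V'`, and the nearby points of `{h ≤ a}` are adherent to it.
  have hDo : ∀ x ∈ D, ∀ᶠ y in 𝓝 x, h y ≤ a → y ∈ D := by
    rintro x ⟨hxa, hx⟩
    rcases (show h x ≤ a from hxa).lt_or_eq with hlt | heq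
    · have hxV : x ∉ V := fun hxV ↦ by
        obtain ⟨y, hy1, hy2⟩ := mem_closure_iff_nhds.1 hx V (hVo.mem_nhds hxV)
        exact hy2.2 hy1
      filter_upwards [hVo'.mem_nhds ⟨hlt, hxV⟩] with y hy hya using ⟨hya, subset_closure hy⟩
    · rcases hconn x with h1 | ⟨N, hN, hNc, hNcl⟩
      · obtain ⟨y, hy1, hy2⟩ := mem_closure_iff_nhds.1 hx _ h1
        exact absurd (show h x ≤ h y from hy1) (not_le.2 (heq ▸ hy2.1))
      · rw [heq] at hNc hNcl
        obtain ⟨y₀, hy₀, hy₀'⟩ := mem_closure_iff_nhds.1 hx _ hN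
        have h2 : N ∩ U ⊆ V' := by
          refine hNc.subset_left_of_subset_union hVo' hVo (disjoint_sdiff_left) ?_
            ⟨y₀, ⟨hy₀, hy₀'.1⟩, hy₀'⟩
          rw [hV', sdiff_union_self]
          exact inter_subset_right.trans subset_union_left
        filter_upwards [eventually_mem_nhds_iff.2 hN] with y hy hya
        refine ⟨hya, mem_closure_iff_nhds.2 fun O hO ↦ ?_⟩
        obtain ⟨z, hz1, hz2⟩ := mem_closure_iff_nhds.1 (hNcl ⟨mem_of_mem_nhds hy, hya⟩) (O ∩ N)
          (Filter.inter_mem hO hy)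
        exact ⟨z, hz1.1, h2 ⟨hz1.2, hz2⟩⟩
  have hpD : p ∉ D := by
    rintro ⟨-, hx⟩
    rcases hpa.lt_or_eq with hlt' | heq
    · obtain ⟨y, hy1, hy2⟩ := mem_closure_iff_nhds.1 hx V
        (hVo.mem_nhds (mem_pathComponentIn_self hlt'))
      exact hy2.2 hy1
    · obtain ⟨y, hy1, hy2⟩ := mem_closure_iff_nhds.1 hx _ hp
      exact absurd (show h p ≤ h y from hy1) (not_le.2 (heq ▸ hy2.1))
  have hqD : q ∈ D := ⟨(show h q < a from hqU).le, subset_closure ⟨hqU, hnot⟩⟩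
  set C := {y | h y ≤ a} \ D with hC
  have hCc : IsClosed C := by
    have h1 : C = {y | h y ≤ a} ∩ {y | ∀ᶠ z in 𝓝 y, h z ≤ a → z ∈ D}ᶜ := by
      ext y
      refine ⟨fun hy ↦ ⟨hy.1, fun h2 ↦ hy.2 (h2.self_of_nhds hy.1)⟩, fun hy ↦ ⟨hy.1, fun h2 ↦ ?_⟩⟩
      exact hy.2 (hDo y h2)
    rw [h1]
    exact (isClosed_le hc continuous_const).inter isOpen_setOfPred_eventually_nhds.isClosed_compl
  -- `C` and `D` are disjoint compact sets with union `{h ≤ a}`. Disjoint open neighbourhoods of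
  -- them still cover `{h < b}` for some `b > a`, so `p` and `q` cannot be joined below `b`,
  -- contrary to the choice of `a`.
  obtain ⟨O₁, O₂, hO₁, hO₂, hCO, hDO, hdis⟩ :=
    SeparatedNhds.of_isCompact_isCompact hCc.isCompact hDc.isCompact disjoint_sdiff_left
  obtain ⟨b, hab, hb⟩ : ∃ b, a < b ∧ {y | h y < b} ⊆ O₁ ∪ O₂ := by
    rcases ((O₁ ∪ O₂)ᶜ).eq_empty_or_nonempty with h1 | h1
    · exact ⟨a + 1, lt_add_one a, by rw [compl_empty_iff.1 h1]; exact subset_univ _⟩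
    · obtain ⟨y, hy, hmin⟩ := (hO₁.union hO₂).isClosed_compl.isCompact.exists_isMinOn h1
        hc.continuousOn
      refine ⟨h y, ?_, fun z hz ↦ ?_⟩
      · by_contra hle
        refine hy ?_
        by_cases hyD : y ∈ D
        · exact .inr (hDO hyD)
        · exact .inl (hCO ⟨not_lt.1 hle, hyD⟩)
      · by_contra hzO
        exact absurd (show h y ≤ h z from hmin hzO) (not_le.2 hz)
  obtain ⟨a', ha', ha'b⟩ := exists_lt_of_csInf_lt hne hab
  obtain ⟨γ, hγ⟩ := ha'
  have h3 : range γ ⊆ O₁ := by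
    refine (isPreconnected_range γ.continuous).subset_left_of_subset_union hO₁ hO₂ hdis ?_
      ⟨p, ⟨0, γ.source⟩, hCO ⟨hpa, hpD⟩⟩
    rintro _ ⟨t, rfl⟩
    exact hb ((show h (γ t) < a' from hγ t).trans ha'b)
  exact disjoint_left.1 hdis (h3 ⟨1, γ.target⟩) (hDO hqD)

/-! ### Sublevel sets near a nondegenerate critical manifold -/

section MorseBott

/-- Polar coordinates; the unit sphere is connected once the dimension exceeds one. -/
theorem isPreconnected_ball_diff_zero {Y : Type*} [NormedAddCommGroup Y] [NormedSpace ℝ Y]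
    (hY : 1 < Module.rank ℝ Y) (ε : ℝ) : IsPreconnected (Metric.ball (0 : Y) ε \ {0}) := by
  have h1 : Metric.ball (0 : Y) ε \ {0} =
      (fun w : ℝ × Y ↦ w.1 • w.2) '' (Ioo 0 ε ×ˢ Metric.sphere 0 1) := by
    ext y
    constructor
    · rintro ⟨hy, hy0⟩
      rw [mem_ball_zero_iff] at hy
      have h2 : 0 < ‖y‖ := norm_pos_iff.2 hy0
      refine ⟨(‖y‖, ‖y‖⁻¹ • y), ⟨⟨h2, hy⟩, ?_⟩, ?_⟩
      · simp [norm_smul, h2.ne']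
      · simp [smul_smul, h2.ne']
    · rintro ⟨⟨t, y⟩, ⟨⟨ht, ht'⟩, hy⟩, rfl⟩
      rw [mem_sphere_zero_iff_norm] at hy
      refine ⟨?_, ?_⟩
      · rw [mem_ball_zero_iff, norm_smul, hy, mul_one, Real.norm_of_nonneg ht.le]
        exact ht'
      · refine smul_ne_zero ht.ne' fun h ↦ ?_
        rw [show y = 0 from h] at hy
        simp at hy
  rw [h1]
  exact ((isPreconnected_Ioo).prod (isPreconnected_sphere hY 0 1)).image _
    (by fun_prop)

variable {Z X Y : Type*} [NormedAddCommGroup Z] [NormedSpace ℝ Z] [NormedAddCommGroup X]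
  [NormedSpace ℝ X] [NormedAddCommGroup Y] [NormedSpace ℝ Y]

/-- Convexity in the `X` direction allows a point with `k < 0` to be moved straight to `x = 0`
inside `{k < 0}`. The slice `x = 0` of the negative set is a ball times a punctured ball, which is
connected as `Y` has dimension at least two. Points with `k = 0` are limits of negative ones,
reached by shrinking `x`, or by moving in the `Y` direction when `x` and `y` vanish. -/
theorem sublevel_box {k : Z × X × Y → ℝ} {ε : ℝ} (hε : 0 < ε) {N : Set (Z × X × Y)}
    (hN : N = Metric.ball 0 ε ×ˢ Metric.ball 0 ε ×ˢ Metric.ball 0 ε)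
    (hconv : ∀ z x y, (z, x, y) ∈ N → ∀ t ∈ Icc (0 : ℝ) 1,
      k (z, t • x, y) ≤ t * k (z, x, y) + (1 - t) * k (z, 0, y))
    (hpos : ∀ z x, (z, x, 0) ∈ N → x ≠ 0 → 0 < k (z, x, 0))
    (hneg : ∀ z y, (z, 0, y) ∈ N → y ≠ 0 → k (z, 0, y) < 0)
    (hzero : ∀ z, (z, 0, 0) ∈ N → k (z, 0, 0) = 0) (hY : 1 < Module.rank ℝ Y) :
    IsPreconnected (N ∩ {w | k w < 0}) ∧ N ∩ {w | k w ≤ 0} ⊆ closure {w | k w < 0} := by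
  have hmem : ∀ z x y, (z, x, y) ∈ N ↔ ‖z‖ < ε ∧ ‖x‖ < ε ∧ ‖y‖ < ε := by
    intro z x y; simp [hN]
  have hsmul : ∀ {t : ℝ} (x : X), t ∈ Icc (0 : ℝ) 1 → ‖x‖ < ε → ‖t • x‖ < ε := by
    intro t x ht hx
    rw [norm_smul, Real.norm_of_nonneg ht.1]
    exact (mul_le_of_le_one_left (norm_nonneg _) ht.2).trans_lt hx
  have hsmul' : ∀ {t : ℝ} (x : Y), t ∈ Icc (0 : ℝ) 1 → ‖x‖ < ε → ‖t • x‖ < ε := by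
    intro t x ht hx
    rw [norm_smul, Real.norm_of_nonneg ht.1]
    exact (mul_le_of_le_one_left (norm_nonneg _) ht.2).trans_lt hx
  have hy0 : ∀ z x y, (z, x, y) ∈ N → k (z, x, y) < 0 → y ≠ 0 := by
    rintro z x y hw hk rfl
    rcases eq_or_ne x 0 with rfl | hx
    · exact hk.ne (hzero z hw)
    · exact hk.not_gt (hpos z x hw hx)
  have : Nontrivial Y := rank_pos_iff_nontrivial.1 (zero_lt_one.trans hY)
  constructor
  · obtain ⟨y₀, hy₀⟩ := exists_ne (0 : Y)
    obtain ⟨y₁, hy₁, hy₁'⟩ : ∃ y : Y, y ≠ 0 ∧ ‖y‖ < ε := by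
      refine ⟨(ε / 2 / ‖y₀‖) • y₀, smul_ne_zero (by have := norm_pos_iff.2 hy₀; positivity) hy₀, ?_⟩
      rw [norm_smul, Real.norm_of_nonneg (by positivity), div_mul_cancel₀ _ (norm_ne_zero_iff.2 hy₀)]
      linarith
    set Q : Set (Z × X × Y) := (fun w : Z × Y ↦ (w.1, (0 : X), w.2)) ''
      (Metric.ball 0 ε ×ˢ (Metric.ball 0 ε \ {0}))
    have hQ : IsPreconnected Q :=
      ((convex_ball (0 : Z) ε).isPreconnected.prod (isPreconnected_ball_diff_zero hY ε)).image _
        (by fun_prop)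
    have hQmem : ∀ z y, ‖z‖ < ε → ‖y‖ < ε → y ≠ 0 → (z, (0 : X), y) ∈ Q := fun z y h1 h2 h3 ↦
      ⟨(z, y), ⟨mem_ball_zero_iff.2 h1, mem_ball_zero_iff.2 h2, h3⟩, rfl⟩
    have hQsub : Q ⊆ N ∩ {w | k w < 0} := by
      rintro _ ⟨⟨z, y⟩, ⟨h1, h2, h3⟩, rfl⟩
      rw [mem_ball_zero_iff] at h1 h2
      have h4 : (z, (0 : X), y) ∈ N := (hmem _ _ _).2 ⟨h1, by simpa using hε, h2⟩
      exact ⟨h4, hneg z y h4 h3⟩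
    refine isPreconnected_of_forall (0, 0, y₁) ?_
    rintro ⟨z, x, y⟩ ⟨hw, hk⟩
    have hw' := (hmem _ _ _).1 hw
    have hy := hy0 z x y hw hk
    set R : Set (Z × X × Y) := (fun t : ℝ ↦ (z, t • x, y)) '' Icc 0 1
    have hR : IsPreconnected R := isPreconnected_Icc.image _ (by fun_prop)
    have hz : (z, (0 : X), y) ∈ N := (hmem _ _ _).2 ⟨hw'.1, by simpa using hε, hw'.2.2⟩
    have hRsub : R ⊆ N ∩ {w | k w < 0} := by
      rintro _ ⟨t, ht, rfl⟩
      refine ⟨(hmem _ _ _).2 ⟨hw'.1, hsmul x ht hw'.2.1, hw'.2.2⟩, ?_⟩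
      have h1 := hconv z x y hw t ht
      have h2 := hneg z y hz hy
      have h3 : k (z, x, y) < 0 := hk
      have h4 : t * k (z, x, y) + (1 - t) * k (z, 0, y) < 0 := by
        rcases ht.1.eq_or_lt with rfl | h0
        · simpa using h2
        · nlinarith [mul_neg_of_pos_of_neg h0 h3, mul_nonneg (sub_nonneg.2 ht.2) (neg_pos.2 h2).le]
      exact h1.trans_lt h4
    refine ⟨Q ∪ R, union_subset hQsub hRsub, .inl (hQmem _ _ (by simpa using hε) hy₁' hy₁),
      .inr ⟨1, by simp, by simp⟩, ?_⟩
    exact hQ.union (z, 0, y) (hQmem _ _ hw'.1 hw'.2.2 hy) ⟨0, by simp, by simp⟩ hR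
  · rintro ⟨z, x, y⟩ ⟨hw, hk⟩
    have hw' := (hmem _ _ _).1 hw
    have hclos : ∀ z y, (z, (0 : X), y) ∈ N → (z, (0 : X), y) ∈ closure {w | k w < 0} := by
      intro z y hzy
      have h1 := (hmem _ _ _).1 hzy
      rcases eq_or_ne y 0 with rfl | hy
      · obtain ⟨y₀, hy₀⟩ := exists_ne (0 : Y)
        have h2 : Filter.Tendsto (fun t : ℝ ↦ (z, (0 : X), t • y₀)) (𝓝[>] 0) (𝓝 (z, 0, 0)) := by
          refine Filter.Tendsto.mono_left ?_ nhdsWithin_le_nhds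
          exact Continuous.tendsto' (by fun_prop) _ _ (by simp)
        refine mem_closure_of_tendsto h2 ?_
        have h3 : N ∈ 𝓝 (z, (0 : X), (0 : Y)) := by
          rw [hN]
          exact (Metric.isOpen_ball.prod (Metric.isOpen_ball.prod Metric.isOpen_ball)).mem_nhds
            (hN ▸ hzy)
        filter_upwards [h2 h3, self_mem_nhdsWithin] with t ht ht0
        exact hneg _ _ ht (smul_ne_zero (ne_of_gt ht0) hy₀)
      · exact subset_closure (hneg z y hzy hy)
    have hz : (z, (0 : X), y) ∈ N := (hmem _ _ _).2 ⟨hw'.1, by simpa using hε, hw'.2.2⟩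
    rcases eq_or_ne x 0 with rfl | hx
    · exact hclos z y hw
    have hy : y ≠ 0 := by
      rintro rfl
      exact (hpos z x hw hx).not_ge hk
    have h2 : Filter.Tendsto (fun t : ℝ ↦ (z, t • x, y)) (𝓝[<] 1) (𝓝 (z, x, y)) := by
      refine Filter.Tendsto.mono_left ?_ nhdsWithin_le_nhds
      exact Continuous.tendsto' (by fun_prop) _ _ (by simp)
    refine mem_closure_of_tendsto h2 ?_
    filter_upwards [Ioo_mem_nhdsLT (zero_lt_one (α := ℝ))] with t ht
    refine (hconv z x y hw t (Ioo_subset_Icc_self ht)).trans_lt ?_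
    have h3 := hneg z y hz hy
    have h4 : k (z, x, y) ≤ 0 := hk
    nlinarith [mul_nonneg ht.1.le (neg_nonneg.2 h4), mul_neg_of_pos_of_neg (sub_pos.2 ht.2) h3]

section Segment

variable {P : Type*} [NormedAddCommGroup P] [NormedSpace ℝ P] {k : P → ℝ} {U : Set P}
  (hUo : IsOpen U) (hU : Convex ℝ U) (hk : ∀ u ∈ U, ContDiffAt ℝ 2 k u) {a v : P}
include hk

omit hk in
theorem hasDerivAt_comp_line (t : ℝ) (hk : ContDiffAt ℝ 2 k (a + t • v)) :
    HasDerivAt (fun s : ℝ ↦ k (a + s • v)) (fderiv ℝ k (a + t • v) v) t ∧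
    HasDerivAt (fun s : ℝ ↦ fderiv ℝ k (a + s • v) v)
      (fderiv ℝ (fderiv ℝ k) (a + t • v) v v) t := by
  have hl : HasDerivAt (fun s : ℝ ↦ a + s • v) v t := by
    simpa using ((hasDerivAt_id t).smul_const v).const_add a
  refine ⟨(hk.differentiableAt (by norm_num)).hasFDerivAt.comp_hasDerivAt t hl, ?_⟩
  have h1 : DifferentiableAt ℝ (fderiv ℝ k) (a + t • v) :=
    (hk.fderiv_right (m := 1) (by norm_num)).differentiableAt (by norm_num)
  have h2 : HasDerivAt (fun s : ℝ ↦ fderiv ℝ k (a + s • v))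
      (fderiv ℝ (fderiv ℝ k) (a + t • v) v) t :=
    h1.hasFDerivAt.comp_hasDerivAt (f := fun s : ℝ ↦ a + s • v) t hl
  simpa using h2.clm_apply (hasDerivAt_const t v)

include hU

theorem le_of_second_derivative_nonneg (ha : a ∈ U) (hav : a + v ∈ U)
    (hpos : ∀ u ∈ U, 0 ≤ fderiv ℝ (fderiv ℝ k) u v v) {t : ℝ} (ht : t ∈ Icc (0 : ℝ) 1) :
    k (a + t • v) ≤ t * k (a + v) + (1 - t) * k a := by
  have hmem : ∀ t ∈ Icc (0 : ℝ) 1, a + t • v ∈ U := fun t ht ↦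
    hU.add_smul_mem ha hav ht
  have hd := fun t ht ↦ hasDerivAt_comp_line t (hk _ (hmem t ht))
  have hconv : ConvexOn ℝ (Icc (0 : ℝ) 1) fun s : ℝ ↦ k (a + s • v) := by
    have hm : MonotoneOn (fun s ↦ fderiv ℝ k (a + s • v) v) (Icc (0 : ℝ) 1) :=
      monotoneOn_of_hasDerivWithinAt_nonneg (convex_Icc 0 1)
        (fun t ht ↦ (hd t ht).2.continuousAt.continuousWithinAt)
        (fun t ht ↦ (hd t (interior_subset ht)).2.hasDerivWithinAt)
        (fun t ht ↦ hpos _ (hmem t (interior_subset ht)))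
    refine MonotoneOn.convexOn_of_deriv (convex_Icc 0 1)
      (fun t ht ↦ (hd t ht).1.continuousAt.continuousWithinAt)
      (fun t ht ↦ (hd t (interior_subset ht)).1.differentiableAt.differentiableWithinAt) ?_
    exact (hm.mono interior_subset).congr fun t ht ↦ (hd t (interior_subset ht)).1.deriv.symm
  have h1 := hconv.2 (right_mem_Icc.2 zero_le_one) (left_mem_Icc.2 zero_le_one) ht.1
    (sub_nonneg.2 ht.2) (by ring)
  simpa using h1

theorem lt_of_second_derivative_pos (ha : a ∈ U) (hav : a + v ∈ U)
    (hpos : ∀ u ∈ U, 0 < fderiv ℝ (fderiv ℝ k) u v v) (h0 : fderiv ℝ k a v = 0) :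
    k a < k (a + v) := by
  have hmem : ∀ t ∈ Icc (0 : ℝ) 1, a + t • v ∈ U := fun t ht ↦
    hU.add_smul_mem ha hav ht
  have hd := fun t ht ↦ hasDerivAt_comp_line t (hk _ (hmem t ht))
  have hmono : StrictMonoOn (fun s ↦ fderiv ℝ k (a + s • v) v) (Icc (0 : ℝ) 1) :=
    strictMonoOn_of_hasDerivWithinAt_pos (convex_Icc 0 1)
      (fun t ht ↦ (hd t ht).2.continuousAt.continuousWithinAt)
      (fun t ht ↦ (hd t (interior_subset ht)).2.hasDerivWithinAt)
      (fun t ht ↦ hpos _ (hmem t (interior_subset ht)))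
  have hmono2 : StrictMonoOn (fun s : ℝ ↦ k (a + s • v)) (Icc (0 : ℝ) 1) := by
    refine strictMonoOn_of_hasDerivWithinAt_pos (convex_Icc 0 1)
      (f' := fun s ↦ fderiv ℝ k (a + s • v) v)
      (fun t ht ↦ (hd t ht).1.continuousAt.continuousWithinAt)
      (fun t ht ↦ (hd t (interior_subset ht)).1.hasDerivWithinAt) fun t ht ↦ ?_
    have h1 := hmono (left_mem_Icc.2 zero_le_one) (interior_subset ht)
      (by rw [interior_Icc] at ht; exact ht.1)
    simpa [h0] using h1
  have := hmono2 (left_mem_Icc.2 zero_le_one) (right_mem_Icc.2 zero_le_one) zero_lt_one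
  simpa using this

end Segment

/-- By homogeneity positivity needs checking only on the unit sphere, which is compact. -/
theorem eventually_posDef {P : Type*} [NormedAddCommGroup P] [NormedSpace ℝ P]
    [FiniteDimensional ℝ X] {Q : P → P →L[ℝ] P →L[ℝ] ℝ} {p : P} (hQ : ContinuousAt Q p)
    (L : X →L[ℝ] P) (hpos : ∀ x ≠ 0, 0 < Q p (L x) (L x)) :
    ∀ᶠ u in 𝓝 p, ∀ x ≠ 0, 0 < Q u (L x) (L x) := by
  have : ProperSpace X := FiniteDimensional.proper ℝ X
  have h1 : ∀ᶠ u in 𝓝 p, ∀ x ∈ Metric.sphere (0 : X) 1, 0 < Q u (L x) (L x) := by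
    refine (isCompact_sphere (0 : X) 1).eventually_forall_of_forall_eventually fun x hx ↦ ?_
    have h2 : ContinuousAt (fun w : P × X ↦ Q w.1 (L w.2) (L w.2)) (p, x) := by
      have h3 : ContinuousAt (fun w : P × X ↦ Q w.1) (p, x) :=
        ContinuousAt.comp (f := Prod.fst) (g := Q) hQ continuousAt_fst
      have h4 : ContinuousAt (fun w : P × X ↦ L w.2) (p, x) := by fun_prop
      exact (h3.clm_apply h4).clm_apply h4
    refine h2.eventually (lt_mem_nhds (hpos x ?_))
    rintro rfl
    simp at hx
  filter_upwards [h1] with u hu x hx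
  have h2 := hu (‖x‖⁻¹ • x) (by simp [norm_smul, norm_ne_zero_iff.2 hx])
  have h3 : 0 < ‖x‖ := norm_pos_iff.2 hx
  simp only [map_smul, smul_apply, smul_eq_mul, ← mul_assoc] at h2
  exact pos_of_mul_pos_right h2 (by positivity)

/-- Sublevel sets near a nondegenerate critical manifold `Z`, where the Hessian has no negative
part, or a negative part of dimension at least two. -/
theorem exists_sublevel_nhds [FiniteDimensional ℝ X] [FiniteDimensional ℝ Y] {k : Z × X × Y → ℝ}
    (hk : ContDiffAt ℝ 2 k 0) (hZ : ∀ᶠ z in 𝓝 (0 : Z), k (z, 0, 0) = 0 ∧ fderiv ℝ k (z, 0, 0) = 0)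
    (hX : ∀ x ≠ 0, 0 < fderiv ℝ (fderiv ℝ k) 0 (0, x, 0) (0, x, 0))
    (hY : ∀ y ≠ 0, fderiv ℝ (fderiv ℝ k) 0 (0, 0, y) (0, 0, y) < 0) {U : Set (Z × X × Y)}
    (hU : U ∈ 𝓝 0) :
    ∃ N ∈ 𝓝 (0 : Z × X × Y), N ⊆ U ∧ (Subsingleton Y → ∀ w ∈ N, 0 ≤ k w) ∧
      (1 < Module.rank ℝ Y → IsPreconnected (N ∩ {w | k w < 0}) ∧
        N ∩ {w | k w ≤ 0} ⊆ closure {w | k w < 0}) := by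
  have hQ : ContinuousAt (fderiv ℝ (fderiv ℝ k)) 0 :=
    ((hk.fderiv_right (m := 1) (by norm_num)).fderiv_right (m := 0) (by norm_num)).continuousAt
  have h1 := eventually_posDef hQ ((ContinuousLinearMap.inr ℝ Z (X × Y)).comp
    (ContinuousLinearMap.inl ℝ X Y)) hX
  have h2 := eventually_posDef (Q := fun u ↦ -fderiv ℝ (fderiv ℝ k) u) hQ.neg
    ((ContinuousLinearMap.inr ℝ Z (X × Y)).comp (ContinuousLinearMap.inr ℝ X Y))
    (fun y hy ↦ neg_pos.2 (hY y hy))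
  have h3 := hk.eventually (by simp)
  have h4 : ∀ᶠ w : Z × X × Y in 𝓝 0, k (w.1, 0, 0) = 0 ∧ fderiv ℝ k (w.1, 0, 0) = 0 :=
    (continuous_fst.tendsto (0 : Z × X × Y)).eventually hZ
  obtain ⟨ε, hε, hball⟩ := Metric.eventually_nhds_iff_ball.1
    (h1.and (h2.and (h3.and (h4.and hU))))
  set N : Set (Z × X × Y) := Metric.ball 0 ε with hN
  have hNp : N = Metric.ball 0 ε ×ˢ Metric.ball 0 ε ×ˢ Metric.ball 0 ε := by
    rw [hN, ← ball_prod_same, ← ball_prod_same]; rfl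
  have hmem : ∀ z x y, (z, x, y) ∈ N ↔ ‖z‖ < ε ∧ ‖x‖ < ε ∧ ‖y‖ < ε := by
    intro z x y; simp [hNp]
  have hconvex : Convex ℝ N := convex_ball _ _
  have hdiff : ∀ u ∈ N, ContDiffAt ℝ 2 k u := fun u hu ↦ (hball u hu).2.2.1
  have hzero : ∀ z, (z, (0 : X), (0 : Y)) ∈ N → k (z, 0, 0) = 0 ∧ fderiv ℝ k (z, 0, 0) = 0 :=
    fun z hz ↦ (hball _ hz).2.2.2.1
  have hpos : ∀ z x, (z, x, (0 : Y)) ∈ N → x ≠ 0 → 0 < k (z, x, 0) := by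
    intro z x hw hx
    have hz : (z, (0 : X), (0 : Y)) ∈ N :=
      (hmem _ _ _).2 ⟨((hmem _ _ _).1 hw).1, by simpa using hε, by simpa using hε⟩
    have h5 := lt_of_second_derivative_pos hconvex hdiff (v := (0, x, 0)) hz
      (by simpa using hw) (fun u hu ↦ (hball u hu).1 x hx) (by rw [(hzero z hz).2]; rfl)
    rw [(hzero z hz).1] at h5
    simpa using h5
  refine ⟨N, Metric.ball_mem_nhds _ hε, fun w hw ↦ (hball w hw).2.2.2.2, fun hsub ↦ ?_, fun hr ↦ ?_⟩
  · rintro ⟨z, x, y⟩ hw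
    obtain rfl := Subsingleton.elim y 0
    rcases eq_or_ne x 0 with rfl | hx
    · exact (hzero z hw).1.ge
    · exact (hpos z x hw hx).le
  · refine sublevel_box hε hNp ?_ hpos ?_ (fun z hz ↦ (hzero z hz).1) hr
    -- The Hessian stays positive in the `X` direction on the whole ball, so `k` is convex along the
    -- segment from `(z, 0, y)` to `(z, x, y)`.
    · intro z x y hw t ht
      have hw' := (hmem _ _ _).1 hw
      have h5 := le_of_second_derivative_nonneg hconvex hdiff (a := (z, 0, y)) (v := (0, x, 0))
        ((hmem _ _ _).2 ⟨hw'.1, by simpa using hε, hw'.2.2⟩) (by simpa using hw)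
        (fun u hu ↦ by
          rcases eq_or_ne x 0 with rfl | hx
          · rw [show ((0 : Z), (0 : X), (0 : Y)) = 0 from rfl]; simp
          · exact ((hball u hu).1 x hx).le) ht
      simpa using h5
    · intro z y hw hy
      have hw' := (hmem _ _ _).1 hw
      have hz : (z, (0 : X), (0 : Y)) ∈ N :=
        (hmem _ _ _).2 ⟨hw'.1, by simpa using hε, by simpa using hε⟩
      have hfd : fderiv ℝ (fderiv ℝ fun w ↦ -k w) = fun u ↦ -fderiv ℝ (fderiv ℝ k) u := by
        have h6 : (fderiv ℝ fun w ↦ -k w) = fun u ↦ -fderiv ℝ k u := funext fun u ↦ fderiv_fun_neg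
        rw [h6]
        exact funext fun u ↦ fderiv_fun_neg
      have h5 := lt_of_second_derivative_pos (k := fun w ↦ -k w) hconvex
        (fun u hu ↦ (hdiff u hu).neg) (v := (0, 0, y)) hz (by simpa using hw)
        (fun u hu ↦ by rw [hfd]; exact (hball u hu).2.1 y hy)
        (by rw [fderiv_fun_neg, (hzero z hz).2]; simp)
      rw [(hzero z hz).1] at h5
      simpa using h5

end MorseBott

/-! ### The inverse function theorem for maps from a manifold to a vector space -/

section InverseFunction

variable {V : Type*} [NormedAddCommGroup V] [NormedSpace ℝ V] [CompleteSpace V]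
  {H : Type*} [TopologicalSpace H] (I : ModelWithCorners ℝ V H) [I.Boundaryless]
  {M : Type*} [TopologicalSpace M] [ChartedSpace H M]
  {P : Type*} [NormedAddCommGroup P] [NormedSpace ℝ P] [CompleteSpace P]
  {n : WithTop ℕ∞} [IsManifold I n M] [IsManifold I 1 M]

/-- The inverse function theorem on a manifold. -/
theorem exists_localDiffeo {f : M → P} (hn : n ≠ 0) (hf : ContMDiff I 𝓘(ℝ, P) n f) {p : M}
    (hp : Function.Bijective (mD I 𝓘(ℝ, P) f p)) :
    ∃ φ : OpenPartialHomeomorph M P, p ∈ φ.source ∧ (∀ q ∈ φ.source, φ q = f q) ∧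
      ∀ y ∈ φ.target, ContMDiffAt 𝓘(ℝ, P) I n φ.symm y := by
  let e : OpenPartialHomeomorph M V :=
    { extChartAt I p with
      open_source := isOpen_extChartAt_source p
      open_target := isOpen_extChartAt_target p
      continuousOn_toFun := continuousOn_extChartAt p
      continuousOn_invFun := continuousOn_extChartAt_symm p }
  have hn1 : (1 : WithTop ℕ∞) ≤ n := ENat.one_le_iff_ne_zero_withTop.2 hn
  set x₀ := extChartAt I p p
  have hx₀ : x₀ ∈ e.target := mem_extChartAt_target p
  set g : V → P := f ∘ e.symm
  have hg : ContDiffOn ℝ n g e.target :=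
    (hf.comp_contMDiffOn (contMDiffOn_extChartAt_symm (I := I) (n := n) p)).contDiffOn
  have hgx : ∀ x ∈ e.target, ContDiffAt ℝ n g x := fun x hx ↦
    hg.contDiffAt (e.open_target.mem_nhds hx)
  have hgx₀ : fderiv ℝ g x₀ = mD I 𝓘(ℝ, P) f p :=
    fderiv_comp_symm_self I p (hf.mdifferentiableAt hn)
  let L : V ≃L[ℝ] P := ContinuousLinearEquiv.ofBijective (mD I 𝓘(ℝ, P) f p)
    (LinearMap.ker_eq_bot.2 hp.1) (LinearMap.range_eq_top.2 hp.2)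
  have hL : HasFDerivAt g (L : V →L[ℝ] P) x₀ := by
    rw [ContinuousLinearEquiv.coe_ofBijective, ← hgx₀]
    exact ((hgx x₀ hx₀).differentiableAt hn).hasFDerivAt
  -- Restricting to the points with invertible derivative makes the inverse of class `C^n` at every
  -- point of the target, and not only at the image of `p`.
  set W : Set V := e.target ∩ fderiv ℝ g ⁻¹' range ((↑) : (V ≃L[ℝ] P) → V →L[ℝ] P)
  have hW : IsOpen W :=
    ((hg.continuousOn_fderiv_of_isOpen e.open_target hn1).isOpen_inter_preimage e.open_target
      ContinuousLinearEquiv.isOpen)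
  let ψ := ((hgx x₀ hx₀).toOpenPartialHomeomorph g hL hn).restrOpen W hW
  refine ⟨e.trans ψ, ?_, fun q hq ↦ ?_, fun y hy ↦ ?_⟩
  · rw [OpenPartialHomeomorph.trans_source]
    refine ⟨mem_extChartAt_source p, ?_, hx₀, L, ?_⟩
    · exact (hgx x₀ hx₀).mem_toOpenPartialHomeomorph_source hL hn
    · exact hL.fderiv.symm
  · rw [OpenPartialHomeomorph.trans_source] at hq
    exact congrArg f (e.left_inv hq.1)
  · rw [OpenPartialHomeomorph.trans_target] at hy
    have hyψ : y ∈ ψ.target := hy.1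
    have h2 := ψ.map_target hyψ
    obtain ⟨h3, L', hL'⟩ : ψ.symm y ∈ W := h2.2
    have h4 : ContDiffAt ℝ n ψ.symm y := ψ.contDiffAt_symm (f₀' := L') hyψ
      (by rw [hL']; exact ((hgx _ h3).differentiableAt hn).hasFDerivAt) (hgx _ h3)
    have h5 : ContMDiffAt 𝓘(ℝ, V) I n e.symm (ψ.symm y) :=
      (contMDiffOn_extChartAt_symm (I := I) (n := n) p).contMDiffAt (e.open_target.mem_nhds h3)
    exact h5.comp y h4.contMDiffAt

omit [CompleteSpace V] [I.Boundaryless] [CompleteSpace P] [IsManifold I n M] [IsManifold I 1 M]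
variable {f : M → P} {φ : OpenPartialHomeomorph M P}
  (hφ : ∀ q ∈ φ.source, φ q = f q) (hs : ∀ y ∈ φ.target, MDifferentiableAt 𝓘(ℝ, P) I φ.symm y)
  (hf : MDifferentiable I 𝓘(ℝ, P) f)
include hφ hs hf

theorem mD_mD_symm {y : P} (hy : y ∈ φ.target) (Y : P) :
    mD I 𝓘(ℝ, P) f (φ.symm y) (mD 𝓘(ℝ, P) I φ.symm y Y) = Y := by
  rw [← mD_comp_apply _ _ _ (hf _) (hs y hy)]
  have h1 : (fun z ↦ f (φ.symm z)) =ᶠ[𝓝 y] fun z ↦ z := by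
    filter_upwards [φ.open_target.mem_nhds hy] with z hz
    rw [← hφ _ (φ.map_target hz), φ.right_inv hz]
  rw [mD_congr _ _ h1, mD_id]
  rfl

theorem mD_symm_mD {y : P} (hy : y ∈ φ.target) (X : V) :
    mD 𝓘(ℝ, P) I φ.symm y (mD I 𝓘(ℝ, P) f (φ.symm y) X) = X := by
  have hfy : f (φ.symm y) = y := by rw [← hφ _ (φ.map_target hy), φ.right_inv hy]
  have h0 := mD_comp_apply I 𝓘(ℝ, P) I (f := f) (g := φ.symm) (p := φ.symm y)
    (by rw [hfy]; exact hs y hy) (hf _) X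
  rw [hfy] at h0
  rw [← h0]
  have h1 : (fun z ↦ φ.symm (f z)) =ᶠ[𝓝 (φ.symm y)] fun z ↦ z := by
    filter_upwards [φ.open_source.mem_nhds (φ.map_target hy)] with z hz
    rw [← hφ _ hz, φ.left_inv hz]
  rw [mD_congr _ _ h1, mD_id]
  rfl

end InverseFunction

theorem SublevelConnectedAt.of_homeomorph {X Y : Type*} [TopologicalSpace X] [TopologicalSpace Y]
    {h : X → ℝ} {p : X} (φ : OpenPartialHomeomorph X Y) (hp : p ∈ φ.source) {N : Set Y}
    (hN : N ∈ 𝓝 (φ p)) (hNt : N ⊆ φ.target)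
    (h1 : IsPreconnected (N ∩ {y | h (φ.symm y) < h p}))
    (h2 : N ∩ {y | h (φ.symm y) ≤ h p} ⊆ closure {y | h (φ.symm y) < h p}) :
    SublevelConnectedAt h p := by
  have himage : ∀ s : Set ℝ, φ.symm '' N ∩ {x | h x ∈ s} =
      φ.symm '' (N ∩ {y | h (φ.symm y) ∈ s}) := by
    intro s
    ext x
    constructor
    · rintro ⟨⟨y, hy, rfl⟩, hx⟩
      exact ⟨y, ⟨hy, hx⟩, rfl⟩
    · rintro ⟨y, ⟨hy, hx⟩, rfl⟩
      exact ⟨⟨y, hy, rfl⟩, hx⟩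
  refine .inr ⟨φ.symm '' N, ?_, ?_, ?_⟩
  · have := φ.symm.image_mem_nhds (φ.map_source hp) hN
    rwa [φ.left_inv hp] at this
  · have h3 := himage (Iio (h p))
    simp only [mem_Iio] at h3
    rw [h3]
    exact h1.image _ (φ.continuousOn_symm.mono (inter_subset_left.trans hNt))
  · rintro _ ⟨⟨y, hy, rfl⟩, hx⟩
    have h3 := mem_closure_image (φ.continuousAt_symm (hNt hy)) (h2 ⟨hy, hx⟩)
    refine closure_mono ?_ h3
    rintro _ ⟨z, hz, rfl⟩
    exact hz

/-- At a critical point the Hessian is a tensor: the term with the second derivative of `κ` is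
multiplied by `fderiv ℝ k (κ x) = 0`. -/
theorem fderiv_fderiv_comp {V P : Type*} [NormedAddCommGroup V] [NormedSpace ℝ V]
    [NormedAddCommGroup P] [NormedSpace ℝ P] {k : P → ℝ} {κ : V → P} {x : V}
    (hk : ContDiffAt ℝ 2 k (κ x)) (hκ : ContDiffAt ℝ 2 κ x) (h0 : fderiv ℝ k (κ x) = 0) (U Y : V) :
    fderiv ℝ (fun z ↦ fderiv ℝ (fun w ↦ k (κ w)) z Y) x U =
      fderiv ℝ (fderiv ℝ k) (κ x) (fderiv ℝ κ x U) (fderiv ℝ κ x Y) := by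
  have h1 : (fun z ↦ fderiv ℝ (fun w ↦ k (κ w)) z Y) =ᶠ[𝓝 x]
      fun z ↦ fderiv ℝ k (κ z) (fderiv ℝ κ z Y) := by
    filter_upwards [hκ.continuousAt.eventually (hk.eventually (by simp)),
      hκ.eventually (by simp)] with z h2 h3
    exact congrArg (fun L : V →L[ℝ] ℝ ↦ L Y) (fderiv_comp z (h2.differentiableAt (by norm_num))
      (h3.differentiableAt (by norm_num)))
  rw [h1.fderiv_eq]
  have h2 : HasFDerivAt (fun z ↦ fderiv ℝ k (κ z))
      ((fderiv ℝ (fderiv ℝ k) (κ x)).comp (fderiv ℝ κ x)) x :=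
    HasFDerivAt.comp (f := κ) (g := fderiv ℝ k) x
      (((hk.fderiv_right (m := 1) (by norm_num)).differentiableAt (by norm_num)).hasFDerivAt)
      (hκ.differentiableAt (by norm_num)).hasFDerivAt
  have h3 : DifferentiableAt ℝ (fun z ↦ fderiv ℝ κ z Y) x :=
    ((hκ.fderiv_right (m := 1) (by norm_num)).differentiableAt (by norm_num)).clm_apply
      (differentiableAt_const Y)
  rw [(h2.clm_apply h3.hasFDerivAt).fderiv]
  simp [h0]

/-! ### Homogeneity and Hessians of the components of the moment map -/

section MomentSublevel

variable {E : Type*} [NormedAddCommGroup E] [NormedSpace ℝ E]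
  {S : Type*} [TopologicalSpace S] [ChartedSpace E S] [IsManifold 𝓘(ℝ, E) ∞ S]
  {m : ℕ} [MulAction (Torus m) S] {A : SasakiStructure E S}

omit [IsManifold 𝓘(ℝ, E) ∞ S] in
theorem gen_eq_prod (h : IsSmoothTorusAction E S m) (q : Cone S) (v : LieAlg m) :
    gen E q v = (mD 𝓘(ℝ, LieAlg m) 𝓘(ℝ, E) (fun w : LieAlg m ↦ torusExp w • q.1) 0 v, 0) := by
  have h1 : MDifferentiableAt 𝓘(ℝ, LieAlg m) 𝓘(ℝ, E) (fun w : LieAlg m ↦ torusExp w • q.1) 0 :=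
    (h.comp (contMDiff_id.prodMk contMDiff_const)).mdifferentiableAt (by simp)
  have h2 := mD_prodMk h1 (mdifferentiableAt_const (c := q.2) (I' := 𝓘(ℝ, ℝ)))
  rw [mD_const] at h2
  exact congrArg (fun L : LieAlg m →L[ℝ] E × ℝ ↦ L v) h2

variable {b : LieAlg m} (hb : ∀ p : Cone S, generator E p b = A.reeb p)
include hb

theorem moment_reeb (q : Cone S) : A.moment q b = 1 / 2 * (q.2 : ℝ) ^ 2 := by
  have h1 : (gen E q b : E × ℝ) = A.J q (positionVector q) := hb q
  rw [A.moment_eq hb, h1]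
  have h2 := A.isKaehler.compat q (positionVector (E := E) q) (positionVector (E := E) q)
  have h3 := A.coneForm_positionVector q (positionVector (E := E) q)
  exact congrArg (fun x ↦ 1 / 2 * x) (h2.trans (h3.trans (pow_two _).symm))

/-- Generators of the torus action have no radial part and do not depend on the radius, while the
cone metric on `S` is scaled by the square of the radius. Questions about signs thereby descend to
the compact manifold `S`. -/
theorem moment_eq_sq_mul (h : IsSmoothTorusAction E S m) (s : S) (r r' : PosReal) (v : LieAlg m) :
    (r' : ℝ) ^ 2 * A.moment (s, r) v = (r : ℝ) ^ 2 * A.moment (s, r') v := by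
  have h1 : ∀ r : PosReal, A.moment (s, r) v = 1 / 2 * ((r : ℝ) ^ 2 *
      A.g.inner s (gen E (s, r) b).1 (gen E (s, r) v).1) := fun r ↦ by
    rw [A.moment_eq hb]
    have h2 : coneForm A.g (s, r) (gen E (s, r) b) (gen E (s, r) v) =
      (r : ℝ) ^ 2 * A.g.inner s (gen E (s, r) b).1 (gen E (s, r) v).1 +
        (gen E (s, r) b).2 * (gen E (s, r) v).2 := rfl
    have h3 : (gen E (s, r) b).2 = 0 := by rw [gen_eq_prod h]
    rw [h2, h3, zero_mul, add_zero]
  rw [h1, h1, gen_eq_prod h, gen_eq_prod h, gen_eq_prod h, gen_eq_prod h]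
  ring

variable [FiniteDimensional ℝ E] [T2Space S] (hA : A.IsToric m)
include hA

/-- The Hessian of a component of the moment map at a critical point. -/
theorem hessian_moment {p : Cone S} (l : LocalModel E m p) {v : LieAlg m} (hv : gen E p v = 0)
    (U Y : E × ℝ) :
    fderiv ℝ (fun x ↦ fderiv ℝ (fun w ↦ A.moment ((extChartAt (coneModel E) p).symm w) v) x Y)
      (extChartAt (coneModel E) p p) U = -coneForm A.g p (A.cJ p (l.B v U)) Y := by
  set e := extChartAt (coneModel E) p
  set x₀ := e p
  have hK := A.isKaehler
  have hmom := (A.contMDiff_moment hb hA v).mdifferentiable (by simp)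
  set G : E × ℝ → E × ℝ := fieldInChart (coneModel E) p fun q ↦ gen E q v
  have hGd : DifferentiableAt ℝ G x₀ :=
    (isSmoothField_gen hA.smooth v).differentiableAt_fieldInChart (coneModel E) p
  have hG0 : G x₀ = 0 := by
    rw [← hv]; exact fieldInChart_self (coneModel E) p _
  set κ : E × ℝ → E × ℝ := l.Ψ ∘ e.symm
  have hκ : ContDiffAt ℝ 2 κ x₀ := by
    have h1 : ContMDiffOn 𝓘(ℝ, E × ℝ) 𝓘(ℝ, E × ℝ) 2 κ e.target :=
      l.contMDiff.comp_contMDiffOn (contMDiffOn_extChartAt_symm (I := coneModel E) p)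
    exact h1.contDiffOn.contDiffAt (target_mem_nhds _ p (mem_extChartAt_target p))
  have hκ0 : κ x₀ = 0 := by
    rw [← l.map_self]; exact congrArg l.Ψ (extChartAt_to_inv p)
  have hκ1 : fderiv ℝ κ x₀ = ContinuousLinearMap.id ℝ (E × ℝ) := by
    rw [← l.mD_self]
    exact fderiv_comp_symm_self (coneModel E) p (l.contMDiff.mdifferentiableAt (by norm_num))
  have hGB : (fun x ↦ fderiv ℝ κ x (G x)) =ᶠ[𝓝 x₀] fun x ↦ l.B v (κ x) := by
    filter_upwards [eventually_mem_target (coneModel E) p] with x hx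
    rw [fderiv_comp_symm (coneModel E) p hx (l.contMDiff.mdifferentiableAt (by norm_num))]
    have h1 : chartD (coneModel E) p x (G x) = gen E (e.symm x) v :=
      chartD_fieldInChart (coneModel E) p _ hx
    rw [ContinuousLinearMap.comp_apply, h1, l.mD_gen v hv]
    rfl
  -- Differentiate `dκ(G) = B v ∘ κ` at `x₀`, where `G` vanishes and `dκ` is the identity.
  have hG1 : fderiv ℝ G x₀ U = l.B v U := by
    have h1 : DifferentiableAt ℝ (fderiv ℝ κ) x₀ :=
      (hκ.fderiv_right (m := 1) (by norm_num)).differentiableAt (by norm_num)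
    have h2 := hGB.fderiv_eq (𝕜 := ℝ)
    rw [(h1.hasFDerivAt.clm_apply hGd.hasFDerivAt).fderiv] at h2
    have h3 : HasFDerivAt (fun x ↦ l.B v (κ x)) ((l.B v).comp (fderiv ℝ κ x₀)) x₀ :=
      (l.B v).hasFDerivAt.comp x₀ (hκ.differentiableAt (by norm_num)).hasFDerivAt
    rw [h3.fderiv] at h2
    have h4 := congrArg (fun L : E × ℝ →L[ℝ] E × ℝ ↦ L U) h2
    simpa [hG0, hκ1] using h4
  have hd : (fun x ↦ fderiv ℝ (fun w ↦ A.moment (e.symm w) v) x Y) =ᶠ[𝓝 x₀]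
      fun x ↦ -metricInChart (coneModel E) (coneForm A.g) p x
        (endInChart (coneModel E) A.cJ p x (G x)) Y := by
    filter_upwards [eventually_mem_target (coneModel E) p] with x hx
    have h1 := fderiv_comp_symm (coneModel E) p hx (hmom (e.symm x))
    have h2 : chartD (coneModel E) p x (G x) = gen E (e.symm x) v :=
      chartD_fieldInChart (coneModel E) p _ hx
    refine (congrArg (fun L : E × ℝ →L[ℝ] ℝ ↦ L Y) h1).trans ?_
    rw [ContinuousLinearMap.comp_apply, A.mD_moment hb hA, metricInChart_apply, tensorInChart,
      chartD_endInChart _ _ _ hx, h2]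
    rfl
  rw [hd.fderiv_eq]
  have hM : DifferentiableAt ℝ (metricInChart (coneModel E) (coneForm A.g) p) x₀ :=
    hK.differentiableAt_metricInChart p
  have hJd : DifferentiableAt ℝ (endInChart (coneModel E) A.cJ p) x₀ :=
    differentiableAt_endInChart (coneModel E) hK.smooth_J p
  have h5 := ((hM.hasFDerivAt.clm_apply (hJd.hasFDerivAt.clm_apply hGd.hasFDerivAt)).clm_apply
    (hasFDerivAt_const Y x₀)).neg
  have h6 : endInChart (coneModel E) A.cJ p x₀ = A.cJ p := endInChart_self _ _ _
  have h7 : metricInChart (coneModel E) (coneForm A.g) p x₀ = coneForm A.g p :=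
    metricInChart_self _ _ _
  refine (congrArg (fun L : E × ℝ →L[ℝ] ℝ ↦ L U) h5.fderiv).trans ?_
  simp only [hG0, h6, h7, map_zero]
  simp [hG1]

end MomentSublevel

/-- The point of the half line with coordinate one. -/
def unitRadius : PosReal := ⟨1, show (0 : ℝ) < 1 from zero_lt_one⟩

/-! ### Local minima of components of the moment map are global -/

section MomentLocal

variable {E : Type*} [NormedAddCommGroup E] [NormedSpace ℝ E]
  {S : Type*} [TopologicalSpace S] [ChartedSpace E S] [IsManifold 𝓘(ℝ, E) ∞ S]
  {m : ℕ} [MulAction (Torus m) S] {A : SasakiStructure E S}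
  {b : LieAlg m} (hb : ∀ p : Cone S, generator E p b = A.reeb p)
include hb

theorem moment_eq_zero {q : Cone S} {v : LieAlg m} (hv : gen E q v = 0) : A.moment q v = 0 := by
  rw [A.moment_eq hb, hv, map_zero, mul_zero]

variable [FiniteDimensional ℝ E] [T2Space S] (hA : A.IsToric m)
include hA

theorem mD_moment_eq (v : LieAlg m) (p : Cone S) (X : E × ℝ) :
    mD (coneModel E) 𝓘(ℝ, ℝ) (fun q : Cone S ↦ A.moment q v) p X =
      -coneForm A.g p (A.cJ p (gen E p v)) X :=
  A.mD_moment hb hA v p X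

/-- In the equivariant chart the kernel of `l.B v` consists of zeros of the field of `v`, hence of
critical points with value `0`, and the Hessian `-J ∘ l.B v` is nondegenerate transversally. The
Hessian is complex linear, so its negative part is zero or of dimension at least two, and
`exists_sublevel_nhds` applies. -/
theorem moment_local_of_gen_eq_zero {p : Cone S} (l : LocalModel E m p) {v : LieAlg m}
    (hv : gen E p v = 0) :
    SublevelConnectedAt (fun q ↦ A.moment q v) p ∧
      ((∀ X, 0 ≤ coneForm A.g p (-A.cJ p (l.B v X)) X) → ∀ᶠ q in 𝓝 p, 0 ≤ A.moment q v) := by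
  have hK := A.isKaehler
  have hsm := A.contMDiff_moment hb hA v
  have hBJ : ∀ X, l.B v (A.cJ p X) = A.cJ p (l.B v X) := fun X ↦ l.B_J hA hv X
  have hJJ : ∀ X, A.cJ p (A.cJ p X) = -X := fun X ↦ hK.J_sq p X
  have hJl : ∀ X Y, coneForm A.g p (A.cJ p X) Y = -coneForm A.g p X (A.cJ p Y) :=
    fun X Y ↦ hK.J_left p X Y
  obtain ⟨k₀, k₁, k₂, _, _, _, T, hT0, hT1, hT2, hk₂⟩ := exists_signature_splitting
    (ContinuousLinearMap.coeLM ℝ ∘ₗ (coneForm A.g p).toLinearMap) (fun X Y ↦ hK.symm p X Y)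
    (fun X hX ↦ hK.pos p X hX) (-(A.cJ p).comp (l.B v)).toLinearMap
    (fun X Y ↦ by
      change coneForm A.g p (-A.cJ p (l.B v X)) Y = coneForm A.g p X (-A.cJ p (l.B v Y))
      rw [map_neg, neg_apply, hJl, neg_neg, l.B_skew hA hv, hBJ, map_neg])
    (A.cJ p).toLinearMap hJJ
    (fun X ↦ by
      change -A.cJ p (l.B v (A.cJ p X)) = A.cJ p (-A.cJ p (l.B v X))
      rw [hBJ, map_neg])
  have hΨ2 := l.contMDiff
  set f : Cone S → (k₀ → ℝ) × (k₁ → ℝ) × (k₂ → ℝ) := fun q ↦ T.symm (l.Ψ q)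
  have hf : ContMDiff (coneModel E) 𝓘(ℝ, (k₀ → ℝ) × (k₁ → ℝ) × (k₂ → ℝ)) 2 f :=
    T.symm.contDiff.contMDiff.comp hΨ2
  have hfd : ∀ q X, mD (coneModel E) 𝓘(ℝ, (k₀ → ℝ) × (k₁ → ℝ) × (k₂ → ℝ)) f q X =
      T.symm (mD (coneModel E) 𝓘(ℝ, E × ℝ) l.Ψ q X) := fun q X ↦ by
    have := mD_comp_apply (coneModel E) 𝓘(ℝ, E × ℝ) 𝓘(ℝ, (k₀ → ℝ) × (k₁ → ℝ) × (k₂ → ℝ))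
      (f := l.Ψ) (g := T.symm) (p := q) (T.symm.differentiableAt.mdifferentiableAt)
      (hΨ2.mdifferentiableAt (by norm_num)) X
    rw [mD_eq_fderiv, T.symm.fderiv] at this
    exact this
  obtain ⟨φ, hpφ, hφ, hs⟩ := exists_localDiffeo (coneModel E) (by norm_num) hf (p := p) (by
    rw [show mD (coneModel E) 𝓘(ℝ, (k₀ → ℝ) × (k₁ → ℝ) × (k₂ → ℝ)) f p =
      (T.symm : E × ℝ →L[ℝ] _) from ContinuousLinearMap.ext fun X ↦ by
        rw [hfd, l.mD_self]; rfl]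
    exact T.symm.bijective)
  have hsd : ∀ y ∈ φ.target, MDifferentiableAt 𝓘(ℝ, (k₀ → ℝ) × (k₁ → ℝ) × (k₂ → ℝ))
      (coneModel E) φ.symm y := fun y hy ↦ (hs y hy).mdifferentiableAt (by norm_num)
  have hfm := hf.mdifferentiable (by norm_num)
  have hφp : φ p = 0 := by
    rw [hφ p hpφ]; simp only [f, l.map_self, map_zero]
  have h0t : (0 : (k₀ → ℝ) × (k₁ → ℝ) × (k₂ → ℝ)) ∈ φ.target := hφp ▸ φ.map_source hpφ
  have hφ0 : φ.symm 0 = p := by rw [← hφp, φ.left_inv hpφ]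
  set k : (k₀ → ℝ) × (k₁ → ℝ) × (k₂ → ℝ) → ℝ := fun y ↦ A.moment (φ.symm y) v with hkdef
  have hk2 : ContDiffAt ℝ 2 k 0 :=
    (((hsm.of_le (WithTop.coe_le_coe.2 le_top)).contMDiffAt (x := φ.symm 0)).comp _
      (hs 0 h0t)).contDiffAt
  have hkd : ∀ y ∈ φ.target, gen E (φ.symm y) v = 0 → k y = 0 ∧ fderiv ℝ k y = 0 := by
    intro y hy hg
    refine ⟨moment_eq_zero hb hg, ?_⟩
    rw [← mD_eq_fderiv]
    refine ContinuousLinearMap.ext fun Y ↦ ?_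
    refine (mD_comp_apply _ (coneModel E) _ (hsm.mdifferentiableAt (by simp)) (hsd y hy) Y).trans ?_
    rw [mD_moment_eq hb hA, hg, map_zero, map_zero]
    simp
  have hgen : ∀ y ∈ φ.target, l.B v (T y) = 0 → gen E (φ.symm y) v = 0 := by
    intro y hy hB
    rw [← mD_symm_mD (coneModel E) hφ hsd hfm hy (gen E (φ.symm y) v), hfd, l.mD_gen v hv]
    have h1 : f (φ.symm y) = y := by rw [← hφ _ (φ.map_target hy), φ.right_inv hy]
    have h2 : l.Ψ (φ.symm y) = T y := by
      simp only [f] at h1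
      rw [← h1, T.apply_symm_apply, h1]
    rw [h2, hB, map_zero, map_zero]
  have hZ : ∀ᶠ z in 𝓝 (0 : k₀ → ℝ), k (z, 0, 0) = 0 ∧ fderiv ℝ k (z, 0, 0) = 0 := by
    have h1 : Filter.Tendsto (fun z : k₀ → ℝ ↦ (z, (0 : k₁ → ℝ), (0 : k₂ → ℝ))) (𝓝 0) (𝓝 0) :=
      Continuous.tendsto' (by fun_prop) _ _ rfl
    filter_upwards [h1 (φ.open_target.mem_nhds h0t)] with z hz
    refine hkd _ hz (hgen _ hz ?_)
    have h2 : -A.cJ p (l.B v (T (z, 0, 0))) = 0 := hT0 z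
    have h3 := congrArg (A.cJ p) h2
    rwa [map_neg, hJJ, neg_neg, map_zero] at h3
  -- The Hessian formula holds in the preferred chart. It passes to the coordinates of `φ` because
  -- `0` is a critical point of `k` and the coordinate change has differential `T.symm`.
  have hess : ∀ U Y, fderiv ℝ (fderiv ℝ k) 0 U Y = coneForm A.g p (-A.cJ p (l.B v (T U))) (T Y) := by
    intro U Y
    set e := extChartAt (coneModel E) p
    have hpe : e.symm (e p) = p := extChartAt_to_inv p
    set κ : E × ℝ → (k₀ → ℝ) × (k₁ → ℝ) × (k₂ → ℝ) := f ∘ e.symm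
    have hκ : ContDiffAt ℝ 2 κ (e p) := by
      have h1 : ContMDiffOn 𝓘(ℝ, E × ℝ) 𝓘(ℝ, (k₀ → ℝ) × (k₁ → ℝ) × (k₂ → ℝ)) 2 κ e.target :=
        hf.comp_contMDiffOn (contMDiffOn_extChartAt_symm (I := coneModel E) p)
      exact h1.contDiffOn.contDiffAt (target_mem_nhds _ p (mem_extChartAt_target p))
    have hκ0 : κ (e p) = 0 := by
      rw [← hφp, hφ p hpφ]; exact congrArg f hpe
    have hκ1 : ∀ X, fderiv ℝ κ (e p) X = T.symm X := by
      intro X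
      rw [fderiv_comp_symm_self (coneModel E) p (hfm p), hfd, l.mD_self]
      rfl
    have h1 := fderiv_fderiv_comp (k := k) (κ := κ) (x := e p) (by rwa [hκ0]) hκ
      (by rw [hκ0]; exact (hkd 0 h0t (by rw [hφ0]; exact hv)).2) (T U) (T Y)
    rw [hκ0, hκ1, hκ1, T.symm_apply_apply, T.symm_apply_apply] at h1
    rw [← h1]
    have h2 : (fun w ↦ k (κ w)) =ᶠ[𝓝 (e p)] fun w ↦ A.moment (e.symm w) v := by
      have h3 := tendsto_extChartAt_symm (coneModel E) p (φ.open_source.mem_nhds hpφ)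
      filter_upwards [h3] with w hw
      have h4 : κ w = φ (e.symm w) := (hφ _ hw).symm
      simp only [hkdef]
      rw [h4, φ.left_inv hw]
    have h3 : (fun x ↦ fderiv ℝ (fun w ↦ k (κ w)) x (T Y)) =ᶠ[𝓝 (e p)]
        fun x ↦ fderiv ℝ (fun w ↦ A.moment (e.symm w) v) x (T Y) :=
      (h2.fderiv (𝕜 := ℝ)).fun_comp (fun L : E × ℝ →L[ℝ] ℝ ↦ L (T Y))
    rw [h3.fderiv_eq, hessian_moment hb hA l hv, map_neg]
    rfl
  obtain ⟨N, hN, hNt, hN1, hN2⟩ := exists_sublevel_nhds hk2 hZ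
    (fun x hx ↦ by rw [hess]; exact hT1 x hx) (fun y hy ↦ by rw [hess]; exact hT2 y hy)
    (φ.open_target.mem_nhds h0t)
  have hnonneg : IsEmpty k₂ → ∀ᶠ q in 𝓝 p, 0 ≤ A.moment q v := by
    intro he
    have h1 := φ.continuousAt hpφ
    rw [ContinuousAt, hφp] at h1
    filter_upwards [h1 hN, φ.open_source.mem_nhds hpφ] with q hq hqs
    have h2 := hN1 inferInstance _ hq
    simp only [hkdef] at h2
    rwa [φ.left_inv hqs] at h2
  have hp0 : A.moment p v = 0 := moment_eq_zero hb hv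
  rcases hk₂ with he | ⟨hcard, X, hX⟩
  · refine ⟨.inl ?_, fun _ ↦ hnonneg he⟩
    filter_upwards [hnonneg he] with q hq
    exact hp0.trans_le hq
  · refine ⟨?_, fun h ↦ absurd (h X) (not_le.2 hX)⟩
    have hr : 1 < Module.rank ℝ (k₂ → ℝ) := by
      rw [rank_fun']
      exact_mod_cast hcard
    refine .of_homeomorph φ hpφ (hφp ▸ hN) hNt ?_ ?_
    · simp only [hp0]; exact (hN2 hr).1
    · simp only [hp0]; exact (hN2 hr).2

/-- At a regular point the function is linear in a suitable chart, and its sublevel sets in a ball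
are convex. -/
theorem moment_local_of_gen_ne_zero {p : Cone S} (l : LocalModel E m p) {v : LieAlg m}
    (hv : gen E p v ≠ 0) : SublevelConnectedAt (fun q ↦ A.moment q v) p := by
  have hK := A.isKaehler
  set L : E × ℝ →L[ℝ] ℝ := mD (coneModel E) 𝓘(ℝ, ℝ) (fun q : Cone S ↦ A.moment q v) p with hL
  set h : Cone S → ℝ := fun q ↦ A.moment q v with hh
  have hsm : ContMDiff (coneModel E) 𝓘(ℝ, ℝ) 2 h :=
    (A.contMDiff_moment hb hA v).of_le (WithTop.coe_le_coe.2 le_top)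
  obtain ⟨w, hw⟩ : ∃ w, L w = 1 := by
    have h1 : L (-A.cJ p (gen E p v)) ≠ 0 := by
      rw [hL, A.mD_moment hb hA, map_neg, neg_neg]
      refine (Eq.trans_ne (hK.compat p _ _) (hK.pos p _ hv).ne')
    exact ⟨(L (-A.cJ p (gen E p v)))⁻¹ • -A.cJ p (gen E p v), by
      rw [map_smul, smul_eq_mul, inv_mul_cancel₀ h1]⟩
  have hΨ2 := l.contMDiff
  -- The correction along `w` makes `L ∘ f = h` and leaves the differential at `p` equal to the
  -- identity.
  set f : Cone S → E × ℝ := fun q ↦ l.Ψ q + (h q - L (l.Ψ q)) • w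
  have hf : ContMDiff (coneModel E) 𝓘(ℝ, E × ℝ) 2 f :=
    hΨ2.add ((hsm.sub (L.contDiff.contMDiff.comp hΨ2)).smul contMDiff_const)
  have hLf : ∀ q, L (f q) = h q := fun q ↦ by
    simp [f, hw]
  have hfd : mD (coneModel E) 𝓘(ℝ, E × ℝ) f p = ContinuousLinearMap.id ℝ (E × ℝ) := by
    set e := extChartAt (coneModel E) p
    have hΨd := hΨ2.mdifferentiable (by norm_num)
    have hhd := hsm.mdifferentiable (by norm_num)
    have hpe : e.symm (e p) = p := extChartAt_to_inv p
    have h1 : HasFDerivAt (l.Ψ ∘ e.symm) (ContinuousLinearMap.id ℝ (E × ℝ)) (e p) := by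
      rw [← l.mD_self, ← fderiv_comp_symm_self (coneModel E) p (hΨd p)]
      exact (differentiableAt_comp_symm (coneModel E) p (mem_extChartAt_target p)
        (hΨd _)).hasFDerivAt
    have h2 : HasFDerivAt (h ∘ e.symm) L (e p) := by
      rw [hL, ← fderiv_comp_symm_self (coneModel E) p (hhd p)]
      exact (differentiableAt_comp_symm (coneModel E) p (mem_extChartAt_target p)
        (hhd _)).hasFDerivAt
    have h3 := h1.add ((h2.sub (L.hasFDerivAt.comp (e p) h1)).smul_const w)
    rw [← fderiv_comp_symm_self (coneModel E) p (hf.mdifferentiableAt (by norm_num))]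
    refine h3.fderiv.trans (ContinuousLinearMap.ext fun X ↦ ?_)
    simp
  obtain ⟨φ, hpφ, hφ, -⟩ := exists_localDiffeo (coneModel E) (by norm_num) hf (p := p)
    (by rw [hfd]; exact Function.bijective_id)
  have hk : ∀ y ∈ φ.target, h (φ.symm y) = L y := fun y hy ↦ by
    rw [← hLf, ← hφ _ (φ.map_target hy), φ.right_inv hy]
  obtain ⟨ε, hε, hball⟩ := Metric.isOpen_iff.1 φ.open_target _ (φ.map_source hpφ)
  refine .of_homeomorph φ hpφ (Metric.ball_mem_nhds _ hε) hball ?_ ?_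
  · have h1 : Metric.ball (φ p) ε ∩ {y | h (φ.symm y) < h p} =
        Metric.ball (φ p) ε ∩ {y | L y < h p} := by
      ext y
      refine and_congr_right fun hy ↦ ?_
      rw [mem_ofPred_eq, mem_ofPred_eq, hk y (hball hy)]
    rw [h1]
    exact ((convex_ball _ _).inter (convex_halfSpace_lt L.isBoundedLinearMap.toIsLinearMap _)).isPreconnected
  · rintro y ⟨hy, hyh⟩
    have h2 : Filter.Tendsto (fun t : ℝ ↦ y - t • w) (𝓝[>] 0) (𝓝 y) := by
      refine Filter.Tendsto.mono_left ?_ nhdsWithin_le_nhds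
      exact Continuous.tendsto' (by fun_prop) _ _ (by simp)
    refine mem_closure_of_tendsto h2 ?_
    filter_upwards [h2 (Metric.isOpen_ball.mem_nhds hy), self_mem_nhdsWithin] with t ht ht0
    have h3 : h (φ.symm y) ≤ h p := hyh
    rw [hk y (hball hy)] at h3
    change h (φ.symm (y - t • w)) < h p
    rw [hk _ (hball ht), map_sub, map_smul, hw, smul_eq_mul, mul_one]
    exact (sub_lt_self _ ht0).trans_le h3

/-- A critical point of the function on `S` need not be one on the cone. Subtracting `2 * c` times
the Reeb element, whose component is `1 / 2` at radius one, gives a component that vanishes at the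
point in question. On the cone that component is the radius squared times the function on `S` minus
`c`, so both have the same sublevel sets up to the radial factor. -/
theorem sublevelConnectedAt_moment [CompactSpace S] (s₀ : S) (v : LieAlg m) :
    SublevelConnectedAt (fun s ↦ A.moment (s, unitRadius) v) s₀ := by
  set c := A.moment (s₀, unitRadius) v with hc
  set v' := v - (2 * c) • b
  have h1 : ∀ s, A.moment (s, unitRadius) v' = A.moment (s, unitRadius) v - c := fun s ↦ by
    have h2 : ((unitRadius : PosReal) : ℝ) = 1 := rfl
    simp only [v', map_sub, map_smul, moment_reeb hb, h2, smul_eq_mul]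
    ring
  have hr : ∀ q : Cone S, A.moment q v' = (q.2 : ℝ) ^ 2 * (A.moment (q.1, unitRadius) v - c) := by
    intro q
    have h2 := moment_eq_sq_mul hb hA.smooth q.1 unitRadius q.2 v'
    rw [h1, show ((unitRadius : PosReal) : ℝ) = 1 from rfl, one_pow, one_mul] at h2
    exact h2.symm
  have hpos : ∀ q : Cone S, 0 < (q.2 : ℝ) ^ 2 := fun q ↦ pow_pos q.2.2 2
  have hlt : ∀ q : Cone S, A.moment q v' < 0 ↔ A.moment (q.1, unitRadius) v < c := fun q ↦ by
    rw [hr]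
    exact ⟨fun h ↦ by nlinarith [hpos q], fun h ↦ mul_neg_of_pos_of_neg (hpos q) (sub_neg.2 h)⟩
  have hle : ∀ q : Cone S, A.moment q v' ≤ 0 ↔ A.moment (q.1, unitRadius) v ≤ c := fun q ↦ by
    rw [hr]
    exact ⟨fun h ↦ by nlinarith [hpos q],
      fun h ↦ mul_nonpos_of_nonneg_of_nonpos (hpos q).le (sub_nonpos.2 h)⟩
  set p : Cone S := (s₀, unitRadius)
  have hp : A.moment p v' = 0 := by rw [h1]; exact sub_self _
  obtain ⟨l⟩ := exists_localModel hA.smooth p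
  have h2 : SublevelConnectedAt (fun q ↦ A.moment q v') p := by
    by_cases hv : gen E p v' = 0
    · exact (moment_local_of_gen_eq_zero hb hA l hv).1
    · exact moment_local_of_gen_ne_zero hb hA l hv
  rcases h2 with h3 | ⟨N, hN, hN1, hN2⟩
  · left
    have h4 : Filter.Tendsto (fun s : S ↦ (s, unitRadius)) (𝓝 s₀) (𝓝 p) :=
      Continuous.tendsto (by fun_prop) s₀
    filter_upwards [h4.eventually h3] with s hs
    rw [hp, h1] at hs
    exact sub_nonneg.1 hs
  · right
    refine ⟨Prod.fst '' N, isOpenMap_fst.image_mem_nhds hN, ?_, ?_⟩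
    · have h4 : Prod.fst '' N ∩ {s | A.moment (s, unitRadius) v < c} =
          Prod.fst '' (N ∩ {q | A.moment q v' < A.moment p v'}) := by
        ext s
        constructor
        · rintro ⟨⟨q, hq, rfl⟩, hs⟩
          exact ⟨q, ⟨hq, by rw [mem_ofPred_eq, hp, hlt]; exact hs⟩, rfl⟩
        · rintro ⟨q, ⟨hq, hs⟩, rfl⟩
          rw [mem_ofPred_eq, hp, hlt] at hs
          exact ⟨⟨q, hq, rfl⟩, hs⟩
      rw [h4]
      exact hN1.image _ continuous_fst.continuousOn
    · rintro _ ⟨⟨q, hq, rfl⟩, hs⟩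
      have h4 := mem_closure_image (f := Prod.fst) continuousAt_fst
        (hN2 ⟨hq, by simp only [mem_ofPred_eq, hp, hle]; exact hs⟩)
      refine closure_mono ?_ h4
      rintro _ ⟨z, hz, rfl⟩
      simp only [mem_ofPred_eq, hp, hlt] at hz
      exact hz

/-- A component of the moment map that is nonnegative near a point where it vanishes is nonnegative
everywhere. -/
theorem moment_nonneg_of_eventually [CompactSpace S] [ConnectedSpace S] {p : Cone S}
    {v : LieAlg m} (hp : A.moment p v = 0) (h : ∀ᶠ q in 𝓝 p, 0 ≤ A.moment q v) (q : Cone S) :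
    0 ≤ A.moment q v := by
  have : LocallyPathConnectedSpace S := ChartedSpace.locallyPathConnectedSpace E S
  have hr : ∀ q : Cone S, A.moment q v = (q.2 : ℝ) ^ 2 * A.moment (q.1, unitRadius) v := by
    intro q
    have h2 := moment_eq_sq_mul hb hA.smooth q.1 unitRadius q.2 v
    rw [show ((unitRadius : PosReal) : ℝ) = 1 from rfl, one_pow, one_mul] at h2
    exact h2.symm
  have hpos : ∀ q : Cone S, 0 < (q.2 : ℝ) ^ 2 := fun q ↦ pow_pos q.2.2 2
  have hp' : A.moment (p.1, unitRadius) v = 0 := by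
    have h1 := hr p
    rw [hp] at h1
    exact (mul_eq_zero.1 h1.symm).resolve_left (hpos p).ne'
  have h1 : ∀ s, A.moment (p.1, unitRadius) v ≤ A.moment (s, unitRadius) v := by
    refine le_of_eventually_le_of_sublevelConnectedAt (X := S) ?_
      (fun s ↦ sublevelConnectedAt_moment hb hA s v) ?_
    · exact (A.contMDiff_moment hb hA v).continuous.comp (by fun_prop)
    · have h4 : Filter.Tendsto (fun s : S ↦ (s, p.2)) (𝓝 p.1) (𝓝 p) :=
        Continuous.tendsto (by fun_prop) p.1
      filter_upwards [h4.eventually h] with s hs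
      rw [hr] at hs
      rw [hp']
      exact nonneg_of_mul_nonneg_right hs (hpos (s, p.2))
  rw [hr]
  exact mul_nonneg (hpos q).le (hp' ▸ h1 q.1)

end MomentLocal

/-! ### Primitive vectors on rational lines -/

section Rational

variable {m : ℕ}

theorem mem_lattice_iff {v : LieAlg m} :
    v ∈ lattice m ↔ ∃ n : Fin m → ℤ, ∀ k, v k = 2 * Real.pi * n k := by
  have h1 : v ∈ lattice m ↔ ∀ k, Circle.exp (v k) = 1 := by
    unfold lattice torusExp
    exact funext_iff
  rw [h1, ← Classical.skolem (p := fun k (n : ℤ) ↦ v k = 2 * Real.pi * n)]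
  refine forall_congr' fun k ↦ ?_
  rw [Circle.exp_eq_one]
  exact exists_congr fun n ↦ by rw [mul_comm]

/-- A rational line contains a positive primitive multiple of each of its nonzero vectors. -/
theorem exists_isPrimitive_smul {v : LieAlg m} (hv : v ≠ 0) {T : Set (Fin m → ℤ)}
    (hvT : ∀ n ∈ T, weight n v = 0)
    (hT : ∀ w : LieAlg m, (∀ n ∈ T, weight n w = 0) → ∃ a : ℝ, w = a • v) :
    ∃ s : ℝ, 0 < s ∧ IsPrimitive (s • v) := by
  classical
  -- The weights in `T` span a proper rational subspace because `v ≠ 0`. A nonzero rational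
  -- functional vanishing on it is a rational point of the line of `v`.
  set W : Submodule ℚ (Fin m → ℚ) := Submodule.span ℚ ((fun n k ↦ (n k : ℚ)) '' T)
  have hW : W < ⊤ := by
    rw [lt_top_iff_ne_top]
    intro htop
    refine hv (funext fun k ↦ ?_)
    let f : (Fin m → ℚ) →ₗ[ℚ] ℝ := ∑ i, (LinearMap.toSpanSingleton ℚ ℝ (v i)) ∘ₗ LinearMap.proj i
    have hf : ∀ q, f q = ∑ i, (q i : ℝ) * v i := fun q ↦ by
      simp [f, Rat.smul_def]
    have h1 : W ≤ LinearMap.ker f := by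
      refine Submodule.span_le.2 ?_
      rintro _ ⟨n, hn, rfl⟩
      have := hvT n hn
      rw [weight_apply] at this
      simpa [hf] using this
    have h2 : f (Pi.single k 1) = 0 := h1 (htop ▸ Submodule.mem_top)
    rw [hf, Finset.sum_eq_single k] at h2
    · simpa using h2
    · intro i _ hi
      simp [hi]
    · simp
  obtain ⟨f, hf0, hf⟩ := Submodule.exists_le_ker_of_lt_top W hW
  set q : Fin m → ℚ := fun k ↦ f (Pi.single k 1)
  have hq : ∀ x, f x = ∑ k, x k * q k := fun x ↦ by
    conv_lhs => rw [← Finset.univ_sum_single x]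
    rw [map_sum]
    refine Finset.sum_congr rfl fun k _ ↦ ?_
    rw [show (Pi.single k (x k) : Fin m → ℚ) = x k • Pi.single k 1 by
      rw [← Pi.single_smul, smul_eq_mul, mul_one], map_smul, smul_eq_mul]
  have hq0 : q ≠ 0 := fun h ↦ hf0 (LinearMap.ext fun x ↦ by simp [hq, h])
  obtain ⟨⟨d, hd⟩, hdq⟩ := IsLocalization.exist_integer_multiples_of_finite (nonZeroDivisors ℤ) q
  choose z hz using hdq
  have hd0 : (d : ℚ) ≠ 0 := by exact_mod_cast nonZeroDivisors.ne_zero hd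
  have hz' : ∀ k, (z k : ℚ) = d * q k := fun k ↦ by simpa using hz k
  obtain ⟨k₀, hk₀⟩ := Function.ne_iff.1 hq0
  have hzk₀ : z k₀ ≠ 0 := by
    intro h
    have := hz' k₀
    rw [h] at this
    simp [hd0] at this
    exact hk₀ this
  -- Denominators have been cleared; dividing by the greatest common divisor makes the integral
  -- vector primitive.
  obtain ⟨w, hw, hw1⟩ := Finset.extract_gcd (s := Finset.univ) z ⟨k₀, Finset.mem_univ _⟩
  set G : ℤ := Finset.univ.gcd z
  have hG0 : (G : ℚ) ≠ 0 := by
    intro h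
    have h' : G = 0 := by exact_mod_cast h
    rw [hw k₀ (Finset.mem_univ _), h', zero_mul] at hzk₀
    exact hzk₀ rfl
  have hwT : ∀ n ∈ T, weight n (fun k ↦ (w k : ℝ)) = 0 := by
    intro n hn
    have h1 : f (fun k ↦ (n k : ℚ)) = 0 := hf (Submodule.subset_span ⟨n, hn, rfl⟩)
    have h2 : ∑ k, (n k : ℚ) * w k = 0 := by
      have h3 : ∀ k, (G : ℚ) * w k = d * q k := fun k ↦ by
        rw [← hz', hw k (Finset.mem_univ _)]; push_cast; rfl
      rw [hq] at h1
      have h4 : (G : ℚ) * ∑ k, (n k : ℚ) * w k = d * ∑ k, (n k : ℚ) * q k := by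
        rw [Finset.mul_sum, Finset.mul_sum]
        refine Finset.sum_congr rfl fun k _ ↦ ?_
        linear_combination (n k : ℚ) * h3 k
      rw [h1, mul_zero] at h4
      exact (mul_eq_zero.1 h4).resolve_left hG0
    rw [weight_apply]
    exact_mod_cast h2
  obtain ⟨a, ha⟩ := hT _ hwT
  have hw0 : w k₀ ≠ 0 := by
    intro h
    rw [hw k₀ (Finset.mem_univ _), h, mul_zero] at hzk₀
    exact hzk₀ rfl
  have hak : ∀ k, (w k : ℝ) = a * v k := fun k ↦ congrFun ha k
  have ha0 : a ≠ 0 := by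
    rintro rfl
    have := hak k₀
    rw [zero_mul] at this
    exact hw0 (by exact_mod_cast this)
  -- Replacing `w` by `-w` if necessary makes the multiple of `v` positive.
  obtain ⟨u, hu, hu1⟩ : ∃ u : Fin m → ℤ, (∀ k, (u k : ℝ) = |a| * v k) ∧
      ∀ n : ℕ, (∀ k, (n : ℤ) ∣ u k) → n = 1 := by
    have hgcd : ∀ n : ℕ, (∀ k, (n : ℤ) ∣ w k) → n = 1 := fun n hn ↦ by
      have h1 : (n : ℤ) ∣ Finset.univ.gcd w := Finset.dvd_gcd fun k _ ↦ hn k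
      rw [hw1] at h1
      exact Int.natCast_dvd_natCast.1 (by simpa using h1) |> Nat.dvd_one.1
    rcases le_total 0 a with h | h
    · exact ⟨w, fun k ↦ by rw [abs_of_nonneg h, hak], hgcd⟩
    · refine ⟨-w, fun k ↦ ?_, fun n hn ↦ hgcd n fun k ↦ ?_⟩
      · rw [abs_of_nonpos h, Pi.neg_apply, Int.cast_neg, hak]; ring
      · exact (dvd_neg.1 (hn k))
  have hpi : (0 : ℝ) < 2 * Real.pi := by positivity
  -- The integral lattice is `2π` times the standard one.
  refine ⟨2 * Real.pi * |a|, mul_pos hpi (abs_pos.2 ha0), ?_, ?_, ?_⟩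
  · refine mem_lattice_iff.2 ⟨u, fun k ↦ ?_⟩
    rw [hu, Pi.smul_apply, smul_eq_mul, mul_assoc]
  · exact smul_ne_zero (mul_pos hpi (abs_pos.2 ha0)).ne' hv
  · intro n x hx hnx
    obtain ⟨y, hy⟩ := mem_lattice_iff.1 hx
    refine hu1 n fun k ↦ ⟨y k, ?_⟩
    have h1 := congrFun hnx k
    rw [Pi.smul_apply, Pi.smul_apply, hy, nsmul_eq_mul, smul_eq_mul, mul_assoc _ |a|, ← hu] at h1
    have h2 : (u k : ℝ) = n * y k := by
      refine mul_left_cancel₀ hpi.ne' ?_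
      rw [← h1]; ring
    exact_mod_cast h2

end Rational

/-! ### Isotropy algebras are spanned by facet normals -/

section FacetNormals

variable {m : ℕ}

/-- Duality: the span of `F` has as coannihilator the line of `v`, and the two dimensions add up to
`m`. -/
theorem finrank_span_of_coannihilator_line {F : Set (DualLieAlg m)} {v : LieAlg m} (hv : v ≠ 0)
    (hF : ∀ y ∈ F, y v = 0) (h : ∀ u : LieAlg m, (∀ y ∈ F, y u = 0) → ∃ a : ℝ, u = a • v) :
    finrank ℝ (Submodule.span ℝ F) + 1 = m := by
  let T : DualLieAlg m ≃ₗ[ℝ] Dual ℝ (LieAlg m) :=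
    (LinearMap.toContinuousLinearMap : (LieAlg m →ₗ[ℝ] ℝ) ≃ₗ[ℝ] DualLieAlg m).symm
  set W : Subspace ℝ (Dual ℝ (LieAlg m)) := (Submodule.span ℝ F).map (T : DualLieAlg m →ₗ[ℝ] _)
  have h1 : finrank ℝ W = finrank ℝ (Submodule.span ℝ F) := LinearEquiv.finrank_map_eq T _
  have h2 : W.dualCoannihilator = Submodule.span ℝ {v} := by
    ext u
    rw [Submodule.mem_dualCoannihilator, Submodule.mem_span_singleton]
    constructor
    · intro hu
      obtain ⟨a, ha⟩ := h u fun y hy ↦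
        hu (T y) (Submodule.mem_map_of_mem (Submodule.subset_span hy))
      exact ⟨a, ha.symm⟩
    · rintro ⟨a, rfl⟩ _ ⟨y, hy, rfl⟩
      change y (a • v) = 0
      rw [map_smul]
      have h3 : y v = 0 := by
        induction hy using Submodule.span_induction with
        | mem y hy => exact hF y hy
        | zero => rfl
        | add x y _ _ hx hy => rw [add_apply, hx, hy, add_zero]
        | smul a x _ hx => rw [smul_apply, hx, smul_zero]
      rw [h3, smul_zero]
  have h3 := Subspace.finrank_add_finrank_dualCoannihilator_eq W
  rw [h2, finrank_span_singleton hv, h1] at h3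
  simpa using h3

variable {E : Type*} [NormedAddCommGroup E] [NormedSpace ℝ E] [FiniteDimensional ℝ E]
  {S : Type*} [TopologicalSpace S] [ChartedSpace E S] [IsManifold 𝓘(ℝ, E) ∞ S] [T2Space S]
  [CompactSpace S] [MulAction (Torus m) S] {A : SasakiStructure E S}
  {b : LieAlg m} (hb : ∀ p : Cone S, generator E p b = A.reeb p) (hA : A.IsToric m)

omit [T2Space S] [CompactSpace S] in
theorem LocalModel.exists_localDiffeo {p : Cone S} (l : LocalModel E m p) :
    ∃ φ : OpenPartialHomeomorph (Cone S) (E × ℝ), p ∈ φ.source ∧ (∀ q ∈ φ.source, φ q = l.Ψ q) ∧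
      ∀ y ∈ φ.target, ContMDiffAt 𝓘(ℝ, E × ℝ) (coneModel E) 2 φ.symm y :=
  ToricSasaki.exists_localDiffeo (coneModel E) (by norm_num) l.contMDiff
    (by rw [l.mD_self]; exact Function.bijective_id)

include hb hA

/-- The components of the moment map that vanish on the face `{⟨y, v⟩ = 0}`. -/
theorem gen_eq_zero_of_face {p : Cone S} {v u : LieAlg m} (hv : gen E p v = 0)
    (h : ∀ q, A.moment q v = 0 → A.moment q u = 0) : gen E p u = 0 := by
  obtain ⟨l⟩ := exists_localModel hA.smooth p
  obtain ⟨φ, hpφ, hφ, hs⟩ := l.exists_localDiffeo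
  have hsd : ∀ y ∈ φ.target, MDifferentiableAt 𝓘(ℝ, E × ℝ) (coneModel E) φ.symm y :=
    fun y hy ↦ (hs y hy).mdifferentiableAt (by norm_num)
  have hΨd := l.contMDiff.mdifferentiable (by norm_num)
  have hφp : φ p = 0 := by rw [hφ p hpφ, l.map_self]
  have h0t : (0 : E × ℝ) ∈ φ.target := hφp ▸ φ.map_source hpφ
  have hφ0 : φ.symm 0 = p := by rw [← hφp, φ.left_inv hpφ]
  have hid : ∀ X, mD 𝓘(ℝ, E × ℝ) (coneModel E) φ.symm 0 X = X := fun X ↦ by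
    have h1 := mD_mD_symm (coneModel E) hφ hsd hΨd h0t X
    rwa [hφ0, l.mD_self] at h1
  -- `l.B v` kills `Y`, so the chart line `t • Y` consists of zeros of the field of `v`, where `⟨μ,
  -- v⟩` and hence `⟨μ, u⟩` vanish. The derivative of `⟨μ, u⟩` along it at `p` is `-|gen E p u|²`.
  set Y := A.cJ p (gen E p u)
  have hBY : l.B v Y = 0 := by
    refine (l.B_J hA hv _).trans ?_
    rw [l.B_gen hA hv]
    exact (A.cJ p).map_zero
  have hzero : (fun t : ℝ ↦ A.moment (φ.symm (t • Y)) u) =ᶠ[𝓝 0] fun _ ↦ 0 := by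
    have h1 : Filter.Tendsto (fun t : ℝ ↦ t • Y) (𝓝 0) (𝓝 0) :=
      Continuous.tendsto' (by fun_prop) _ _ (zero_smul ℝ Y)
    filter_upwards [h1 (φ.open_target.mem_nhds h0t)] with t ht
    refine h _ (moment_eq_zero hb ?_)
    rw [← mD_symm_mD (coneModel E) hφ hsd hΨd ht (gen E _ v), l.mD_gen v hv,
      ← hφ _ (φ.map_target ht), φ.right_inv ht, map_smul, hBY, smul_zero, map_zero]
  have hline : HasDerivAt (fun t : ℝ ↦ t • Y) Y 0 := by
    simpa using (hasDerivAt_id (0 : ℝ)).smul_const Y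
  have hd1 : MDifferentiableAt 𝓘(ℝ, ℝ) 𝓘(ℝ, E × ℝ) (fun t : ℝ ↦ t • Y) 0 :=
    hline.differentiableAt.mdifferentiableAt
  have hd2 : MDifferentiableAt 𝓘(ℝ, E × ℝ) (coneModel E) φ.symm ((0 : ℝ) • Y) := by
    rw [zero_smul]; exact hsd 0 h0t
  have h2 := mD_comp_apply 𝓘(ℝ, ℝ) (coneModel E) 𝓘(ℝ, ℝ) (f := fun t : ℝ ↦ φ.symm (t • Y))
    (g := fun q : Cone S ↦ A.moment q u) (p := (0 : ℝ))
    ((A.contMDiff_moment hb hA u).mdifferentiableAt (by simp)) (hd2.comp (0 : ℝ) hd1) 1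
  rw [mD_congr _ _ hzero, mD_const, mD_comp_apply 𝓘(ℝ, ℝ) 𝓘(ℝ, E × ℝ) (coneModel E)
    (f := fun t : ℝ ↦ t • Y) (g := φ.symm) hd2 hd1, mD_eq_fderiv, hline.hasFDerivAt.fderiv] at h2
  simp only [zero_smul, hφ0, ContinuousLinearMap.toSpanSingleton_apply, one_smul, hid,
    mD_moment_eq hb hA] at h2
  by_contra hne
  have h3 := A.isKaehler.pos p _ hne
  have h4 : coneForm A.g p (A.cJ p (gen E p u)) Y = coneForm A.g p (gen E p u) (gen E p u) :=
    A.isKaehler.compat p _ _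
  rw [h4] at h2
  exact h3.ne' (neg_eq_zero.1 h2.symm)

/-- A vector of the isotropy algebra spanning the isotropy algebra at nearby points, and whose
component of the moment map is nonnegative, is a positive multiple of a facet normal. -/
theorem exists_smul_mem_facetNormals {p : Cone S} {v : LieAlg m} (hv0 : v ≠ 0) (hv : gen E p v = 0)
    (hline : ∀ u, gen E p u = 0 → ∃ a : ℝ, u = a • v) {T : Set (Fin m → ℤ)}
    (hT : ∀ u : LieAlg m, gen E p u = 0 ↔ ∀ n ∈ T, weight n u = 0)
    (hpos : ∀ q, 0 ≤ A.moment q v) :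
    ∃ s : ℝ, 0 < s ∧ s • v ∈ facetNormals (A.momentImage m) := by
  obtain ⟨s, hs, hprim⟩ := exists_isPrimitive_smul hv0 ((hT v).1 hv)
    (fun w hw ↦ hline w ((hT w).2 hw))
  refine ⟨s, hs, hprim, ?_, ?_⟩
  · rintro _ ⟨q, rfl⟩
    rw [map_smul, smul_eq_mul]
    exact mul_nonneg hs.le (hpos q)
  · have hsv : ∀ y : DualLieAlg m, y (s • v) = 0 ↔ y v = 0 := fun y ↦ by
      rw [map_smul, smul_eq_mul, mul_eq_zero, or_iff_right hs.ne']
    refine finrank_span_of_coannihilator_line hv0 (fun y hy ↦ (hsv y).1 hy.2) fun u hu ↦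
      hline u (gen_eq_zero_of_face hb hA hv fun q hq ↦ ?_)
    exact hu _ ⟨⟨q, rfl⟩, (hsv _).2 hq⟩

/-- The isotropy algebra of a point is spanned by the normals of the facets through its image under
the moment map. -/
theorem mem_zSpan_of_gen_eq_zero [ConnectedSpace S] (hdim : finrank ℝ E + 1 = 2 * m) {p : Cone S}
    {v : LieAlg m} (hv : gen E p v = 0) : v ∈ zSpan (A.momentImage m) (A.moment p) := by
  classical
  obtain ⟨l⟩ := exists_localModel hA.smooth p
  obtain ⟨k, β, e, he, hBe, hX⟩ := exists_isotropy_basis hA hdim hb l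
  have hK := A.isKaehler
  have hJJ : ∀ X, A.cJ p (A.cJ p X) = -X := fun X ↦ hK.J_sq p X
  have hBJ : ∀ i X, l.B (β i).1 (A.cJ p X) = A.cJ p (l.B (β i).1 X) :=
    fun i X ↦ l.B_J hA (β i).2 X
  have hBg : ∀ i u, l.B (β i).1 (gen E p u) = 0 := fun i u ↦ l.B_gen hA (β i).2 u
  suffices h : ∀ i, (β i).1 ∈ zSpan (A.momentImage m) (A.moment p) by
    have h1 : v = ∑ i, β.repr ⟨v, hv⟩ i • (β i).1 := by
      have h2 := congrArg (Submodule.subtype _) (β.sum_repr ⟨v, hv⟩)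
      rw [map_sum] at h2
      exact h2.symm
    rw [h1]
    exact Submodule.sum_mem _ fun i _ ↦ Submodule.smul_mem _ _ (h i)
  intro i
  have hi0 : (β i).1 ≠ 0 := fun h ↦ β.ne_zero i (Subtype.ext h)
  have hpos : ∀ q, 0 ≤ A.moment q (β i).1 := by
    refine moment_nonneg_of_eventually hb hA (moment_eq_zero hb (β i).2)
      ((moment_local_of_gen_eq_zero hb hA l (β i).2).2 fun X ↦ ?_)
    -- The Hessian operator of `⟨μ, β i⟩` is the projection to the weight line of `e i`. Being
    -- idempotent and symmetric, it is nonnegative.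
    have hP : ∀ X, -A.cJ p (l.B (β i).1 (-A.cJ p (l.B (β i).1 X))) = -A.cJ p (l.B (β i).1 X) := by
      intro X
      obtain ⟨x, y, c, d, rfl⟩ := hX X
      have h1 : l.B (β i).1 (gen E p x + A.cJ p (gen E p y) +
          ∑ j, (c j • e j + d j • A.cJ p (e j))) = c i • A.cJ p (e i) - d i • e i := by
        simp only [map_add, map_sum, map_smul, hBJ, hBg, hBe, map_zero, add_zero, zero_add]
        rw [Finset.sum_eq_single i]
        · simp [hJJ, sub_eq_add_neg]
        · intro j _ hj
          simp [hj.symm]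
        · simp
      rw [h1]
      simp [hBJ, hBe, hJJ, add_comm]
    have h2 : ∀ X Y, coneForm A.g p (-A.cJ p (l.B (β i).1 X)) Y =
        coneForm A.g p X (-A.cJ p (l.B (β i).1 Y)) := fun X Y ↦ by
      have hJl : ∀ X Y, coneForm A.g p (A.cJ p X) Y = -coneForm A.g p X (A.cJ p Y) :=
        fun X Y ↦ hK.J_left p X Y
      rw [map_neg, neg_apply, hJl, neg_neg, l.B_skew hA (β i).2, hBJ, map_neg]
    rw [← hP X, h2]
    by_cases h3 : -A.cJ p (l.B (β i).1 X) = 0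
    · rw [h3, map_zero]
    · exact (hK.pos p _ h3).le
  obtain ⟨φ, hpφ, hφ, hs⟩ := l.exists_localDiffeo
  have hφp : φ p = 0 := by rw [hφ p hpφ, l.map_self]
  have h0t : (0 : E × ℝ) ∈ φ.target := hφp ▸ φ.map_source hpφ
  have hφ0 : φ.symm 0 = p := by rw [← hφp, φ.left_inv hpφ]
  -- The direction `Y` has a component in every weight line but the one with index `i`. At points `t
  -- • Y` near `p` the isotropy algebra therefore shrinks to the line of `β i`.
  set Y : E × ℝ := ∑ j ∈ Finset.univ.erase i, e j
  have hBY : ∀ a : Fin k → ℝ, l.B (∑ j, a j • (β j).1) Y =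
      ∑ j ∈ Finset.univ.erase i, a j • A.cJ p (e j) := by
    intro a
    simp only [Y, map_sum, map_smul, sum_apply, smul_apply, hBe]
    refine Finset.sum_congr rfl fun j _ ↦ ?_
    simp
  have htY : Filter.Tendsto (fun t : ℝ ↦ t • Y) (𝓝[>] 0) (𝓝 0) := by
    refine Filter.Tendsto.mono_left ?_ nhdsWithin_le_nhds
    exact Continuous.tendsto' (by fun_prop) _ _ (zero_smul ℝ Y)
  have htend : Filter.Tendsto (fun t : ℝ ↦ φ.symm (t • Y)) (𝓝[>] 0) (𝓝 p) := by
    have h2 := φ.continuousAt_symm h0t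
    rw [ContinuousAt, hφ0] at h2
    exact h2.comp htY
  have htgt : ∀ᶠ t : ℝ in 𝓝[>] 0, t • Y ∈ φ.target :=
    htY (φ.open_target.mem_nhds h0t)
  obtain ⟨t, ⟨T, hT⟩, hker, hbij, ht, ht0⟩ := ((htend.eventually l.isotropy).and
    ((htend.eventually l.ker_le).and ((htend.eventually l.eventually_bijective).and
      (htgt.and self_mem_nhdsWithin)))).exists
  set p' := φ.symm (t • Y)
  have ht0' : t ≠ 0 := ne_of_gt ht0
  have hΨp' : l.Ψ p' = t • Y := by rw [← hφ _ (φ.map_target ht), φ.right_inv ht]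
  have hgen : ∀ a : Fin k → ℝ, mD (coneModel E) 𝓘(ℝ, E × ℝ) l.Ψ p'
      (gen E p' (∑ j, a j • (β j).1)) = t • ∑ j ∈ Finset.univ.erase i, a j • A.cJ p (e j) := by
    intro a
    rw [l.mD_gen _ (by
      simp only [map_sum, map_smul]
      exact Finset.sum_eq_zero fun j _ ↦ by
        rw [show gen E p (β j).1 = 0 from (β j).2, smul_zero]), hΨp', map_smul, hBY]
  have hgi : gen E p' (β i).1 = 0 := by
    refine hbij.1 ?_
    have h1 := hgen (Pi.single i 1)
    rw [Finset.sum_eq_single i (by intro j _ hj; simp [hj]) (by simp)] at h1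
    rw [Pi.single_eq_same, one_smul] at h1
    rw [h1, map_zero, Finset.sum_eq_zero, smul_zero]
    intro j hj
    rw [Pi.single_eq_of_ne (Finset.ne_of_mem_erase hj), zero_smul]
  have hline : ∀ u, gen E p' u = 0 → ∃ a : ℝ, u = a • (β i).1 := by
    intro u hu
    set a := β.repr ⟨u, hker u hu⟩
    have h1 : u = ∑ j, a j • (β j).1 := by
      have h2 := congrArg (Submodule.subtype _) (β.sum_repr ⟨u, hker u hu⟩)
      rw [map_sum] at h2
      exact h2.symm
    have h2 := hgen a
    rw [← h1, hu, map_zero] at h2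
    have h3 : ∑ j ∈ Finset.univ.erase i, a j • A.cJ p (e j) = 0 :=
      (smul_eq_zero.1 h2.symm).resolve_left ht0'
    refine ⟨a i, ?_⟩
    rw [h1, Finset.sum_eq_single i]
    · intro j _ hj
      have h4 := congrArg (l.B (β j).1) h3
      simp only [map_sum, map_smul, hBJ, hBe, map_zero] at h4
      rw [Finset.sum_eq_single j] at h4
      · rw [if_pos rfl, hJJ, smul_neg, neg_eq_zero, smul_eq_zero] at h4
        rw [h4.resolve_right (he j), zero_smul]
      · intro j' _ hj'
        simp [hj'.symm]
      · intro h; exact absurd (Finset.mem_erase.2 ⟨hj, Finset.mem_univ _⟩) h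
    · simp
  obtain ⟨s, hs0, hsm⟩ := exists_smul_mem_facetNormals hb hA hi0 hgi hline hT hpos
  have h1 : (β i).1 = s⁻¹ • s • (β i).1 := by rw [smul_smul, inv_mul_cancel₀ hs0.ne', one_smul]
  rw [h1]
  refine Submodule.smul_mem _ _ (Submodule.subset_span ⟨hsm, ?_⟩)
  rw [map_smul, moment_eq_zero hb (β i).2, smul_zero]

end FacetNormals

/-! ### The differential of the conjugation and isotropy of the real form -/

section Conjugation

variable {E : Type*} [NormedAddCommGroup E] [NormedSpace ℝ E]
  {S : Type*} [TopologicalSpace S] [ChartedSpace E S] [IsManifold 𝓘(ℝ, E) ∞ S]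
  {m : ℕ} [MulAction (Torus m) S] {A : SasakiStructure E S}
  {σ : Cone S → Cone S} (hσ : A.IsToricConjugation m σ)
include hσ

namespace SasakiStructure.IsToricConjugation

theorem mdifferentiable : MDifferentiable (coneModel E) (coneModel E) σ :=
  hσ.smooth.mdifferentiable (by simp)

theorem mD_J (q : Cone S) (X : E × ℝ) :
    mD (coneModel E) (coneModel E) σ q (A.cJ q X) =
      -A.cJ (σ q) (mD (coneModel E) (coneModel E) σ q X) := hσ.antiholomorphic q X

theorem torusAct_exp (v : LieAlg m) (q : Cone S) :
    σ (torusAct (torusExp v) q) = torusAct (torusExp (-v)) (σ q) := by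
  rw [hσ.equivariant]
  have h1 : torusExp v * torusExp (-v) = 1 := by
    rw [← torusExp_add, add_neg_cancel, torusExp_zero]
  rw [inv_eq_of_mul_eq_one_right h1]

theorem mD_mD {p : Cone S} (hp : σ p = p) (X : E × ℝ) :
    mD (coneModel E) (coneModel E) σ p (mD (coneModel E) (coneModel E) σ p X) = X := by
  have h1 := mD_comp_apply (coneModel E) (coneModel E) (coneModel E) (f := σ) (g := σ) (p := p)
    (hσ.mdifferentiable _) (hσ.mdifferentiable _) X
  simp only [hσ.involutive, hp] at h1
  rw [mD_id] at h1
  exact h1.symm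

theorem mD_gen (h : IsSmoothTorusAction E S m) (q : Cone S) (v : LieAlg m) :
    mD (coneModel E) (coneModel E) σ q (gen E q v) = -gen E (σ q) v := by
  have hs := isSmooth_torusVectorAction h
  have hq : torusAct (torusExp (0 : LieAlg m)) q = q := by rw [torusExp_zero, torusAct_one]
  have h1 := mD_comp_apply 𝓘(ℝ, LieAlg m) (coneModel E) (coneModel E)
    (f := fun w : LieAlg m ↦ torusAct (torusExp w) q) (g := σ) (p := 0) (hσ.mdifferentiable _)
    (hs.mdifferentiableAt_orbit q 0) v
  have hn : HasFDerivAt (fun w : LieAlg m ↦ -w) (-ContinuousLinearMap.id ℝ (LieAlg m)) 0 :=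
    (hasFDerivAt_id _).neg
  have h2 := mD_comp_apply 𝓘(ℝ, LieAlg m) 𝓘(ℝ, LieAlg m) (coneModel E) (f := fun w : LieAlg m ↦ -w)
    (g := fun w : LieAlg m ↦ torusAct (torusExp w) (σ q)) (p := 0)
    (hs.mdifferentiableAt_orbit (σ q) _) hn.differentiableAt.mdifferentiableAt v
  simp only [hσ.torusAct_exp, hq] at h1
  rw [h2, mD_eq_fderiv, hn.fderiv, neg_zero] at h1
  refine h1.symm.trans ?_
  exact (gen E (σ q)).map_neg v

/-- The position vector is `-J` of the Reeb field; `σ` reverses the sign of both `J` and the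
generator. -/
theorem mD_positionVector (h : IsSmoothTorusAction E S m) {b : LieAlg m}
    (hb : ∀ p : Cone S, generator E p b = A.reeb p) (q : Cone S) :
    mD (coneModel E) (coneModel E) σ q (positionVector (E := E) q) =
      positionVector (E := E) (σ q) := by
  have h1 : ∀ q, (positionVector q : E × ℝ) = -A.cJ q (gen E q b) := fun q ↦ A.positionVector_eq hb q
  rw [h1, h1, map_neg, hσ.mD_J, hσ.mD_gen h, map_neg, neg_neg]

/-- Differentiate at `t = 0` the relation between `σ ∘ exp(tv)` and `exp(-tv) ∘ σ` on tangent
vectors at `p`. -/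
theorem mD_B (h : IsSmoothTorusAction E S m) {p : Cone S} (hp : σ p = p) (l : LocalModel E m p)
    {v : LieAlg m} (hv : gen E p v = 0) (X : E × ℝ) :
    mD (coneModel E) (coneModel E) σ p (l.B v X) =
      -l.B v (mD (coneModel E) (coneModel E) σ p X) := by
  set D := mD (coneModel E) (coneModel E) σ p
  have hs := isSmooth_torusVectorAction h
  have h1 := D.hasFDerivAt.comp_hasDerivAt 0 (l.hasDerivAt v hv X)
  have hn : HasDerivAt (fun t : ℝ ↦ -t) (-1) 0 := hasDerivAt_neg 0
  have h2 : HasDerivAt (fun t : ℝ ↦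
      mD (coneModel E) (coneModel E) (torusAct (torusExp (t • v))) p (D X)) (l.B v (D X)) (-0) := by
    rw [neg_zero]
    exact l.hasDerivAt v hv (D X)
  have h3 := h2.scomp (0 : ℝ) hn
  rw [neg_one_smul] at h3
  refine h1.unique (h3.congr_of_eventuallyEq (.of_forall fun t ↦ ?_))
  have h4 : (fun q ↦ σ (torusAct (torusExp (t • v)) q)) =
      fun q ↦ torusAct (torusExp ((-t) • v)) (σ q) := by
    funext q
    rw [hσ.torusAct_exp, neg_smul]
  have h5 := mD_comp_apply (coneModel E) (coneModel E) (coneModel E)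
    (f := torusAct (torusExp (t • v))) (g := σ) (p := p)
    (hσ.mdifferentiable _) (hs.mdifferentiableAt_map _ _) X
  have h6 := mD_comp_apply (coneModel E) (coneModel E) (coneModel E)
    (f := σ) (g := torusAct (torusExp ((-t) • v))) (p := p)
    (hs.mdifferentiableAt_map _ _) (hσ.mdifferentiable _) X
  rw [← h4, h5, torusAct_exp_eq_self h hv] at h6
  simp only [hp] at h6
  exact h6

/-- An anti-holomorphic involution compatible with the torus action commutes with dilations. -/
theorem scale_comm (h : IsSmoothTorusAction E S m) {b : LieAlg m}
    (hb : ∀ p : Cone S, generator E p b = A.reeb p) (ρ : PosReal) (q : Cone S) :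
    σ (scale ρ q) = scale ρ (σ q) := by
  let e : ℝ → PosReal := fun t ↦ ⟨Real.exp t, Real.exp_pos t⟩
  set c : ℝ → Cone S := fun t ↦ scale (e t) q with hc
  have hcsm : ContMDiff 𝓘(ℝ, ℝ) (coneModel E) ∞ c := by
    refine ContMDiff.prodMk contMDiff_const (contMDiff_posReal_iff.2 ?_)
    exact (Real.contDiff_exp.mul contDiff_const).contMDiff
  have hcd : ∀ t, mD 𝓘(ℝ, ℝ) (coneModel E) c t 1 = positionVector (E := E) (c t) := by
    intro t
    have h1 : MDifferentiableAt 𝓘(ℝ, ℝ) 𝓘(ℝ, ℝ) (fun t ↦ (c t).2) t :=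
      (contMDiff_snd.comp hcsm).mdifferentiableAt (by simp)
    have h2 := mD_prodMk (f := fun t ↦ (c t).1) (r := fun t ↦ (c t).2)
      (mdifferentiableAt_const (I' := 𝓘(ℝ, E))) h1
    have h3 : HasDerivAt (fun t ↦ ((c t).2 : ℝ)) (Real.exp t * q.2) t :=
      (Real.hasDerivAt_exp t).mul_const _
    refine (congrArg (fun L : ℝ →L[ℝ] E × ℝ ↦ L 1) h2).trans (Prod.ext ?_ ?_)
    · exact congrArg (fun L : ℝ →L[ℝ] E ↦ L 1) (mD_const 𝓘(ℝ, ℝ) 𝓘(ℝ, E) t q.1)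
    · change mD 𝓘(ℝ, ℝ) 𝓘(ℝ, ℝ) (fun t ↦ ((c t).2 : ℝ)) t 1 = _
      rw [mD_eq_fderiv, h3.hasFDerivAt.fderiv]
      simp
      rfl
  have hσc : ContMDiff 𝓘(ℝ, ℝ) (coneModel E) ∞ fun t ↦ σ (c t) := hσ.smooth.comp hcsm
  -- The curve `σ ∘ c` is again an integral curve of the position vector: its component in `S` is
  -- constant and its radius grows like `exp t`.
  have hσcd : ∀ t, mD 𝓘(ℝ, ℝ) (coneModel E) (fun t ↦ σ (c t)) t 1 =
      positionVector (E := E) (σ (c t)) := by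
    intro t
    rw [mD_comp_apply 𝓘(ℝ, ℝ) (coneModel E) (coneModel E) (hσ.mdifferentiable _)
      (hcsm.mdifferentiableAt (by simp)), hcd, hσ.mD_positionVector h hb]
  have h1 : MDifferentiable 𝓘(ℝ, ℝ) 𝓘(ℝ, E) fun t ↦ (σ (c t)).1 :=
    (contMDiff_fst.comp hσc).mdifferentiable (by simp)
  have h2 : MDifferentiable 𝓘(ℝ, ℝ) 𝓘(ℝ, ℝ) fun t ↦ (σ (c t)).2 :=
    (contMDiff_snd.comp hσc).mdifferentiable (by simp)
  have h3 : ∀ t, (mD 𝓘(ℝ, ℝ) 𝓘(ℝ, E) (fun t ↦ (σ (c t)).1) t 1,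
      mD 𝓘(ℝ, ℝ) 𝓘(ℝ, ℝ) (fun t ↦ ((σ (c t)).2 : ℝ)) t 1) = ((0 : E), ((σ (c t)).2 : ℝ)) := by
    intro t
    have := hσcd t
    rw [show (fun t ↦ σ (c t)) = fun t ↦ ((σ (c t)).1, (σ (c t)).2) from rfl,
      mD_prodMk (h1 t) (h2 t)] at this
    exact this
  have hc0 : c 0 = q := Prod.ext rfl (Subtype.ext (by simp [hc, scale, e]))
  have hfst : ∀ t, (σ (c t)).1 = (σ q).1 := fun t ↦ by
    rw [eq_of_mD_eq_zero h1 (fun t ↦ congrArg Prod.fst (h3 t)) t 0, hc0]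
  have hsnd : ∀ t, ((σ (c t)).2 : ℝ) = Real.exp t * ((σ q).2 : ℝ) := by
    have h4 : ∀ t, HasDerivAt (fun t ↦ ((σ (c t)).2 : ℝ)) ((σ (c t)).2 : ℝ) t := fun t ↦ by
      have h5 : DifferentiableAt ℝ (fun t ↦ ((σ (c t)).2 : ℝ)) t :=
        ((contMDiff_posReal_iff.1 (contMDiff_snd.comp hσc)).mdifferentiableAt
          (by simp)).differentiableAt
      have h6 := congrArg Prod.snd (h3 t)
      simp only [mD_eq_fderiv] at h6
      exact h5.hasDerivAt.congr_deriv h6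
    have h5 : ∀ t, HasDerivAt (fun t ↦ Real.exp (-t) * ((σ (c t)).2 : ℝ)) 0 t := fun t ↦ by
      have h6 := ((hasDerivAt_neg t).exp).mul (h4 t)
      refine h6.congr_deriv ?_
      ring
    intro t
    have h6 := is_const_of_deriv_eq_zero (fun t ↦ (h5 t).differentiableAt) (fun t ↦ (h5 t).deriv) t 0
    simp only [hc0, neg_zero, Real.exp_zero, one_mul] at h6
    rw [← h6, ← mul_assoc, ← Real.exp_add, add_neg_cancel, Real.exp_zero, one_mul]
  have hρ : (0 : ℝ) < ρ := ρ.2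
  have hρe : e (Real.log ρ) = ρ := Subtype.ext (Real.exp_log hρ)
  have h4 := hfst (Real.log ρ)
  have h5 := hsnd (Real.log ρ)
  rw [Real.exp_log hρ] at h5
  simp only [hc, hρe] at h4 h5
  exact Prod.ext h4 (Subtype.ext h5)

variable [FiniteDimensional ℝ E] [T2Space S] [CompactSpace S] [ConnectedSpace S] (hA : A.IsToric m)
  {b : LieAlg m}
include hA

/-- The real form is isotropic for the Kähler form. -/
theorem isotropic (hb : ∀ p : Cone S, generator E p b = A.reeb p) (hdim : finrank ℝ E + 1 = 2 * m)
    {p : Cone S} (hp : σ p = p) {X Y : E × ℝ}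
    (hX : mD (coneModel E) (coneModel E) σ p X = X)
    (hY : mD (coneModel E) (coneModel E) σ p Y = Y) : coneForm A.g p (A.cJ p X) Y = 0 := by
  classical
  obtain ⟨l⟩ := exists_localModel hA.smooth p
  obtain ⟨k, β, e, he, hBe, hdec⟩ := exists_isotropy_basis hA hdim hb l
  have hK := A.isKaehler
  set D := mD (coneModel E) (coneModel E) σ p
  set J := A.cJ p
  have hJJ : ∀ X, J (J X) = -X := fun X ↦ hK.J_sq p X
  have hJl : ∀ X Y, coneForm A.g p (J X) Y = -coneForm A.g p X (J Y) := fun X Y ↦ hK.J_left p X Y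
  have hBJ : ∀ i X, l.B (β i).1 (J X) = J (l.B (β i).1 X) := fun i X ↦ l.B_J hA (β i).2 X
  have hBg : ∀ i (u : LieAlg m), l.B (β i).1 (gen E p u) = 0 := fun i u ↦ l.B_gen hA (β i).2 u
  have hDJ : ∀ X, D (J X) = -J (D X) := fun X ↦ by
    have := hσ.mD_J p X
    rwa [hp] at this
  have hDg : ∀ u : LieAlg m, D (gen E p u) = -gen E p u := fun u ↦ by
    have := hσ.mD_gen hA.smooth p u
    rwa [hp] at this
  have hDB : ∀ i X, D (l.B (β i).1 X) = -l.B (β i).1 (D X) := fun i X ↦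
    hσ.mD_B hA.smooth hp l (β i).2 X
  -- `P i` is the projection to the weight line of `e i`. It commutes with `D`, which anticommutes
  -- with both `J` and `l.B (β i)`.
  set P : Fin k → E × ℝ → E × ℝ := fun i X ↦ -J (l.B (β i).1 X) with hP
  have hDP : ∀ i X, D (P i X) = P i (D X) := fun i X ↦ by
    simp only [hP, map_neg, hDJ, hDB]
    simp
  have hPsymm : ∀ i X Y, coneForm A.g p (P i X) Y = coneForm A.g p X (P i Y) := fun i X Y ↦ by
    simp only [hP]
    rw [map_neg, neg_apply, hJl, neg_neg, l.B_skew hA (β i).2, hBJ, map_neg]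
  have hPJ : ∀ i X, P i (J X) = J (P i X) := fun i X ↦ by simp only [hP, hBJ, map_neg]
  have hPdec : ∀ X, ∃ x y : LieAlg m, ∃ c d : Fin k → ℝ,
      X = gen E p x + J (gen E p y) + ∑ i, P i X ∧ ∀ i, P i X = c i • e i + d i • J (e i) := by
    intro X
    obtain ⟨x, y, c, d, hX⟩ := hdec X
    have h1 : ∀ i, P i X = c i • e i + d i • J (e i) := fun i ↦ by
      simp only [hP]
      conv_lhs => rw [hX]
      simp only [map_add, map_sum, map_smul, hBJ, hBg, hBe, map_zero, add_zero, zero_add]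
      rw [Finset.sum_eq_single i]
      · simp [hJJ, add_comm]
      · intro j _ hj
        simp [hj.symm]
      · simp
    exact ⟨x, y, c, d, by simp only [h1]; exact hX, h1⟩
  have hPP : ∀ i X, P i (P i X) = P i X := fun i X ↦ by
    obtain ⟨_, _, c, d, -, h1⟩ := hPdec X
    rw [h1 i]
    simp only [hP, map_add, map_smul, hBJ, hBe, if_true, hJJ]
    simp [add_comm]
  have hPgJ : ∀ i (y : LieAlg m), P i (J (gen E p y)) = 0 := fun i y ↦ by simp only [hP, hBJ, hBg]; simp
  -- `D` negates `gen E p x`, fixes `J (gen E p y)` and commutes with the projections, so a fixed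
  -- vector has no component in `𝔤(p)`.
  have hfixed : ∀ X, D X = X → ∃ y : LieAlg m, X = J (gen E p y) + ∑ i, P i X := fun X hX ↦ by
    obtain ⟨x, y, c, d, h1, h2⟩ := hPdec X
    have h3 : D X = -gen E p x + J (gen E p y) + ∑ i, P i X := by
      conv_lhs => rw [h1]
      simp only [map_add, map_sum, hDJ, hDg, hDP, hX, map_neg, neg_neg]
    rw [hX] at h3
    have h4 : gen E p x + gen E p x = 0 := by
      have h5 := h1.symm.trans h3
      rw [add_assoc, add_assoc] at h5
      have h6 := add_right_cancel h5
      nth_rewrite 1 [h6]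
      exact neg_add_cancel _
    have h5 : gen E p x = 0 := by
      have h6 : (2 : ℝ) • gen E p x = 0 := by rw [two_smul]; exact h4
      exact (smul_eq_zero.1 h6).resolve_left two_ne_zero
    exact ⟨y, by rw [h5, zero_add] at h1; exact h1⟩
  obtain ⟨y, hy⟩ := hfixed X hX
  obtain ⟨z, hz⟩ := hfixed Y hY
  have hPi : ∀ i Z, coneForm A.g p (J (P i X)) Z = coneForm A.g p (J (P i X)) (P i Z) := fun i Z ↦ by
    conv_lhs => rw [← hPP i X, ← hPJ, hPsymm]
  have h0 : coneForm A.g p (J (J (gen E p y))) Y = 0 := by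
    rw [hz, map_add, map_sum]
    have h1 : coneForm A.g p (J (J (gen E p y))) (J (gen E p z)) = 0 := by
      rw [show coneForm A.g p (J (J (gen E p y))) (J (gen E p z)) =
        coneForm A.g p (J (gen E p y)) (gen E p z) from hK.compat p _ _]
      exact gen_isotropic hA hb p y z
    rw [h1, zero_add]
    refine Finset.sum_eq_zero fun i _ ↦ ?_
    rw [← hPsymm, hPJ, hPgJ, map_zero, map_zero]
    rfl
  have hi : ∀ i, coneForm A.g p (J (P i X)) Y = 0 := fun i ↦ by
    rw [hPi]
    obtain ⟨_, _, a₁, a₂, -, hc⟩ := hPdec X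
    obtain ⟨_, _, a₃, a₄, -, hc'⟩ := hPdec Y
    obtain ⟨_, _, a₅, a₆, -, hα⟩ := hPdec (D (e i))
    set c := a₁ i
    set d := a₂ i
    set c' := a₃ i
    set d' := a₄ i
    set α := a₅ i
    set γ := a₆ i
    have hPe : P i (e i) = e i := by simp [hP, hBe, hJJ]
    have hDe : D (e i) = α • e i + γ • J (e i) := by
      rw [← hα i, ← hDP, hPe]
    have hg := hK.pos p _ (he i)
    have hJe : coneForm A.g p (J (e i)) (e i) = 0 := by
      have := hJl (e i) (e i)
      rw [hK.symm p (e i) (J (e i))] at this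
      linarith
    have hJe' : coneForm A.g p (e i) (J (e i)) = 0 := by rw [hK.symm]; exact hJe
    have hJJe : coneForm A.g p (J (e i)) (J (e i)) = coneForm A.g p (e i) (e i) := hK.compat p _ _
    -- The coordinates in the weight line of a vector fixed by the antilinear map `D`, where `α` and
    -- `γ` are the coordinates of `D (e i)`.
    have hcoef : ∀ (Z : E × ℝ) (c d : ℝ), D Z = Z → P i Z = c • e i + d • J (e i) →
        c = α * c + γ * d ∧ d = γ * c - α * d := by
      intro Z c d hZ hPZ
      have h1 := hDP i Z
      rw [hZ, hPZ] at h1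
      simp only [map_add, map_smul, hDJ, hDe, hJJ, smul_add, smul_neg, neg_add] at h1
      have h2 := congrArg (fun W ↦ coneForm A.g p W (e i)) h1
      have h3 := congrArg (fun W ↦ coneForm A.g p W (J (e i))) h1
      simp [hJe, hJe', hJJe] at h2 h3
      constructor
      · refine mul_right_cancel₀ hg.ne' ?_
        linear_combination -h2
      · refine mul_right_cancel₀ hg.ne' ?_
        linear_combination -h3
    obtain ⟨h1, h2⟩ := hcoef X c d hX (hc i)
    obtain ⟨h3, h4⟩ := hcoef Y c' d' hY (hc' i)
    -- Components of fixed vectors in a weight line are proportional over the reals: their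
    -- determinant is annihilated by `1 - α` and by `1 + α`, whose sum is `2`.
    have h5 : c * d' - d * c' = 0 := by
      have h6 : (1 - α) * (c * d' - d * c') = 0 := by linear_combination d' * h1 - d * h3
      have h7 : (1 + α) * (c * d' - d * c') = 0 := by linear_combination c * h4 - c' * h2
      linarith
    rw [hc i, hc' i]
    simp [hJJ, hJe, hJe', hJJe]
    linear_combination h5 * coneForm A.g p (e i) (e i)
  conv_lhs => rw [hy]
  rw [map_add, map_add, map_sum, map_sum, add_apply, sum_apply, h0, zero_add]
  exact Finset.sum_eq_zero fun i _ ↦ hi i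

end SasakiStructure.IsToricConjugation

end Conjugation

/-! ### Submanifolds from slice charts -/

section Slice

variable {V : Type*} [NormedAddCommGroup V] [NormedSpace ℝ V]
  {H : Type*} [TopologicalSpace H] (I : ModelWithCorners ℝ V H)
  {M : Type*} [TopologicalSpace M] [ChartedSpace H M]

/-- A chart of `M` in which `N` is a linear subspace of dimension `d`. -/
structure SliceChart (N : Set M) (d : ℕ) where
  /-- the chart -/
  φ : OpenPartialHomeomorph M V
  /-- the inclusion of the subspace -/
  κ : EuclideanSpace ℝ (Fin d) →L[ℝ] V
  /-- a projection to the subspace -/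
  ρ : V →L[ℝ] EuclideanSpace ℝ (Fin d)
  contMDiffOn : ContMDiffOn I 𝓘(ℝ, V) ∞ φ φ.source
  contMDiffOn_symm : ContMDiffOn 𝓘(ℝ, V) I ∞ φ.symm φ.target
  ρ_κ : ∀ x, ρ (κ x) = x
  mem_iff : ∀ q ∈ φ.source, q ∈ N ↔ κ (ρ (φ q)) = φ q

namespace SliceChart

variable {I} {N : Set M} {d : ℕ} (c : SliceChart I N d)

theorem symm_mem {x : EuclideanSpace ℝ (Fin d)} (hx : c.κ x ∈ c.φ.target) :
    c.φ.symm (c.κ x) ∈ N := by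
  rw [c.mem_iff _ (c.φ.map_target hx), c.φ.right_inv hx, c.ρ_κ]

open Classical in
/-- The chart of the submanifold `N` given by a slice chart. -/
def chart (p : N) : OpenPartialHomeomorph N (EuclideanSpace ℝ (Fin d)) where
  toFun q := c.ρ (c.φ q)
  -- Off the target the value `p` is a mere default.
  invFun x := if hx : c.κ x ∈ c.φ.target then ⟨c.φ.symm (c.κ x), c.symm_mem hx⟩ else p
  source := {q | q.1 ∈ c.φ.source}
  target := {x | c.κ x ∈ c.φ.target}
  map_source' q hq := by
    rw [mem_ofPred_eq, (c.mem_iff _ hq).1 q.2]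
    exact c.φ.map_source hq
  map_target' x hx := by
    have hx' : c.κ x ∈ c.φ.target := hx
    rw [dif_pos hx']
    exact c.φ.map_target hx'
  left_inv' q hq := by
    have h1 := (c.mem_iff _ hq).1 q.2
    have h2 : c.κ (c.ρ (c.φ q)) ∈ c.φ.target := by rw [h1]; exact c.φ.map_source hq
    rw [dif_pos h2]
    refine Subtype.ext ?_
    simp only [h1]
    exact c.φ.left_inv hq
  right_inv' x hx := by
    have hx' : c.κ x ∈ c.φ.target := hx
    rw [dif_pos hx', c.φ.right_inv hx', c.ρ_κ]
  open_source := c.φ.open_source.preimage continuous_subtype_val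
  open_target := c.φ.open_target.preimage c.κ.continuous
  continuousOn_toFun := c.ρ.continuous.comp_continuousOn
    (c.φ.continuousOn.comp continuous_subtype_val.continuousOn fun _ hq ↦ hq)
  continuousOn_invFun := by
    rw [Topology.IsInducing.subtypeVal.continuousOn_iff]
    have h1 : ContinuousOn (fun x ↦ c.φ.symm (c.κ x)) {x | c.κ x ∈ c.φ.target} :=
      c.φ.continuousOn_symm.comp c.κ.continuous.continuousOn fun _ hx ↦ hx
    refine h1.congr fun x hx ↦ ?_
    have hx' : c.κ x ∈ c.φ.target := hx
    simp only [Function.comp, dif_pos hx']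

theorem chart_symm_apply (p : N) {x : EuclideanSpace ℝ (Fin d)} (hx : c.κ x ∈ c.φ.target) :
    ((c.chart p).symm x : M) = c.φ.symm (c.κ x) :=
  congrArg Subtype.val (dif_pos hx)

theorem κ_chart (p : N) {q : N} (hq : q.1 ∈ c.φ.source) : c.κ (c.chart p q) = c.φ q :=
  (c.mem_iff _ hq).1 q.2

end SliceChart

/-- A subset covered by slice charts is an embedded submanifold. -/
theorem exists_submanifold {N : Set M} {d : ℕ} (C : N → SliceChart I N d)
    (hC : ∀ p : N, p.1 ∈ (C p).φ.source) :
    ∃ _ : ChartedSpace (EuclideanSpace ℝ (Fin d)) N, IsManifold (𝓡 d) ∞ N ∧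
      IsSmoothImmersion (𝓡 d) I (Subtype.val : N → M) := by
  let cs : ChartedSpace (EuclideanSpace ℝ (Fin d)) N :=
    { atlas := range fun p ↦ (C p).chart p
      chartAt := fun p ↦ (C p).chart p
      mem_chart_source := hC
      chart_mem_atlas := fun p ↦ ⟨p, rfl⟩ }
  have hman : IsManifold (𝓡 d) ∞ N := by
    refine isManifold_of_contDiffOn _ _ _ ?_
    rintro _ _ ⟨p, rfl⟩ ⟨p', rfl⟩
    simp only [modelWithCornersSelf_coe, modelWithCornersSelf_coe_symm, Function.comp_id,
      Function.id_comp, preimage_id, range_id, inter_univ]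
    rw [OpenPartialHomeomorph.trans_source]
    set s := ((C p).chart p).symm.source ∩ ((C p).chart p).symm ⁻¹' ((C p').chart p').source
    have hs1 : ∀ x ∈ s, (C p).κ x ∈ (C p).φ.target := fun x hx ↦ hx.1
    have hs2 : ∀ x ∈ s, (C p).φ.symm ((C p).κ x) ∈ (C p').φ.source := fun x hx ↦ by
      rw [← (C p).chart_symm_apply p (hs1 x hx)]
      exact hx.2
    have h1 : ContMDiffOn 𝓘(ℝ, EuclideanSpace ℝ (Fin d)) I ∞
        (fun x ↦ (C p).φ.symm ((C p).κ x)) s :=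
      (C p).contMDiffOn_symm.comp (C p).κ.contDiff.contMDiff.contMDiffOn hs1
    have h2 : ContMDiffOn 𝓘(ℝ, EuclideanSpace ℝ (Fin d)) 𝓘(ℝ, EuclideanSpace ℝ (Fin d)) ∞
        (fun x ↦ (C p').ρ ((C p').φ ((C p).φ.symm ((C p).κ x)))) s :=
      (C p').ρ.contDiff.contMDiff.comp_contMDiffOn ((C p').contMDiffOn.comp h1 hs2)
    refine h2.contDiffOn.congr fun x hx ↦ ?_
    change (C p').ρ ((C p').φ (((C p).chart p).symm x)) = _
    rw [(C p).chart_symm_apply p (hs1 x hx)]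
  have hval : ∀ p : N, (Subtype.val : N → M) =ᶠ[𝓝 p] fun q ↦ (C p).φ.symm ((C p).κ (chartAt
      (EuclideanSpace ℝ (Fin d)) p q)) := fun p ↦ by
    filter_upwards [(chart_source_mem_nhds (EuclideanSpace ℝ (Fin d)) p)] with q hq
    rw [show (C p).κ (chartAt (EuclideanSpace ℝ (Fin d)) p q) = (C p).φ q from
      (C p).κ_chart p hq, (C p).φ.left_inv hq]
  have hsm : ContMDiff (𝓡 d) I ∞ (Subtype.val : N → M) := by
    intro p
    have h1 : ContMDiffAt (𝓡 d) (𝓡 d) ∞ (chartAt (EuclideanSpace ℝ (Fin d)) p) p :=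
      contMDiffAt_of_mem_maximalAtlas (IsManifold.chart_mem_maximalAtlas p)
        (mem_chart_source _ p)
    have h2 : (C p).κ (chartAt (EuclideanSpace ℝ (Fin d)) p p) ∈ (C p).φ.target := by
      rw [show (C p).κ (chartAt (EuclideanSpace ℝ (Fin d)) p p) = (C p).φ p from
        (C p).κ_chart p (hC p)]
      exact (C p).φ.map_source (hC p)
    have h3 : ContMDiffAt 𝓘(ℝ, V) I ∞ (C p).φ.symm
        ((C p).κ (chartAt (EuclideanSpace ℝ (Fin d)) p p)) :=
      (C p).contMDiffOn_symm.contMDiffAt ((C p).φ.open_target.mem_nhds h2)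
    exact (h3.comp p ((C p).κ.contDiff.contMDiff.contMDiffAt.comp p h1)).congr_of_eventuallyEq
      (hval p)
  refine ⟨cs, hman, hsm, fun p ↦ ?_⟩
  have hinj : Function.Injective (mD (𝓡 d) I (Subtype.val : N → M) p) := by
    rw [injective_iff_map_eq_zero]
    intro X hX
    have h1 : MDifferentiableAt I 𝓘(ℝ, V) (C p).φ p :=
      ((C p).contMDiffOn.contMDiffAt ((C p).φ.open_source.mem_nhds (hC p))).mdifferentiableAt
        (by simp)
    have h2 : MDifferentiableAt I 𝓘(ℝ, EuclideanSpace ℝ (Fin d))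
        (fun q ↦ (C p).ρ ((C p).φ q)) p :=
      (C p).ρ.differentiableAt.mdifferentiableAt.comp _ h1
    have h3 := mD_comp_apply (𝓡 d) I 𝓘(ℝ, EuclideanSpace ℝ (Fin d)) (f := (Subtype.val : N → M))
      (g := fun q ↦ (C p).ρ ((C p).φ q)) (p := p) h2 (hsm.mdifferentiableAt (by simp)) X
    rw [hX, map_zero] at h3
    -- The map in `h3` is the preferred chart of `N` at `p`, whose differential there is the
    -- identity.
    have h4 := mD_extChartAt_self (𝓡 d) p
    have h5 : mD (𝓡 d) 𝓘(ℝ, EuclideanSpace ℝ (Fin d)) (extChartAt (𝓡 d) p) p X = 0 := h3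
    rw [h4] at h5
    exact h5
  exact hinj

end Slice

/-! ### Dimension of the real form and slice charts of its level sets -/

section RealStructure

variable {V : Type*} [AddCommGroup V] [Module ℝ V] [FiniteDimensional ℝ V]

/-- The fixed space of an antilinear involution has half the dimension. -/
theorem two_mul_finrank_fixed (D J : V →ₗ[ℝ] V) (hD : ∀ X, D (D X) = X) (hJ : ∀ X, J (J X) = -X)
    (hDJ : ∀ X, D (J X) = -J (D X)) :
    2 * finrank ℝ (LinearMap.eqLocus D LinearMap.id) = finrank ℝ V := by
  set P := LinearMap.eqLocus D LinearMap.id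
  set Q := LinearMap.eqLocus D (-LinearMap.id)
  have hP : ∀ X, X ∈ P ↔ D X = X := fun X ↦ Iff.rfl
  have hQ : ∀ X, X ∈ Q ↔ D X = -X := fun X ↦ Iff.rfl
  have hPQ : IsCompl P Q := by
    refine IsCompl.of_eq ?_ ?_
    · rw [Submodule.eq_bot_iff]
      rintro X ⟨h1, h2⟩
      have h3 : (2 : ℝ) • X = 0 := by
        rw [two_smul]
        nth_rewrite 1 [← (hP X).1 h1]
        rw [(hQ X).1 h2, neg_add_cancel]
      exact (smul_eq_zero.1 h3).resolve_left two_ne_zero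
    · rw [Submodule.eq_top_iff']
      intro X
      have h1 : X = (1 / 2 : ℝ) • (X + D X) + (1 / 2 : ℝ) • (X - D X) := by
        rw [← smul_add, add_add_sub_cancel, ← two_smul ℝ X, smul_smul]
        norm_num
      rw [h1]
      refine Submodule.add_mem_sup ((hP _).2 ?_) ((hQ _).2 ?_)
      · rw [map_smul, map_add, hD, add_comm]
      · rw [map_smul, map_sub, hD, ← smul_neg, neg_sub]
  -- `J` exchanges the eigenspaces of `D` for `1` and `-1`, so they have equal dimensions.
  let e : V ≃ₗ[ℝ] V := LinearEquiv.ofLinearMap J (-J)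
    (LinearMap.ext fun X ↦ by simp [hJ]) (LinearMap.ext fun X ↦ by simp [hJ])
  have hmap : P.map (e : V →ₗ[ℝ] V) = Q := by
    ext X
    rw [Submodule.mem_map]
    constructor
    · rintro ⟨Y, hY, rfl⟩
      refine (hQ _).2 ?_
      change D (J Y) = -J Y
      rw [hDJ, (hP Y).1 hY]
    · intro hX
      refine ⟨-J X, (hP _).2 ?_, ?_⟩
      · rw [map_neg, hDJ, (hQ X).1 hX, map_neg, neg_neg]
      · change J (-J X) = X
        rw [map_neg, hJ, neg_neg]
  have h1 : finrank ℝ Q = finrank ℝ P := by rw [← hmap]; exact LinearEquiv.finrank_map_eq e P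
  have h2 := Submodule.finrank_add_eq_of_isCompl hPQ
  omega

theorem finrank_inf_ker_add_one (P : Submodule ℝ V) (L : V →ₗ[ℝ] ℝ) {w : V} (hw : w ∈ P)
    (hL : L w ≠ 0) : finrank ℝ (P ⊓ LinearMap.ker L : Submodule ℝ V) + 1 = finrank ℝ P := by
  have h1 : L.domRestrict P ≠ 0 := fun h ↦ hL (congrArg (fun f ↦ f ⟨w, hw⟩) h)
  have h2 := Module.Dual.finrank_ker_add_one_of_ne_zero (f := L.domRestrict P) h1
  have h3 : (LinearMap.ker (L.domRestrict P)).map P.subtype = P ⊓ LinearMap.ker L := by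
    rw [LinearMap.ker_domRestrict]
    exact Submodule.map_comap_subtype _ _
  rw [← h2, ← h3, Submodule.finrank_map_subtype_eq]

end RealStructure

theorem exists_smooth_map_mD_eq_id {V : Type*} [NormedAddCommGroup V] [NormedSpace ℝ V]
    [FiniteDimensional ℝ V] {H : Type*} [TopologicalSpace H] (I : ModelWithCorners ℝ V H)
    {M : Type*} [TopologicalSpace M] [ChartedSpace H M] [IsManifold I ∞ M] [T2Space M] (p : M) :
    ∃ χ : M → V, ContMDiff I 𝓘(ℝ, V) ∞ χ ∧ mD I 𝓘(ℝ, V) χ p = ContinuousLinearMap.id ℝ V := by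
  have : IsManifold I 1 M := IsManifold.of_le (n := ∞) (by simp)
  let f : SmoothBumpFunction I p := Classical.arbitrary _
  refine ⟨fun q ↦ f q • extChartAt I p q, f.contMDiff_smul contMDiffOn_extChartAt, ?_⟩
  have h1 : (fun q ↦ f q • extChartAt I p q) =ᶠ[𝓝 p] extChartAt I p := by
    filter_upwards [f.eventuallyEq_one] with q hq
    rw [hq, Pi.one_apply, one_smul]
  rw [mD_congr _ _ h1, mD_extChartAt_self]

theorem hasFDerivAt_comp_symm_self {V : Type*} [NormedAddCommGroup V] [NormedSpace ℝ V]
    {H : Type*} [TopologicalSpace H] (I : ModelWithCorners ℝ V H) [I.Boundaryless]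
    {M : Type*} [TopologicalSpace M] [ChartedSpace H M] [IsManifold I ∞ M] (p : M)
    {G : Type*} [NormedAddCommGroup G] [NormedSpace ℝ G] {f : M → G}
    (hf : MDifferentiableAt I 𝓘(ℝ, G) f p) :
    HasFDerivAt (f ∘ (extChartAt I p).symm) (mD I 𝓘(ℝ, G) f p) (extChartAt I p p) := by
  rw [← fderiv_comp_symm_self I p hf]
  refine (differentiableAt_comp_symm I p (mem_extChartAt_target p) ?_).hasFDerivAt
  rw [extChartAt_to_inv]
  exact hf

section RealLevel

variable {E : Type*} [NormedAddCommGroup E] [NormedSpace ℝ E] [FiniteDimensional ℝ E]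
  {S : Type*} [TopologicalSpace S] [ChartedSpace E S] [IsManifold 𝓘(ℝ, E) ∞ S] [T2Space S]
  {m : ℕ} [MulAction (Torus m) S] {A : SasakiStructure E S}
  {σ : Cone S → Cone S} (hσ : A.IsToricConjugation m σ) (hA : A.IsToric m) {b : LieAlg m}
  (hb : ∀ p : Cone S, generator E p b = A.reeb p)
include hσ hA hb

/-- A level set of a component of the moment map in the real form has slice charts at the points
where the component is regular. -/
theorem exists_sliceChart (hdim : finrank ℝ E + 1 = 2 * m) {ζ : LieAlg m} {c : ℝ} {p : Cone S}
    (hp : p ∈ A.realLevel σ ζ c) (hζ : gen E p ζ ≠ 0) :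
    ∃ C : SliceChart (coneModel E) (A.realLevel σ ζ c) (m - 1), p ∈ C.φ.source := by
  have hK := A.isKaehler
  have hσp : σ p = p := hp.1
  set D := mD (coneModel E) (coneModel E) σ p with hDdef
  set J := A.cJ p
  have hJJ : ∀ X, J (J X) = -X := fun X ↦ hK.J_sq p X
  have hDD : ∀ X, D (D X) = X := hσ.mD_mD hσp
  have hDJ : ∀ X, D (J X) = -J (D X) := fun X ↦ by
    have := hσ.mD_J p X
    rwa [hσp] at this
  set h : Cone S → ℝ := fun q ↦ A.moment q ζ - c with hh
  have hsm : ContMDiff (coneModel E) 𝓘(ℝ, ℝ) ∞ h :=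
    (A.contMDiff_moment hb hA ζ).sub contMDiff_const
  set L : E × ℝ →L[ℝ] ℝ := mD (coneModel E) 𝓘(ℝ, ℝ) h p with hL
  have hLmom : L = mD (coneModel E) 𝓘(ℝ, ℝ) (fun q : Cone S ↦ A.moment q ζ) p := by
    have h1 : HasFDerivAt (fun x : ℝ ↦ x - c) (ContinuousLinearMap.id ℝ ℝ) (A.moment p ζ) :=
      (hasFDerivAt_id _).sub_const c
    refine ContinuousLinearMap.ext fun X ↦ ?_
    have h2 := mD_comp_apply (coneModel E) 𝓘(ℝ, ℝ) 𝓘(ℝ, ℝ) (f := fun q : Cone S ↦ A.moment q ζ)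
      (g := fun x : ℝ ↦ x - c) (p := p) h1.differentiableAt.mdifferentiableAt
      ((A.contMDiff_moment hb hA ζ).mdifferentiableAt (by simp)) X
    rw [mD_eq_fderiv, h1.fderiv] at h2
    exact h2
  -- `D` negates both the generator and `J`, so it fixes `-J (gen E p ζ)`, on which `L` is positive.
  -- The level set is therefore transversal to a real direction.
  obtain ⟨w, hw, hDw⟩ : ∃ w, L w = 1 ∧ D w = w := by
    have h1 : L (-J (gen E p ζ)) ≠ 0 := by
      rw [hLmom, mD_moment_eq hb hA, map_neg, neg_neg]
      exact Eq.trans_ne (hK.compat p _ _) (hK.pos p _ hζ).ne'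
    refine ⟨(L (-J (gen E p ζ)))⁻¹ • -J (gen E p ζ), ?_, ?_⟩
    · rw [map_smul, smul_eq_mul, inv_mul_cancel₀ h1]
    · have h2 := hσ.mD_gen hA.smooth p ζ
      rw [hσp] at h2
      have h3 : D (-J (gen E p ζ)) = -J (gen E p ζ) := by
        rw [map_neg, hDJ, h2, map_neg, neg_neg]
      rw [map_smul, h3]
  obtain ⟨χ, hχ, hχp⟩ := exists_smooth_map_mD_eq_id (coneModel E) p
  -- Averaging `χ` over `σ` gives `Ψ ∘ σ = D ∘ Ψ`, with identity differential at `p` because `D` is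
  -- an involution.
  set Ψ : Cone S → E × ℝ := fun q ↦ (1 / 2 : ℝ) • (χ q + D (χ (σ q))) with hΨdef
  have hΨ : ContMDiff (coneModel E) 𝓘(ℝ, E × ℝ) ∞ Ψ :=
    ((contDiff_const_smul (1 / 2 : ℝ)).contMDiff (E := E × ℝ)).comp
      (hχ.add (D.contDiff.contMDiff.comp (hχ.comp hσ.smooth)))
  have hΨσ : ∀ q, Ψ (σ q) = D (Ψ q) := fun q ↦ by
    simp only [hΨdef, hσ.involutive, map_smul, map_add, hDD]
    rw [add_comm]
  -- The correction along the real vector `w` makes `L ∘ Ξ = h` without changing which points have a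
  -- value fixed by `D`.
  set Ξ : Cone S → E × ℝ := fun q ↦ Ψ q + (h q - L (Ψ q)) • w with hΞdef
  have hΞ : ContMDiff (coneModel E) 𝓘(ℝ, E × ℝ) ∞ Ξ :=
    hΨ.add ((hsm.sub (L.contDiff.contMDiff.comp hΨ)).smul contMDiff_const)
  have hLΞ : ∀ q, L (Ξ q) = h q := fun q ↦ by simp [hΞdef, hw]
  have hDΞ : ∀ q, D (Ξ q) = Ξ q ↔ D (Ψ q) = Ψ q := fun q ↦ by
    simp only [hΞdef, map_add, map_smul, hDw, add_left_inj]
  set e := extChartAt (coneModel E) p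
  have hΨd : mD (coneModel E) 𝓘(ℝ, E × ℝ) Ψ p = ContinuousLinearMap.id ℝ (E × ℝ) := by
    have hχσ : MDifferentiable (coneModel E) 𝓘(ℝ, E × ℝ) fun q ↦ χ (σ q) :=
      (hχ.comp hσ.smooth).mdifferentiable (by simp)
    have h1 : mD (coneModel E) 𝓘(ℝ, E × ℝ) (fun q ↦ χ (σ q)) p = D := by
      refine ContinuousLinearMap.ext fun X ↦ ?_
      rw [mD_comp_apply (coneModel E) (coneModel E) 𝓘(ℝ, E × ℝ)
        (hχ.mdifferentiableAt (by simp)) (hσ.mdifferentiable p), hσp, hχp]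
      rfl
    have h2 := hasFDerivAt_comp_symm_self (coneModel E) p (hχ.mdifferentiableAt (by simp))
    have h3 := hasFDerivAt_comp_symm_self (coneModel E) p (hχσ p)
    rw [h1] at h3
    rw [hχp] at h2
    have h4 := (h2.add (D.hasFDerivAt.comp (e p) h3)).const_smul (1 / 2 : ℝ)
    rw [← fderiv_comp_symm_self (coneModel E) p (hΨ.mdifferentiableAt (by simp))]
    refine h4.fderiv.trans (ContinuousLinearMap.ext fun X ↦ ?_)
    simp only [smul_apply, add_apply, ContinuousLinearMap.comp_apply, hDD,
      ContinuousLinearMap.id_apply]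
    rw [← two_smul ℝ X, smul_smul]
    norm_num
  have hΞd : mD (coneModel E) 𝓘(ℝ, E × ℝ) Ξ p = ContinuousLinearMap.id ℝ (E × ℝ) := by
    have h1 := hasFDerivAt_comp_symm_self (coneModel E) p (hΨ.mdifferentiableAt (by simp))
    have h2 := hasFDerivAt_comp_symm_self (coneModel E) p (hsm.mdifferentiableAt (by simp))
    rw [hΨd] at h1
    have h3 := h1.add ((h2.sub (L.hasFDerivAt.comp (e p) h1)).smul_const w)
    rw [← fderiv_comp_symm_self (coneModel E) p (hΞ.mdifferentiableAt (by simp))]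
    refine h3.fderiv.trans (ContinuousLinearMap.ext fun X ↦ ?_)
    simp [hL]
  obtain ⟨φ₁, hp₁, hφ₁, -⟩ := exists_localDiffeo (coneModel E) (by simp) hΨ (p := p)
    (by rw [hΨd]; exact Function.bijective_id)
  obtain ⟨φ₂, hp₂, hφ₂, hs₂⟩ := exists_localDiffeo (coneModel E) (by simp) hΞ (p := p)
    (by rw [hΞd]; exact Function.bijective_id)
  -- On `O` both `q` and `σ q` lie where `Ψ` is injective, so `D (Ψ q) = Ψ q` implies `σ q = q`.
  set O : Set (Cone S) := φ₁.source ∩ σ ⁻¹' φ₁.source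
  have hO : IsOpen O := φ₁.open_source.inter (φ₁.open_source.preimage hσ.smooth.continuous)
  set φ := φ₂.restrOpen O hO with hφdef
  have hφ : ∀ q ∈ φ.source, φ q = Ξ q := fun q hq ↦ hφ₂ q hq.1
  set K : Submodule ℝ (E × ℝ) :=
    LinearMap.eqLocus D.toLinearMap LinearMap.id ⊓ LinearMap.ker L.toLinearMap with hKdef
  have hKmem : ∀ X, X ∈ K ↔ D X = X ∧ L X = 0 := fun X ↦ Iff.rfl
  -- The fixed space of `D` has dimension `m`, and `L` is nonzero on it.
  have hKrank : finrank ℝ K = m - 1 := by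
    have h1 := two_mul_finrank_fixed D.toLinearMap J.toLinearMap hDD hJJ hDJ
    have h2 := finrank_inf_ker_add_one (LinearMap.eqLocus D.toLinearMap LinearMap.id)
      L.toLinearMap (w := w) hDw (by change L w ≠ 0; rw [hw]; exact one_ne_zero)
    rw [finrank_prod, finrank_self, hdim] at h1
    rw [hKdef]
    omega
  let κ₀ : EuclideanSpace ℝ (Fin (m - 1)) ≃L[ℝ] K :=
    ContinuousLinearEquiv.ofFinrankEq (by rw [hKrank, finrank_euclideanSpace_fin])
  set κ : EuclideanSpace ℝ (Fin (m - 1)) →L[ℝ] E × ℝ :=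
    K.subtypeL.comp (κ₀ : EuclideanSpace ℝ (Fin (m - 1)) →L[ℝ] K) with hκdef
  have hκinj : LinearMap.ker κ.toLinearMap = ⊥ := LinearMap.ker_eq_bot.2
    (Subtype.val_injective.comp κ₀.injective)
  obtain ⟨ρ₀, hρ₀⟩ := LinearMap.exists_leftInverse_of_injective κ.toLinearMap hκinj
  set ρ : E × ℝ →L[ℝ] EuclideanSpace ℝ (Fin (m - 1)) := LinearMap.toContinuousLinearMap ρ₀
  have hρκ : ∀ x, ρ (κ x) = x := fun x ↦ congrArg (fun f ↦ f x) hρ₀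
  have hκρ : ∀ y, κ (ρ y) = y ↔ y ∈ K := by
    intro y
    constructor
    · intro hy
      rw [← hy]
      exact (κ₀ (ρ y)).2
    · intro hy
      have h1 : κ (κ₀.symm ⟨y, hy⟩) = y := by
        change ((κ₀ (κ₀.symm ⟨y, hy⟩) : K) : E × ℝ) = y
        rw [κ₀.apply_symm_apply]
      rw [← h1, hρκ]
  refine ⟨⟨φ, κ, ρ, hΞ.contMDiffOn.congr hφ, fun y hy ↦ (hs₂ y hy.1).contMDiffWithinAt, hρκ,
    fun q hq ↦ ?_⟩, hp₂, hp₁, ?_⟩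
  · rw [hκρ, hφ q hq, hKmem, hLΞ, hDΞ, hh]
    refine and_congr ⟨fun h1 ↦ ?_, fun h1 ↦ ?_⟩ sub_eq_zero.symm
    · rw [← hΨσ, h1]
    · rw [← hΨσ] at h1
      refine φ₁.injOn hq.2.2 hq.2.1 ?_
      rw [hφ₁ _ hq.2.2, hφ₁ _ hq.2.1, h1]
  · change σ p ∈ φ₁.source
    rw [hσp]
    exact hp₁

end RealLevel

/-! ### The differential of the map `F` and the Lagrangian condition -/

namespace IsSmoothVectorAction

variable {V : Type*} [NormedAddCommGroup V] [NormedSpace ℝ V]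
  {H : Type*} [TopologicalSpace H] {I : ModelWithCorners ℝ V H}
  {M : Type*} [TopologicalSpace M] [ChartedSpace H M]
  {𝔥 : Type*} [NormedAddCommGroup 𝔥] [NormedSpace ℝ 𝔥]
  {act : 𝔥 → M → M} (hact : IsSmoothVectorAction I act)
include hact

theorem mD_injective (a : 𝔥) (q : M) : Function.Injective (mD I I (act a) q) := by
  refine Function.LeftInverse.injective (g := mD I I (act (-a)) (act a q)) fun X ↦ ?_
  have h1 := mD_comp_apply I I I (f := act a) (g := act (-a)) (p := q)
    (hact.mdifferentiableAt_map _ _) (hact.mdifferentiableAt_map _ _) X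
  rw [← h1]
  simp only [← hact.add, neg_add_cancel, hact.zero]
  rw [mD_id]
  rfl

/-- The differential of `x ↦ a(x) · ι(x)`. -/
theorem mD_act_apply {W : Type*} [NormedAddCommGroup W] [NormedSpace ℝ W]
    {K : Type*} [TopologicalSpace K] {I₁ : ModelWithCorners ℝ W K}
    {N : Type*} [TopologicalSpace N] [ChartedSpace K N] {a : N → 𝔥} {ι : N → M} {x : N}
    (ha : MDifferentiableAt I₁ 𝓘(ℝ, 𝔥) a x) (hι : MDifferentiableAt I₁ I ι x) (X : W) :
    mD I₁ I (fun x ↦ act (a x) (ι x)) x X = mD I I (act (a x)) (ι x)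
      (mD I₁ I ι x X + genField I act (ι x) (mD I₁ 𝓘(ℝ, 𝔥) a x X)) := by
  have hsm : MDifferentiableAt (𝓘(ℝ, 𝔥).prod I) I (fun q : 𝔥 × M ↦ act q.1 q.2) (a x, ι x) :=
    hact.smooth.mdifferentiableAt (by simp)
  have h1 := mD_comp_apply I₁ (𝓘(ℝ, 𝔥).prod I) I (f := fun x ↦ (a x, ι x))
    (g := fun q : 𝔥 × M ↦ act q.1 q.2) (p := x) hsm (ha.prodMk hι) X
  have h2 : mD I₁ (𝓘(ℝ, 𝔥).prod I) (fun x ↦ (a x, ι x)) x X =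
      (mD I₁ 𝓘(ℝ, 𝔥) a x X, mD I₁ I ι x X) :=
    congrArg (fun L : W →L[ℝ] 𝔥 × V ↦ L X) (mfderiv_prodMk ha hι)
  have h3 : ∀ Y : 𝔥 × V, mD (𝓘(ℝ, 𝔥).prod I) I (fun q : 𝔥 × M ↦ act q.1 q.2) (a x, ι x) Y =
      mD 𝓘(ℝ, 𝔥) I (fun v ↦ act v (ι x)) (a x) Y.1 + mD I I (act (a x)) (ι x) Y.2 :=
    fun Y ↦ mfderiv_prod_eq_add_apply hsm
  rw [h1, h2, h3, hact.mD_orbit, hact.genField_act, ← map_add, add_comm]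

end IsSmoothVectorAction

section LagrangianImmersion

variable {E : Type*} [NormedAddCommGroup E] [NormedSpace ℝ E]
  {S : Type*} [TopologicalSpace S] [ChartedSpace E S] [IsManifold 𝓘(ℝ, E) ∞ S]
  {m : ℕ} [MulAction (Torus m) S] {A : SasakiStructure E S}

variable (E) in
/-- The position vector `r ∂/∂r`, as a vector of the model space. -/
def coneVector (p : Cone S) : E × ℝ := positionVector (E := E) p

omit [IsManifold 𝓘(ℝ, E) ∞ S] in
theorem genField_coneAct (h : IsSmoothTorusAction E S m) (q : Cone S) (v : LieAlg m) (l : ℝ) :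
    genField (coneModel E) (coneAct (m := m)) q (v, l) =
      gen E q v + l • coneVector E q := by
  have h1 : ((v, l) : LieAlg m × ℝ) = (v, 0) + l • (0, 1) := by simp
  rw [h1, map_add, map_smul, genField_inl h, genField_inr h]
  rfl

omit [IsManifold 𝓘(ℝ, E) ∞ S] in
theorem gen_scale_ne_zero (h : IsSmoothTorusAction E S m) {q : Cone S} {v : LieAlg m}
    (hv : gen E q v ≠ 0) (ρ : PosReal) : gen E (scale ρ q) v ≠ 0 := by
  rw [gen_eq_prod h] at hv ⊢
  exact hv

theorem moment_scale {b : LieAlg m} (hb : ∀ p : Cone S, generator E p b = A.reeb p)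
    (h : IsSmoothTorusAction E S m) (ρ : PosReal) (q : Cone S) (v : LieAlg m) :
    A.moment (scale ρ q) v = (ρ : ℝ) ^ 2 * A.moment q v := by
  have h1 := moment_eq_sq_mul hb h q.1 (scale ρ q).2 q.2 v
  have h2 : (q.2 : ℝ) ^ 2 ≠ 0 := (pow_pos q.2.2 2).ne'
  refine mul_left_cancel₀ h2 (h1.trans ?_)
  change ((ρ : ℝ) * q.2) ^ 2 * A.moment q v = _
  ring

variable {σ : Cone S → Cone S} (hσ : A.IsToricConjugation m σ) (hA : A.IsToric m) {b : LieAlg m}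
  (hb : ∀ p : Cone S, generator E p b = A.reeb p)
include hσ hA hb

section Linear

variable [FiniteDimensional ℝ E] [T2Space S] [CompactSpace S] [ConnectedSpace S]

/-- With `U = aζ + lR`, the pairing of `Z` and `Z'` vanishes by isotropy of the real form, and so
does that of `R` with real vectors, `R` being real. The pairing of `ζ` with `Z` is minus the
derivative of `⟨μ, ζ⟩`, and `U` pairs to zero with itself. -/
theorem coneForm_real_add_smul (hdim : finrank ℝ E + 1 = 2 * m) {p : Cone S} (hp : σ p = p)
    {ζ : LieAlg m} {Z Z' : E × ℝ} (hZ : mD (coneModel E) (coneModel E) σ p Z = Z)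
    (hZ' : mD (coneModel E) (coneModel E) σ p Z' = Z')
    (hμ : mD (coneModel E) 𝓘(ℝ, ℝ) (fun q : Cone S ↦ A.moment q ζ) p Z = 0)
    (hμ' : mD (coneModel E) 𝓘(ℝ, ℝ) (fun q : Cone S ↦ A.moment q ζ) p Z' = 0) (a l c c' : ℝ) :
    coneForm A.g p
      (A.cJ p (Z + c • (a • gen E p ζ + l • coneVector E p)))
      (Z' + c' • (a • gen E p ζ + l • coneVector E p)) = 0 := by
  have hK := A.isKaehler
  set R : E × ℝ := coneVector E p
  have hR : mD (coneModel E) (coneModel E) σ p R = R := by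
    have := hσ.mD_positionVector hA.smooth hb p
    rwa [hp] at this
  have hanti : ∀ X Y, coneForm A.g p (A.cJ p X) Y = -coneForm A.g p (A.cJ p Y) X := fun X Y ↦
    (hK.J_left p X Y).trans (congrArg Neg.neg (hK.symm p _ _))
  have hself : ∀ X, coneForm A.g p (A.cJ p X) X = 0 := fun X ↦ by
    have := hanti X X
    linarith
  have hζ : ∀ {Y}, mD (coneModel E) 𝓘(ℝ, ℝ) (fun q : Cone S ↦ A.moment q ζ) p Y = 0 →
      coneForm A.g p (A.cJ p (gen E p ζ)) Y = 0 := fun {Y} hY ↦ by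
    rw [mD_moment_eq hb hA] at hY
    exact neg_eq_zero.1 hY
  have hU : ∀ {Y}, mD (coneModel E) (coneModel E) σ p Y = Y →
      mD (coneModel E) 𝓘(ℝ, ℝ) (fun q : Cone S ↦ A.moment q ζ) p Y = 0 →
      coneForm A.g p (A.cJ p (a • gen E p ζ + l • R)) Y = 0 := fun {Y} h1 h2 ↦ by
    simp only [map_add, map_smul, add_apply, smul_apply, smul_eq_mul]
    rw [hζ h2, hσ.isotropic hA hb hdim hp hR h1, mul_zero, mul_zero, add_zero]
  set U := a • gen E p ζ + l • R
  simp only [map_add, map_smul, add_apply, smul_apply, smul_eq_mul]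
  rw [hσ.isotropic hA hb hdim hp hZ hZ', hU hZ' hμ', hself, hanti Z U, hU hZ hμ]
  simp

omit [FiniteDimensional ℝ E] [T2Space S] [CompactSpace S] [ConnectedSpace S] in
-- `D` fixes `Z` and the position vector but negates `gen E p ζ`. Subtracting the image of the
-- relation under `D` isolates the term with `ζ`.
theorem eq_zero_of_real_add_smul_eq_zero {p : Cone S} (hp : σ p = p)
    {ζ : LieAlg m} (hζ : gen E p ζ ≠ 0) {Z : E × ℝ}
    (hZ : mD (coneModel E) (coneModel E) σ p Z = Z) {a l c : ℝ} (ha : a ≠ 0)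
    (h : Z + c • (a • gen E p ζ + l • coneVector E p) = 0) :
    Z = 0 ∧ c = 0 := by
  set R : E × ℝ := coneVector E p
  have hR : mD (coneModel E) (coneModel E) σ p R = R := by
    have := hσ.mD_positionVector hA.smooth hb p
    rwa [hp] at this
  have hg := hσ.mD_gen hA.smooth p ζ
  rw [hp] at hg
  have h1 := congrArg (mD (coneModel E) (coneModel E) σ p) h
  simp only [map_add, map_smul, hZ, hR, hg, map_zero] at h1
  have h2 : (2 * (c * a)) • gen E p ζ = 0 := by
    have h3 := h.trans h1.symm
    have h4 : (2 * (c * a)) • gen E p ζ =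
      (Z + c • (a • gen E p ζ + l • R)) - (Z + c • (a • -gen E p ζ + l • R)) := by module
    rw [h4, h3, sub_self]
  have h3 : c = 0 := by
    rcases smul_eq_zero.1 h2 with h3 | h3
    · simpa [ha] using h3
    · exact absurd h3 hζ
  refine ⟨?_, h3⟩
  rwa [h3, zero_smul, add_zero] at h

end Linear

section LagMap

variable {ζ : LieAlg m} {c : ℝ} {d : ℕ} [ChartedSpace (EuclideanSpace ℝ (Fin d)) (A.realLevel σ ζ c)]

/-- Dilations commute with `σ`, so the dilated level set consists of fixed points of `σ`, and its
tangent vectors are fixed by the differential. -/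
theorem real_of_tangent_realLevel
    (hval : ContMDiff (𝓡 d) (coneModel E) ∞ (Subtype.val : A.realLevel σ ζ c → Cone S))
    (ρ : PosReal) (x : A.realLevel σ ζ c) (X : EuclideanSpace ℝ (Fin d)) :
    mD (coneModel E) (coneModel E) σ (scale ρ x.1)
      (mD (coneModel E) (coneModel E) (scale ρ) x.1 (mD (𝓡 d) (coneModel E) Subtype.val x X)) =
    mD (coneModel E) (coneModel E) (scale ρ) x.1 (mD (𝓡 d) (coneModel E) Subtype.val x X) := by
  have hv : MDifferentiableAt (𝓡 d) (coneModel E) (Subtype.val : A.realLevel σ ζ c → Cone S) x :=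
    hval.mdifferentiableAt (by simp)
  have h1 := mD_comp_apply (𝓡 d) (coneModel E) (coneModel E)
    (mdifferentiableAt_scale ρ x.1) hv X
  have h2 := mD_comp_apply (𝓡 d) (coneModel E) (coneModel E)
    (f := fun x : A.realLevel σ ζ c ↦ scale ρ x.1) (p := x) (hσ.mdifferentiable _)
    ((mdifferentiableAt_scale ρ x.1).comp x hv) X
  have h3 : ∀ x : A.realLevel σ ζ c, σ (scale ρ x.1) = scale ρ x.1 := fun x ↦ by
    rw [hσ.scale_comm hA.smooth hb, x.2.1]
  rw [← h1, ← h2]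
  simp only [h3]

omit hσ in
theorem mD_moment_tangent_realLevel
    (hval : ContMDiff (𝓡 d) (coneModel E) ∞ (Subtype.val : A.realLevel σ ζ c → Cone S))
    (ρ : PosReal) (x : A.realLevel σ ζ c) (X : EuclideanSpace ℝ (Fin d)) :
    mD (coneModel E) 𝓘(ℝ, ℝ) (fun q : Cone S ↦ A.moment q ζ) (scale ρ x.1)
      (mD (coneModel E) (coneModel E) (scale ρ) x.1 (mD (𝓡 d) (coneModel E) Subtype.val x X)) =
    0 := by
  have hv : MDifferentiableAt (𝓡 d) (coneModel E) (Subtype.val : A.realLevel σ ζ c → Cone S) x :=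
    hval.mdifferentiableAt (by simp)
  have h1 := mD_comp_apply (𝓡 d) (coneModel E) (coneModel E)
    (mdifferentiableAt_scale ρ x.1) hv X
  have h2 := mD_comp_apply (𝓡 d) (coneModel E) 𝓘(ℝ, ℝ)
    (f := fun x : A.realLevel σ ζ c ↦ scale ρ x.1) (p := x)
    (g := fun q : Cone S ↦ A.moment q ζ)
    ((A.contMDiff_moment hb hA ζ).mdifferentiableAt (by simp))
    ((mdifferentiableAt_scale ρ x.1).comp x hv) X
  have h3 : ∀ x : A.realLevel σ ζ c, A.moment (scale ρ x.1) ζ = (ρ : ℝ) ^ 2 * c := fun x ↦ by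
    rw [moment_scale hb hA.smooth, x.2.2]
  rw [← h1, ← h2]
  simp only [h3]
  rw [mD_const]
  rfl

/-- `F` moves the level set by a path in the group `LieAlg m × ℝ`, so its differential comes from
the inclusion of the level set and the velocity of the path. This reduces everything to the two
linear statements `coneForm_real_add_smul` and `eq_zero_of_real_add_smul_eq_zero` at the dilated
real point. -/
theorem lagMap_isLagrangianImmersion [FiniteDimensional ℝ E] [T2Space S] [CompactSpace S]
    [ConnectedSpace S] (hdim : finrank ℝ E + 1 = 2 * m) (hd : d + 1 = m)
    (hval : IsSmoothImmersion (𝓡 d) (coneModel E) (Subtype.val : A.realLevel σ ζ c → Cone S))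
    (hζ : ∀ x : A.realLevel σ ζ c, gen E x.1 ζ ≠ 0)
    {I : Opens ℝ} {f : I → ℝ} (hf : ContMDiff 𝓘(ℝ, ℝ) 𝓘(ℝ, ℝ) ∞ f)
    (hf' : ∀ t : I, mfderiv 𝓘(ℝ, ℝ) 𝓘(ℝ, ℝ) f t ≠ 0)
    {ρ : I → PosReal} (hρ : ContMDiff 𝓘(ℝ, ℝ) 𝓘(ℝ, ℝ) ∞ ρ) (τ₀ : Torus m) :
    IsLagrangianImmersion ((𝓡 d).prod 𝓘(ℝ, ℝ)) (coneModel E) A.kaehlerForm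
      (A.lagMap σ ζ c f ρ τ₀) := by
  obtain ⟨v₀, rfl⟩ := exists_torusExp τ₀
  have hs := coneAct_isSmooth hA.smooth
  -- The path in the group: `τ(t)` in exponential coordinates, and the logarithm of the dilation
  -- factor.
  set a : I → LieAlg m × ℝ := fun t ↦ (f t • ζ + v₀, Real.log (ρ t)) with hadef
  have ha : ContMDiff 𝓘(ℝ, ℝ) 𝓘(ℝ, LieAlg m × ℝ) ∞ a := by
    refine ContMDiff.prodMk_space ?_ fun t ↦ ?_
    · exact (contDiff_id.smul contDiff_const |>.add contDiff_const :
        ContDiff ℝ ∞ fun y : ℝ ↦ y • ζ + v₀).contMDiff.comp hf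
    · exact (Real.contDiffAt_log.2 (show (0 : ℝ) < ρ t from (ρ t).2).ne').contMDiffAt.comp t
        (contMDiff_posReal_iff.1 hρ t)
  have hF : A.lagMap σ ζ c f ρ (torusExp v₀) =
      fun x : A.realLevel σ ζ c × I ↦ coneAct (a x.2) (x.1 : Cone S) := by
    funext x
    have h1 : (⟨Real.exp (Real.log (ρ x.2)), Real.exp_pos _⟩ : PosReal) = ρ x.2 :=
      Subtype.ext (Real.exp_log (ρ x.2).2)
    have h2 : a x.2 = (0, Real.log (ρ x.2)) + (f x.2 • ζ + v₀, 0) := by simp [hadef]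
    rw [h2, hs.add, coneAct_inl, coneAct_inr, h1, torusExp_add]
    rfl
  have hι : ContMDiff ((𝓡 d).prod 𝓘(ℝ, ℝ)) (coneModel E) ∞
      fun x : A.realLevel σ ζ c × I ↦ (x.1 : Cone S) := hval.1.comp contMDiff_fst
  have ha₂ : ContMDiff ((𝓡 d).prod 𝓘(ℝ, ℝ)) 𝓘(ℝ, LieAlg m × ℝ) ∞
      fun x : A.realLevel σ ζ c × I ↦ a x.2 := ha.comp contMDiff_snd
  -- The velocity is `(kζ, l)`, where `k` is the derivative of `f` and hence nonzero.
  have hda : ∀ t : I, ∃ k l : ℝ, k ≠ 0 ∧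
      mD 𝓘(ℝ, ℝ) 𝓘(ℝ, LieAlg m × ℝ) a t 1 = (k • ζ, l) := fun t ↦ by
    refine ⟨mD 𝓘(ℝ, ℝ) 𝓘(ℝ, ℝ) f t 1, (mD 𝓘(ℝ, ℝ) 𝓘(ℝ, LieAlg m × ℝ) a t 1).2, fun h ↦
      hf' t (ContinuousLinearMap.ext_ring (R₁ := ℝ) h), Prod.ext ?_ rfl⟩
    have h1 := mD_comp_apply 𝓘(ℝ, ℝ) 𝓘(ℝ, LieAlg m × ℝ) 𝓘(ℝ, LieAlg m) (f := a) (p := t)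
      (g := fun y : LieAlg m × ℝ ↦ y.1) differentiableAt_fst.mdifferentiableAt
      (ha.mdifferentiableAt (by simp)) 1
    have h2 : HasFDerivAt (fun y : ℝ ↦ y • ζ + v₀)
        ((ContinuousLinearMap.id ℝ ℝ).smulRight ζ) (f t) :=
      ((hasFDerivAt_id (𝕜 := ℝ) (f t)).smul_const ζ).add_const v₀
    have h3 := mD_comp_apply 𝓘(ℝ, ℝ) 𝓘(ℝ, ℝ) 𝓘(ℝ, LieAlg m) (f := f) (p := t)
      (g := fun y : ℝ ↦ y • ζ + v₀) h2.differentiableAt.mdifferentiableAt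
      (hf.mdifferentiableAt (by simp)) 1
    rw [mD_eq_fderiv, h2.fderiv] at h3
    rw [mD_eq_fderiv, fderiv_fst] at h1
    exact h1.symm.trans h3
  -- The differential of `F`, with the torus element factored out and the remaining vector placed at
  -- the dilated real point.
  have key : ∀ x : A.realLevel σ ζ c × I, ∃ (ρ' : PosReal) (τ : LieAlg m) (k l : ℝ), k ≠ 0 ∧
      torusAct (torusExp τ) (scale ρ' x.1.1) = A.lagMap σ ζ c f ρ (torusExp v₀) x ∧
      ∀ Y : EuclideanSpace ℝ (Fin d) × ℝ,
        mD ((𝓡 d).prod 𝓘(ℝ, ℝ)) (coneModel E) (A.lagMap σ ζ c f ρ (torusExp v₀)) x Y =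
        mD (coneModel E) (coneModel E) (torusAct (torusExp τ)) (scale ρ' x.1.1)
          (mD (coneModel E) (coneModel E) (scale ρ') x.1.1
            (mD (𝓡 d) (coneModel E) Subtype.val x.1 Y.1) +
          Y.2 • (k • gen E (scale ρ' x.1.1) ζ +
            l • coneVector E (scale ρ' x.1.1))) := by
    intro x
    obtain ⟨k, l, hk, hkl⟩ := hda x.2
    set v := (a x.2).1 with hvdef
    set r := (a x.2).2 with hrdef
    have hadd : a x.2 = (v, 0) + (0, r) := by simp [hvdef, hrdef]
    have hact : ∀ q : Cone S, coneAct (a x.2) q =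
        torusAct (torusExp v) (scale ⟨Real.exp r, Real.exp_pos r⟩ q) := fun q ↦ by
      rw [hadd, hs.add, coneAct_inl, coneAct_inr]
    refine ⟨⟨Real.exp r, Real.exp_pos r⟩, v, k, l, hk, ?_, fun Y ↦ ?_⟩
    · rw [hF]
      exact (hact _).symm
    rw [hF, hs.mD_act_apply (a := fun x : A.realLevel σ ζ c × I ↦ a x.2)
      (ι := fun x : A.realLevel σ ζ c × I ↦ (x.1 : Cone S)) (ha₂.mdifferentiableAt (by simp))
      (hι.mdifferentiableAt (by simp))]
    have h1 : mD ((𝓡 d).prod 𝓘(ℝ, ℝ)) (coneModel E)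
        (fun x : A.realLevel σ ζ c × I ↦ (x.1 : Cone S)) x Y =
        mD (𝓡 d) (coneModel E) Subtype.val x.1 Y.1 := by
      refine (mD_comp_apply ((𝓡 d).prod 𝓘(ℝ, ℝ)) (𝓡 d) (coneModel E)
        (f := fun x : A.realLevel σ ζ c × I ↦ x.1)
        (hval.1.mdifferentiableAt (by simp)) mdifferentiableAt_fst Y).trans ?_
      exact congrArg (fun L : EuclideanSpace ℝ (Fin d) × ℝ →L[ℝ] EuclideanSpace ℝ (Fin d) ↦
        mD (𝓡 d) (coneModel E) Subtype.val x.1 (L Y)) mfderiv_fst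
    have h2 : mD ((𝓡 d).prod 𝓘(ℝ, ℝ)) 𝓘(ℝ, LieAlg m × ℝ)
        (fun x : A.realLevel σ ζ c × I ↦ a x.2) x Y = Y.2 • (k • ζ, l) := by
      refine (mD_comp_apply ((𝓡 d).prod 𝓘(ℝ, ℝ)) 𝓘(ℝ, ℝ) 𝓘(ℝ, LieAlg m × ℝ)
        (f := fun x : A.realLevel σ ζ c × I ↦ x.2)
        (ha.mdifferentiableAt (by simp)) mdifferentiableAt_snd Y).trans ?_
      refine (congrArg (fun L : EuclideanSpace ℝ (Fin d) × ℝ →L[ℝ] ℝ ↦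
        mD 𝓘(ℝ, ℝ) 𝓘(ℝ, LieAlg m × ℝ) a x.2 (L Y)) mfderiv_snd).trans ?_
      change mD 𝓘(ℝ, ℝ) 𝓘(ℝ, LieAlg m × ℝ) a x.2 Y.2 = _
      rw [← hkl, ← map_smul, smul_eq_mul, mul_one]
    have h3 := fun X ↦ mD_comp_apply (coneModel E) (coneModel E) (coneModel E)
      (f := scale ⟨Real.exp r, Real.exp_pos r⟩) (g := torusAct (torusExp v)) (p := x.1.1)
      ((contMDiff_torusAct hA.smooth (torusExp v)).mdifferentiableAt (by simp))
      (mdifferentiableAt_scale _ _) X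
    have h4 := hs.genField_act x.1.1 (0, r) (Y.2 • (k • ζ, l))
    rw [coneAct_inr] at h4
    rw [h1, h2, show coneAct (a x.2) = _ from funext hact, h3, map_add, ← h4, map_smul,
      genField_coneAct hA.smooth, map_smul]
  refine ⟨⟨?_, fun x ↦ ?_⟩, ?_, fun x X Y ↦ ?_⟩
  · rw [hF]
    exact hs.smooth.comp (ha₂.prodMk hι)
  · obtain ⟨ρ', τ, k, l, hk, -, hD⟩ := key x
    change Function.Injective
      (mD ((𝓡 d).prod 𝓘(ℝ, ℝ)) (coneModel E) (A.lagMap σ ζ c f ρ (torusExp v₀)) x)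
    rw [injective_iff_map_eq_zero]
    intro Y hY
    have hT := (isSmooth_torusVectorAction hA.smooth).mD_injective τ (scale ρ' x.1.1)
    rw [hD] at hY
    have h1 := hT (hY.trans (map_zero _).symm)
    have hp : σ (scale ρ' x.1.1) = scale ρ' x.1.1 := by
      rw [hσ.scale_comm hA.smooth hb, x.1.2.1]
    obtain ⟨h2, h3⟩ := eq_zero_of_real_add_smul_eq_zero hσ hA hb hp
      (gen_scale_ne_zero hA.smooth (hζ x.1) ρ')
      (real_of_tangent_realLevel hσ hA hb hval.1 ρ' x.1 Y.1) hk h1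
    have h4 : mD (𝓡 d) (coneModel E) Subtype.val x.1 Y.1 = 0 := by
      rw [mD_scale] at h2
      have hρ' : (ρ' : ℝ) ≠ 0 := (show (0 : ℝ) < ρ' from ρ'.2).ne'
      obtain ⟨h5, h6⟩ := Prod.ext_iff.1 h2
      exact Prod.ext h5 ((mul_eq_zero.1 h6).resolve_left hρ')
    have h5 : Function.Injective (mD (𝓡 d) (coneModel E) Subtype.val x.1) := hval.2 x.1
    exact Prod.ext (h5 (h4.trans (map_zero _).symm)) h3
  · rw [finrank_prod, finrank_prod, finrank_euclideanSpace_fin, finrank_self, hdim, hd]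
  · obtain ⟨ρ', τ, k, l, hk, hx, hD⟩ := key x
    have hp : σ (scale ρ' x.1.1) = scale ρ' x.1.1 := by
      rw [hσ.scale_comm hA.smooth hb, x.1.2.1]
    suffices h : ∀ X Y : EuclideanSpace ℝ (Fin d) × ℝ, coneForm A.g
      (A.lagMap σ ζ c f ρ (torusExp v₀) x) (A.cJ (A.lagMap σ ζ c f ρ (torusExp v₀) x)
        (mD ((𝓡 d).prod 𝓘(ℝ, ℝ)) (coneModel E) (A.lagMap σ ζ c f ρ (torusExp v₀)) x X))
      (mD ((𝓡 d).prod 𝓘(ℝ, ℝ)) (coneModel E) (A.lagMap σ ζ c f ρ (torusExp v₀)) x Y) = 0 from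
      h X Y
    intro X Y
    rw [hD, hD, ← hx]
    -- The torus is holomorphic and isometric, hence preserves the Kähler form, so the torus element
    -- can be dropped.
    have h1 : ∀ Z W : E × ℝ, coneForm A.g (torusAct (torusExp τ) (scale ρ' x.1.1))
        (A.cJ (torusAct (torusExp τ) (scale ρ' x.1.1))
          (mD (coneModel E) (coneModel E) (torusAct (torusExp τ)) (scale ρ' x.1.1) Z))
        (mD (coneModel E) (coneModel E) (torusAct (torusExp τ)) (scale ρ' x.1.1) W) =
        coneForm A.g (scale ρ' x.1.1) (A.cJ (scale ρ' x.1.1) Z) W := fun Z W ↦ by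
      have h2 : mD (coneModel E) (coneModel E) (torusAct (torusExp τ)) (scale ρ' x.1.1)
          (A.cJ (scale ρ' x.1.1) Z) = A.cJ (torusAct (torusExp τ) (scale ρ' x.1.1))
          (mD (coneModel E) (coneModel E) (torusAct (torusExp τ)) (scale ρ' x.1.1) Z) :=
        hA.holomorphic _ _ _
      rw [← h2]
      exact hA.isometric _ _ _ _
    rw [h1]
    exact coneForm_real_add_smul hσ hA hb hdim hp
      (real_of_tangent_realLevel hσ hA hb hval.1 ρ' x.1 X.1)
      (real_of_tangent_realLevel hσ hA hb hval.1 ρ' x.1 Y.1)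
      (mD_moment_tangent_realLevel hA hb hval.1 ρ' x.1 X.1)
      (mD_moment_tangent_realLevel hA hb hval.1 ρ' x.1 Y.1) k l X.2 Y.2

end LagMap

end LagrangianImmersion

end ToricSasaki

end

theorem mainTheorem5 {m : ℕ}
    {E : Type*} [NormedAddCommGroup E] [NormedSpace ℝ E] [FiniteDimensional ℝ E]
    (hdim : finrank ℝ E + 1 = 2 * m)
    {S : Type*} [TopologicalSpace S] [ChartedSpace E S] [IsManifold 𝓘(ℝ, E) ∞ S]
    [T2Space S] [CompactSpace S] [ConnectedSpace S]
    [MulAction (Torus m) S]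
    (A : SasakiStructure E S) (hA : A.IsToric m) (hReeb : A.ReebGenerated m)
    (σ : Cone S → Cone S) (hσ : A.IsToricConjugation m σ)
    (ζ : LieAlg m) (c : ℝ)
    (hint : (interior (A.momentImage m) ∩ hyperplane ζ c).Nonempty)
    (hreg : ∀ y ∈ A.momentImage m ∩ hyperplane ζ c, ζ ∉ zSpan (A.momentImage m) y)
    (I : Opens ℝ) (hI : (I : Set ℝ).OrdConnected)
    (f : I → ℝ) (hf : ContMDiff 𝓘(ℝ, ℝ) 𝓘(ℝ, ℝ) ∞ f)
    (hf' : ∀ t : I, mfderiv 𝓘(ℝ, ℝ) 𝓘(ℝ, ℝ) f t ≠ 0)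
    (ρ : I → PosReal) (hρ : ContMDiff 𝓘(ℝ, ℝ) 𝓘(ℝ, ℝ) ∞ ρ)
    (τ₀ : Torus m) :
    ∃ _ : ChartedSpace (EuclideanSpace ℝ (Fin (m - 1))) (A.realLevel σ ζ c),
      IsManifold (𝓡 (m - 1)) ∞ (A.realLevel σ ζ c) ∧
      IsSmoothImmersion (𝓡 (m - 1)) (coneModel E)
        (Subtype.val : A.realLevel σ ζ c → Cone S) ∧
      IsLagrangianImmersion ((𝓡 (m - 1)).prod 𝓘(ℝ, ℝ)) (coneModel E) A.kaehlerForm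
        (A.lagMap σ ζ c f ρ τ₀) := by
  obtain ⟨b, hb⟩ := hReeb
  -- Were `ζ` in the isotropy algebra of a point of the level set, it would lie in the span of the
  -- normals of the facets through its image, which `hreg` excludes.
  have hζ : ∀ x : A.realLevel σ ζ c, gen E x.1 ζ ≠ 0 := fun x h ↦
    hreg _ ⟨⟨x.1, rfl⟩, x.2.2⟩ (mem_zSpan_of_gen_eq_zero hb hA hdim h)
  choose C hC using fun x : A.realLevel σ ζ c ↦ exists_sliceChart hσ hA hb hdim x.2 (hζ x)
  obtain ⟨cs, hman, himm⟩ := exists_submanifold (coneModel E) C hC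
  exact ⟨cs, hman, himm,
    -- By `hdim` the case `m = 0` is impossible, so `m - 1 + 1 = m`.
    lagMap_isLagrangianImmersion hσ hA hb hdim (by omega) himm hζ hf hf' hρ τ₀⟩
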